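/- Let $M$ be a smooth paracompact Hausdorff manifold of finite dimension $n$ with a Poisson structure $\alpha$, regarded as a skew bundle map $\alpha:T^*M\to TM$, $(\alpha p)^i=\alpha^{ij}p_j$. Let $I=[0,1]$ and let $\mathcal C$ be the set of vector bundle morphisms $(X,\eta):TI\to T^*M$ with $X:I\to M$ continuously differentiable, $\eta$ continuous, and $dX(u)+\alpha(X(u))\eta(u)=0$ for all $u\in I$ (Gauss law). For $(X,\eta)\in\mathcal C$ and $\beta\in C^1_0(I,X^*(T^*M))$ (a $C^1$ section of $T^*M$ along $X$ with $\beta(0)=\beta(1)=0$) the infinitesimal gauge transformation $\xi_\beta$ at $(X,\eta)$ is given, in any local coordinates of $M$, by $$\xi_\beta X^i(u)=-\alpha^{ij}(X(u))\beta_j(u),\qquad \xi_\beta\eta_i(u)=d_u\beta_i(u)+\partial_i\alpha^{jk}(X(u))\eta_j(u)\beta_k(u).$$ Let $P_0\Omega^1(M)$ be the space of continuously differentiable maps $\beta:I\to\Omega^1(M)$ with $\beta(0)=\beta(1)=0$. Each such $\beta$ defines a vector field $\xi_\beta$ on $\mathcal C$, whose value at $(X,\eta)$ is $\xi_{\beta_X}$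 with $\beta_X(u)=\beta(u)(X(u))$. Let the gauge group $H$ be the group of transformations of $\mathcal C$ generated by the flows of those vector fields $\xi_\beta$, $\beta\in P_0\Omega^1(M)$, whose flow is complete. Theorem. $\mathcal C$ is a smooth Banach manifold modelled on $\mathbb R^n\times C^0(I,\mathbb R^n)$: those charts $e$ for which $e^{-1}$ is a smooth family of solutions, and through which every smooth family of solutions is smooth, form a smooth atlas that covers $\mathcal C$. (A continuous family of solutions parametrised by an open subset of the model space is smooth if its local coordinate functions $X^i,\eta_i$ on closed subintervals of $I$ depend smoothly on the parameter, as elements of the Banach spaces of continuous functions.) Moreover: 1. For every $(X,\eta)\in\mathcal C$ and $\beta\in C^1_0(I,X^*(T^*M))$ the formulas above define a unique vector $\xi_\beta\in T_{(X,\eta)}\mathcal C$, and the vectors $\xi_\beta$ span a closed subspace $V_{(X,\eta)}\subset T_{(X,\eta)}\mathcal C$ of codimension $2n$. 2. The distribution $V$ is integrable: around each point of $\mathcal C$ there is a smooth chart in which $V$ is constant, equal to a closed subspace of codimension $2n$ of the model space. 3. The maximal connected integral manifolds of $V$ are the orbits of $H$: the orbit through each point $Z\in\mathcal C$ is a connected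 integral manifold of $V$ (the image of a connected smooth Banach manifold under an injective smooth immersion with tangent spaces $V$, hence smooth of codimension $2n$), and it contains every connected integral manifold of $V$ through $Z$. Moreover, every integral curve, defined on an open interval, of a vector field $\xi_\beta$, $\beta\in P_0\Omega^1(M)$ (with complete flow or not), lies in a single orbit of $H$. -/

import Mathlib

open Set Bundle
open scoped Manifold ContDiff Topology unitInterval

noncomputable section

namespace PoissonSigma

universe u

/-- The coordinate space `ℝⁿ`. -/
abbrev Coord (n : ℕ) : Type := EuclideanSpace ℝ (Fin n)

/-- The space of coordinate covectors `(ℝⁿ)*`. -/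
abbrev CoCoord (n : ℕ) : Type := Coord n →L[ℝ] ℝ

section Manifold

variable (n : ℕ) {M : Type u} [TopologicalSpace M] [ChartedSpace (Coord n) M]
  [IsManifold (𝓡 n) ∞ M]

/-- The cotangent space `T*ₓM`. -/
abbrev Cotangent (x : M) : Type := TangentSpace (𝓡 n) x →L[ℝ] ℝ

variable (M) in
/-- The total space of the cotangent bundle `T*M`, with Mathlib's topology and smooth structure of
the bundle of linear maps from `TM` to the trivial line bundle. -/
abbrev CotangentBundle : Type u := TotalSpace (CoCoord n) (fun x : M => Cotangent n x)

/-- The coordinates `pᵢ` of the covector `p = pᵢ dxⁱ` at `x`, in the chart around `c`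
(meaningful for `x` in the domain of that chart): the frame `∂/∂xⁱ` at `x` is given by `symmL`. -/
def covectorCoord (c x : M) (p : Cotangent n x) : CoCoord n :=
  p ∘L (trivializationAt (Coord n) (TangentSpace (𝓡 n)) c).symmL ℝ x

/-! ### Poisson structures -/

/-- The bracket `{f, g} = α(df, dg)`, for a bivector field `α` regarded as a family of linear maps
`T*ₓM → TₓM`, so that `α(p, q) = ⟨p, α q⟩`. -/
def poissonBracket (α : ∀ x : M, Cotangent n x →L[ℝ] TangentSpace (𝓡 n) x) (f g : M → ℝ) (x : M) :
    ℝ :=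
  (mfderiv (𝓡 n) 𝓘(ℝ, ℝ) f x : Cotangent n x) (α x (mfderiv (𝓡 n) 𝓘(ℝ, ℝ) g x : Cotangent n x))

variable (M) in
/-- A Poisson structure on `M`: a smooth bivector field `α`, identified with a smooth
skew-symmetric bundle map `T*M → TM`, whose bracket satisfies the Jacobi identity on smooth
functions. -/
structure PoissonStructure where
  /-- The bundle map `T*M → TM`; in coordinates `(α p)ⁱ = αⁱʲ pⱼ`. -/
  sharp : ∀ x : M, Cotangent n x →L[ℝ] TangentSpace (𝓡 n) x
  smooth : ContMDiff (𝓡 n) ((𝓡 n).prod 𝓘(ℝ, CoCoord n →L[ℝ] Coord n)) ∞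
    (fun x => TotalSpace.mk' (CoCoord n →L[ℝ] Coord n)
      (E := fun x : M => Cotangent n x →L[ℝ] TangentSpace (𝓡 n) x) x (sharp x))
  skew : ∀ (x : M) (p q : Cotangent n x), p (sharp x q) = -q (sharp x p)
  jacobi : ∀ f g h : M → ℝ, ContMDiff (𝓡 n) 𝓘(ℝ, ℝ) ∞ f → ContMDiff (𝓡 n) 𝓘(ℝ, ℝ) ∞ g →
    ContMDiff (𝓡 n) 𝓘(ℝ, ℝ) ∞ h → ∀ x : M,
      poissonBracket n sharp f (poissonBracket n sharp g h) x
        + poissonBracket n sharp g (poissonBracket n sharp h f) x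
        + poissonBracket n sharp h (poissonBracket n sharp f g) x = 0

variable {n}

/-- The coordinate expression of `α` in the chart around `c`, at the coordinate point `y`: the vector
`αⁱʲ(y) bⱼ`. -/
def PoissonStructure.coord (α : PoissonStructure n M) (c : M) (y : Coord n) (b : CoCoord n) :
    Coord n :=
  let x : M := (chartAt (Coord n) c).symm y
  let e : TangentSpace (𝓡 n) x →L[ℝ] Coord n :=
    (trivializationAt (Coord n) (TangentSpace (𝓡 n)) c).continuousLinearMapAt ℝ x
  e (α.sharp x (b ∘L e))

/-! ### Solutions of the Gauss law -/

/-- The space `𝒞` of solutions of the Gauss law. A bundle morphism `TI → T*M` over `X : I → M` is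
`(u, v) ↦ (X(u), v η(u))` with `η(u) ∈ T*_{X(u)}M` (as `TI = I × ℝ`), so it is given by the path
`u ↦ (X(u), η(u))` in `T*M`. The path is continuous, its base path is continuously differentiable,
and `X'(u) + α(X(u)) η(u) = 0`. -/
structure GaussSolution (α : PoissonStructure n M) where
  /-- The path `u ↦ (X(u), η(u))`. -/
  path : C(I, CotangentBundle n M)
  contMDiff_base : ContMDiff (𝓡∂ 1) (𝓡 n) 1 (fun u => (path u).proj)
  gauss : ∀ u : I,
    mfderiv (𝓡∂ 1) (𝓡 n) (fun u => (path u).proj) u (1 : TangentSpace (𝓡∂ 1) u)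
      + α.sharp (path u).proj (path u).snd = 0

namespace GaussSolution

variable {α : PoissonStructure n M}

/-- The base path `X`. -/
def base (Z : GaussSolution α) (u : I) : M := (Z.path u).proj

/-- The covector `η(u)` at `X(u)`. -/
def eta (Z : GaussSolution α) (u : I) : Cotangent n (Z.base u) := (Z.path u).snd

/-- The coordinates `Xⁱ(u)` in the chart around `c`. -/
def xCoord (c : M) (u : I) (Z : GaussSolution α) : Coord n := chartAt (Coord n) c (Z.base u)

/-- The coordinates `ηᵢ(u)` in the chart around `c`. -/
def etaCoord (c : M) (u : I) (Z : GaussSolution α) : CoCoord n :=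
  covectorCoord n c (Z.base u) (Z.eta u)

/-- The topology of `𝒞`: uniform convergence of `(X, η)`. Since `X' = -α(X) η` on `𝒞`, this is the
topology of `C¹` convergence of `X` and `C⁰` convergence of `η`. -/
instance : TopologicalSpace (GaussSolution α) :=
  TopologicalSpace.induced path inferInstance

end GaussSolution

variable (n) in
/-- The Banach space `ℝⁿ × C⁰(I, ℝⁿ)` on which `𝒞` is modelled. -/
abbrev GaussModel : Type := Coord n × C(I, Coord n)

variable (α : PoissonStructure n M)

/-- A family of solutions, parametrised by an open subset `W` of the model space, is smooth if it is
continuous and if, for every closed interval `[a, b] ⊆ I` and every chart of `M`, the coordinate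
functions `(Xⁱ, ηᵢ)` on `[a, b]` depend smoothly on the parameter, as elements of the Banach space of
continuous functions on `[a, b]`, as long as `X([a, b])` lies in the domain of the chart.
(The derivatives of the `Xⁱ` are then smooth in the parameter as well, by the Gauss law.) -/
def IsSmoothFamily (W : Set (GaussModel n)) (g : GaussModel n → GaussSolution α) : Prop :=
  ContinuousOn g W ∧ ∀ (c : M) (a b : I),
    let W' := {w ∈ W | ∀ u ∈ Icc a b, (g w).base u ∈ (chartAt (Coord n) c).source}
    ∃ G : GaussModel n → C(Icc a b, Coord n × CoCoord n),
      ContDiffOn ℝ ∞ G W' ∧ ∀ w ∈ W', ∀ u : Icc a b,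
        G w u = ((g w).xCoord c u, (g w).etaCoord c u)

/-- The smooth atlas of `𝒞`: all homeomorphisms `e` from open subsets of `𝒞` onto open subsets of
`ℝⁿ × C⁰(I, ℝⁿ)` such that `e⁻¹` is a smooth family of solutions and every smooth family of
solutions is smooth when read through `e`. Any two such charts are smoothly compatible. -/
def gaussAtlas : Set (OpenPartialHomeomorph (GaussSolution α) (GaussModel n)) :=
  {e | IsSmoothFamily α e.target e.symm ∧
    ∀ (W : Set (GaussModel n)) (g : GaussModel n → GaussSolution α), IsOpen W →
      IsSmoothFamily α W g → ContDiffOn ℝ ∞ (fun w => e (g w)) (W ∩ g ⁻¹' e.source)}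

/-! ### Infinitesimal gauge transformations -/

variable {α}

/-- `β ∈ C¹₀(I, X*(T*M))`: a `C¹` section of `T*M` along `X` vanishing at both ends. -/
def IsGaugeSection (Z : GaussSolution α) (β : ∀ u : I, Cotangent n (Z.base u)) : Prop :=
  ContMDiff (𝓡∂ 1) ((𝓡 n).prod 𝓘(ℝ, CoCoord n)) 1
    (fun u => (⟨Z.base u, β u⟩ : CotangentBundle n M)) ∧ β 0 = 0 ∧ β 1 = 0

section Distribution

variable [ChartedSpace (GaussModel n) (GaussSolution α)]

/-- The tangent vector `v` of `𝒞` at `Z = (X, η)` is the infinitesimal gauge transformation `ξ_β(Z)`.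
Applied to the coordinate functions `Xⁱ(u)` and `ηᵢ(u)`, for all charts of `M` and all `u` for which
`X(u)` lies in the domain of the chart, it gives
`v Xⁱ(u) = - αⁱʲ(X(u)) βⱼ(u)` and `v ηᵢ(u) = βᵢ'(u) + ∂ᵢαʲᵏ(X(u)) ηⱼ(u) βₖ(u)`. -/
def IsGaugeVector (Z : GaussSolution α) (β : ∀ u : I, Cotangent n (Z.base u))
    (v : TangentSpace 𝓘(ℝ, GaussModel n) Z) : Prop :=
  ∀ (c : M) (u : I), Z.base u ∈ (chartAt (Coord n) c).source →
    let b : I → CoCoord n := fun u => covectorCoord n c (Z.base u) (β u)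
    let b' : CoCoord n := mfderiv (𝓡∂ 1) 𝓘(ℝ, CoCoord n) b u (1 : TangentSpace (𝓡∂ 1) u)
    mfderiv 𝓘(ℝ, GaussModel n) 𝓘(ℝ, Coord n) (GaussSolution.xCoord c u) Z v
        = -α.coord c (Z.xCoord c u) (b u) ∧
      mfderiv 𝓘(ℝ, GaussModel n) 𝓘(ℝ, CoCoord n) (GaussSolution.etaCoord c u) Z v
        = b' + Z.etaCoord c u ∘L fderiv ℝ (fun y => α.coord c y (b u)) (Z.xCoord c u)

/-- The gauge distribution: the subspace of the tangent space of `𝒞` at `Z` spanned by the `ξ_β(Z)`,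
`β ∈ C¹₀(I, X*(T*M))`. -/
def gaugeDistribution (Z : GaussSolution α) :
    Submodule ℝ (TangentSpace 𝓘(ℝ, GaussModel n) Z) :=
  Submodule.span ℝ {v | ∃ β, IsGaugeSection Z β ∧ IsGaugeVector Z β v}

variable (α) in
/-- Integrability of the gauge distribution, with leaves of codimension `d`: around every point there
is a smooth chart of `𝒞` in which the distribution is constant, equal to a closed subspace `K` of
codimension `d` of the model space, so that the slices parallel to `K` are integral manifolds. -/
def IsGaugeDistributionIntegrable (d : ℕ) : Prop :=
  ∀ Z : GaussSolution α,
    ∃ e ∈ IsManifold.maximalAtlas 𝓘(ℝ, GaussModel n) ∞ (GaussSolution α), Z ∈ e.source ∧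
      ∃ K : Submodule ℝ (GaussModel n), IsClosed (K : Set (GaussModel n)) ∧
        Module.finrank ℝ (GaussModel n ⧸ K) = d ∧
        ∀ Y ∈ e.source, ∀ v : TangentSpace 𝓘(ℝ, GaussModel n) Y,
          v ∈ gaugeDistribution Y ↔
            (mfderiv 𝓘(ℝ, GaussModel n) 𝓘(ℝ, GaussModel n) e Y v : GaussModel n) ∈ K

/-- `S` is a connected integral manifold of the gauge distribution: it is the image of a connected
smooth Banach manifold under an injective smooth immersion whose tangent spaces are
the subspaces of the gauge distribution. -/
def IsConnectedIntegralManifold (S : Set (GaussSolution α)) : Prop :=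
  ∃ (F : Type) (_ : NormedAddCommGroup F) (_ : NormedSpace ℝ F) (_ : CompleteSpace F)
    (L : Type u) (_ : TopologicalSpace L) (_ : ChartedSpace F L) (_ : IsManifold 𝓘(ℝ, F) ∞ L)
    (_ : ConnectedSpace L) (j : L → GaussSolution α),
    Function.Injective j ∧ range j = S ∧ ContMDiff 𝓘(ℝ, F) 𝓘(ℝ, GaussModel n) ∞ j ∧
      ∀ p : L, Function.Injective (mfderiv 𝓘(ℝ, F) 𝓘(ℝ, GaussModel n) j p) ∧
        range (mfderiv 𝓘(ℝ, F) 𝓘(ℝ, GaussModel n) j p) = (gaugeDistribution (j p) : Set _)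

end Distribution

/-! ### The gauge group -/

/-- A family `β(u)`, `u ∈ I`, of smooth 1-forms on `M` which is continuous as a map from `I` to
`Ω¹(M)` with the topology of locally uniform convergence of all derivatives. -/
def IsContinuousFormFamily (β : I → ∀ x : M, Cotangent n x) : Prop :=
  ∀ c : M,
    let b : I → Coord n → CoCoord n := fun u y =>
      covectorCoord n c ((chartAt (Coord n) c).symm y) (β u ((chartAt (Coord n) c).symm y))
    (∀ u, ContDiffOn ℝ ∞ (b u) (chartAt (Coord n) c).target) ∧
      ∀ k : ℕ, ContinuousOn (fun q : I × Coord n => iteratedFDeriv ℝ k (b q.1) q.2)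
        (univ ×ˢ (chartAt (Coord n) c).target)

variable (n M) in
/-- The space `P₀Ω¹(M)` of continuously differentiable maps `β : I → Ω¹(M)` with
`β(0) = β(1) = 0`. -/
structure GaugeForm where
  form : I → ∀ x : M, Cotangent n x
  continuous : IsContinuousFormFamily form
  hasDeriv : ∃ form' : I → ∀ x : M, Cotangent n x, IsContinuousFormFamily form' ∧
    ∀ (u : I) (x : M) (v : TangentSpace (𝓡 n) x),
      HasDerivWithinAt (fun r : ℝ => form (projIcc 0 1 zero_le_one r) x v) (form' u x v)
        (Icc 0 1) u
  zero_left : form 0 = 0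
  zero_right : form 1 = 0

section GaugeGroup

variable [ChartedSpace (GaussModel n) (GaussSolution α)]

/-- At time `t` the curve `γ` in `𝒞` satisfies `dγ/dt = ξ_β(γ(t))`, where the gauge parameter at the
solution `(X, η)` is `u ↦ β(X(u), u)`. -/
def IsGaugeCurveAt (β : GaugeForm n M) (γ : ℝ → GaussSolution α) (t : ℝ) : Prop :=
  ∃ v : TangentSpace 𝓘(ℝ, GaussModel n) (γ t),
    IsGaugeVector (γ t) (fun u => β.form u ((γ t).base u)) v ∧
      HasMFDerivAt 𝓘(ℝ, ℝ) 𝓘(ℝ, GaussModel n) γ t ((1 : ℝ →L[ℝ] ℝ).smulRight v)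

variable (α) in
/-- The gauge group `H`, acting on `𝒞`: the group generated by the time `t` maps of the (complete)
flows of the vector fields `ξ_β`, `β ∈ P₀Ω¹(M)`. -/
def gaugeGroup : Subgroup (Equiv.Perm (GaussSolution α)) :=
  Subgroup.closure {f | ∃ (β : GaugeForm n M) (Φ : Flow ℝ (GaussSolution α)),
    (∀ Z t, IsGaugeCurveAt β (fun s => Φ s Z) t) ∧ ∃ t, ∀ Z, f Z = Φ t Z}

end GaugeGroup

end Manifold

end PoissonSigma

end

open PoissonSigma

noncomputable section

namespace PoissonSigma

set_option linter.unusedSectionVars false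

/-! ### Superposition operators on spaces of continuous functions -/

section Superposition

variable {K : Type} [TopologicalSpace K] [CompactSpace K]
  {E F : Type} [NormedAddCommGroup E] [NormedSpace ℝ E] [NormedAddCommGroup F] [NormedSpace ℝ F]

/-! The proof rests on a large supply of explicit symmetries of the Gauss law. Let k be a
Hamiltonian with compact support in a chart domain, let φ_ρ be the flow of -α dk, and let s be a C¹
function on I. The substitution X(u) ↦ φ_{s(u)}(X(u)), η(u) ↦ (η(u) + s'(u) dk) ∘ (Dφ_{s(u)})⁻¹ maps
solutions to solutions. Indeed φ_ρ is a Poisson map, by the Jacobi identity, and the additional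
velocity -s' α dk of the base path is the one produced by the translation s' dk of the covector
(`hasDerivWithinAt_lift_fst`). These symmetries carry infinitesimal gauge transformations to
infinitesimal gauge transformations, and a variation δs of the time function adds the gauge
parameter δs dk, transported by the flow (`IsGaugeDeriv.act`).

Charts. Near a point, take n Hamiltonians whose differentials there are the dxⁱ, and apply them to
the constant solutions (y, 0) with time functions s_i = ∫₀ p_i. The covectors obtained are linear in
p(u), with a coefficient that depends on y and ∫₀ᵘ p and that is the identification of vectors with
covectors at the centre. As a solution in one chart domain is determined by X(0) and η (uniqueness
for the Gauss law as an ODE for X), the inverse function theorem makes (y, p) ∈ ℝⁿ × C⁰(I, ℝⁿ) a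
chart near the constant solution (`HamFrame.chart`). Moreover every solution is a finite composition
of symmetries applied to a constant solution (`exists_eq_wordAct`): on a short time interval,
rescaled to I, the covector becomes small and the chart near a constant applies; overlapping
intervals are glued after a change of time. Translating the charts by such words therefore covers 𝒞.

Distribution. In these adapted charts (`IsAdapted`), moving p by q with y fixed is an infinitesimal
gauge transformation whose parameter is an invertible linear image of ∫₀ᵘ q. It vanishes at u = 0,
and at u = 1 exactly when ∫₀¹ q = 0. Conversely every gauge parameter that vanishes at both ends
arises in this way. Hence the distribution is the constant subspace {(0, q) : ∫₀¹ q = 0} of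
codimension 2n, which gives closedness and integrability together.

Orbits. Two points of the same slice differ by time functions that vanish at both ends. Exchanging
these one letter at a time, each exchange is a conjugate of a symmetry with s(0) = s(1) = 0, and t ↦
(the conjugate for t s) is the complete flow of a field ξ_β with β in P₀Ω¹(M)
(`exists_mem_gaugeGroup`). So slices lie in orbits of H. A map tangent to the distribution stays
locally in a slice, hence connected integral manifolds and integral curves of the ξ_β stay in one
orbit. Finally the slices are charts of each orbit, which is connected in the resulting topology
because flow lines of the generators are continuous there. -/

instance : NormedAddCommGroup C(K, E →L[ℝ] F) := ContinuousMap.instNormedAddCommGroup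

instance : SeminormedAddCommGroup C(K, E →L[ℝ] F) :=
  ContinuousMap.instSeminormedAddCommGroup

/-- Pointwise application of a continuous family of operators to a continuous function. -/
def pointwiseApply : C(K, E →L[ℝ] F) →L[ℝ] C(K, E) →L[ℝ] C(K, F) :=
  LinearMap.mkContinuous₂
    (LinearMap.mk₂ ℝ
      (fun (T : C(K, E →L[ℝ] F)) (g : C(K, E)) =>
        (⟨fun u => T u (g u), T.continuous.clm_apply g.continuous⟩ : C(K, F)))
      (fun _ _ _ => by ext; simp) (fun _ _ _ => by ext; simp)
      (fun _ _ _ => by ext; simp) (fun _ _ _ => by ext; simp)) 1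
    (fun T g => by
      rw [ContinuousMap.norm_le _ (by positivity)]
      intro u
      rw [one_mul]
      exact ((T u).le_opNorm _).trans
        (mul_le_mul (T.norm_coe_le_norm u) (g.norm_coe_le_norm u) (norm_nonneg _) (norm_nonneg _)))

@[simp]
theorem pointwiseApply_apply (T : C(K, E →L[ℝ] F)) (g : C(K, E)) (u : K) :
    pointwiseApply T g u = T u (g u) := rfl

theorem isOpen_setOf_forall_mem {Ω : Set E} (hΩ : IsOpen Ω) :
    IsOpen {g : C(K, E) | ∀ u, g u ∈ Ω} := by
  have := ContinuousMap.isOpen_setOfPred_mapsTo (X := K) (Y := E) isCompact_univ hΩ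
  convert! this using 1
  ext g
  simp [MapsTo]

open Classical in
/-- The superposition operator `g ↦ f ∘ g`, with junk value `0` if `f ∘ g` is not continuous. -/
def superpose (f : E → F) (g : C(K, E)) : C(K, F) :=
  if h : Continuous (fun u => f (g u)) then ⟨_, h⟩ else 0

theorem superpose_apply {f : E → F} {Ω : Set E} (hf : ContinuousOn f Ω) {g : C(K, E)}
    (hg : ∀ u, g u ∈ Ω) (u : K) : superpose f g u = f (g u) := by
  have h : Continuous (fun u => f (g u)) := hf.comp_continuous g.continuous hg
  simp [superpose, h]

/-- The range of `g` is compact, so `fderiv ℝ f` is uniformly continuous near it, and the mean value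
inequality on balls of one fixed radius bounds the remainder uniformly in `u`. -/
theorem hasFDerivAt_superpose {f : E → F} {Ω : Set E} (hΩ : IsOpen Ω) (hf : ContDiffOn ℝ 1 f Ω)
    {g : C(K, E)} (hg : ∀ u, g u ∈ Ω) :
    HasFDerivAt (superpose f) (pointwiseApply (superpose (fderiv ℝ f) g)) g := by
  have hd : ContinuousOn (fderiv ℝ f) Ω := hf.continuousOn_fderiv_of_isOpen hΩ le_rfl
  have hcpt : IsCompact (range g) := isCompact_range g.continuous
  have hsub : range g ⊆ Ω := by rintro _ ⟨u, rfl⟩; exact hg u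
  obtain ⟨δ, hδ, hth⟩ := hcpt.exists_thickening_subset_open hΩ hsub
  rw [hasFDerivAt_iff_isLittleO_nhds_zero, Asymptotics.isLittleO_iff]
  intro ε hε
  have huc := hcpt.uniformContinuousAt_of_continuousAt (fderiv ℝ f)
    (fun x hx => hd.continuousAt (hΩ.mem_nhds (hsub hx))) (Metric.dist_mem_uniformity hε)
  obtain ⟨δ', hδ', huc⟩ := Metric.mem_uniformity_dist.1 huc
  filter_upwards [Metric.ball_mem_nhds (0 : C(K, E)) (lt_min hδ hδ')] with h hh
  rw [mem_ball_zero_iff] at hh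
  rw [ContinuousMap.norm_le _ (by positivity)]
  intro u
  have hball : ∀ x ∈ Metric.ball (g u) (min δ δ'), x ∈ Ω := fun x hx =>
    hth (Metric.mem_thickening_iff.2 ⟨g u, mem_range_self u, hx.trans_le (min_le_left _ _)⟩)
  have hhu : ‖h u‖ ≤ ‖h‖ := h.norm_coe_le_norm u
  have hgh : g u + h u ∈ Metric.ball (g u) (min δ δ') := by
    simpa using hhu.trans_lt hh
  have hghΩ : ∀ v, (g + h) v ∈ Ω := fun v =>
    hth (Metric.mem_thickening_iff.2 ⟨g v, mem_range_self v, by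
      simpa using ((h.norm_coe_le_norm v).trans_lt hh).trans_le (min_le_left _ _)⟩)
  have key := (convex_ball (g u) (min δ δ')).norm_image_sub_le_of_norm_hasFDerivWithin_le'
    (f := f) (f' := fderiv ℝ f) (φ := fderiv ℝ f (g u)) (C := ε)
    (fun x hx => ((hf.contDiffAt (hΩ.mem_nhds (hball x hx))).differentiableAt
      one_ne_zero).hasFDerivAt.hasFDerivWithinAt)
    (fun x hx => by
      have := @huc (g u) x (by
        rw [dist_comm]; exact (Metric.mem_ball.1 hx).trans_le (min_le_right _ _)) (mem_range_self u)
      rw [← dist_eq_norm, dist_comm]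
      exact le_of_lt this)
    (Metric.mem_ball_self (lt_min hδ hδ')) hgh
  simp only [ContinuousMap.sub_apply, pointwiseApply_apply, superpose_apply hd hg,
    superpose_apply hf.continuousOn hg, superpose_apply hf.continuousOn hghΩ]
  refine (by simpa using key : _ ≤ ε * ‖h u‖).trans (by gcongr)

/-- Induction on the order: the derivative is again a superposition operator, that of `fderiv ℝ f`,
followed by the bounded bilinear pointwise application. The target space changes in the induction,
hence the generalization over `F`. -/
theorem contDiffOn_superpose {f : E → F} {Ω : Set E} (hΩ : IsOpen Ω)
    (hf : ContDiffOn ℝ ∞ f Ω) :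
    ContDiffOn ℝ ∞ (superpose f : C(K, E) → C(K, F)) {g | ∀ u, g u ∈ Ω} := by
  rw [contDiffOn_infty]
  intro m
  have hU := isOpen_setOf_forall_mem (K := K) hΩ
  induction m generalizing F with
  | zero =>
    have h1 : ContDiffOn ℝ 1 f Ω := hf.of_le (by simp)
    exact contDiffOn_zero.2 fun g hg =>
      (hasFDerivAt_superpose hΩ h1 hg).continuousAt.continuousWithinAt
  | succ m ih =>
    have h1 : ContDiffOn ℝ 1 f Ω := hf.of_le (by simp)
    push_cast
    rw [contDiffOn_succ_iff_fderiv_of_isOpen hU]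
    refine ⟨fun g hg =>
      (hasFDerivAt_superpose hΩ h1 hg).differentiableAt.differentiableWithinAt, by simp, ?_⟩
    have hf' : ContDiffOn ℝ ∞ (fderiv ℝ f) Ω := ((contDiffOn_infty_iff_fderiv_of_isOpen hΩ).1 hf).2
    have := ((pointwiseApply (K := K) (E := E) (F := F)).contDiff (n := m)).comp_contDiffOn (ih hf')
    exact this.congr fun g hg => (hasFDerivAt_superpose hΩ h1 hg).fderiv

/-- Restriction of continuous functions along a continuous map. -/
def pullbackCLM {K' : Type} [TopologicalSpace K'] [CompactSpace K'] (i : C(K', K)) :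
    C(K, E) →L[ℝ] C(K', E) :=
  LinearMap.mkContinuous
    { toFun := fun g => g.comp i, map_add' := fun _ _ => rfl, map_smul' := fun _ _ => rfl } 1
    (fun g => by
      rw [one_mul, ContinuousMap.norm_le _ (norm_nonneg _)]
      exact fun u => g.norm_coe_le_norm (i u))

@[simp]
theorem pullbackCLM_apply {K' : Type} [TopologicalSpace K'] [CompactSpace K'] (i : C(K', K))
    (g : C(K, E)) (u : K') : pullbackCLM i g u = g (i u) := rfl

variable (K E) in
/-- Constant functions. -/
def constCLM : E →L[ℝ] C(K, E) :=
  LinearMap.mkContinuous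
    { toFun := fun x => ContinuousMap.const K x, map_add' := fun _ _ => rfl,
      map_smul' := fun _ _ => rfl } 1
    (fun x => by
      rw [one_mul, ContinuousMap.norm_le _ (norm_nonneg _)]
      exact fun u => le_rfl)

@[simp]
theorem constCLM_apply (x : E) (u : K) : constCLM K E x u = x := rfl

/-- Pairing of continuous functions. -/
def pairCLM : C(K, E) × C(K, F) →L[ℝ] C(K, E × F) :=
  LinearMap.mkContinuous
    { toFun := fun g => g.1.prodMk g.2, map_add' := fun _ _ => rfl,
      map_smul' := fun _ _ => rfl } 1
    (fun g => by
      rw [one_mul, ContinuousMap.norm_le _ (norm_nonneg _)]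
      exact fun u => max_le_max (g.1.norm_coe_le_norm u) (g.2.norm_coe_le_norm u))

@[simp]
theorem pairCLM_apply (g : C(K, E) × C(K, F)) (u : K) : pairCLM g u = (g.1 u, g.2 u) := rfl

end Superposition

/-! ### Primitives -/

section Primitive

variable {E : Type} [NormedAddCommGroup E] [NormedSpace ℝ E]

/-- The primitive `r ↦ ∫₀ʳ g`, for `g` extended to the line by constants. -/
def prim (g : C(I, E)) (r : ℝ) : E := ∫ t in (0 : ℝ)..r, g (projIcc 0 1 zero_le_one t)

theorem continuous_extend (g : C(I, E)) : Continuous fun t : ℝ => g (projIcc 0 1 zero_le_one t) :=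
  g.continuous.comp continuous_projIcc

@[simp]
theorem prim_zero_right (g : C(I, E)) : prim g 0 = 0 := by simp [prim]

theorem hasDerivAt_prim [CompleteSpace E] (g : C(I, E)) (r : ℝ) :
    HasDerivAt (prim g) (g (projIcc 0 1 zero_le_one r)) r :=
  (continuous_extend g).integral_hasStrictDerivAt 0 r |>.hasDerivAt

theorem norm_prim_le (g : C(I, E)) (u : I) : ‖prim g u‖ ≤ ‖g‖ := by
  have := intervalIntegral.norm_integral_le_of_norm_le_const (a := 0) (b := (u : ℝ)) (C := ‖g‖)
    (f := fun t => g (projIcc 0 1 zero_le_one t)) (fun t _ => g.norm_coe_le_norm _)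
  refine this.trans ?_
  rw [sub_zero, abs_of_nonneg u.2.1]
  exact mul_le_of_le_one_right (norm_nonneg _) u.2.2

theorem continuous_prim [CompleteSpace E] (g : C(I, E)) : Continuous (prim g) :=
  continuous_iff_continuousAt.2 fun r => (hasDerivAt_prim g r).continuousAt

theorem contDiff_prim [CompleteSpace E] (g : C(I, E)) : ContDiff ℝ 1 (prim g) := by
  rw [contDiff_one_iff_deriv]
  refine ⟨fun r => (hasDerivAt_prim g r).differentiableAt, ?_⟩
  rw [funext fun r => (hasDerivAt_prim g r).deriv]
  exact continuous_extend g

theorem prim_add (g g' : C(I, E)) (r : ℝ) : prim (g + g') r = prim g r + prim g' r :=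
  intervalIntegral.integral_add ((continuous_extend g).intervalIntegrable _ _)
    ((continuous_extend g').intervalIntegrable _ _)

theorem prim_smul (a : ℝ) (g : C(I, E)) (r : ℝ) : prim (a • g) r = a • prim g r :=
  intervalIntegral.integral_smul _ _

variable [CompleteSpace E]

variable (E) in
/-- The primitive as an operator on continuous functions. -/
def primCLM : C(I, E) →L[ℝ] C(I, E) :=
  LinearMap.mkContinuous
    { toFun := fun g => ⟨fun u => prim g u, (continuous_prim g).comp continuous_subtype_val⟩
      map_add' := fun g g' => by ext u; exact prim_add g g' u
      map_smul' := fun a g => by ext u; exact prim_smul a g u } 1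
    (fun g => by
      rw [one_mul, ContinuousMap.norm_le _ (norm_nonneg _)]
      exact norm_prim_le g)

@[simp]
theorem primCLM_apply (g : C(I, E)) (u : I) : primCLM E g u = prim g u := rfl

theorem norm_primCLM_le (g : C(I, E)) : ‖primCLM E g‖ ≤ ‖g‖ := by
  rw [ContinuousMap.norm_le _ (norm_nonneg _)]
  exact norm_prim_le g

end Primitive

/-! ### Flows of compactly supported vector fields -/

section Flow

open scoped NNReal

variable {E : Type} [NormedAddCommGroup E] [NormedSpace ℝ E] [CompleteSpace E] {w : E → E}

theorem exists_lipschitz (hw : ContDiff ℝ ∞ w) (hc : HasCompactSupport w) :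
    ∃ C : ℝ≥0, LipschitzWith C w :=
  (hw.lipschitzWith_of_hasCompactSupport hc (by simp)).imp fun _ h => h

theorem integralCurve_unique (hw : ContDiff ℝ ∞ w) (hc : HasCompactSupport w) {f g : ℝ → E}
    (hf : ∀ t, HasDerivAt f (w (f t)) t) (hg : ∀ t, HasDerivAt g (w (g t)) t) {t₀ : ℝ}
    (h : f t₀ = g t₀) : f = g := by
  obtain ⟨C, hC⟩ := exists_lipschitz hw hc
  exact ODE_solution_unique_univ (v := fun _ => w) (s := fun _ => univ) (K := C)
    (fun _ => hC.lipschitzOnWith) (fun t => ⟨hf t, mem_univ _⟩) (fun t => ⟨hg t, mem_univ _⟩) h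

/-- The field is bounded and globally Lipschitz, so Picard–Lindelöf yields solutions on an interval
of the same length for every initial point; such local solutions extend to all times. -/
theorem exists_integralCurve (hw : ContDiff ℝ ∞ w) (hc : HasCompactSupport w) (y : E) :
    ∃ f : ℝ → E, f 0 = y ∧ ∀ t, HasDerivAt f (w (f t)) t := by
  obtain ⟨C, hC⟩ := exists_lipschitz hw hc
  obtain ⟨B, hB⟩ := hc.exists_bound_of_continuous hw.continuous
  have hB0 : 0 ≤ B := (norm_nonneg _).trans (hB 0)
  let v : (z : E) → TangentSpace 𝓘(ℝ, E) z := w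
  have hloc : ∀ x : E, ∃ f : ℝ → E, f 0 = x ∧
      IsMIntegralCurveOn f v (Ioo (-1) 1) := by
    intro x
    have hpl : IsPicardLindelof (fun _ => w) (tmin := -1) (tmax := 1) ⟨0, by simp⟩ x
        (⟨B, hB0⟩ : ℝ≥0) 0 ⟨B, hB0⟩ C :=
      IsPicardLindelof.of_time_independent (fun z _ => hB z) hC.lipschitzOnWith (by simp)
    obtain ⟨f, hf0, hf⟩ := hpl.exists_eq_forall_mem_Icc_hasDerivWithinAt₀
    refine ⟨f, hf0, ?_⟩
    intro t ht
    exact ((hf t (Ioo_subset_Icc_self ht)).hasDerivAt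
      (Icc_mem_nhds ht.1 ht.2)).hasDerivWithinAt.hasFDerivWithinAt.hasMFDerivWithinAt
  have hv : ContMDiff 𝓘(ℝ, E) 𝓘(ℝ, E).tangent 1
      (fun x => (⟨x, v x⟩ : TangentBundle 𝓘(ℝ, E) E)) := by
    intro x
    rw [Bundle.contMDiffAt_totalSpace]
    refine ⟨contMDiffAt_id, ?_⟩
    simpa using! (hw.contDiffAt.of_le (by simp) : ContDiffAt ℝ 1 w x).contMDiffAt
  obtain ⟨f, hf0, hf⟩ := exists_isMIntegralCurve_of_isMIntegralCurveOn hv one_pos hloc y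
  refine ⟨f, hf0, fun t => ?_⟩
  have h : HasFDerivAt f (ContinuousLinearMap.smulRight (1 : ℝ →L[ℝ] ℝ) (w (f t))) t :=
    hasMFDerivAt_iff_hasFDerivAt.1 (hf t)
  simpa using h.hasDerivAt

open Classical in
/-- The flow of a smooth compactly supported vector field. -/
def flow (w : E → E) (t : ℝ) (y : E) : E :=
  if h : ∃ f : ℝ → E, f 0 = y ∧ ∀ t, HasDerivAt f (w (f t)) t then h.choose t else y

variable (hw : ContDiff ℝ ∞ w) (hc : HasCompactSupport w)

include hw hc

theorem flow_zero (y : E) : flow w 0 y = y := by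
  have h := exists_integralCurve hw hc y
  simp only [flow, h, dite_true]
  exact h.choose_spec.1

theorem hasDerivAt_flow (t : ℝ) (y : E) : HasDerivAt (fun t => flow w t y) (w (flow w t y)) t := by
  have h := exists_integralCurve hw hc y
  simp only [flow, h, dite_true]
  exact h.choose_spec.2 t

theorem eq_flow {f : ℝ → E} (hf : ∀ t, HasDerivAt f (w (f t)) t) (t : ℝ) :
    f t = flow w t (f 0) :=
  congrFun (integralCurve_unique hw hc hf (fun t => hasDerivAt_flow hw hc t (f 0)) (t₀ := 0)
    (flow_zero hw hc _).symm) t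

theorem flow_add (s t : ℝ) (y : E) : flow w (s + t) y = flow w s (flow w t y) := by
  have := eq_flow hw hc (f := fun r => flow w (r + t) y)
    (fun r => (hasDerivAt_flow hw hc (r + t) y).comp_add_const r t) s
  simpa using this

theorem flow_neg_flow (t : ℝ) (y : E) : flow w (-t) (flow w t y) = y := by
  rw [← flow_add hw hc, neg_add_cancel, flow_zero hw hc]

theorem flow_of_eq_zero {y : E} (hy : w y = 0) (t : ℝ) : flow w t y = y := by
  have := eq_flow hw hc (f := fun _ => y) (fun t => by rw [hy]; exact hasDerivAt_const t y) t
  exact this.symm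

/-- Points outside `Ω` are zeros of the field and so are fixed by the flow; running time backwards
from such a point would never return to `y`. -/
theorem flow_mem {Ω : Set E} (hΩ : ∀ y, y ∉ Ω → w y = 0) {y : E} (hy : y ∈ Ω) (t : ℝ) :
    flow w t y ∈ Ω := by
  by_contra h
  have h1 := flow_of_eq_zero hw hc (hΩ _ h) (-t)
  rw [flow_neg_flow hw hc] at h1
  exact h (h1 ▸ hy)

set_option synthInstance.maxHeartbeats 200000 in
-- The path u ↦ flow(tu, y) is the solution g of g - t ∫₀ w(g) = y in `C(I, E)`. The left side is
-- smooth in (t, g) by the superposition lemma. For small t it is injective in g and has invertible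
-- derivative, so the inverse function theorem shows that g, and then g(1), depends smoothly on (t,
-- y) jointly.
theorem exists_contDiffAt_flow_of_small :
    ∃ δ > 0, ∀ t y, |t| < δ → ContDiffAt ℝ ∞ (fun q : ℝ × E => flow w q.1 q.2) (t, y) := by
  obtain ⟨C, hC⟩ := exists_lipschitz hw hc
  -- With `C` the Lipschitz constant, |t| < 1/(C+1) gives |t| C < 1; adding 1 covers the case C = 0.
  refine ⟨1 / (C + 1), by positivity, fun t₀ y₀ ht₀ => ?_⟩
  have hsmall : ∀ {t : ℝ}, |t| < 1 / (C + 1) → |t| * C < 1 := fun {t} ht => by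
    rw [lt_div_iff₀ (by positivity)] at ht
    nlinarith [abs_nonneg t]
  have hcont := hw.continuous
  let S : C(I, E) → C(I, E) := superpose w
  have hS : ∀ g u, S g u = w (g u) := fun g u =>
    superpose_apply (Ω := univ) hcont.continuousOn (fun _ => mem_univ _) u
  have hSd : ContDiff ℝ ∞ S := by
    have := contDiffOn_superpose (K := I) isOpen_univ hw.contDiffOn
    simpa [contDiffOn_univ] using this
  let F : ℝ × C(I, E) → ℝ × C(I, E) := fun q => (q.1, q.2 - q.1 • primCLM E (S q.2))
  have hF : ContDiff ℝ ∞ F := by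
    have : ContDiff ℝ ∞ fun q : ℝ × C(I, E) => primCLM E (S q.2) :=
      (primCLM E).contDiff.comp (hSd.comp contDiff_snd)
    exact contDiff_fst.prodMk (contDiff_snd.sub (contDiff_fst.smul this))
  have hlip : ∀ g g' : C(I, E), ‖S g - S g'‖ ≤ C * ‖g - g'‖ := fun g g' => by
    rw [ContinuousMap.norm_le _ (by positivity)]
    intro u
    rw [ContinuousMap.sub_apply, hS, hS]
    exact (hC.norm_sub_le _ _).trans (by gcongr; exact (g - g').norm_coe_le_norm u)
  have hinj : ∀ t : ℝ, |t| < 1 / (C + 1) → ∀ g g' : C(I, E), F (t, g) = F (t, g') → g = g' := by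
    intro t ht g g' h
    have h2 : g - g' = t • primCLM E (S g - S g') := by
      have := (Prod.mk.inj h).2
      simp only at this
      rw [map_sub, smul_sub]
      calc g - g' = (g - t • primCLM E (S g)) - (g' - t • primCLM E (S g')) +
            (t • primCLM E (S g) - t • primCLM E (S g')) := by abel
        _ = _ := by rw [this, sub_self, zero_add]
    have h3 : ‖g - g'‖ ≤ |t| * (C * ‖g - g'‖) := by
      conv_lhs => rw [h2]
      rw [norm_smul, Real.norm_eq_abs]
      gcongr
      exact (norm_primCLM_le _).trans (hlip g g')
    have h4 := hsmall ht
    have : ‖g - g'‖ = 0 := by nlinarith [norm_nonneg (g - g')]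
    exact sub_eq_zero.1 (norm_eq_zero.1 this)
  let path : ℝ → E → C(I, E) := fun t y =>
    ⟨fun u => flow w (t * u) y, by
      have : Continuous fun r => flow w r y :=
        continuous_iff_continuousAt.2 fun r => (hasDerivAt_flow hw hc r y).continuousAt
      exact this.comp (by fun_prop)⟩
  have hpath : ∀ t y, F (t, path t y) = (t, constCLM I E y) := by
    intro t y
    refine Prod.ext rfl ?_
    ext u
    have hd : ∀ r ∈ uIcc (0 : ℝ) u, HasDerivAt (fun r => flow w (t * r) y)
        (t • w (flow w (t * r) y)) r := fun r _ => by
      have h1 := (hasDerivAt_flow hw hc (t * r) y).scomp r ((hasDerivAt_id r).const_mul t)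
      simpa using! h1
    have hci : Continuous fun r => t • w (flow w (t * r) y) := by
      have : Continuous fun r => flow w r y :=
        continuous_iff_continuousAt.2 fun r => (hasDerivAt_flow hw hc r y).continuousAt
      exact (hcont.comp (this.comp (by fun_prop))).const_smul t
    have h2 := intervalIntegral.integral_eq_sub_of_hasDerivAt hd (hci.intervalIntegrable _ _)
    have h3 : prim (S (path t y)) u = ∫ r in (0 : ℝ)..u, w (flow w (t * r) y) := by
      refine intervalIntegral.integral_congr fun r hr => ?_
      rw [uIcc_of_le u.2.1] at hr
      simp only [hS]
      simp only [path, ContinuousMap.coe_mk]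
      rw [projIcc_of_mem zero_le_one ⟨hr.1, hr.2.trans u.2.2⟩]
    rw [intervalIntegral.integral_smul, ← h3] at h2
    simp only [F, ContinuousMap.sub_apply, ContinuousMap.smul_apply, primCLM_apply, h2,
      constCLM_apply]
    simp [path, flow_zero hw hc]
  let T : C(I, E) →L[ℝ] C(I, E) := (primCLM E).comp (fderiv ℝ S (path t₀ y₀))
  have hTle : ∀ g, ‖T g‖ ≤ C * ‖g‖ := fun g => by
    refine (norm_primCLM_le _).trans ((fderiv ℝ S _).le_of_opNorm_le ?_ g)
    refine norm_fderiv_le_of_lip' ℝ C.2 (Filter.Eventually.of_forall fun x => hlip _ _)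
  let D : ℝ × C(I, E) →L[ℝ] ℝ × C(I, E) :=
    (ContinuousLinearMap.fst ℝ _ _).prod (ContinuousLinearMap.snd ℝ _ _ -
      (t₀ • T.comp (ContinuousLinearMap.snd ℝ _ _) +
        (ContinuousLinearMap.fst ℝ _ _).smulRight (primCLM E (S (path t₀ y₀)))))
  have hD : HasFDerivAt F D (t₀, path t₀ y₀) := by
    have h1 : HasFDerivAt (fun q : ℝ × C(I, E) => primCLM E (S q.2))
        (T.comp (ContinuousLinearMap.snd ℝ _ _)) (t₀, path t₀ y₀) := by
      have h0 : HasFDerivAt S (fderiv ℝ S (path t₀ y₀)) (path t₀ y₀) :=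
        ((hSd.differentiable (by simp)) (path t₀ y₀)).hasFDerivAt
      have h2 : HasFDerivAt (fun q : ℝ × C(I, E) => S q.2) _ (t₀, path t₀ y₀) :=
        HasFDerivAt.comp (g := S) (t₀, path t₀ y₀) h0 hasFDerivAt_snd
      exact (primCLM E).hasFDerivAt.comp (t₀, path t₀ y₀) h2
    exact hasFDerivAt_fst.prodMk (hasFDerivAt_snd.sub (hasFDerivAt_fst.smul h1))
  -- Neumann series: the operator `t₀ • T` has norm at most |t₀| C < 1.
  have hunit : IsUnit (1 - t₀ • T) := by
    refine ⟨Units.oneSub (t₀ • T) ?_, rfl⟩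
    refine lt_of_le_of_lt (ContinuousLinearMap.opNorm_le_bound _ (by positivity) fun g => ?_)
      (hsmall ht₀)
    rw [smul_apply, norm_smul, Real.norm_eq_abs, mul_assoc]
    gcongr
    exact hTle g
  obtain ⟨A, hA⟩ := hunit
  have hA1 : ∀ g, g - t₀ • T g = (A : C(I, E) →L[ℝ] C(I, E)) g := fun g => by rw [hA]; rfl
  have hAinv : ∀ g, (A : C(I, E) →L[ℝ] C(I, E)) ((↑A⁻¹ : C(I, E) →L[ℝ] C(I, E)) g) = g := fun g => by
    rw [← mul_apply_eq_comp, Units.mul_inv]; rfl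
  have hinvA : ∀ g, (↑A⁻¹ : C(I, E) →L[ℝ] C(I, E)) ((A : C(I, E) →L[ℝ] C(I, E)) g) = g := fun g => by
    rw [← mul_apply_eq_comp, Units.inv_mul]; rfl
  have hDapp : ∀ q : ℝ × C(I, E),
      D q = (q.1, (A : C(I, E) →L[ℝ] C(I, E)) q.2 - q.1 • primCLM E (S (path t₀ y₀))) := fun q => by
    rw [← hA1]
    simp [D, sub_sub]
  have hker : D.ker = ⊥ := by
    refine LinearMap.ker_eq_bot'.2 fun q hq => ?_
    have hq' := (hDapp q).symm.trans hq
    rw [Prod.ext_iff] at hq'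
    obtain ⟨h1, h2⟩ := hq'
    simp only [Prod.fst_zero, Prod.snd_zero] at h1 h2
    rw [h1, zero_smul, sub_zero] at h2
    have h3 := hinvA q.2
    rw [h2, map_zero] at h3
    exact Prod.ext h1 h3.symm
  have hrange : D.range = ⊤ := by
    refine LinearMap.range_eq_top.2 fun q => ?_
    refine ⟨(q.1, (↑A⁻¹ : C(I, E) →L[ℝ] C(I, E)) (q.2 + q.1 • primCLM E (S (path t₀ y₀)))), ?_⟩
    refine (hDapp _).trans ?_
    simp only [hAinv]
    simp
  let D' := ContinuousLinearEquiv.ofBijective D hker hrange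
  have hD' : HasFDerivAt F (D' : ℝ × C(I, E) →L[ℝ] ℝ × C(I, E)) (t₀, path t₀ y₀) := by
    have h : (D' : ℝ × C(I, E) →L[ℝ] ℝ × C(I, E)) = D :=
      ContinuousLinearEquiv.coe_ofBijective D hker hrange
    rw [h]
    exact hD
  have hFat : ContDiffAt ℝ ∞ F (t₀, path t₀ y₀) := hF.contDiffAt
  have hG := hFat.to_localInverse hD' (by simp)
  set G := hFat.localInverse hD' (by simp) with hGdef
  rw [hpath] at hG
  have hright : ∀ᶠ z in 𝓝 (t₀, constCLM I E y₀), F (G z) = z := by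
    have := (hFat.hasStrictFDerivAt' hD' (by simp)).eventually_right_inverse
    rw [hpath] at this
    exact this
  have hin : ContDiffAt ℝ ∞ (fun q : ℝ × E => (q.1, constCLM I E q.2)) (t₀, y₀) := by
    fun_prop
  have hcomp : ContDiffAt ℝ ∞ (fun q : ℝ × E => (G (q.1, constCLM I E q.2)).2 1) (t₀, y₀) :=
    (ContinuousMap.evalCLM ℝ (1 : I) : C(I, E) →L[ℝ] E).contDiff.contDiffAt.comp (t₀, y₀)
      (contDiffAt_snd.comp _ (ContDiffAt.comp (t₀, y₀) (g := G) hG hin))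
  refine hcomp.congr_of_eventuallyEq ?_
  have h5 : ∀ᶠ q : ℝ × E in 𝓝 (t₀, y₀), |q.1| < 1 / ((C : ℝ) + 1) :=
    (continuous_abs.comp continuous_fst).continuousAt.eventually_lt_const ht₀
  filter_upwards [hin.continuousAt.eventually hright, h5] with q hq1 hq2
  -- The local inverse and the flow path solve the same equation, so by `hinj` they coincide;
  -- smoothness of `G` thus passes to the flow.
  have h6 : F (q.1, path q.1 q.2) = F (q.1, (G (q.1, constCLM I E q.2)).2) := by
    have h7 : (G (q.1, constCLM I E q.2)).1 = q.1 := congrArg Prod.fst hq1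
    have h8 : (q.1, (G (q.1, constCLM I E q.2)).2) = G (q.1, constCLM I E q.2) :=
      Prod.ext h7.symm rfl
    rw [hpath, h8, hq1]
  have h8 := hinj q.1 hq2 _ _ h6
  rw [← h8]
  simp [path]

/-- The group law reduces everything to small times: the time t map is an iterate of the time t/N
map, and near (t, y) the flow is the flow for the small time q.1 - t after the fixed map `flow w t`.
-/
theorem contDiff_flow : ContDiff ℝ ∞ (fun q : ℝ × E => flow w q.1 q.2) := by
  obtain ⟨δ, hδ, h⟩ := exists_contDiffAt_flow_of_small hw hc
  have hs : ∀ t, |t| < δ → ContDiff ℝ ∞ (flow w t) := fun t ht =>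
    contDiff_iff_contDiffAt.2 fun y =>
      ContDiffAt.comp y (g := fun q : ℝ × E => flow w q.1 q.2) (h t y ht)
        (contDiffAt_const.prodMk contDiffAt_id)
  have hall : ∀ t, ContDiff ℝ ∞ (flow w t) := by
    intro t
    obtain ⟨N, hN⟩ := exists_nat_gt (|t| / δ)
    have hN0 : (0 : ℝ) < N := lt_of_le_of_lt (by positivity) hN
    have h1 : ContDiff ℝ ∞ (flow w (t / N)) := hs _ (by
      rw [abs_div, abs_of_pos hN0, div_lt_iff₀ hN0]
      rw [div_lt_iff₀ hδ] at hN
      linarith)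
    have h2 : ∀ k : ℕ, flow w (k * (t / N)) = (flow w (t / N))^[k] := by
      intro k
      induction k with
      | zero => ext y; simp [flow_zero hw hc]
      | succ k ih =>
        ext y
        rw [Function.iterate_succ_apply', ← ih, ← flow_add hw hc]
        congr 1
        push_cast
        ring
    have h3 := h2 N
    rw [mul_div_cancel₀ t hN0.ne'] at h3
    rw [h3]
    clear h3 h2 hN hN0
    generalize flow w (t / N) = f at h1
    induction N with
    | zero => exact contDiff_id
    | succ k ih => rw [Function.iterate_succ']; exact h1.comp ih
  rw [contDiff_iff_contDiffAt]
  rintro ⟨t, y⟩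
  have h1 : (fun q : ℝ × E => flow w q.1 q.2) =
      fun q => (fun q : ℝ × E => flow w q.1 q.2) (q.1 - t, flow w t q.2) := by
    ext q
    simp only
    rw [← flow_add hw hc, sub_add_cancel]
  rw [h1]
  refine ContDiffAt.comp (t, y) (g := fun q : ℝ × E => flow w q.1 q.2)
    (by simpa using h (t - t) (flow w t y) (by simpa using hδ)) ?_
  exact (contDiffAt_fst.sub contDiffAt_const).prodMk ((hall t).contDiffAt.comp _ contDiffAt_snd)

end Flow

/-! ### Poisson structures and Hamiltonian flows in a coordinate domain -/

set_option synthInstance.maxHeartbeats 200000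

theorem minSmoothness_two_le : minSmoothness ℝ 2 ≤ (∞ : WithTop ℕ∞) := by
  rw [minSmoothness_of_isRCLikeNormedField]
  exact ENat.LEInfty.out

section LocalPoisson

variable {E : Type} [NormedAddCommGroup E] [NormedSpace ℝ E]

/-- A Poisson structure on an open set `Ω` of a normed space. -/
structure IsLocalPoisson (Ω : Set E) (a : E → (E →L[ℝ] ℝ) →L[ℝ] E) : Prop where
  isOpen : IsOpen Ω
  smooth : ContDiffOn ℝ ∞ a Ω
  skew : ∀ y ∈ Ω, ∀ p q : E →L[ℝ] ℝ, p (a y q) = -q (a y p)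
  jacobi : ∀ y ∈ Ω, ∀ p q r : E →L[ℝ] ℝ, q (fderiv ℝ a y (a y p) r) + r (fderiv ℝ a y (a y q) p)
    + p (fderiv ℝ a y (a y r) q) = 0

/-- The Hamiltonian vector field of `k`, with the sign of the gauge transformations. -/
def hamField (a : E → (E →L[ℝ] ℝ) →L[ℝ] E) (k : E → ℝ) (y : E) : E := -a y (fderiv ℝ k y)

/-- The Hamiltonian `k` is smooth with compact support in the domain `Ω` of a local Poisson
structure `a`. -/
structure IsLocalHam (Ω : Set E) (a : E → (E →L[ℝ] ℝ) →L[ℝ] E) (k : E → ℝ) : Prop where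
  poisson : IsLocalPoisson Ω a
  smooth : ContDiff ℝ ∞ k
  compact : HasCompactSupport k
  supp : tsupport k ⊆ Ω

namespace IsLocalPoisson

variable {Ω : Set E} {a : E → (E →L[ℝ] ℝ) →L[ℝ] E} (hP : IsLocalPoisson Ω a)
include hP

theorem contDiffAt {y : E} (hy : y ∈ Ω) : ContDiffAt ℝ ∞ a y :=
  hP.smooth.contDiffAt (hP.isOpen.mem_nhds hy)

theorem hasFDerivAt {y : E} (hy : y ∈ Ω) : HasFDerivAt a (fderiv ℝ a y) y :=
  ((hP.contDiffAt hy).differentiableAt (by simp)).hasFDerivAt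

theorem hasFDerivAt_apply {y : E} (hy : y ∈ Ω) (q : E →L[ℝ] ℝ) :
    HasFDerivAt (fun y => a y q) ((fderiv ℝ a y).flip q) y := by
  simpa using (hP.hasFDerivAt hy).clm_apply (hasFDerivAt_const q y)

theorem skew_fderiv {y : E} (hy : y ∈ Ω) (v : E) (p q : E →L[ℝ] ℝ) :
    p (fderiv ℝ a y v q) = -q (fderiv ℝ a y v p) := by
  have h1 : HasFDerivAt (fun y => p (a y q) + q (a y p)) _ y :=
    (p.hasFDerivAt.comp y (hP.hasFDerivAt_apply hy q)).add
      (q.hasFDerivAt.comp y (hP.hasFDerivAt_apply hy p))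
  have h2 : HasFDerivAt (fun y => p (a y q) + q (a y p)) (0 : E →L[ℝ] ℝ) y := by
    refine (hasFDerivAt_const (0 : ℝ) y).congr_of_eventuallyEq ?_
    filter_upwards [hP.isOpen.mem_nhds hy] with z hz
    rw [hP.skew z hz p q, neg_add_cancel]
  have h3 := congrArg (fun T : E →L[ℝ] ℝ => T v) (h1.unique h2)
  simp at h3
  linarith

end IsLocalPoisson

namespace IsLocalHam

variable {Ω : Set E} {a : E → (E →L[ℝ] ℝ) →L[ℝ] E} {k : E → ℝ} (hH : IsLocalHam Ω a k)
include hH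

theorem fderiv_eq_zero {y : E} (hy : y ∉ tsupport k) : fderiv ℝ k y = 0 := by
  by_contra h
  exact hy (support_fderiv_subset ℝ h)

theorem hamField_eq_zero {y : E} (hy : y ∉ tsupport k) : hamField a k y = 0 := by
  simp [hamField, hH.fderiv_eq_zero hy]

theorem hamField_eq_zero' {y : E} (hy : y ∉ Ω) : hamField a k y = 0 :=
  hH.hamField_eq_zero fun h => hy (hH.supp h)

theorem contDiff_fderiv : ContDiff ℝ ∞ (fderiv ℝ k) :=
  hH.smooth.fderiv_right (m := ∞) (by simp)

theorem contDiff_hamField : ContDiff ℝ ∞ (hamField a k) := by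
  rw [contDiff_iff_contDiffAt]
  intro y
  by_cases hy : y ∈ tsupport k
  · exact ((hH.poisson.contDiffAt (hH.supp hy)).clm_apply hH.contDiff_fderiv.contDiffAt).neg
  · refine (contDiffAt_const (c := (0 : E))).congr_of_eventuallyEq ?_
    filter_upwards [(isClosed_tsupport k).isOpen_compl.mem_nhds hy] with z hz
    exact hH.hamField_eq_zero hz

theorem hasCompactSupport_hamField : HasCompactSupport (hamField a k) :=
  hH.compact.mono' fun y hy => by
    by_contra h
    exact hy (hH.hamField_eq_zero h)

theorem fderiv_symm (y v v' : E) :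
    fderiv ℝ (fderiv ℝ k) y v v' = fderiv ℝ (fderiv ℝ k) y v' v :=
  (hH.smooth.contDiffAt.isSymmSndFDerivAt minSmoothness_two_le) v v'

theorem hasFDerivAt_fderiv (y : E) : HasFDerivAt (fderiv ℝ k) (fderiv ℝ (fderiv ℝ k) y) y :=
  (hH.contDiff_fderiv.differentiable (by simp) y).hasFDerivAt

theorem fderiv_hamField {y : E} (hy : y ∈ Ω) (v : E) :
    fderiv ℝ (hamField a k) y v =
      -(fderiv ℝ a y v (fderiv ℝ k y) + a y (fderiv ℝ (fderiv ℝ k) y v)) := by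
  have h := ((hH.poisson.hasFDerivAt hy).clm_apply (hH.hasFDerivAt_fderiv y)).neg
  have h' : HasFDerivAt (hamField a k) _ y := h
  rw [h'.fderiv]
  simp [add_comm]

/-- Hamiltonian vector fields preserve the Poisson structure. -/
theorem fderiv_poisson_hamField {y : E} (hy : y ∈ Ω) (q : E →L[ℝ] ℝ) :
    fderiv ℝ a y (hamField a k y) q =
      fderiv ℝ (hamField a k) y (a y q) + a y (q ∘L fderiv ℝ (hamField a k) y) := by
  refine (SeparatingDual.eq_iff_forall_dual_eq (R := ℝ)).2 fun p => ?_
  have hsk := hH.poisson.skew y hy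
  have hskd := fun v => hH.poisson.skew_fderiv hy v
  rw [map_add, hsk p (q ∘L _), ContinuousLinearMap.comp_apply, hH.fderiv_hamField hy,
    hH.fderiv_hamField hy]
  simp only [hamField, map_neg, map_add, neg_apply]
  -- Tested against `p`, the claim is the Jacobi identity for `p`, `q` and dk. The second
  -- derivatives of `k` cancel by their symmetry and the skewness of `a`.
  have hj := hH.poisson.jacobi y hy p q (fderiv ℝ k y)
  have h1 := hskd (a y q) (fderiv ℝ k y) p
  have h2 := hsk p (fderiv ℝ (fderiv ℝ k) y (a y q))
  have h3 := hsk q (fderiv ℝ (fderiv ℝ k) y (a y p))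
  have h4 := hH.fderiv_symm y (a y q) (a y p)
  linarith

variable [CompleteSpace E]

theorem contDiff_hamFlow : ContDiff ℝ ∞ (fun z : ℝ × E => flow (hamField a k) z.1 z.2) :=
  contDiff_flow hH.contDiff_hamField hH.hasCompactSupport_hamField

end IsLocalHam

/-- The derivative of the Hamiltonian flow. -/
def flowDeriv (a : E → (E →L[ℝ] ℝ) →L[ℝ] E) (k : E → ℝ) (ρ : ℝ) (y : E) : E →L[ℝ] E :=
  fderiv ℝ (flow (hamField a k) ρ) y

/-- Mixed partial derivatives commute. -/
theorem hasDerivAt_fderiv_of_contDiffAt {F : Type} [NormedAddCommGroup F] [NormedSpace ℝ F]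
    {Φ : ℝ × E → F} {ρ : ℝ} {y : E} (hΦ : ContDiffAt ℝ ∞ Φ (ρ, y)) {ψ : E → F}
    (hψ : ∀ᶠ z in 𝓝 y, HasDerivAt (fun s => Φ (s, z)) (ψ z) ρ) :
    HasDerivAt (fun s => fderiv ℝ (fun z => Φ (s, z)) y) (fderiv ℝ ψ y) ρ := by
  have hd : ContDiffAt ℝ ∞ (fderiv ℝ Φ) (ρ, y) := hΦ.fderiv_right (m := ∞) (by simp)
  have hdd : HasFDerivAt (fderiv ℝ Φ) (fderiv ℝ (fderiv ℝ Φ) (ρ, y)) (ρ, y) :=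
    (hd.differentiableAt (by simp)).hasFDerivAt
  have hev : ∀ᶠ z in 𝓝 (ρ, y), DifferentiableAt ℝ Φ z :=
    ((hΦ.of_le (m := 1) (by simp)).eventually (by simp)).mono
      fun z hz => hz.differentiableAt (by simp)
  have hψ' : HasFDerivAt ψ ((fderiv ℝ (fderiv ℝ Φ) (ρ, y) |>.flip (1, 0)) ∘L
      ContinuousLinearMap.inr ℝ ℝ E) y := by
    have h1 : HasFDerivAt (fun z : E => fderiv ℝ Φ (ρ, z) (1, 0)) _ y :=
      (hdd.comp y (hasFDerivAt_prodMk_right ρ y)).clm_apply (hasFDerivAt_const ((1 : ℝ), (0 : E)) y)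
    refine (h1.congr_fderiv ?_).congr_of_eventuallyEq ?_
    · ext v; simp
    · have h2 : ∀ᶠ z in 𝓝 y, DifferentiableAt ℝ Φ (ρ, z) :=
        (continuousAt_const.prodMk continuousAt_id : ContinuousAt (fun z : E => (ρ, z)) y).eventually
          hev
      filter_upwards [hψ, h2] with z hz hz2
      have h3 := hz2.hasFDerivAt.comp_hasDerivAt ρ ((hasDerivAt_id ρ).prodMk (hasDerivAt_const ρ z))
      exact hz.unique h3
  rw [hψ'.fderiv]
  have h4 : HasDerivAt (fun s : ℝ => fderiv ℝ Φ (s, y) ∘L ContinuousLinearMap.inr ℝ ℝ E)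
      (fderiv ℝ (fderiv ℝ Φ) (ρ, y) (1, 0) ∘L ContinuousLinearMap.inr ℝ ℝ E) ρ := by
    have := hdd.comp_hasDerivAt ρ ((hasDerivAt_id ρ).prodMk (hasDerivAt_const ρ y))
    simpa using! this.clm_comp (hasDerivAt_const ρ (ContinuousLinearMap.inr ℝ ℝ E))
  refine (h4.congr_deriv ?_).congr_of_eventuallyEq ?_
  · ext v
    have := (hΦ.isSymmSndFDerivAt minSmoothness_two_le) (1, 0) (0, v)
    simpa using this
  · have h2 : ∀ᶠ s in 𝓝 ρ, DifferentiableAt ℝ Φ (s, y) :=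
      (continuousAt_id.prodMk continuousAt_const : ContinuousAt (fun s : ℝ => (s, y)) ρ).eventually
        hev
    filter_upwards [h2] with s hs
    exact (hs.hasFDerivAt.comp y (hasFDerivAt_prodMk_right s y)).fderiv

namespace IsLocalHam

variable [CompleteSpace E]
variable {Ω : Set E} {a : E → (E →L[ℝ] ℝ) →L[ℝ] E} {k : E → ℝ} (hH : IsLocalHam Ω a k)
include hH

theorem contDiff_flow_apply (ρ : ℝ) : ContDiff ℝ ∞ (flow (hamField a k) ρ) :=
  hH.contDiff_hamFlow.comp (contDiff_const.prodMk contDiff_id)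

theorem hasFDerivAt_flow (ρ : ℝ) (y : E) :
    HasFDerivAt (flow (hamField a k) ρ) (flowDeriv a k ρ y) y :=
  ((hH.contDiff_flow_apply ρ).differentiable (by simp) y).hasFDerivAt

theorem contDiff_flowDeriv : ContDiff ℝ ∞ (fun z : ℝ × E => flowDeriv a k z.1 z.2) := by
  have h : (fun z : ℝ × E => flowDeriv a k z.1 z.2) = fun z =>
      fderiv ℝ (fun z : ℝ × E => flow (hamField a k) z.1 z.2) z ∘L
        ContinuousLinearMap.inr ℝ ℝ E := by
    ext1 z
    exact (HasFDerivAt.comp (g := fun z : ℝ × E => flow (hamField a k) z.1 z.2) z.2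
      (f := fun y => (z.1, y)) (hH.contDiff_hamFlow.differentiable (by simp) z).hasFDerivAt
      (hasFDerivAt_prodMk_right z.1 z.2)).fderiv
  rw [h]
  exact (hH.contDiff_hamFlow.fderiv_right (m := ∞) (by simp)).clm_comp contDiff_const

theorem hasDerivAt_hamFlow (ρ : ℝ) (y : E) :
    HasDerivAt (fun s => flow (hamField a k) s y) (hamField a k (flow (hamField a k) ρ y)) ρ :=
  hasDerivAt_flow hH.contDiff_hamField hH.hasCompactSupport_hamField ρ y

theorem hamFlow_zero (y : E) : flow (hamField a k) 0 y = y :=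
  flow_zero hH.contDiff_hamField hH.hasCompactSupport_hamField y

theorem hamFlow_add (ρ τ : ℝ) (y : E) :
    flow (hamField a k) (ρ + τ) y = flow (hamField a k) ρ (flow (hamField a k) τ y) :=
  flow_add hH.contDiff_hamField hH.hasCompactSupport_hamField ρ τ y

theorem hamFlow_neg_flow (ρ : ℝ) (y : E) :
    flow (hamField a k) (-ρ) (flow (hamField a k) ρ y) = y :=
  flow_neg_flow hH.contDiff_hamField hH.hasCompactSupport_hamField ρ y

theorem hamFlow_mem {y : E} (hy : y ∈ Ω) (ρ : ℝ) : flow (hamField a k) ρ y ∈ Ω :=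
  flow_mem hH.contDiff_hamField hH.hasCompactSupport_hamField (fun _ h => hH.hamField_eq_zero' h)
    hy ρ

theorem hamFlow_of_notMem {y : E} (hy : y ∉ tsupport k) (ρ : ℝ) : flow (hamField a k) ρ y = y :=
  flow_of_eq_zero hH.contDiff_hamField hH.hasCompactSupport_hamField (hH.hamField_eq_zero hy) ρ

theorem flowDeriv_zero (y : E) : flowDeriv a k 0 y = ContinuousLinearMap.id ℝ E := by
  have : flow (hamField a k) 0 = id := funext hH.hamFlow_zero
  rw [flowDeriv, this, fderiv_id]

theorem flowDeriv_of_notMem {y : E} (hy : y ∉ tsupport k) (ρ : ℝ) :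
    flowDeriv a k ρ y = ContinuousLinearMap.id ℝ E := by
  refine HasFDerivAt.fderiv ?_
  refine (hasFDerivAt_id y).congr_of_eventuallyEq ?_
  filter_upwards [(isClosed_tsupport k).isOpen_compl.mem_nhds hy] with z hz
  exact hH.hamFlow_of_notMem hz ρ

theorem flowDeriv_add (ρ τ : ℝ) (y : E) :
    flowDeriv a k (ρ + τ) y = flowDeriv a k ρ (flow (hamField a k) τ y) ∘L flowDeriv a k τ y := by
  have h : flow (hamField a k) (ρ + τ) = flow (hamField a k) ρ ∘ flow (hamField a k) τ :=
    funext fun y => hH.hamFlow_add ρ τ y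
  rw [flowDeriv, h]
  exact ((hH.hasFDerivAt_flow ρ _).comp y (hH.hasFDerivAt_flow τ y)).fderiv

theorem flowDeriv_neg_comp (ρ : ℝ) (y : E) :
    flowDeriv a k (-ρ) (flow (hamField a k) ρ y) ∘L flowDeriv a k ρ y =
      ContinuousLinearMap.id ℝ E := by
  rw [← hH.flowDeriv_add, neg_add_cancel, hH.flowDeriv_zero]

theorem flowDeriv_comp_neg (ρ : ℝ) (y : E) :
    flowDeriv a k ρ y ∘L flowDeriv a k (-ρ) (flow (hamField a k) ρ y) =
      ContinuousLinearMap.id ℝ E := by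
  have := hH.flowDeriv_neg_comp (-ρ) (flow (hamField a k) ρ y)
  rwa [neg_neg, hH.hamFlow_neg_flow] at this

theorem hasDerivAt_flowDeriv (ρ : ℝ) (y : E) :
    HasDerivAt (fun s => flowDeriv a k s y)
      (fderiv ℝ (hamField a k) (flow (hamField a k) ρ y) ∘L flowDeriv a k ρ y) ρ := by
  have h := hasDerivAt_fderiv_of_contDiffAt (hH.contDiff_hamFlow.contDiffAt (x := (ρ, y)))
    (ψ := fun z => hamField a k (flow (hamField a k) ρ z))
    (Filter.Eventually.of_forall fun z => hH.hasDerivAt_hamFlow ρ z)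
  refine h.congr_deriv ?_
  exact (((hH.contDiff_hamField.differentiable (by simp) _).hasFDerivAt).comp y
    (hH.hasFDerivAt_flow ρ y)).fderiv

/-- The Hamiltonian vector field is invariant under its flow. -/
theorem flowDeriv_hamField (ρ : ℝ) (y : E) :
    flowDeriv a k ρ y (hamField a k y) = hamField a k (flow (hamField a k) ρ y) := by
  have h1 : HasDerivAt (fun s => flow (hamField a k) ρ (flow (hamField a k) s y))
      (flowDeriv a k ρ (flow (hamField a k) 0 y) (hamField a k (flow (hamField a k) 0 y))) 0 :=
    (hH.hasFDerivAt_flow ρ _).comp_hasDerivAt 0 (hH.hasDerivAt_hamFlow 0 y)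
  have h2 : HasDerivAt (fun s => flow (hamField a k) (s + ρ) y)
      (hamField a k (flow (hamField a k) (0 + ρ) y)) 0 :=
    (hH.hasDerivAt_hamFlow (0 + ρ) y).comp_add_const 0 ρ
  have h3 : (fun s => flow (hamField a k) (s + ρ) y) =
      fun s => flow (hamField a k) ρ (flow (hamField a k) s y) := by
    ext s
    rw [add_comm, hH.hamFlow_add]
  rw [h3] at h2
  have := h1.unique h2
  rwa [hH.hamFlow_zero, zero_add] at this

/-- The Hamiltonian is a constant of motion. -/
theorem ham_flow (ρ : ℝ) (y : E) : k (flow (hamField a k) ρ y) = k y := by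
  have hd : ∀ s, HasDerivAt (fun s => k (flow (hamField a k) s y)) 0 s := fun s => by
    have h := ((hH.smooth.differentiable (by simp) _).hasFDerivAt).comp_hasDerivAt s
      (hH.hasDerivAt_hamFlow s y)
    refine h.congr_deriv ?_
    generalize flow (hamField a k) s y = z
    by_cases hz : z ∈ Ω
    · have := hH.poisson.skew _ hz (fderiv ℝ k z) (fderiv ℝ k z)
      rw [hamField, map_neg]
      linarith
    · simp [hH.hamField_eq_zero' hz]
  have := is_const_of_deriv_eq_zero (fun s => (hd s).differentiableAt) (fun s => (hd s).deriv) ρ 0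
  rwa [hH.hamFlow_zero] at this

theorem fderiv_ham_flow (ρ : ℝ) (y : E) :
    fderiv ℝ k (flow (hamField a k) ρ y) ∘L flowDeriv a k ρ y = fderiv ℝ k y := by
  have h : k ∘ flow (hamField a k) ρ = k := funext fun y => hH.ham_flow ρ y
  have h2 := (((hH.smooth.differentiable (by simp) _).hasFDerivAt).comp y
    (hH.hasFDerivAt_flow ρ y)).fderiv
  rw [h] at h2
  exact h2.symm

/-- The operator transports tangent vectors from time `t` to time `ρ`, so its composition with
`flowDeriv a k t y` does not depend on `t`. Differentiating this product and cancelling the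
invertible factor gives the formula. -/
theorem hasDerivAt_flowDeriv_sub (ρ t : ℝ) (y : E) :
    HasDerivAt (fun t => flowDeriv a k (ρ - t) (flow (hamField a k) t y))
      (-(flowDeriv a k (ρ - t) (flow (hamField a k) t y) ∘L
        fderiv ℝ (hamField a k) (flow (hamField a k) t y))) t := by
  let G : ℝ → E →L[ℝ] E := fun t => flowDeriv a k (ρ - t) (flow (hamField a k) t y)
  have hG : ContDiff ℝ ∞ G := by
    have h1 : ContDiff ℝ ∞ fun t : ℝ => (ρ - t, flow (hamField a k) t y) :=
      (contDiff_const.sub contDiff_id).prodMk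
        (hH.contDiff_hamFlow.comp (contDiff_id.prodMk contDiff_const))
    exact hH.contDiff_flowDeriv.comp h1
  have hG' : HasDerivAt G (deriv G t) t := (hG.differentiable (by simp) t).hasDerivAt
  have h2 : HasDerivAt (fun t => G t ∘L flowDeriv a k t y) 0 t := by
    refine (hasDerivAt_const t (flowDeriv a k ρ y)).congr_of_eventuallyEq
      (Filter.Eventually.of_forall fun s => ?_)
    change flowDeriv a k (ρ - s) (flow (hamField a k) s y) ∘L flowDeriv a k s y = _
    rw [← hH.flowDeriv_add, sub_add_cancel]
  have h3 := (hG'.clm_comp (hH.hasDerivAt_flowDeriv t y)).unique h2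
  refine hG'.congr_deriv ?_
  ext v
  have h4 := congrArg (fun T : E →L[ℝ] E =>
    T (flowDeriv a k (-t) (flow (hamField a k) t y) v)) h3
  have h5 := congrArg (fun T : E →L[ℝ] E => T v) (hH.flowDeriv_comp_neg t y)
  simp only [ContinuousLinearMap.comp_apply, ContinuousLinearMap.id_apply] at h5
  simp only [add_apply, ContinuousLinearMap.comp_apply, zero_apply, h5] at h4
  rw [neg_apply, ContinuousLinearMap.comp_apply]
  exact eq_neg_of_add_eq_zero_left h4

/-- The Hamiltonian flow consists of Poisson maps. -/
theorem flow_isPoisson {y : E} (hy : y ∈ Ω) (ρ : ℝ) (q : E →L[ℝ] ℝ) :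
    flowDeriv a k ρ y (a y (q ∘L flowDeriv a k ρ y)) = a (flow (hamField a k) ρ y) q := by
  refine (SeparatingDual.eq_iff_forall_dual_eq (R := ℝ)).2 fun p => ?_
  let G : ℝ → E →L[ℝ] E := fun t => flowDeriv a k (ρ - t) (flow (hamField a k) t y)
  let z : ℝ → E := fun t => flow (hamField a k) t y
  have hcov : ∀ (p : E →L[ℝ] ℝ) t, HasDerivAt (fun t => p ∘L G t)
      (-((p ∘L G t) ∘L fderiv ℝ (hamField a k) (z t))) t := fun p t => by
    refine ((hasDerivAt_const t p).clm_comp (hH.hasDerivAt_flowDeriv_sub ρ t y)).congr_deriv ?_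
    ext v
    simp [G, z]
  -- The bracket of the covectors `p` and `q`, pulled back from time `ρ` to time `t`, is constant in
  -- `t` because the field preserves `a` infinitesimally. Its values at `t = 0` and `t = ρ` are the
  -- two sides of the claim.
  have hd : ∀ t, HasDerivAt (fun t => (p ∘L G t) (a (z t) (q ∘L G t))) 0 t := fun t => by
    have hmem : z t ∈ Ω := hH.hamFlow_mem hy t
    have h1 : HasDerivAt (fun t => a (z t)) (fderiv ℝ a (z t) (hamField a k (z t))) t := by
      have h0 := hH.poisson.hasFDerivAt hmem
      have h1 : HasDerivAt z (hamField a k (z t)) t := hH.hasDerivAt_hamFlow t y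
      exact HasFDerivAt.comp_hasDerivAt (E := (E →L[ℝ] ℝ) →L[ℝ] E) (F := E) (l := a) t h0 h1
    refine ((hcov p t).clm_apply (h1.clm_apply (hcov q t))).congr_deriv ?_
    have h2 := hH.fderiv_poisson_hamField hmem (q ∘L G t)
    change _ + (p ∘L G t) ((fderiv ℝ a (z t)) (hamField a k (z t)) (q ∘L G t) + _) = 0
    rw [h2, map_neg, neg_apply, ContinuousLinearMap.comp_apply (p ∘L G t)]
    simp only [map_add, map_neg]
    ring
  have := is_const_of_deriv_eq_zero (fun s => (hd s).differentiableAt) (fun s => (hd s).deriv) 0 ρ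
  simpa [G, z, hH.hamFlow_zero, hH.flowDeriv_zero] using this

end IsLocalHam

end LocalPoisson

/-! ### Lifts of Hamiltonian flows to covectors, and the transport of gauge vectors -/

section Lift

variable {E : Type} [NormedAddCommGroup E] [NormedSpace ℝ E]

/-- The action on covectors of the time `ρ` Hamiltonian flow, followed by the translation by
`τ dk`. -/
def lift (a : E → (E →L[ℝ] ℝ) →L[ℝ] E) (k : E → ℝ) (ρ τ : ℝ) (z : E × (E →L[ℝ] ℝ)) :
    E × (E →L[ℝ] ℝ) :=
  (flow (hamField a k) ρ z.1,
    (z.2 + τ • fderiv ℝ k z.1) ∘L flowDeriv a k (-ρ) (flow (hamField a k) ρ z.1))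

/-- The coordinate form of the infinitesimal gauge transformation: `z = (X, η)`, `b` is the gauge
parameter and `b'` its derivative along the path. -/
def GaugeRel (a : E → (E →L[ℝ] ℝ) →L[ℝ] E) (z : E × (E →L[ℝ] ℝ)) (b b' : E →L[ℝ] ℝ)
    (v : E × (E →L[ℝ] ℝ)) : Prop :=
  v.1 = -a z.1 b ∧ v.2 = b' + z.2 ∘L fderiv ℝ (fun y => a y b) z.1

/-- The algebraic identity behind the invariance of infinitesimal gauge transformations. -/
theorem gaugeRel_transport_aux {A A' : (E →L[ℝ] ℝ) →L[ℝ] E} {Da Da' : E →L[ℝ] (E →L[ℝ] ℝ) →L[ℝ] E}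
    {J₀ J₁ : E →L[ℝ] E} {J₂ : E →L[ℝ] E →L[ℝ] E} {κ : E →L[ℝ] ℝ} {H : E →L[ℝ] E →L[ℝ] ℝ} {τ : ℝ}
    {Dw : E →L[ℝ] E} (hsurj : Function.Surjective J₀)
    (hA : ∀ p r : E →L[ℝ] ℝ, p (A r) = -r (A p))
    (hDa : ∀ v, ∀ p r : E →L[ℝ] ℝ, p (Da v r) = -r (Da v p))
    (hJ₂ : ∀ v w, J₂ v w = J₂ w v) (hH : ∀ v w, H v w = H w v)
    (hDw : ∀ v, Dw v = -(Da v κ + A (H v)))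
    (h₀ : ∀ β, A' β = J₀ (A (β ∘L J₀)))
    (h₂ : ∀ v β, J₂ v (A (β ∘L J₀)) + J₀ (Da v (β ∘L J₀)) + J₀ (A (β ∘L J₂ v)) = Da' (J₀ v) β)
    (h₃ : ∀ v, J₁ v = J₂ v (-A κ) + J₀ (Dw v))
    {q q' β β' b' v₂ v₂' : E →L[ℝ] ℝ} {v₁ v₁' : E}
    (hq : q + τ • κ = q' ∘L J₀) (hb' : b' = β' ∘L J₀ + β ∘L (τ • J₁ + J₂ (-A q)))
    (hv₁ : v₁ = -A (β ∘L J₀)) (hv₂ : v₂ = b' + q ∘L Da.flip (β ∘L J₀))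
    (hv₁' : v₁' = J₀ v₁) (hv₂' : v₂' ∘L J₀ + q' ∘L J₂ v₁ = v₂ + τ • H v₁) :
    v₁' = -A' β ∧ v₂' = β' + q' ∘L Da'.flip β := by
  -- In the application, `J₀`, `J₂` are the first and second space derivatives of the map, `J₁` is
  -- the time derivative of `J₀`, `κ` and `H` are the differential and the Hessian of the
  -- Hamiltonian, and `τ` is the rate of the time function. Since `J₀` is onto, the covector
  -- identity may be tested on vectors `J₀ v`.
  refine ⟨by rw [hv₁', hv₁, h₀, map_neg], ?_⟩
  ext x
  obtain ⟨v, rfl⟩ := hsurj x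
  have e1 := congrArg (fun T : E →L[ℝ] ℝ => T v) hv₂'
  have e2 := congrArg (fun T : E →L[ℝ] ℝ => T v) hv₂
  have e3 := congrArg (fun T : E →L[ℝ] ℝ => T v) hb'
  have e4 := congrArg q' (h₂ v β)
  have e5 := fun x => congrArg (fun T : E →L[ℝ] ℝ => T x) hq
  have e6 := hA q (β ∘L J₂ v)
  have e7 := hA κ (β ∘L J₂ v)
  have e8 := hDa v (β ∘L J₀) κ
  have e9 := hA (β ∘L J₀) (H v)
  have e10 := congrArg β (h₃ v)
  have e11 := hH v (A (β ∘L J₀))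
  have e12 := e5 (Da v (β ∘L J₀))
  have e13 := e5 (A (β ∘L J₂ v))
  have e14 := congrArg (fun x => β (J₀ x)) (hDw v)
  have e15 := hJ₂ v (A (β ∘L J₀))
  have e16 := congrArg q' e15
  have e17 := congrArg β (hJ₂ v (A q))
  simp only [add_apply, ContinuousLinearMap.comp_apply, smul_apply, smul_eq_mul,
    ContinuousLinearMap.flip_apply, map_add, map_neg, map_smul, hv₁, neg_apply] at *
  linear_combination e1 + e2 + e3 + e4 + e12 + e13 - e6 - τ * e7 - τ * e8 - τ * e9 + τ * e10
    + τ * e11 + τ * e14 - e16 + e17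

/-- Infinitesimal gauge transformations are transported by Poisson maps `Φ(s(u), ·)`, where
`∂Φ/∂s` is the Hamiltonian vector field of `k`. -/
theorem gaugeRel_transport {P : Type} [NormedAddCommGroup P] [NormedSpace ℝ P]
    {Ω : Set E} {a a' : E → (E →L[ℝ] ℝ) →L[ℝ] E} {k : E → ℝ} {Φ : ℝ × E → E}
    {J : ℝ × E → E →L[ℝ] E} {τ : ℝ}
    {s : ℝ → ℝ} {y : ℝ → E} {β b : ℝ → E →L[ℝ] ℝ} {S : Set ℝ} {u : ℝ} {b' β' : E →L[ℝ] ℝ}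
    {F F' : P → E × (E →L[ℝ] ℝ)} {w : P} {ν : P}
    (ha : IsLocalPoisson Ω a) (hy : y u ∈ Ω) (ha' : DifferentiableAt ℝ a' (Φ (s u, y u)))
    (hk : ContDiff ℝ ∞ k) (hΦ : ContDiffAt ℝ ∞ Φ (s u, y u))
    (hJ : ∀ x, J x = fderiv ℝ (fun z => Φ (x.1, z)) x.2)
    (hJd : ContDiffAt ℝ ∞ J (s u, y u))
    (hsurj : Function.Surjective (J (s u, y u)))
    (hpois : ∀ᶠ z in 𝓝 (y u), ∀ q, J (s u, z) (a z (q ∘L J (s u, z))) = a' (Φ (s u, z)) q)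
    (hflow : ∀ᶠ z in 𝓝 (y u), HasDerivAt (fun r => Φ (r, z)) (J (s u, z) (hamField a k z)) (s u))
    (hS : UniqueDiffWithinAt ℝ S u) (huS : u ∈ S)
    (hs : HasDerivWithinAt s τ S u) (hyd : HasDerivWithinAt y (-a (y u) (F w).2) S u)
    (hb : HasDerivWithinAt b b' S u) (hβ : HasDerivWithinAt β β' S u)
    (hbβ : ∀ᶠ r in 𝓝[S] u, b r = β r ∘L J (s r, y r))
    (hFw : (F w).1 = y u)
    (hF : DifferentiableAt ℝ F w) (hF' : DifferentiableAt ℝ F' w)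
    (h1 : ∀ᶠ x in 𝓝 w, (F' x).1 = Φ (s u, (F x).1))
    (h2 : ∀ᶠ x in 𝓝 w, (F x).2 + τ • fderiv ℝ k (F x).1 = (F' x).2 ∘L J (s u, (F x).1))
    (hrel : GaugeRel a (F w) (b u) b' (fderiv ℝ F w ν)) :
    GaugeRel a' (F' w) (β u) β' (fderiv ℝ F' w ν) := by
  -- The statement serves two purposes: changes of chart, with zero Hamiltonian and `Φ` independent
  -- of time, and Hamiltonian flows. All hypotheses of `gaugeRel_transport_aux` are obtained by
  -- differentiating the relations between the two sides.
  have hb₀ : b u = β u ∘L J (s u, y u) := hbβ.self_of_nhdsWithin huS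
  have hJ' : HasFDerivAt J (fderiv ℝ J (s u, y u)) (s u, y u) :=
    (hJd.differentiableAt (by simp)).hasFDerivAt
  set DJ := fderiv ℝ J (s u, y u)
  set J₁ : E →L[ℝ] E := DJ (1, 0)
  set J₂ : E →L[ℝ] E →L[ℝ] E := DJ ∘L ContinuousLinearMap.inr ℝ ℝ E
  have hJ₂d : HasFDerivAt (fun z => J (s u, z)) J₂ (y u) :=
    HasFDerivAt.comp (g := J) (f := fun z => (s u, z)) (y u) hJ' (hasFDerivAt_prodMk_right _ _)
  have hJ₁d : HasDerivAt (fun r => J (r, y u)) J₁ (s u) :=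
    HasFDerivAt.comp_hasDerivAt (f := fun r => (r, y u)) (s u) hJ'
      ((hasDerivAt_id (s u)).prodMk (hasDerivAt_const (s u) (y u)))
  have hΦd : ∀ᶠ z in 𝓝 (y u), HasFDerivAt (fun z => Φ (s u, z)) (J (s u, z)) z := by
    have h : ContDiffAt ℝ 1 (fun z => Φ (s u, z)) (y u) :=
      (hΦ.of_le (by simp)).comp (y u) (contDiffAt_const.prodMk contDiffAt_id)
    filter_upwards [h.eventually (by simp)] with z hz
    rw [hJ]
    exact (hz.differentiableAt (by simp)).hasFDerivAt
  have hsymm : ∀ v v', J₂ v v' = J₂ v' v := by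
    have h : ContDiffAt ℝ ∞ (fun z => Φ (s u, z)) (y u) :=
      hΦ.comp (y u) (contDiffAt_const.prodMk contDiffAt_id)
    have h3 := h.isSymmSndFDerivAt minSmoothness_two_le
    have h4 : fderiv ℝ (fun z => Φ (s u, z)) = fun z => J (s u, z) := funext fun z => (hJ (s u, z)).symm
    rw [IsSymmSndFDerivAt, h4, hJ₂d.fderiv] at h3
    exact h3
  have hκd : HasFDerivAt (fderiv ℝ k) (fderiv ℝ (fderiv ℝ k) (y u)) (y u) :=
    ((hk.fderiv_right (m := ∞) (by simp)).differentiable (by simp) _).hasFDerivAt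
  have hda := ha.hasFDerivAt hy
  have hwd : HasFDerivAt (hamField a k) (-(a (y u) ∘L fderiv ℝ (fderiv ℝ k) (y u) +
      (fderiv ℝ a (y u)).flip (fderiv ℝ k (y u)))) (y u) :=
    (hda.clm_apply hκd).neg
  -- The relation b = β ∘ J(s, y) is differentiated along the path, whose velocity is given by the
  -- Gauss law.
  have hb' : b' = β' ∘L J (s u, y u) + β u ∘L (τ • J₁ + J₂ (-a (y u) (F w).2)) := by
    have h3 : HasDerivWithinAt (fun r => J (s r, y r)) (DJ (τ, -a (y u) (F w).2)) S u :=
      HasFDerivAt.comp_hasDerivWithinAt (f := fun r => (s r, y r)) u hJ' (hs.prodMk hyd)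
    have h4 := (hβ.clm_comp h3).congr_of_eventuallyEq hbβ hb₀
    have h5 := hS.eq_deriv _ hb h4
    rw [h5]
    have h6 : DJ (τ, -a (y u) (F w).2) = τ • J₁ + J₂ (-a (y u) (F w).2) := by
      rw [← map_smul, ContinuousLinearMap.comp_apply, ← map_add]
      simp
    rw [h6]
  have hFd := hF.hasFDerivAt
  have hF'd := hF'.hasFDerivAt
  have hF1 : HasFDerivAt (fun x => (F x).1) (ContinuousLinearMap.fst ℝ _ _ ∘L fderiv ℝ F w) w :=
    hasFDerivAt_fst.comp w hFd
  have hF2 : HasFDerivAt (fun x => (F x).2) (ContinuousLinearMap.snd ℝ _ _ ∘L fderiv ℝ F w) w :=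
    hasFDerivAt_snd.comp w hFd
  have hF'1 : HasFDerivAt (fun x => (F' x).1) (ContinuousLinearMap.fst ℝ _ _ ∘L fderiv ℝ F' w) w :=
    hasFDerivAt_fst.comp w hF'd
  have hF'2 : HasFDerivAt (fun x => (F' x).2) (ContinuousLinearMap.snd ℝ _ _ ∘L fderiv ℝ F' w) w :=
    hasFDerivAt_snd.comp w hF'd
  have hF'w : (F' w).1 = Φ (s u, y u) := by rw [h1.self_of_nhds, hFw]
  have hv₁' : (fderiv ℝ F' w ν).1 = J (s u, y u) (fderiv ℝ F w ν).1 := by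
    have h3 : HasFDerivAt (fun x => Φ (s u, (F x).1)) _ w :=
      HasFDerivAt.comp (g := fun z => Φ (s u, z)) w (hFw ▸ hΦd.self_of_nhds) hF1
    have h4 := hF'1.unique (h3.congr_of_eventuallyEq h1)
    have h5 := congrArg (fun T : P →L[ℝ] E => T ν) h4
    simp only [hFw] at h5
    exact h5
  have hv₂' : (fderiv ℝ F' w ν).2 ∘L J (s u, y u) + (F' w).2 ∘L J₂ (fderiv ℝ F w ν).1 =
      (fderiv ℝ F w ν).2 + τ • fderiv ℝ (fderiv ℝ k) (y u) (fderiv ℝ F w ν).1 := by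
    have h3 : HasFDerivAt (fun x => fderiv ℝ k (F x).1) _ w :=
      HasFDerivAt.comp (g := fderiv ℝ k) w (hFw ▸ hκd) hF1
    have h4 : HasFDerivAt (fun x => J (s u, (F x).1)) _ w :=
      HasFDerivAt.comp (g := fun z => J (s u, z)) w (hFw ▸ hJ₂d) hF1
    have h5 := (hF2.add (h3.const_smul τ)).unique ((hF'2.clm_comp h4).congr_of_eventuallyEq h2)
    have h6 := congrArg (fun T : P →L[ℝ] E →L[ℝ] ℝ => T ν) h5
    simp only [hFw] at h6
    ext v
    have h7 := congrArg (fun T : E →L[ℝ] ℝ => T v) h6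
    simp at h7
    simp
    linarith
  have hq : (F w).2 + τ • fderiv ℝ k (y u) = (F' w).2 ∘L J (s u, y u) := by
    have := h2.self_of_nhds
    rwa [hFw] at this
  -- The space derivative of the Poisson property `hpois`.
  have h₂ : ∀ v β, J₂ v (a (y u) (β ∘L J (s u, y u))) +
      J (s u, y u) (fderiv ℝ a (y u) v (β ∘L J (s u, y u))) +
      J (s u, y u) (a (y u) (β ∘L J₂ v)) = fderiv ℝ a' (Φ (s u, y u)) (J (s u, y u) v) β := by
    intro v β
    have h3 : HasFDerivAt (fun z => β ∘L J (s u, z)) _ (y u) :=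
      (hasFDerivAt_const β (y u)).clm_comp hJ₂d
    have h4 := hJ₂d.clm_apply (hda.clm_apply h3)
    have h5 : HasFDerivAt (fun z => a' (Φ (s u, z)) β) _ (y u) :=
      (HasFDerivAt.comp (g := a') (f := fun z => Φ (s u, z)) (y u) ha'.hasFDerivAt
        hΦd.self_of_nhds).clm_apply (hasFDerivAt_const β (y u))
    have h6 := h4.unique (h5.congr_of_eventuallyEq (hpois.mono fun z hz => hz β))
    have h7 := congrArg (fun T : E →L[ℝ] E => T v) h6
    simp at h7
    rw [← h7]
    abel
  -- The space derivative of the flow equation `hflow`, with the two derivatives exchanged.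
  have h₃ : ∀ v, J₁ v = J₂ v (-a (y u) (fderiv ℝ k (y u))) +
      J (s u, y u) (fderiv ℝ (hamField a k) (y u) v) := by
    intro v
    have h3 := hasDerivAt_fderiv_of_contDiffAt hΦ hflow
    have h4 : (fun r => fderiv ℝ (fun z => Φ (r, z)) (y u)) = fun r => J (r, y u) :=
      funext fun r => (hJ (r, y u)).symm
    rw [h4] at h3
    rw [hJ₁d.unique h3, (hJ₂d.clm_apply hwd).fderiv, hwd.fderiv]
    simp [hamField, add_comm]
  rw [hb₀] at hrel
  obtain ⟨hr1, hr2⟩ := hrel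
  rw [hFw] at hr1 hr2
  have hfl : ∀ (c : E → (E →L[ℝ] ℝ) →L[ℝ] E) (z : E) (q : E →L[ℝ] ℝ), DifferentiableAt ℝ c z →
      fderiv ℝ (fun y => c y q) z = (fderiv ℝ c z).flip q := fun c z q hc => by
    rw [(hc.hasFDerivAt.clm_apply (hasFDerivAt_const q z)).fderiv]
    simp
  rw [hfl a _ _ hda.differentiableAt] at hr2
  have key := gaugeRel_transport_aux (Dw := fderiv ℝ (hamField a k) (y u)) hsurj
    (ha.skew _ hy) (ha.skew_fderiv hy) hsymm
    (fun v v' => (hk.contDiffAt.isSymmSndFDerivAt minSmoothness_two_le) v v')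
    (fun v => by rw [hwd.fderiv]; simp [add_comm])
    (fun β => (hpois.self_of_nhds β).symm) h₂ h₃ hq hb' hr1 hr2 hv₁' hv₂'
  refine ⟨by rw [hF'w]; exact key.1, ?_⟩
  rw [hF'w, hfl a' _ _ ha']
  exact key.2

end Lift

/-! ### The group law of the lifted flows and the preservation of the Gauss law -/

section LiftLemmas

variable {E : Type} [NormedAddCommGroup E] [NormedSpace ℝ E] [CompleteSpace E]

namespace IsLocalHam

variable {Ω : Set E} {a : E → (E →L[ℝ] ℝ) →L[ℝ] E} {k : E → ℝ} (hH : IsLocalHam Ω a k)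
include hH

theorem contDiff_lift :
    ContDiff ℝ ∞ (fun z : (ℝ × ℝ) × (E × (E →L[ℝ] ℝ)) => lift a k z.1.1 z.1.2 z.2) := by
  have h1 : ContDiff ℝ ∞ (fun z : (ℝ × ℝ) × (E × (E →L[ℝ] ℝ)) =>
      flow (hamField a k) z.1.1 z.2.1) :=
    hH.contDiff_hamFlow.comp (g := fun z : ℝ × E => flow (hamField a k) z.1 z.2)
      (f := fun z : (ℝ × ℝ) × (E × (E →L[ℝ] ℝ)) => (z.1.1, z.2.1)) (by fun_prop)
  have h2 : ContDiff ℝ ∞ (fun z : (ℝ × ℝ) × (E × (E →L[ℝ] ℝ)) =>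
      flowDeriv a k (-z.1.1) (flow (hamField a k) z.1.1 z.2.1)) :=
    hH.contDiff_flowDeriv.comp (g := fun z : ℝ × E => flowDeriv a k z.1 z.2)
      (f := fun z : (ℝ × ℝ) × (E × (E →L[ℝ] ℝ)) =>
        (-z.1.1, flow (hamField a k) z.1.1 z.2.1)) (ContDiff.prodMk (by fun_prop) h1)
  have h3 : ContDiff ℝ ∞ (fun z : (ℝ × ℝ) × (E × (E →L[ℝ] ℝ)) =>
      z.2.2 + z.1.2 • fderiv ℝ k z.2.1) := by
    have : ContDiff ℝ ∞ (fun z : (ℝ × ℝ) × (E × (E →L[ℝ] ℝ)) => fderiv ℝ k z.2.1) :=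
      hH.contDiff_fderiv.comp (f := fun z : (ℝ × ℝ) × (E × (E →L[ℝ] ℝ)) => z.2.1) (by fun_prop)
    have e1 : ContDiff ℝ ∞ (fun z : (ℝ × ℝ) × (E × (E →L[ℝ] ℝ)) => z.2.2) := by fun_prop
    have e2 : ContDiff ℝ ∞ (fun z : (ℝ × ℝ) × (E × (E →L[ℝ] ℝ)) => z.1.2) := by fun_prop
    exact e1.add (e2.smul this)
  exact h1.prodMk (h3.clm_comp h2)

/-- The flow leaves dk invariant, so translations by dk commute with it and the pairs (ρ, τ) act as
the additive group ℝ². -/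
theorem lift_add (ρ' τ' ρ τ : ℝ) (z : E × (E →L[ℝ] ℝ)) :
    lift a k ρ' τ' (lift a k ρ τ z) = lift a k (ρ' + ρ) (τ' + τ) z := by
  refine Prod.ext (hH.hamFlow_add ρ' ρ z.1).symm ?_
  have h1 := hH.flowDeriv_add (-ρ) (-ρ') (flow (hamField a k) (ρ' + ρ) z.1)
  have h2 : flow (hamField a k) (-ρ') (flow (hamField a k) (ρ' + ρ) z.1) =
      flow (hamField a k) ρ z.1 := by rw [hH.hamFlow_add, hH.hamFlow_neg_flow]
  have h3 := hH.fderiv_ham_flow (-ρ) (flow (hamField a k) ρ z.1)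
  rw [hH.hamFlow_neg_flow] at h3
  simp only [lift]
  rw [show -(ρ' + ρ) = -ρ + -ρ' by ring, h1, h2, ← hH.hamFlow_add, ← h3]
  ext v
  simp
  ring

theorem lift_zero (z : E × (E →L[ℝ] ℝ)) : lift a k 0 0 z = z := by
  refine Prod.ext (hH.hamFlow_zero z.1) ?_
  simp only [lift, neg_zero, hH.flowDeriv_zero, zero_smul, add_zero]
  ext v
  simp

theorem lift_of_notMem {z : E × (E →L[ℝ] ℝ)} (hz : z.1 ∉ tsupport k) (ρ τ : ℝ) :
    lift a k ρ τ z = z := by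
  refine Prod.ext (hH.hamFlow_of_notMem hz ρ) ?_
  simp only [lift, hH.hamFlow_of_notMem hz, hH.flowDeriv_of_notMem hz, hH.fderiv_eq_zero hz,
    smul_zero, add_zero]
  ext v
  simp

theorem lift_snd_comp (ρ τ : ℝ) (z : E × (E →L[ℝ] ℝ)) :
    (lift a k ρ τ z).2 ∘L flowDeriv a k ρ z.1 = z.2 + τ • fderiv ℝ k z.1 := by
  simp only [lift]
  rw [ContinuousLinearMap.comp_assoc, hH.flowDeriv_neg_comp]
  ext v
  simp

/-- Compatibility with changes of time: running through a solution at speed `c` multiplies both the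
covector and the rate of the time function by `c`. -/
theorem lift_smul (ρ τ c : ℝ) (y : E) (q : E →L[ℝ] ℝ) :
    (lift a k ρ (c * τ) (y, c • q)).2 = c • (lift a k ρ τ (y, q)).2 := by
  ext v
  simp [lift, mul_assoc]

/-- The velocity is τ w(φ) - Dφ a(q) with w = -a dk. As w(φ) = Dφ w, it equals -Dφ a(q + τ dk), and
the Poisson property of φ turns this into -a applied to the lifted covector. This is why the
translation by τ dk is built into `lift`. -/
theorem hasDerivWithinAt_lift_fst {s : ℝ → ℝ} {y : ℝ → E} {S : Set ℝ} {u τ : ℝ}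
    {q : E →L[ℝ] ℝ} (hs : HasDerivWithinAt s τ S u) (hy : HasDerivWithinAt y (-a (y u) q) S u)
    (hyu : y u ∈ Ω) :
    HasDerivWithinAt (fun r => flow (hamField a k) (s r) (y r))
      (-a (lift a k (s u) τ (y u, q)).1 (lift a k (s u) τ (y u, q)).2) S u := by
  have hd := (hH.contDiff_hamFlow.differentiable (by simp) (s u, y u)).hasFDerivAt
  have h1 : HasDerivWithinAt (fun r => flow (hamField a k) (s r) (y r)) _ S u :=
    HasFDerivAt.comp_hasDerivWithinAt (f := fun r => (s r, y r)) u hd (hs.prodMk hy)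
  refine h1.congr_deriv ?_
  set D := fderiv ℝ (fun z : ℝ × E => flow (hamField a k) z.1 z.2) (s u, y u)
  have h2 : D (1, 0) = hamField a k (flow (hamField a k) (s u) (y u)) :=
    (HasFDerivAt.comp_hasDerivAt (f := fun r => (r, y u)) (s u) hd
      ((hasDerivAt_id (s u)).prodMk (hasDerivAt_const (s u) (y u)))).unique
      (hH.hasDerivAt_hamFlow (s u) (y u))
  have h3 : D ∘L ContinuousLinearMap.inr ℝ ℝ E = flowDeriv a k (s u) (y u) :=
    (HasFDerivAt.comp (g := fun z : ℝ × E => flow (hamField a k) z.1 z.2)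
      (f := fun z => (s u, z)) (y u) hd (hasFDerivAt_prodMk_right _ _)).unique
      (hH.hasFDerivAt_flow (s u) (y u))
  have h4 : (τ, -a (y u) q) = τ • ((1 : ℝ), (0 : E)) + ContinuousLinearMap.inr ℝ ℝ E (-a (y u) q) := by
    simp
  have h5 := hH.flow_isPoisson hyu (s u) (lift a k (s u) τ (y u, q)).2
  rw [hH.lift_snd_comp] at h5
  rw [h4, map_add, map_smul, ← ContinuousLinearMap.comp_apply, h2, h3,
    show (lift a k (s u) τ (y u, q)).1 = flow (hamField a k) (s u) (y u) from rfl, ← h5,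
    ← hH.flowDeriv_hamField]
  simp [hamField, add_comm]

end IsLocalHam

end LiftLemmas

/-! ### Coordinates of covectors -/

section Coordinates

universe u

variable {n : ℕ} {M : Type u} [TopologicalSpace M] [ChartedSpace (Coord n) M]
  [IsManifold (𝓡 n) ∞ M]

variable (n) in
/-- The coordinates of tangent vectors at `x` in the chart around `c`. -/
def frame (c x : M) : TangentSpace (𝓡 n) x →L[ℝ] Coord n :=
  (trivializationAt (Coord n) (TangentSpace (𝓡 n)) c).continuousLinearMapAt ℝ x

variable (n) in
/-- The tangent vectors at `x` with given coordinates in the chart around `c`. -/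
def coframe (c x : M) : Coord n →L[ℝ] TangentSpace (𝓡 n) x :=
  (trivializationAt (Coord n) (TangentSpace (𝓡 n)) c).symmL ℝ x

theorem frame_coframe {c x : M} (hx : x ∈ (chartAt (Coord n) c).source) (v : Coord n) :
    frame n c x (coframe n c x v) = v :=
  Trivialization.continuousLinearMapAt_symmL _ (by simpa using hx) v

theorem coframe_frame {c x : M} (hx : x ∈ (chartAt (Coord n) c).source)
    (v : TangentSpace (𝓡 n) x) : coframe n c x (frame n c x v) = v :=
  Trivialization.symmL_continuousLinearMapAt _ (by simpa using hx) v

theorem covectorCoord_def (c x : M) (p : Cotangent n x) :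
    covectorCoord n c x p = p ∘L coframe n c x := rfl

theorem covectorCoord_comp_frame {c x : M} (hx : x ∈ (chartAt (Coord n) c).source)
    (q : CoCoord n) : covectorCoord n c x (q ∘L frame n c x) = q := by
  ext v
  simp [covectorCoord_def, frame_coframe hx]

theorem covectorCoord_comp {c x : M} (hx : x ∈ (chartAt (Coord n) c).source)
    (p : Cotangent n x) : covectorCoord n c x p ∘L frame n c x = p := by
  ext v
  simp [covectorCoord_def, coframe_frame hx]

theorem frame_eq_mfderiv {c x : M} (hx : x ∈ (chartAt (Coord n) c).source) :
    frame n c x = mfderiv (𝓡 n) 𝓘(ℝ, Coord n) (chartAt (Coord n) c) x := by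
  have h : frame n c x = mfderiv (𝓡 n) 𝓘(ℝ, Coord n) (extChartAt (𝓡 n) c) x :=
    TangentBundle.continuousLinearMapAt_trivializationAt hx
  rw [h]
  rfl

theorem hasMFDerivAt_chartAt {c x : M} (hx : x ∈ (chartAt (Coord n) c).source) :
    HasMFDerivAt (𝓡 n) 𝓘(ℝ, Coord n) (chartAt (Coord n) c) x (frame n c x) := by
  rw [frame_eq_mfderiv hx]
  have h : MDifferentiableAt (𝓡 n) (𝓡 n) (chartAt (Coord n) c) x :=
    mdifferentiableAt_atlas (chart_mem_atlas _ c) hx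
  exact h.hasMFDerivAt

/-- The coordinate change from the chart around `c` to the chart around `c'`. -/
def chartChange (c c' : M) (y : Coord n) : Coord n :=
  chartAt (Coord n) c' ((chartAt (Coord n) c).symm y)

theorem contDiffAt_chartChange {c c' x : M} (hx : x ∈ (chartAt (Coord n) c).source)
    (hx' : x ∈ (chartAt (Coord n) c').source) :
    ContDiffAt ℝ ∞ (chartChange c c') (chartAt (Coord n) c x) := by
  have h : ContDiffWithinAt ℝ ∞ (extChartAt (𝓡 n) c' ∘ (extChartAt (𝓡 n) c).symm) (range (𝓡 n))
      (chartAt (Coord n) c x) :=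
    contDiffWithinAt_ext_coord_change c' c (by simp [hx, hx'])
  rwa [modelWithCornersSelf_coe, range_id, contDiffWithinAt_univ] at h

theorem chartChange_apply {c c' x : M} (hx : x ∈ (chartAt (Coord n) c).source) :
    chartChange c c' (chartAt (Coord n) c x) = chartAt (Coord n) c' x := by
  rw [chartChange, (chartAt (Coord n) c).left_inv hx]

/-- The derivative of the coordinate change at the point `x`. -/
def jac (c c' x : M) : Coord n →L[ℝ] Coord n :=
  fderiv ℝ (chartChange c c') (chartAt (Coord n) c x)

theorem frame_eq_jac_comp {c c' x : M} (hx : x ∈ (chartAt (Coord n) c).source)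
    (hx' : x ∈ (chartAt (Coord n) c').source) : frame n c' x = jac c c' x ∘L frame n c x := by
  have h1 := hasMFDerivAt_chartAt hx
  have h2 := hasMFDerivAt_chartAt hx'
  have h3 : HasMFDerivAt 𝓘(ℝ, Coord n) 𝓘(ℝ, Coord n) (chartChange c c') (chartAt (Coord n) c x)
      (jac c c' x) :=
    ((contDiffAt_chartChange hx hx').differentiableAt (by simp)).hasFDerivAt.hasMFDerivAt
  have h4 := h3.comp x h1
  have h5 : chartChange c c' ∘ chartAt (Coord n) c =ᶠ[𝓝 x] chartAt (Coord n) c' := by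
    filter_upwards [(chartAt (Coord n) c).open_source.mem_nhds hx] with z hz
    exact chartChange_apply hz
  exact hasMFDerivAt_unique h2 (h4.congr_of_eventuallyEq h5.symm)

theorem covectorCoord_eq_comp_jac {c c' x : M} (hx : x ∈ (chartAt (Coord n) c).source)
    (hx' : x ∈ (chartAt (Coord n) c').source) (p : Cotangent n x) :
    covectorCoord n c x p = covectorCoord n c' x p ∘L jac c c' x := by
  have h := covectorCoord_comp hx' p
  rw [frame_eq_jac_comp hx hx'] at h
  rw [← covectorCoord_comp_frame hx (covectorCoord n c' x p ∘L jac c c' x),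
    ContinuousLinearMap.comp_assoc, h]

theorem jac_comp_jac {c c' x : M} (hx : x ∈ (chartAt (Coord n) c).source)
    (hx' : x ∈ (chartAt (Coord n) c').source) (v : Coord n) :
    jac c' c x (jac c c' x v) = v := by
  have h1 := congrArg (fun T => T (coframe n c x v)) (frame_eq_jac_comp hx hx')
  have h2 := congrArg (fun T => T (coframe n c x v)) (frame_eq_jac_comp hx' hx)
  simp only [ContinuousLinearMap.comp_apply, frame_coframe hx] at h1 h2
  rw [← h1, ← h2]

variable (n) in
/-- The coordinates of the cotangent bundle over the chart around `c`. -/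
def cotChart (c : M) : OpenPartialHomeomorph (CotangentBundle n M) (Coord n × CoCoord n) :=
  (trivializationAt (CoCoord n) (fun x : M => Cotangent n x) c).toOpenPartialHomeomorph ≫ₕ
    (chartAt (Coord n) c).prod (OpenPartialHomeomorph.refl (CoCoord n))

theorem cotTriv_apply (c : M) (z : CotangentBundle n M) :
    trivializationAt (CoCoord n) (fun x : M => Cotangent n x) c z =
      (z.proj, covectorCoord n c z.proj z.snd) := by
  rw [hom_trivializationAt_apply]
  refine Prod.ext rfl ?_
  ext v
  simp [ContinuousLinearMap.inCoordinates, covectorCoord]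

theorem cotChart_apply (c : M) (z : CotangentBundle n M) :
    cotChart n c z = (chartAt (Coord n) c z.proj, covectorCoord n c z.proj z.snd) := by
  have := cotTriv_apply c z
  simp [cotChart, this]

theorem cotChart_source (c : M) :
    (cotChart n c).source = {z : CotangentBundle n M | z.proj ∈ (chartAt (Coord n) c).source} := by
  ext z
  have := cotTriv_apply c z
  simp [cotChart, this]

theorem cotChart_target (c : M) :
    (cotChart n c).target = (chartAt (Coord n) c).target ×ˢ univ := by
  ext z
  simp [cotChart]
  intro h
  exact (chartAt (Coord n) c).map_target h

theorem mem_cotChart_source {c : M} {z : CotangentBundle n M} :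
    z ∈ (cotChart n c).source ↔ z.proj ∈ (chartAt (Coord n) c).source := by
  rw [cotChart_source]; rfl

theorem mem_cotChart_target {c : M} {z : Coord n × CoCoord n} :
    z ∈ (cotChart n c).target ↔ z.1 ∈ (chartAt (Coord n) c).target := by
  rw [cotChart_target]; simp

theorem cotChart_symm_proj {c : M} {z : Coord n × CoCoord n}
    (hz : z.1 ∈ (chartAt (Coord n) c).target) :
    ((cotChart n c).symm z).proj = (chartAt (Coord n) c).symm z.1 := by
  have h1 := (cotChart n c).right_inv (mem_cotChart_target.2 hz)
  have h2 := mem_cotChart_source.1 ((cotChart n c).map_target (mem_cotChart_target.2 hz))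
  rw [cotChart_apply] at h1
  rw [← congrArg Prod.fst h1]
  exact ((chartAt (Coord n) c).left_inv h2).symm

/-- The coordinate change of the cotangent bundle. -/
def cotChange (c c' : M) (z : Coord n × CoCoord n) : Coord n × CoCoord n :=
  (chartChange c c' z.1, z.2 ∘L fderiv ℝ (chartChange c' c) (chartChange c c' z.1))

theorem cotChange_apply {c c' : M} {z : CotangentBundle n M}
    (hz : z.proj ∈ (chartAt (Coord n) c).source) (hz' : z.proj ∈ (chartAt (Coord n) c').source) :
    cotChange c c' (cotChart n c z) = cotChart n c' z := by
  simp only [cotChart_apply, cotChange, chartChange_apply hz]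
  rw [covectorCoord_eq_comp_jac hz' hz, jac]

theorem contDiffAt_cotChange {c c' x : M} (hx : x ∈ (chartAt (Coord n) c).source)
    (hx' : x ∈ (chartAt (Coord n) c').source) (q : CoCoord n) :
    ContDiffAt ℝ ∞ (cotChange c c') (chartAt (Coord n) c x, q) := by
  have h1 : ContDiffAt ℝ ∞ (fun z : Coord n × CoCoord n => chartChange c c' z.1)
      (chartAt (Coord n) c x, q) :=
    ContDiffAt.comp (g := chartChange c c') (f := Prod.fst) (chartAt (Coord n) c x, q)
      (contDiffAt_chartChange hx hx') contDiffAt_fst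
  have h2 : ContDiffAt ℝ ∞ (fderiv ℝ (chartChange c' c)) (chartAt (Coord n) c' x) :=
    (contDiffAt_chartChange hx' hx).fderiv_right (m := ∞) (by simp)
  have h3 : ContDiffAt ℝ ∞ (fun z : Coord n × CoCoord n =>
      fderiv ℝ (chartChange c' c) (chartChange c c' z.1)) (chartAt (Coord n) c x, q) :=
    ContDiffAt.comp (g := fderiv ℝ (chartChange c' c)) (f := fun z => chartChange c c' z.1)
      (chartAt (Coord n) c x, q) (by rw [chartChange_apply hx]; exact h2) h1
  exact h1.prodMk (contDiffAt_snd.clm_comp h3)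

/-! ### The Poisson structure in coordinates -/

variable (α : PoissonStructure n M)

/-- The coordinate expression of `α` as a family of linear maps. -/
def PoissonStructure.coordCLM (c : M) (y : Coord n) : CoCoord n →L[ℝ] Coord n :=
  let x : M := (chartAt (Coord n) c).symm y
  frame n c x ∘L α.sharp x ∘L
    ContinuousLinearMap.precomp ℝ (frame n c x)

theorem PoissonStructure.coordCLM_chartAt {c x : M} (hx : x ∈ (chartAt (Coord n) c).source)
    (b : CoCoord n) :
    α.coordCLM c (chartAt (Coord n) c x) b = frame n c x (α.sharp x (b ∘L frame n c x)) := by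
  unfold PoissonStructure.coordCLM
  rw [(chartAt (Coord n) c).left_inv hx]
  rfl

theorem PoissonStructure.frame_sharp {c x : M} (hx : x ∈ (chartAt (Coord n) c).source)
    (p : Cotangent n x) :
    frame n c x (α.sharp x p) = α.coordCLM c (chartAt (Coord n) c x) (covectorCoord n c x p) := by
  rw [α.coordCLM_chartAt hx, covectorCoord_comp hx]

theorem PoissonStructure.coordCLM_change {c c' x : M} (hx : x ∈ (chartAt (Coord n) c).source)
    (hx' : x ∈ (chartAt (Coord n) c').source) (b : CoCoord n) :
    α.coordCLM c' (chartAt (Coord n) c' x) b =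
      jac c c' x (α.coordCLM c (chartAt (Coord n) c x) (b ∘L jac c c' x)) := by
  rw [α.coordCLM_chartAt hx, α.coordCLM_chartAt hx', frame_eq_jac_comp hx hx']
  rfl

theorem PoissonStructure.contDiffOn_coordCLM (c : M) :
    ContDiffOn ℝ ∞ (α.coordCLM c) (chartAt (Coord n) c).target := by
  have h1 : ContMDiffOn (𝓡 n) 𝓘(ℝ, CoCoord n →L[ℝ] Coord n) ∞
      (fun x => α.coordCLM c (chartAt (Coord n) c x)) (chartAt (Coord n) c).source := by
    intro x hx
    have h2 := α.smooth x
    rw [Trivialization.contMDiffAt_section_iff (trivializationAt (CoCoord n →L[ℝ] Coord n)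
      (fun x : M => Cotangent n x →L[ℝ] TangentSpace (𝓡 n) x) c) (by simpa using hx)] at h2
    refine (h2.congr_of_eventuallyEq ?_).contMDiffWithinAt
    filter_upwards [(chartAt (Coord n) c).open_source.mem_nhds hx] with z hz
    rw [hom_trivializationAt_apply]
    ext1 b
    rw [α.coordCLM_chartAt hz]
    simp only [ContinuousLinearMap.inCoordinates, ContinuousLinearMap.comp_apply]
    -- The inverse trivialization of the cotangent bundle is composition with the frame; this
    -- identifies the bundle coordinates of `α` with `coordCLM`.
    have h3 : (trivializationAt (CoCoord n) (fun x : M => Cotangent n x) c).symmL ℝ z b =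
        b ∘L frame n c z := by
      have h4 := Trivialization.continuousLinearMapAt_symmL (R := ℝ)
        (trivializationAt (CoCoord n) (fun x : M => Cotangent n x) c) (b := z) (by simpa using hz) b
      rw [← covectorCoord_comp hz
        ((trivializationAt (CoCoord n) (fun x : M => Cotangent n x) c).symmL ℝ z b)]
      congr 1
      rw [Trivialization.continuousLinearMapAt_apply, Trivialization.coe_linearMapAt_of_mem _
        (by simpa using hz)] at h4
      simp only [cotTriv_apply] at h4
      exact h4
    rw [h3]
    rfl
  have h3 : ContMDiffOn (𝓡 n) (𝓡 n) ∞ (chartAt (Coord n) c).symm (chartAt (Coord n) c).target :=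
    contMDiffOn_chart_symm
  have h2 := h1.comp h3 (fun y hy => (chartAt (Coord n) c).map_target hy)
  rw [← contMDiffOn_iff_contDiffOn]
  refine h2.congr fun y hy => ?_
  simp [(chartAt (Coord n) c).right_inv hy]

/-- The extension by zero of a compactly supported function on a chart domain. -/
def extendChart {F : Type} [Zero F] (c : M) (k : Coord n → F) (x : M) : F :=
  open Classical in if x ∈ (chartAt (Coord n) c).source then k (chartAt (Coord n) c x) else 0

theorem extendChart_of_mem {F : Type} [Zero F] {c x : M} (k : Coord n → F)
    (hx : x ∈ (chartAt (Coord n) c).source) : extendChart c k x = k (chartAt (Coord n) c x) :=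
  if_pos hx

/-- The compact set in `M` corresponding to the support of a function on the chart. -/
def chartSupport {F : Type} [Zero F] (c : M) (k : Coord n → F) : Set M :=
  (chartAt (Coord n) c).symm '' tsupport k

theorem mem_source_of_mem_chartSupport {F : Type} [Zero F] {c x : M} {k : Coord n → F}
    (hk : tsupport k ⊆ (chartAt (Coord n) c).target) (hx : x ∈ chartSupport c k) :
    x ∈ (chartAt (Coord n) c).source := by
  obtain ⟨y, hy, rfl⟩ := hx
  exact (chartAt (Coord n) c).map_target (hk hy)

theorem notMem_tsupport_of_notMem_chartSupport {F : Type} [Zero F] {c x : M} {k : Coord n → F}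
    (hx : x ∉ chartSupport c k) (hxc : x ∈ (chartAt (Coord n) c).source) :
    chartAt (Coord n) c x ∉ tsupport k :=
  fun h => hx ⟨_, h, (chartAt (Coord n) c).left_inv hxc⟩

theorem isClosed_chartSupport [T2Space M] {F : Type} [Zero F] [TopologicalSpace F] {c : M}
    {k : Coord n → F} (hk : tsupport k ⊆ (chartAt (Coord n) c).target) (hc : HasCompactSupport k) :
    IsClosed (chartSupport c k) :=
  (hc.isCompact.image_of_continuousOn ((chartAt (Coord n) c).continuousOn_symm.mono hk)).isClosed

theorem extendChart_of_notMem {F : Type} [Zero F] {c x : M} {k : Coord n → F}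
    (hx : x ∉ chartSupport c k) : extendChart c k x = 0 := by
  by_cases h : x ∈ (chartAt (Coord n) c).source
  · rw [extendChart_of_mem k h]
    exact image_eq_zero_of_notMem_tsupport (notMem_tsupport_of_notMem_chartSupport hx h)
  · exact if_neg h

theorem contMDiff_extendChart [T2Space M] {F : Type} [NormedAddCommGroup F] [NormedSpace ℝ F]
    {c : M} {k : Coord n → F} (hk : tsupport k ⊆ (chartAt (Coord n) c).target)
    (hc : HasCompactSupport k) (hs : ContDiff ℝ ∞ k) :
    ContMDiff (𝓡 n) 𝓘(ℝ, F) ∞ (extendChart c k) := by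
  intro x
  by_cases hx : x ∈ chartSupport c k
  · have hxc := mem_source_of_mem_chartSupport hk hx
    have h1 : ContMDiffAt (𝓡 n) (𝓡 n) ∞ (chartAt (Coord n) c) x :=
      (contMDiffOn_chart.contMDiffAt ((chartAt (Coord n) c).open_source.mem_nhds hxc))
    refine (hs.contMDiff.contMDiffAt.comp x h1).congr_of_eventuallyEq ?_
    filter_upwards [(chartAt (Coord n) c).open_source.mem_nhds hxc] with z hz
    exact extendChart_of_mem k hz
  · refine (contMDiff_const (c := (0 : F)) x).congr_of_eventuallyEq ?_
    filter_upwards [(isClosed_chartSupport hk hc).isOpen_compl.mem_nhds hx] with z hz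
    exact extendChart_of_notMem hz

theorem mfderiv_eq_comp_frame {c x : M} {g : M → ℝ} {k : Coord n → ℝ} {k' : CoCoord n}
    (hx : x ∈ (chartAt (Coord n) c).source) (hk : HasFDerivAt k k' (chartAt (Coord n) c x))
    (hg : g =ᶠ[𝓝 x] fun z => k (chartAt (Coord n) c z)) :
    (mfderiv (𝓡 n) 𝓘(ℝ, ℝ) g x : Cotangent n x) = k' ∘L frame n c x :=
  ((hk.hasMFDerivAt.comp x (hasMFDerivAt_chartAt hx)).congr_of_eventuallyEq hg).mfderiv

theorem PoissonStructure.bracket_eq {c x : M} {f g : M → ℝ} {k l : Coord n → ℝ} {k' l' : CoCoord n}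
    (hx : x ∈ (chartAt (Coord n) c).source) (hk : HasFDerivAt k k' (chartAt (Coord n) c x))
    (hf : f =ᶠ[𝓝 x] fun z => k (chartAt (Coord n) c z))
    (hl : HasFDerivAt l l' (chartAt (Coord n) c x))
    (hg : g =ᶠ[𝓝 x] fun z => l (chartAt (Coord n) c z)) :
    poissonBracket n α.sharp f g x = k' (α.coordCLM c (chartAt (Coord n) c x) l') := by
  rw [poissonBracket, mfderiv_eq_comp_frame hx hk hf, mfderiv_eq_comp_frame hx hl hg,
    α.coordCLM_chartAt hx]
  rfl

theorem exists_bump {s : Set (Coord n)} {y : Coord n} (hs : s ∈ 𝓝 y) :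
    ∃ χ : Coord n → ℝ, ContDiff ℝ ∞ χ ∧ HasCompactSupport χ ∧ tsupport χ ⊆ s ∧
      ∀ᶠ z in 𝓝 y, χ z = 1 := by
  obtain ⟨r, hr, hrs⟩ := Metric.nhds_basis_closedBall.mem_iff.1 hs
  let f : ContDiffBump y := ⟨r / 2, r, by positivity, by linarith⟩
  exact ⟨f, f.contDiff, f.hasCompactSupport, f.tsupport_eq.trans_subset hrs, f.eventuallyEq_one⟩

/-- The Jacobi identity is given for globally defined smooth functions only. To test it on
coordinate functions, these are cut off inside the chart; extension by zero is smooth because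
compact sets are closed in a Hausdorff manifold. -/
theorem exists_extend_linear [T2Space M] {c x : M} (hx : x ∈ (chartAt (Coord n) c).source)
    (p : CoCoord n) : ∃ f : M → ℝ, ContMDiff (𝓡 n) 𝓘(ℝ, ℝ) ∞ f ∧
      f =ᶠ[𝓝 x] fun z => p (chartAt (Coord n) c z) := by
  obtain ⟨χ, hχ, hχc, hχs, hχ1⟩ := exists_bump
    ((chartAt (Coord n) c).open_target.mem_nhds ((chartAt (Coord n) c).map_source hx))
  refine ⟨extendChart c (fun y => χ y * p y), contMDiff_extendChart
    ((closure_mono (Function.support_mul_subset_left _ _)).trans hχs) (hχc.mul_right)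
    (hχ.mul p.contDiff), ?_⟩
  filter_upwards [(chartAt (Coord n) c).open_source.mem_nhds hx,
    ((chartAt (Coord n) c).continuousAt hx).eventually hχ1] with z hz hz'
  rw [extendChart_of_mem _ hz, hz', one_mul]

/-- Brackets of functions that are linear in the chart near the point involve only `a` and its first
derivative, so the Jacobi identity for them is the pointwise identity for arbitrary covectors. -/
theorem PoissonStructure.isLocalPoisson [T2Space M] (c : M) :
    IsLocalPoisson (chartAt (Coord n) c).target (α.coordCLM c) where
  isOpen := (chartAt (Coord n) c).open_target
  smooth := α.contDiffOn_coordCLM c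
  skew y hy p q := by
    have hx := (chartAt (Coord n) c).map_target hy
    rw [← (chartAt (Coord n) c).right_inv hy, α.coordCLM_chartAt hx, α.coordCLM_chartAt hx]
    exact α.skew _ (p ∘L frame n c _) (q ∘L frame n c _)
  jacobi y hy p q r := by
    have hx := (chartAt (Coord n) c).map_target hy
    have hyx := (chartAt (Coord n) c).right_inv hy
    set x := (chartAt (Coord n) c).symm y
    have hda : HasFDerivAt (α.coordCLM c) (fderiv ℝ (α.coordCLM c) y) y :=
      (((α.contDiffOn_coordCLM c).contDiffAt ((chartAt (Coord n) c).open_target.mem_nhds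
        hy)).differentiableAt (by simp)).hasFDerivAt
    -- Near `x` the inner bracket is z ↦ q(a(z) r), and its differential falls on `a` alone.
    have key : ∀ {f g h : M → ℝ} {p q r : CoCoord n},
        f =ᶠ[𝓝 x] (fun z => p (chartAt (Coord n) c z)) →
        g =ᶠ[𝓝 x] (fun z => q (chartAt (Coord n) c z)) →
        h =ᶠ[𝓝 x] (fun z => r (chartAt (Coord n) c z)) →
        poissonBracket n α.sharp f (poissonBracket n α.sharp g h) x =
          p (α.coordCLM c y (q ∘L (fderiv ℝ (α.coordCLM c) y).flip r)) := by
      intro f g h p q r hf hg hh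
      have h1 : HasFDerivAt (fun z => q (α.coordCLM c z r))
          (q ∘L (fderiv ℝ (α.coordCLM c) y).flip r) (chartAt (Coord n) c x) := by
        rw [hyx]
        refine (q.hasFDerivAt.comp y (hda.clm_apply (hasFDerivAt_const r y))).congr_fderiv ?_
        ext v
        simp
      rw [α.bracket_eq hx p.hasFDerivAt hf h1, hyx]
      filter_upwards [hg.eventuallyEq_nhds, hh.eventuallyEq_nhds,
        (chartAt (Coord n) c).open_source.mem_nhds hx] with z hgz hhz hz
      exact α.bracket_eq hz q.hasFDerivAt hgz r.hasFDerivAt hhz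
    obtain ⟨f, hf, hf'⟩ := exists_extend_linear hx p
    obtain ⟨g, hg, hg'⟩ := exists_extend_linear hx q
    obtain ⟨h, hh, hh'⟩ := exists_extend_linear hx r
    have h1 := α.jacobi f g h hf hg hh x
    rw [key hf' hg' hh', key hg' hh' hf', key hh' hf' hg'] at h1
    have hsk : ∀ p q : CoCoord n, p (α.coordCLM c y q) = -q (α.coordCLM c y p) := by
      intro p q
      rw [← hyx, α.coordCLM_chartAt hx, α.coordCLM_chartAt hx]
      exact α.skew _ (p ∘L frame n c _) (q ∘L frame n c _)
    rw [hsk p, hsk q, hsk r] at h1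
    simp at h1 ⊢
    linarith

end Coordinates

/-! ### Paths over the unit interval -/

section UnitInterval

variable {F : Type} [NormedAddCommGroup F] [NormedSpace ℝ F]

/-- The extension of a function on the unit interval by its boundary values. -/
def extend {X : Type*} (f : I → X) (r : ℝ) : X := f (projIcc 0 1 zero_le_one r)

@[simp]
theorem extend_coe {X : Type*} (f : I → X) (u : I) : extend f u = f u := by
  simp [extend]

/-- The derivative with respect to time. -/
def timeDeriv (f : I → F) (u : I) : F :=
  mfderiv (𝓡∂ 1) 𝓘(ℝ, F) f u (1 : TangentSpace (𝓡∂ 1) u)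

theorem hasDerivWithinAt_extend {f : I → F} {u : I} (h : MDifferentiableAt (𝓡∂ 1) 𝓘(ℝ, F) f u) :
    HasDerivWithinAt (extend f) (timeDeriv f u) (Icc 0 1) u := by
  have h1 := (mdifferentiableWithinAt_comp_projIcc_iff (w := u)).2 h
  rw [mdifferentiableWithinAt_iff_differentiableWithinAt] at h1
  have h3 : (mfderivWithin 𝓘(ℝ, ℝ) 𝓘(ℝ, F) (f ∘ projIcc 0 1 zero_le_one) (Icc 0 1) (u : ℝ)
      (1 : ℝ) : F) = timeDeriv f u := mfderivWithin_comp_projIcc_one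
  rw [mfderivWithin_eq_fderivWithin] at h3
  rw [← h3]
  exact h1.hasDerivWithinAt

theorem timeDeriv_eq {f : I → F} {u : I} {v : F}
    (h : HasDerivWithinAt (extend f) v (Icc 0 1) u) : timeDeriv f u = v := by
  have h1 : MDifferentiableAt (𝓡∂ 1) 𝓘(ℝ, F) f u := by
    rw [← mdifferentiableWithinAt_comp_projIcc_iff,
      mdifferentiableWithinAt_iff_differentiableWithinAt]
    exact h.differentiableWithinAt
  exact (uniqueDiffOn_Icc_zero_one u u.2).eq_deriv _ (hasDerivWithinAt_extend h1) h

theorem contMDiffAt_iff_extend {f : I → F} {u : I} :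
    ContMDiffAt (𝓡∂ 1) 𝓘(ℝ, F) 1 f u ↔ ContDiffWithinAt ℝ 1 (extend f) (Icc 0 1) u := by
  rw [← contMDiffWithinAt_comp_projIcc_iff, contMDiffWithinAt_iff_contDiffWithinAt]
  rfl

theorem contDiffWithinAt_extend {f f' : I → F} {u : I} {U : Set I} (hU : IsOpen U) (hu : u ∈ U)
    (hf : ∀ v ∈ U, HasDerivWithinAt (extend f) (f' v) (Icc 0 1) v) (hf' : ContinuousOn f' U) :
    ContDiffWithinAt ℝ 1 (extend f) (Icc 0 1) u := by
  have h0 : ((0 : WithTop ℕ∞) + 1) = 1 := by norm_num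
  rw [← h0, contDiffWithinAt_succ_iff_hasFDerivWithinAt (by simp)]
  have hV : Icc 0 1 ∩ (projIcc (0 : ℝ) 1 zero_le_one) ⁻¹' U ∈ 𝓝[Icc 0 1] (u : ℝ) :=
    Filter.inter_mem self_mem_nhdsWithin
      (continuous_projIcc.continuousAt.continuousWithinAt (hU.mem_nhds (by simpa using hu)))
  refine ⟨Icc 0 1 ∩ (projIcc (0 : ℝ) 1 zero_le_one) ⁻¹' U, ?_, by simp, fun r => ContinuousLinearMap.toSpanSingleton ℝ (extend f' r), ?_, ?_⟩
  · rw [insert_eq_of_mem u.2]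
    exact hV
  · intro r hr
    have h := hf (projIcc 0 1 zero_le_one r) hr.2
    rw [projIcc_of_mem zero_le_one hr.1] at h
    have h2 : HasDerivWithinAt (extend f) (extend f' r) (Icc 0 1) r := by
      rw [extend, projIcc_of_mem zero_le_one hr.1]; exact h
    exact (h2.mono inter_subset_left).hasFDerivWithinAt
  · have hmem : (u : ℝ) ∈ Icc 0 1 ∩ (projIcc (0 : ℝ) 1 zero_le_one) ⁻¹' U :=
      ⟨u.2, by simpa using hu⟩
    rw [contDiffWithinAt_zero hmem]
    refine ⟨univ, Filter.univ_mem, ?_⟩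
    have h1 : ContinuousOn (extend f') (Icc 0 1 ∩ (projIcc (0 : ℝ) 1 zero_le_one) ⁻¹' U) :=
      hf'.comp continuous_projIcc.continuousOn fun r hr => hr.2
    rw [inter_univ]
    exact ((ContinuousLinearMap.toSpanSingletonCLE (𝕜 := ℝ) (E := F)).continuous.comp_continuousOn
      h1)

end UnitInterval

/-! ### The Gauss law and sections along solutions, in coordinates -/

section GaussCoordinates

universe u

variable {n : ℕ} {M : Type u} [TopologicalSpace M] [ChartedSpace (Coord n) M]
  [IsManifold (𝓡 n) ∞ M] (α : PoissonStructure n M)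

/-- The Gauss law at time `u` in the chart around `c`. -/
def GaussAt (c : M) (γ : C(I, CotangentBundle n M)) (u : I) : Prop :=
  HasDerivWithinAt (extend fun u => (cotChart n c (γ u)).1)
    (-α.coordCLM c (cotChart n c (γ u)).1 (cotChart n c (γ u)).2) (Icc 0 1) u

variable {α}

theorem eventually_extend_mem {X : Type*} [TopologicalSpace X] {γ : I → X} (hγ : Continuous γ)
    {u : I} {U : Set X} (hU : IsOpen U) (hu : γ u ∈ U) :
    ∀ᶠ r in 𝓝[Icc 0 1] (u : ℝ), extend γ r ∈ U :=
  (hγ.comp continuous_projIcc).continuousAt.continuousWithinAt (hU.mem_nhds (by simpa using hu))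

theorem GaussAt.change {c c' : M} {γ : C(I, CotangentBundle n M)} {u : I} (h : GaussAt α c γ u)
    (hc : (γ u).proj ∈ (chartAt (Coord n) c).source)
    (hc' : (γ u).proj ∈ (chartAt (Coord n) c').source) : GaussAt α c' γ u := by
  have h1 := ((contDiffAt_chartChange hc hc').differentiableAt (by simp)).hasFDerivAt
  have h2 : HasDerivWithinAt (fun r => chartChange c c' (extend (fun u => (cotChart n c (γ u)).1) r))
      (jac c c' (γ u).proj (-α.coordCLM c (cotChart n c (γ u)).1 (cotChart n c (γ u)).2))
      (Icc 0 1) u := by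
    refine HasFDerivAt.comp_hasDerivWithinAt (l := chartChange c c') (l' := jac c c' (γ u).proj)
      (u : ℝ) ?_ h
    rw [extend_coe, cotChart_apply]
    exact h1
  unfold GaussAt
  have h3 : (extend fun u => (cotChart n c' (γ u)).1) =ᶠ[𝓝[Icc 0 1] (u : ℝ)]
      fun r => chartChange c c' (extend (fun u => (cotChart n c (γ u)).1) r) := by
    filter_upwards [eventually_extend_mem γ.continuous (cotChart n c).open_source
      (mem_cotChart_source.2 hc)] with r hr
    simp only [extend, cotChart_apply]
    exact (chartChange_apply (mem_cotChart_source.1 hr)).symm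
  refine (h2.congr_of_eventuallyEq h3 (h3.self_of_nhdsWithin u.2)).congr_deriv ?_
  simp only [cotChart_apply]
  rw [α.coordCLM_change hc hc', map_neg, ← covectorCoord_eq_comp_jac hc hc']

theorem GaussAt.congr {c : M} {γ γ' : C(I, CotangentBundle n M)} {u : I} (h : GaussAt α c γ u)
    (h' : ∀ᶠ v in 𝓝 u, γ' v = γ v) : GaussAt α c γ' u := by
  unfold GaussAt
  have h1 : (extend fun u => (cotChart n c (γ' u)).1) =ᶠ[𝓝[Icc 0 1] (u : ℝ)]
      extend fun u => (cotChart n c (γ u)).1 := by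
    have h2 : Filter.Tendsto (projIcc (0 : ℝ) 1 zero_le_one) (𝓝[Icc 0 1] (u : ℝ)) (𝓝 u) := by
      have := (continuous_projIcc (h := zero_le_one (α := ℝ))).tendsto (u : ℝ)
      rw [projIcc_val] at this
      exact this.mono_left nhdsWithin_le_nhds
    filter_upwards [h2.eventually h'] with r hr
    simp [extend, hr]
  rw [h'.self_of_nhds]
  exact HasDerivWithinAt.congr_of_eventuallyEq h h1 (h1.self_of_nhdsWithin u.2)

theorem timeDeriv_chart {γ : C(I, CotangentBundle n M)} {c : M} {u : I}
    (hu : (γ u).proj ∈ (chartAt (Coord n) c).source)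
    (h : MDifferentiableAt (𝓡∂ 1) (𝓡 n) (fun u => (γ u).proj) u) :
    HasDerivWithinAt (extend fun u => (cotChart n c (γ u)).1)
      (frame n c (γ u).proj (mfderiv (𝓡∂ 1) (𝓡 n) (fun u => (γ u).proj) u
        (1 : TangentSpace (𝓡∂ 1) u))) (Icc 0 1) u := by
  have h2 := (hasMFDerivAt_chartAt (c := c) (x := (γ u).proj) hu).comp u h.hasMFDerivAt
  have h3 : timeDeriv (chartAt (Coord n) c ∘ fun u => (γ u).proj) u =
      frame n c (γ u).proj (mfderiv (𝓡∂ 1) (𝓡 n) (fun u => (γ u).proj) u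
        (1 : TangentSpace (𝓡∂ 1) u)) := by
    rw [timeDeriv, h2.mfderiv]
    rfl
  have h4 := hasDerivWithinAt_extend h2.mdifferentiableAt
  rw [h3] at h4
  refine h4.congr_of_mem (fun r _ => ?_) u.2
  simp [extend, cotChart_apply]

theorem GaussSolution.gaussAt (Z : GaussSolution α) {c : M} {u : I}
    (hu : Z.base u ∈ (chartAt (Coord n) c).source) : GaussAt α c Z.path u := by
  have h1 : MDifferentiableAt (𝓡∂ 1) (𝓡 n) (fun u => (Z.path u).proj) u :=
    (Z.contMDiff_base u).mdifferentiableAt (by simp)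
  have h2 := timeDeriv_chart (γ := Z.path) hu h1
  rw [eq_neg_of_add_eq_zero_left (Z.gauss u), map_neg, α.frame_sharp (c := c) (x := (Z.path u).proj) hu] at h2
  unfold GaussAt
  rw [cotChart_apply]
  exact h2

/-- Continuous differentiability costs nothing: the derivative prescribed by the Gauss law is -α(X)
η, which is continuous along a continuous path of covectors. -/
theorem contMDiffAt_base {γ : C(I, CotangentBundle n M)}
    (h : ∀ u, ∃ c : M, (γ u).proj ∈ (chartAt (Coord n) c).source ∧ GaussAt α c γ u) (u : I) :
    ContMDiffAt (𝓡∂ 1) (𝓡 n) 1 (fun u => (γ u).proj) u := by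
  set c := (γ u).proj
  have hc : (γ u).proj ∈ (chartAt (Coord n) c).source := mem_chart_source _ _
  have hγ : Continuous fun u => (γ u).proj :=
    (FiberBundle.continuous_proj (CoCoord n) (fun x : M => Cotangent n x)).comp γ.continuous
  refine (contMDiffAt_iff_target_of_mem_source (f := fun u => (γ u).proj) hc).2
    ⟨hγ.continuousAt, ?_⟩
  refine contMDiffAt_iff_extend.2 (contDiffWithinAt_extend (U := γ ⁻¹' (cotChart n c).source)
    (f' := fun u => -α.coordCLM c (cotChart n c (γ u)).1 (cotChart n c (γ u)).2)
    ((cotChart n c).open_source.preimage γ.continuous) (mem_cotChart_source.2 hc) ?_ ?_)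
  · intro v hv
    obtain ⟨c', hc', h'⟩ := h v
    have h1 := h'.change hc' (mem_cotChart_source.1 hv)
    refine HasDerivWithinAt.congr_of_mem h1 (fun r _ => ?_) v.2
    simp [extend, cotChart_apply]
  · have h1 : ContinuousOn (fun u => cotChart n c (γ u)) (γ ⁻¹' (cotChart n c).source) :=
      (cotChart n c).continuousOn.comp γ.continuous.continuousOn fun _ h => h
    have h2 : ContinuousOn (fun u => α.coordCLM c (cotChart n c (γ u)).1)
        (γ ⁻¹' (cotChart n c).source) :=
      (α.contDiffOn_coordCLM c).continuousOn.comp h1.fst fun v hv =>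
        mem_cotChart_target.1 ((cotChart n c).map_source hv)
    exact (h2.clm_apply h1.snd).neg

/-- A path which satisfies the Gauss law in coordinates. -/
def GaussSolution.ofPath (γ : C(I, CotangentBundle n M))
    (h : ∀ u, ∃ c : M, (γ u).proj ∈ (chartAt (Coord n) c).source ∧ GaussAt α c γ u) :
    GaussSolution α where
  path := γ
  contMDiff_base u := contMDiffAt_base h u
  gauss u := by
    obtain ⟨c, hc, h'⟩ := h u
    have h1 := timeDeriv_chart hc ((contMDiffAt_base h u).mdifferentiableAt (by simp))
    have h2 := (uniqueDiffOn_Icc_zero_one u u.2).eq_deriv _ h1 h'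
    have h3 : α.coordCLM c (cotChart n c (γ u)).1 (cotChart n c (γ u)).2 =
        frame n c (γ u).proj (α.sharp _ (γ u).snd) := by
      rw [cotChart_apply, α.frame_sharp hc]
    rw [h3, ← map_neg] at h2
    have h4 := congrArg (coframe n c (γ u).proj) h2
    rw [coframe_frame hc, coframe_frame hc] at h4
    rw [h4, neg_add_cancel]

@[ext]
theorem GaussSolution.ext {Z Z' : GaussSolution α} (h : ∀ u, Z.path u = Z'.path u) : Z = Z' := by
  have : Z.path = Z'.path := ContinuousMap.ext h
  cases Z; cases Z'; simp_all

theorem GaussSolution.continuous_path : Continuous (GaussSolution.path (α := α)) :=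
  continuous_induced_dom

theorem GaussSolution.continuous_eval :
    Continuous fun q : GaussSolution α × I => q.1.path q.2 :=
  ContinuousEval.continuous_eval.comp
    ((GaussSolution.continuous_path.comp continuous_fst).prodMk continuous_snd)

/-- The constant solution. -/
def GaussSolution.const (α : PoissonStructure n M) (x : M) : GaussSolution α :=
  GaussSolution.ofPath (ContinuousMap.const I ⟨x, 0⟩) fun u => by
    refine ⟨x, mem_chart_source _ _, ?_⟩
    have : (extend fun u : I => (cotChart n x ((ContinuousMap.const I
        (⟨x, 0⟩ : CotangentBundle n M)) u)).1) = fun _ => chartAt (Coord n) x x := by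
      ext1 r
      simp [extend, cotChart_apply]
    unfold GaussAt
    rw [this]
    refine (hasDerivWithinAt_const _ _ _).congr_deriv ?_
    simp [cotChart_apply, covectorCoord_def]

/-- The fibre coordinates of a path in the cotangent bundle. -/
def secCoord (ρ : I → CotangentBundle n M) (c : M) (u : I) : CoCoord n := (cotChart n c (ρ u)).2

/-- `ρ` is a continuously differentiable section of the cotangent bundle along the base path. -/
structure IsSection (Z : GaussSolution α) (ρ : I → CotangentBundle n M) : Prop where
  proj_eq : ∀ u, (ρ u).proj = Z.base u
  contMDiff : ContMDiff (𝓡∂ 1) ((𝓡 n).prod 𝓘(ℝ, CoCoord n)) 1 ρ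

theorem contMDiffAt_section_iff {Z : GaussSolution α} {ρ : I → CotangentBundle n M} {c : M} {u : I}
    (hρ : ∀ u, (ρ u).proj = Z.base u) (hu : Z.base u ∈ (chartAt (Coord n) c).source) :
    ContMDiffAt (𝓡∂ 1) ((𝓡 n).prod 𝓘(ℝ, CoCoord n)) 1 ρ u ↔
      ContDiffWithinAt ℝ 1 (extend (secCoord ρ c)) (Icc 0 1) u := by
  rw [Trivialization.contMDiffAt_iff
    (e := trivializationAt (CoCoord n) (fun x : M => Cotangent n x) c)
    (f := ρ) (by simpa [Trivialization.mem_source, hρ] using hu)]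
  have h1 : (fun u => (ρ u).proj) = fun u => (Z.path u).proj := funext hρ
  rw [h1, and_iff_right (Z.contMDiff_base u)]
  simp only [cotTriv_apply]
  have h2 : secCoord ρ c = fun u => covectorCoord n c (ρ u).proj (ρ u).snd := by
    ext1 u
    rw [secCoord, cotChart_apply]
  rw [h2]
  exact contMDiffAt_iff_extend

namespace IsSection

variable {Z : GaussSolution α} {ρ : I → CotangentBundle n M}

theorem contDiffWithinAt (h : IsSection Z ρ) {c : M} {u : I}
    (hu : Z.base u ∈ (chartAt (Coord n) c).source) :
    ContDiffWithinAt ℝ 1 (extend (secCoord ρ c)) (Icc 0 1) u :=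
  (contMDiffAt_section_iff h.proj_eq hu).1 (h.contMDiff u)

theorem hasDerivWithinAt (h : IsSection Z ρ) {c : M} {u : I}
    (hu : Z.base u ∈ (chartAt (Coord n) c).source) :
    HasDerivWithinAt (extend (secCoord ρ c)) (timeDeriv (secCoord ρ c) u) (Icc 0 1) u := by
  have h1 := ((h.contDiffWithinAt hu).differentiableWithinAt (by simp)).hasDerivWithinAt
  rwa [← timeDeriv_eq h1] at h1

theorem of_contDiffWithinAt (hρ : ∀ u, (ρ u).proj = Z.base u)
    (h : ∀ u, ∃ c : M, Z.base u ∈ (chartAt (Coord n) c).source ∧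
      ContDiffWithinAt ℝ 1 (extend (secCoord ρ c)) (Icc 0 1) u) : IsSection Z ρ := by
  refine ⟨hρ, fun u => ?_⟩
  obtain ⟨c, hc, h'⟩ := h u
  exact (contMDiffAt_section_iff hρ hc).2 h'

end IsSection

/-- Passage from paths in the total space, which are convenient for transport, to dependent families
of covectors: the base points agree only propositionally. -/
theorem exists_covectors {Z : GaussSolution α} {ρ : I → CotangentBundle n M}
    (hρ : ∀ u, (ρ u).proj = Z.base u) :
    ∃ β : ∀ u : I, Cotangent n (Z.base u), (fun u => ⟨Z.base u, β u⟩) = ρ ∧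
      ∀ u, (ρ u).snd = 0 → β u = 0 := by
  have h : ∀ u, ∃ p : Cotangent n (Z.base u), (⟨Z.base u, p⟩ : CotangentBundle n M) = ρ u ∧
      ((ρ u).snd = 0 → p = 0) := by
    intro u
    rw [← hρ u]
    exact ⟨(ρ u).snd, rfl, id⟩
  choose β hβ hβ' using h
  exact ⟨β, funext hβ, hβ'⟩

theorem isGaugeSection_iff {Z : GaussSolution α} {β : ∀ u : I, Cotangent n (Z.base u)} :
    IsGaugeSection Z β ↔ IsSection Z (fun u => ⟨Z.base u, β u⟩) ∧ β 0 = 0 ∧ β 1 = 0 :=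
  ⟨fun h => ⟨⟨fun _ => rfl, h.1⟩, h.2⟩, fun h => ⟨h.1.2, h.2⟩⟩

end GaussCoordinates

/-! ### Time-dependent Hamiltonian symmetries of the Gauss law -/

/-- Continuously differentiable functions of time, given by the initial value and the derivative. -/
abbrev TimeFun : Type := ℝ × C(I, ℝ)

/-- The value of a function of time. -/
def TimeFun.val (s : TimeFun) (r : ℝ) : ℝ := s.1 + prim s.2 r

namespace TimeFun

theorem val_add (s t : TimeFun) (r : ℝ) : val (s + t) r = val s r + val t r := by
  simp [val, prim_add]
  ring

theorem val_smul (c : ℝ) (s : TimeFun) (r : ℝ) : val (c • s) r = c * val s r := by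
  simp [val, prim_smul]
  ring

theorem val_zero (r : ℝ) : val 0 r = 0 := by
  have := val_smul 0 0 r
  rwa [zero_smul, zero_mul] at this

theorem hasDerivAt_val (s : TimeFun) (u : I) : HasDerivAt (val s) (s.2 u) u := by
  have := (hasDerivAt_prim s.2 u).const_add s.1
  rwa [projIcc_val] at this

theorem continuous_val (s : TimeFun) : Continuous (val s) :=
  continuous_const.add (continuous_prim s.2)

theorem contDiff_val (s : TimeFun) : ContDiff ℝ 1 (val s) :=
  contDiff_const.add (contDiff_prim s.2)

/-- The values and derivatives of a function of time, as a continuous function. -/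
def jetCLM : TimeFun →L[ℝ] C(I, ℝ × ℝ) :=
  pairCLM ∘L ((constCLM I ℝ ∘L ContinuousLinearMap.fst ℝ ℝ C(I, ℝ) +
    primCLM ℝ ∘L ContinuousLinearMap.snd ℝ ℝ C(I, ℝ)).prod (ContinuousLinearMap.snd ℝ ℝ C(I, ℝ)))

end TimeFun

section Symmetries

universe u

variable {n : ℕ} {M : Type u} [TopologicalSpace M] [ChartedSpace (Coord n) M]
  [IsManifold (𝓡 n) ∞ M]

/-- A Hamiltonian with compact support in the domain of a chart. -/
structure Ham (α : PoissonStructure n M) where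
  center : M
  fn : Coord n → ℝ
  isLocalHam : IsLocalHam (chartAt (Coord n) center).target (α.coordCLM center) fn

variable {α : PoissonStructure n M}

namespace Ham

/-- The action on the cotangent bundle of the Hamiltonian flow, followed by a translation. -/
def hat (h : Ham α) (ρ τ : ℝ) (z : CotangentBundle n M) : CotangentBundle n M :=
  open Classical in
  if z.proj ∈ (chartAt (Coord n) h.center).source then
    (cotChart n h.center).symm (lift (α.coordCLM h.center) h.fn ρ τ (cotChart n h.center z))
  else z

/-- The support of the Hamiltonian. -/
def supp (h : Ham α) : Set M := chartSupport h.center h.fn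

variable (h : Ham α)

theorem supp_subset {x : M} (hx : x ∈ h.supp) : x ∈ (chartAt (Coord n) h.center).source :=
  mem_source_of_mem_chartSupport h.isLocalHam.supp hx

theorem isClosed_supp [T2Space M] : IsClosed h.supp :=
  isClosed_chartSupport h.isLocalHam.supp h.isLocalHam.compact

variable {h} {z : CotangentBundle n M}

theorem lift_mem_target (hz : z.proj ∈ (chartAt (Coord n) h.center).source) (ρ τ : ℝ) :
    lift (α.coordCLM h.center) h.fn ρ τ (cotChart n h.center z) ∈ (cotChart n h.center).target := by
  rw [mem_cotChart_target]
  refine h.isLocalHam.hamFlow_mem ?_ ρ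
  rw [cotChart_apply]
  exact (chartAt (Coord n) h.center).map_source hz

theorem hat_eq (hz : z.proj ∈ (chartAt (Coord n) h.center).source) (ρ τ : ℝ) :
    h.hat ρ τ z =
      (cotChart n h.center).symm (lift (α.coordCLM h.center) h.fn ρ τ (cotChart n h.center z)) :=
  if_pos hz

theorem cotChart_hat (hz : z.proj ∈ (chartAt (Coord n) h.center).source) (ρ τ : ℝ) :
    cotChart n h.center (h.hat ρ τ z) =
      lift (α.coordCLM h.center) h.fn ρ τ (cotChart n h.center z) := by
  rw [hat_eq hz, (cotChart n h.center).right_inv (lift_mem_target hz ρ τ)]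

theorem hat_proj_mem (hz : z.proj ∈ (chartAt (Coord n) h.center).source) (ρ τ : ℝ) :
    (h.hat ρ τ z).proj ∈ (chartAt (Coord n) h.center).source := by
  rw [hat_eq hz]
  exact mem_cotChart_source.1 ((cotChart n h.center).map_target (lift_mem_target hz ρ τ))

theorem hat_of_notMem (hz : z.proj ∉ h.supp) (ρ τ : ℝ) : h.hat ρ τ z = z := by
  by_cases hzc : z.proj ∈ (chartAt (Coord n) h.center).source
  · rw [hat_eq hzc, h.isLocalHam.lift_of_notMem,
      (cotChart n h.center).left_inv (mem_cotChart_source.2 hzc)]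
    rw [cotChart_apply]
    exact notMem_tsupport_of_notMem_chartSupport hz hzc
  · exact if_neg hzc

variable (h z)

theorem hat_add (ρ' τ' ρ τ : ℝ) : h.hat ρ' τ' (h.hat ρ τ z) = h.hat (ρ' + ρ) (τ' + τ) z := by
  by_cases hz : z.proj ∈ (chartAt (Coord n) h.center).source
  · rw [hat_eq (hat_proj_mem hz ρ τ), cotChart_hat hz, h.isLocalHam.lift_add, hat_eq hz]
  · have h1 : z.proj ∉ h.supp := fun h' => hz (h.supp_subset h')
    simp only [hat_of_notMem h1]

theorem hat_zero : h.hat 0 0 z = z := by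
  by_cases hz : z.proj ∈ (chartAt (Coord n) h.center).source
  · rw [hat_eq hz, h.isLocalHam.lift_zero, (cotChart n h.center).left_inv (mem_cotChart_source.2 hz)]
  · exact if_neg hz

theorem continuous_proj : Continuous fun z : CotangentBundle n M => z.proj :=
  FiberBundle.continuous_proj (CoCoord n) (fun x : M => Cotangent n x)

/-- The map is continuous in bundle coordinates over the chart domain and is the second projection
off the support. Both sets are open, because the support is closed in the Hausdorff manifold, and
they cover. -/
theorem continuous_hat [T2Space M] :
    Continuous fun q : (ℝ × ℝ) × CotangentBundle n M => h.hat q.1.1 q.1.2 q.2 := by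
  rw [continuous_iff_continuousAt]
  rintro ⟨⟨ρ, τ⟩, z⟩
  by_cases hz : z.proj ∈ h.supp
  · have hzc := h.supp_subset hz
    have h1 : ContinuousAt (fun q : (ℝ × ℝ) × CotangentBundle n M =>
        (cotChart n h.center).symm (lift (α.coordCLM h.center) h.fn q.1.1 q.1.2
          (cotChart n h.center q.2))) ((ρ, τ), z) := by
      refine ContinuousAt.comp (g := (cotChart n h.center).symm)
        ((cotChart n h.center).continuousAt_symm (lift_mem_target hzc ρ τ)) ?_
      refine ContinuousAt.comp (g := fun q : (ℝ × ℝ) × (Coord n × CoCoord n) =>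
        lift (α.coordCLM h.center) h.fn q.1.1 q.1.2 q.2)
        (f := fun q : (ℝ × ℝ) × CotangentBundle n M => (q.1, cotChart n h.center q.2))
        h.isLocalHam.contDiff_lift.continuous.continuousAt ?_
      exact continuousAt_fst.prodMk (ContinuousAt.comp (g := cotChart n h.center)
        (f := Prod.snd) (x := ((ρ, τ), z))
        ((cotChart n h.center).continuousAt (mem_cotChart_source.2 hzc)) continuousAt_snd)
    refine h1.congr ?_
    have h2 : ∀ᶠ q : (ℝ × ℝ) × CotangentBundle n M in 𝓝 ((ρ, τ), z),
        q.2 ∈ (cotChart n h.center).source :=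
      continuousAt_snd.preimage_mem_nhds
        ((cotChart n h.center).open_source.mem_nhds (mem_cotChart_source.2 hzc))
    filter_upwards [h2] with q hq
    exact (hat_eq (mem_cotChart_source.1 hq) _ _).symm
  · have h0 : ContinuousAt Prod.snd (((ρ, τ), z) : (ℝ × ℝ) × CotangentBundle n M) :=
      continuousAt_snd
    refine h0.congr ?_
    have h2 : ∀ᶠ q : (ℝ × ℝ) × CotangentBundle n M in 𝓝 ((ρ, τ), z), q.2.proj ∉ h.supp := by
      have h3 : ContinuousAt (fun q : (ℝ × ℝ) × CotangentBundle n M => q.2.proj) ((ρ, τ), z) :=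
        (continuous_proj.comp continuous_snd).continuousAt
      exact h3.preimage_mem_nhds (h.isClosed_supp.isOpen_compl.mem_nhds hz)
    filter_upwards [h2] with q hq
    exact (hat_of_notMem hq _ _).symm

variable [T2Space M]

/-- The pointwise action of a Hamiltonian on paths. -/
def actPath (s : TimeFun) (γ : C(I, CotangentBundle n M)) : C(I, CotangentBundle n M) :=
  ⟨fun u => h.hat (s.val u) (s.2 u) (γ u),
    h.continuous_hat.comp ((((TimeFun.continuous_val s).comp continuous_subtype_val).prodMk
      s.2.continuous).prodMk γ.continuous)⟩

theorem actPath_apply (s : TimeFun) (γ : C(I, CotangentBundle n M)) (u : I) :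
    h.actPath s γ u = h.hat (s.val u) (s.2 u) (γ u) := rfl

/-- Over the support the law follows from `hasDerivWithinAt_lift_fst`, with τ the derivative of the
time function; elsewhere the path is unchanged near `u`. -/
theorem gaussAt_actPath (s : TimeFun) (Z : GaussSolution α) (u : I) :
    ∃ c : M, (h.actPath s Z.path u).proj ∈ (chartAt (Coord n) c).source ∧
      GaussAt α c (h.actPath s Z.path) u := by
  by_cases hu : Z.base u ∈ h.supp
  · have hc := h.supp_subset hu
    refine ⟨h.center, hat_proj_mem hc _ _, ?_⟩
    have h1 := Z.gaussAt hc
    have hs : HasDerivWithinAt (TimeFun.val s) (s.2 u) (Icc 0 1) u :=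
      (TimeFun.hasDerivAt_val s u).hasDerivWithinAt
    have h2 := h.isLocalHam.hasDerivWithinAt_lift_fst hs (q := (cotChart n h.center (Z.path u)).2)
      (y := extend fun u => (cotChart n h.center (Z.path u)).1)
      (by rw [extend_coe]; exact h1)
      (by
        rw [extend_coe, cotChart_apply]
        exact (chartAt (Coord n) h.center).map_source hc)
    rw [extend_coe] at h2
    have h3 : (extend fun v => (cotChart n h.center (h.actPath s Z.path v)).1)
        =ᶠ[𝓝[Icc 0 1] (u : ℝ)] fun r => flow (hamField (α.coordCLM h.center) h.fn) (s.val r)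
          (extend (fun u => (cotChart n h.center (Z.path u)).1) r) := by
      filter_upwards [eventually_extend_mem Z.path.continuous (cotChart n h.center).open_source
        (mem_cotChart_source.2 hc), self_mem_nhdsWithin] with r hr hr'
      simp only [extend, actPath_apply]
      rw [cotChart_hat (z := Z.path (projIcc 0 1 zero_le_one r)) (mem_cotChart_source.1 hr), lift, projIcc_of_mem zero_le_one hr']
    unfold GaussAt
    rw [actPath_apply, cotChart_hat hc]
    exact h2.congr_of_eventuallyEq h3 (h3.self_of_nhdsWithin u.2)
  · refine ⟨Z.base u, ?_, ?_⟩
    · rw [actPath_apply, hat_of_notMem hu]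
      exact mem_chart_source _ _
    · refine (Z.gaussAt (mem_chart_source _ _)).congr ?_
      filter_upwards [(continuous_proj.comp Z.path.continuous).continuousAt.preimage_mem_nhds
        (h.isClosed_supp.isOpen_compl.mem_nhds hu)] with v hv
      exact hat_of_notMem hv _ _

/-- The action on solutions of the Gauss law. -/
def act (s : TimeFun) (Z : GaussSolution α) : GaussSolution α :=
  GaussSolution.ofPath (h.actPath s Z.path) (h.gaussAt_actPath s Z)

theorem act_path (s : TimeFun) (Z : GaussSolution α) (u : I) :
    (h.act s Z).path u = h.hat (s.val u) (s.2 u) (Z.path u) := rfl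

theorem act_add (s t : TimeFun) (Z : GaussSolution α) :
    h.act (s + t) Z = h.act s (h.act t Z) := by
  ext1 u
  simp only [act_path, hat_add, TimeFun.val_add]
  rfl

theorem act_zero (Z : GaussSolution α) : h.act 0 Z = Z := by
  ext1 u
  simp only [act_path, TimeFun.val_zero]
  exact h.hat_zero _

theorem continuous_act : Continuous fun q : TimeFun × GaussSolution α => h.act q.1 q.2 := by
  refine continuous_induced_rng.2 (ContinuousMap.continuous_of_continuous_uncurry _ ?_)
  have h1 : Continuous fun q : (TimeFun × GaussSolution α) × I => TimeFun.jetCLM q.1.1 q.2 :=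
    ContinuousEval.continuous_eval.comp
      ((TimeFun.jetCLM.continuous.comp (continuous_fst.comp continuous_fst)).prodMk continuous_snd)
  exact h.continuous_hat.comp (h1.prodMk (GaussSolution.continuous_eval.comp
    ((continuous_snd.comp continuous_fst).prodMk continuous_snd)))

/-- The action on solutions of the Gauss law, as a homeomorphism. -/
def actHomeo (s : TimeFun) : GaussSolution α ≃ₜ GaussSolution α where
  toFun := h.act s
  invFun := h.act (-s)
  left_inv Z := by rw [← act_add, neg_add_cancel, act_zero]
  right_inv Z := by rw [← act_add, add_neg_cancel, act_zero]
  continuous_toFun := h.continuous_act.comp (continuous_const.prodMk continuous_id)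
  continuous_invFun := h.continuous_act.comp (continuous_const.prodMk continuous_id)

end Ham

/-- The composition of a list of symmetries. -/
def wordAct [T2Space M] : List (Ham α × TimeFun) → GaussSolution α ≃ₜ GaussSolution α
  | [] => Homeomorph.refl _
  | a :: l => (wordAct l).trans (a.1.actHomeo a.2)

end Symmetries

/-! ### Smooth dependence of functions of time on parameters -/

section SmoothOnIcc

variable {P : Type} [NormedAddCommGroup P] [NormedSpace ℝ P]
  {F F' : Type} [NormedAddCommGroup F] [NormedSpace ℝ F] [NormedAddCommGroup F'] [NormedSpace ℝ F']

/-- Near `w₀`, the family `φ` of functions on `[a, b]` depends smoothly on the parameter, as an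
element of the Banach space of continuous functions. -/
def SmoothOnIcc (φ : P → I → F) (w₀ : P) (a b : I) : Prop :=
  ∃ G : P → C(Icc a b, F), ContDiffAt ℝ ∞ G w₀ ∧ ∀ᶠ w in 𝓝 w₀, ∀ u : Icc a b, G w u = φ w u

namespace SmoothOnIcc

variable {φ : P → I → F} {w₀ : P} {a b : I}

theorem congr (h : SmoothOnIcc φ w₀ a b) {ψ : P → I → F}
    (hψ : ∀ᶠ w in 𝓝 w₀, ∀ u ∈ Icc a b, φ w u = ψ w u) : SmoothOnIcc ψ w₀ a b := by
  obtain ⟨G, hG, hφ⟩ := h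
  refine ⟨G, hG, ?_⟩
  filter_upwards [hφ, hψ] with w h1 h2 u
  rw [h1, h2 u u.2]

theorem mono (h : SmoothOnIcc φ w₀ a b) {a' b' : I} (hab : Icc a' b' ⊆ Icc a b) :
    SmoothOnIcc φ w₀ a' b' := by
  obtain ⟨G, hG, hφ⟩ := h
  refine ⟨fun w => pullbackCLM ⟨Set.inclusion hab, continuous_inclusion hab⟩ (G w),
    (ContinuousLinearMap.contDiff _).contDiffAt.comp w₀ hG, ?_⟩
  filter_upwards [hφ] with w h1 u
  exact h1 ⟨u, hab u.2⟩

theorem glue {m : I} (ham : a ≤ m) (hmb : m ≤ b) (h : SmoothOnIcc φ w₀ a m)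
    (h' : SmoothOnIcc φ w₀ m b) : SmoothOnIcc φ w₀ a b := by
  obtain ⟨G, hG, hφ⟩ := h
  obtain ⟨G', hG', hφ'⟩ := h'
  let i₁ : C(Icc a b, Icc a m) :=
    ⟨fun u => ⟨min u m, le_min u.2.1 ham, min_le_right _ _⟩, by fun_prop⟩
  let i₂ : C(Icc a b, Icc m b) :=
    ⟨fun u => ⟨max u m, le_max_right _ _, max_le u.2.2 hmb⟩, by fun_prop⟩
  let i₃ : C(Icc a b, Icc m b) := ⟨fun _ => ⟨m, le_rfl, hmb⟩, continuous_const⟩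
  -- The glued function is G(min(u, m)) + G'(max(u, m)) - G'(m). Written in this way it is linear in
  -- the two pieces, hence smooth in the parameter, whether or not they match at m.
  refine ⟨fun w => pullbackCLM i₁ (G w) + (pullbackCLM i₂ (G' w) - pullbackCLM i₃ (G' w)),
    ((ContinuousLinearMap.contDiff _).contDiffAt.comp w₀ hG).add
      (((ContinuousLinearMap.contDiff _).contDiffAt.comp w₀ hG').sub
        ((ContinuousLinearMap.contDiff _).contDiffAt.comp w₀ hG')), ?_⟩
  filter_upwards [hφ, hφ'] with w h1 h2 u
  have e1 := h1 (i₁ u)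
  have e2 := h2 (i₂ u)
  have e3 := h2 (i₃ u)
  have e4 := h1 ⟨m, ham, le_rfl⟩
  simp only [ContinuousMap.add_apply, ContinuousMap.sub_apply, pullbackCLM_apply, e1, e2, e3]
  rcases le_total (u : I) m with hu | hu
  · have e5 : (i₁ u : I) = u := min_eq_left hu
    have e6 : (i₂ u : I) = m := max_eq_right hu
    rw [e5, e6]
    exact add_eq_left.2 (sub_self _)
  · have e5 : (i₁ u : I) = m := min_eq_right hu
    have e6 : (i₂ u : I) = u := max_eq_left hu
    rw [e5, e6]
    exact add_sub_cancel _ _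

theorem of_subset_singleton (h : Icc a b = ∅) : SmoothOnIcc φ w₀ a b :=
  ⟨fun _ => 0, contDiffAt_const, .of_forall fun _ u => absurd u.2 (by simp [h])⟩

/-- A finite subdivision of the interval subordinate to the given neighbourhoods (Lebesgue number),
with the pieces glued one after the other. -/
theorem of_local (h : ∀ u ∈ Icc a b, ∃ a' b', Icc a' b' ∈ 𝓝 u ∧ SmoothOnIcc φ w₀ a' b') :
    SmoothOnIcc φ w₀ a b := by
  rcases lt_or_ge b a with hab | hab
  · exact of_subset_singleton (Icc_eq_empty (not_le.2 hab))
  choose! a' b' h1 h2 using h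
  -- The complement of [a, b] is added to have a cover of all of `I`; the division points are then
  -- clamped to [a, b].
  let V : I → Set I := fun u => if u ∈ Icc a b then interior (Icc (a' u) (b' u)) else (Icc a b)ᶜ
  obtain ⟨t, ht0, htm, ⟨N, hN⟩, ht⟩ := exists_monotone_Icc_subset_open_cover_unitInterval
    (c := V) (fun u => by
      by_cases hu : u ∈ Icc a b
      · simp only [V, if_pos hu]; exact isOpen_interior
      · simp only [V, if_neg hu]; exact isClosed_Icc.isOpen_compl)
    (fun u _ => mem_iUnion.2 ⟨u, by
      by_cases hu : u ∈ Icc a b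
      · simp only [V, if_pos hu]; exact mem_interior_iff_mem_nhds.2 (h1 u hu)
      · simp only [V, if_neg hu]; exact hu⟩)
  have hm : ∀ k, a ≤ max a (min b (t k)) ∧ max a (min b (t k)) ≤ b := fun k =>
    ⟨le_max_left _ _, max_le hab (min_le_left _ _)⟩
  have key : ∀ k, SmoothOnIcc φ w₀ a (max a (min b (t k))) := by
    intro k
    induction k with
    | zero =>
      have : max a (min b (t 0)) = a := by
        rw [ht0]; exact max_eq_left ((min_le_right _ _).trans a.2.1)
      rw [this]
      have ha : a ∈ Icc a b := left_mem_Icc.2 hab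
      refine (h2 a ha).mono fun x hx => ?_
      obtain rfl : x = a := le_antisymm hx.2 hx.1
      exact mem_of_mem_nhds (h1 x ha)
    | succ k ih =>
      have hle : max a (min b (t k)) ≤ max a (min b (t (k + 1))) :=
        max_le_max le_rfl (min_le_min le_rfl (htm (Nat.le_succ k)))
      rcases hle.eq_or_lt with heq | hlt
      · rwa [← heq]
      refine ih.glue (hm k).1 hle ?_
      obtain ⟨u, hu⟩ := ht k
      have hsub : Icc (max a (min b (t k))) (max a (min b (t (k + 1)))) ⊆ Icc (t k) (t (k + 1)) := by
        intro x hx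
        have h3 : a < min b (t (k + 1)) := by
          by_contra hcon
          rw [max_eq_left (not_lt.1 hcon)] at hlt
          exact absurd hlt (not_lt.2 (hm k).1)
        rw [max_eq_right h3.le] at hx hlt
        have h4 : t k ≤ b := by
          by_contra hcon
          have h5 := (not_le.1 hcon).le
          rw [min_eq_left h5, max_eq_right hab] at hlt
          exact absurd hlt (not_lt.2 (min_le_left _ _))
        rw [min_eq_right h4] at hx
        exact ⟨(le_max_right _ _).trans hx.1, hx.2.trans (min_le_right _ _)⟩
      by_cases hua : u ∈ Icc a b
      · simp only [V, if_pos hua] at hu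
        exact (h2 u hua).mono (hsub.trans (hu.trans interior_subset))
      · simp only [V, if_neg hua] at hu
        exact absurd (show max a (min b (t k)) ∈ Icc a b from hm k)
          (hu (hsub (left_mem_Icc.2 hle)))
  have h3 := key N
  rwa [hN N le_rfl, min_eq_left unitInterval.le_one', max_eq_right hab] at h3

theorem superpose {Ω : Set F} {f : F → F'} (h : SmoothOnIcc φ w₀ a b) (hΩ : IsOpen Ω)
    (hf : ContDiffOn ℝ ∞ f Ω) (hφ : ∀ u ∈ Icc a b, φ w₀ u ∈ Ω) :
    SmoothOnIcc (fun w u => f (φ w u)) w₀ a b := by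
  obtain ⟨G, hG, hGφ⟩ := h
  have hopen : IsOpen {g : C(Icc a b, F) | ∀ u, g u ∈ Ω} := isOpen_setOf_forall_mem hΩ
  have hmem : G w₀ ∈ {g : C(Icc a b, F) | ∀ u, g u ∈ Ω} := fun u => by
    rw [hGφ.self_of_nhds u]; exact hφ u u.2
  refine ⟨fun w => PoissonSigma.superpose f (G w),
    ((contDiffOn_superpose hΩ hf).contDiffAt (hopen.mem_nhds hmem)).comp w₀ hG, ?_⟩
  filter_upwards [hGφ, hG.continuousAt.preimage_mem_nhds (hopen.mem_nhds hmem)] with w h1 h2 u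
  rw [superpose_apply hf.continuousOn h2, h1]

theorem prodMk {ψ : P → I → F'} (h : SmoothOnIcc φ w₀ a b) (h' : SmoothOnIcc ψ w₀ a b) :
    SmoothOnIcc (fun w u => (φ w u, ψ w u)) w₀ a b := by
  obtain ⟨G, hG, hφ⟩ := h
  obtain ⟨G', hG', hψ⟩ := h'
  refine ⟨fun w => pairCLM (G w, G' w), (ContinuousLinearMap.contDiff _).contDiffAt.comp w₀
    (hG.prodMk hG'), ?_⟩
  filter_upwards [hφ, hψ] with w h1 h2 u
  rw [pairCLM_apply, h1, h2]

theorem contDiffAt_apply (h : SmoothOnIcc φ w₀ a b) {u : I} (hu : u ∈ Icc a b) :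
    ContDiffAt ℝ ∞ (fun w => φ w u) w₀ := by
  obtain ⟨G, hG, hφ⟩ := h
  have h1 : ContDiffAt ℝ ∞ (fun w => ContinuousMap.evalCLM ℝ (⟨u, hu⟩ : Icc a b) (G w)) w₀ :=
    (ContinuousLinearMap.contDiff _).contDiffAt.comp w₀ hG
  refine h1.congr_of_eventuallyEq ?_
  filter_upwards [hφ] with w h2
  exact (h2 ⟨u, hu⟩).symm

theorem of_contDiffAt {G : P → C(I, F)} (hG : ContDiffAt ℝ ∞ G w₀) :
    SmoothOnIcc (fun w u => G w u) w₀ a b :=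
  ⟨fun w => pullbackCLM ⟨Subtype.val, continuous_subtype_val⟩ (G w),
    (ContinuousLinearMap.contDiff _).contDiffAt.comp w₀ hG, .of_forall fun _ _ => rfl⟩

theorem exists_contDiffAt (h : SmoothOnIcc φ w₀ 0 1) :
    ∃ G : P → C(I, F), ContDiffAt ℝ ∞ G w₀ ∧ ∀ᶠ w in 𝓝 w₀, ∀ u, G w u = φ w u := by
  obtain ⟨G, hG, hφ⟩ := h
  let i : C(I, Icc (0 : I) 1) :=
    ⟨fun u => ⟨u, unitInterval.nonneg', unitInterval.le_one'⟩, by fun_prop⟩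
  refine ⟨fun w => pullbackCLM i (G w), (ContinuousLinearMap.contDiff _).contDiffAt.comp w₀ hG, ?_⟩
  filter_upwards [hφ] with w h1 u
  exact h1 (i u)

theorem tendsto (h : SmoothOnIcc φ w₀ a b) {u : I} (hu : Icc a b ∈ 𝓝 u) :
    ContinuousAt (fun q : P × I => φ q.1 q.2) (w₀, u) := by
  obtain ⟨G, hG, hφ⟩ := h
  have huab := mem_of_mem_nhds hu
  let pr : I → Icc a b := projIcc a b (huab.1.trans huab.2)
  have h1 : ContinuousAt (fun q : P × I => G q.1 (pr q.2)) (w₀, u) := by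
    have h2 : ContinuousAt (fun q : P × I => (G q.1, pr q.2)) (w₀, u) :=
      (ContinuousAt.comp (x := (w₀, u)) (f := Prod.fst) hG.continuousAt continuousAt_fst).prodMk
        (continuous_projIcc.comp continuous_snd).continuousAt
    exact ContinuousAt.comp (g := fun p : C(Icc a b, F) × Icc a b => p.1 p.2)
      ContinuousEval.continuous_eval.continuousAt h2
  refine h1.congr ?_
  rw [nhds_prod_eq]
  filter_upwards [hφ.prod_mk hu] with q hq
  rw [hq.1]
  simp only [pr, projIcc_of_mem _ hq.2]

end SmoothOnIcc

end SmoothOnIcc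

/-! ### Smooth families of solutions -/

section SmoothFamilies

universe u

variable {n : ℕ} {M : Type u} [TopologicalSpace M] [ChartedSpace (Coord n) M]
  [IsManifold (𝓡 n) ∞ M] {α : PoissonStructure n M}
  {P : Type} [NormedAddCommGroup P] [NormedSpace ℝ P]

/-- The family `g` is smooth at the parameter `w₀` over the interval `[a, b]`, in the chart
around `c`. -/
def SmoothInChart (g : P → GaussSolution α) (w₀ : P) (c : M) (a b : I) : Prop :=
  (∀ᶠ w in 𝓝 w₀, ∀ u ∈ Icc a b, (g w).base u ∈ (chartAt (Coord n) c).source) ∧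
    SmoothOnIcc (fun w u => cotChart n c ((g w).path u)) w₀ a b

/-- The family `g` of solutions, parametrised by a normed space, is smooth at the parameter `w₀`. -/
def SmoothAt (g : P → GaussSolution α) (w₀ : P) : Prop :=
  ∀ u : I, ∃ (c : M) (a b : I), Icc a b ∈ 𝓝 u ∧ SmoothInChart g w₀ c a b

variable {g : P → GaussSolution α} {w₀ : P}

theorem GaussSolution.continuous_base (Z : GaussSolution α) : Continuous Z.base :=
  Ham.continuous_proj.comp Z.path.continuous

theorem exists_Icc_base_mem (Z : GaussSolution α) {U : Set M} (hU : IsOpen U) {u : I}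
    (hu : Z.base u ∈ U) : ∃ a b : I, Icc a b ∈ 𝓝 u ∧ ∀ v ∈ Icc a b, Z.base v ∈ U := by
  obtain ⟨a, b, -, h1, h2⟩ := exists_Icc_mem_subset_of_mem_nhds
    (Z.continuous_base.continuousAt.preimage_mem_nhds (hU.mem_nhds hu))
  exact ⟨a, b, h1, h2⟩

theorem SmoothInChart.mono {c : M} {a b a' b' : I} (h : SmoothInChart g w₀ c a b)
    (hab : Icc a' b' ⊆ Icc a b) : SmoothInChart g w₀ c a' b' :=
  ⟨h.1.mono fun _ hw u hu => hw u (hab hu), h.2.mono hab⟩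

theorem SmoothInChart.change {c c' : M} {a b : I} (h : SmoothInChart g w₀ c a b)
    (hc' : ∀ᶠ w in 𝓝 w₀, ∀ u ∈ Icc a b, (g w).base u ∈ (chartAt (Coord n) c').source) :
    SmoothInChart g w₀ c' a b := by
  refine ⟨hc', ?_⟩
  have hmem : ∀ {z : CotangentBundle n M}, z.proj ∈ (chartAt (Coord n) c).source →
      z.proj ∈ (chartAt (Coord n) c').source → cotChart n c z ∈ ((chartAt (Coord n) c).target ∩
        (chartAt (Coord n) c).symm ⁻¹' (chartAt (Coord n) c').source) ×ˢ univ := by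
    intro z hz hz'
    rw [cotChart_apply]
    refine ⟨⟨(chartAt (Coord n) c).map_source hz, ?_⟩, mem_univ _⟩
    simpa [(chartAt (Coord n) c).left_inv hz] using hz'
  have h1 : SmoothOnIcc (fun w u => cotChange c c' (cotChart n c ((g w).path u))) w₀ a b := by
    refine h.2.superpose (Ω := ((chartAt (Coord n) c).target ∩
      (chartAt (Coord n) c).symm ⁻¹' (chartAt (Coord n) c').source) ×ˢ univ)
      (((chartAt (Coord n) c).isOpen_inter_preimage_symm (chartAt (Coord n) c').open_source).prod
        isOpen_univ) ?_ ?_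
    · rintro ⟨y, q⟩ ⟨⟨hy, hy'⟩, -⟩
      have h2 := contDiffAt_cotChange ((chartAt (Coord n) c).map_target hy) hy' q
      rw [(chartAt (Coord n) c).right_inv hy] at h2
      exact h2.contDiffWithinAt
    · intro u hu
      exact hmem (h.1.self_of_nhds u hu) (hc'.self_of_nhds u hu)
  refine h1.congr ?_
  filter_upwards [h.1, hc'] with w hw hw' u hu
  exact cotChange_apply (hw u hu) (hw' u hu)

theorem SmoothAt.continuousAt_eval (h : SmoothAt g w₀) (u : I) :
    ContinuousAt (fun q : P × I => (g q.1).path q.2) (w₀, u) := by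
  obtain ⟨c, a, b, hab, h1, h2⟩ := h u
  have h3 := h2.tendsto hab
  have hu := mem_of_mem_nhds hab
  have h4 : ContinuousAt (cotChart n c).symm (cotChart n c ((g w₀).path u)) :=
    (cotChart n c).continuousAt_symm
      ((cotChart n c).map_source (mem_cotChart_source.2 (h1.self_of_nhds u hu)))
  have h5 : ContinuousAt (fun q : P × I => (cotChart n c).symm (cotChart n c ((g q.1).path q.2)))
      (w₀, u) := ContinuousAt.comp (g := (cotChart n c).symm) h4 h3
  refine h5.congr ?_
  rw [nhds_prod_eq]
  filter_upwards [h1.prod_mk hab] with q hq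
  exact (cotChart n c).left_inv (mem_cotChart_source.2 (hq.1 _ hq.2))

theorem SmoothAt.continuousAt (h : SmoothAt g w₀) : ContinuousAt g w₀ := by
  refine (Topology.IsInducing.continuousAt_iff ⟨rfl⟩ (g := GaussSolution.path)).2 ?_
  rw [ContinuousAt, ContinuousMap.tendsto_nhds_compactOpen]
  intro K hK U hU hKU
  refine hK.eventually_forall_of_forall_eventually (P := fun w u => (g w).path u ∈ U) fun u hu => ?_
  exact (h.continuousAt_eval u).preimage_mem_nhds (hU.mem_nhds (hKU hu))

theorem isOpen_forall_base_mem {U : Set M} (hU : IsOpen U) {K : Set I} (hK : IsCompact K) :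
    IsOpen {Z : GaussSolution α | ∀ u ∈ K, Z.base u ∈ U} := by
  have h := (ContinuousMap.isOpen_setOfPred_mapsTo hK (hU.preimage Ham.continuous_proj)).preimage
    (GaussSolution.continuous_path (α := α))
  exact h

theorem SmoothAt.eventually_base_mem (h : SmoothAt g w₀) {U : Set M} (hU : IsOpen U) {a b : I}
    (hu : ∀ u ∈ Icc a b, (g w₀).base u ∈ U) : ∀ᶠ w in 𝓝 w₀, ∀ u ∈ Icc a b, (g w).base u ∈ U :=
  h.continuousAt.preimage_mem_nhds ((isOpen_forall_base_mem hU isCompact_Icc).mem_nhds hu)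

/-- Smoothness in some chart around each time passes to any prescribed chart on short intervals, by
superposition with the coordinate change, and then to the whole interval by gluing. -/
theorem SmoothAt.smoothInChart (h : SmoothAt g w₀) {c : M} {a b : I}
    (hab : ∀ u ∈ Icc a b, (g w₀).base u ∈ (chartAt (Coord n) c).source) :
    SmoothInChart g w₀ c a b := by
  refine ⟨h.eventually_base_mem (chartAt (Coord n) c).open_source hab,
    SmoothOnIcc.of_local fun u hu => ?_⟩
  obtain ⟨c', a', b', h1, h2⟩ := h u
  obtain ⟨a'', b'', h3, h4⟩ := exists_Icc_base_mem (g w₀) (chartAt (Coord n) c).open_source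
    (hab u hu)
  obtain ⟨A, B, -, h5, h6⟩ := exists_Icc_mem_subset_of_mem_nhds (Filter.inter_mem h1 h3)
  exact ⟨A, B, h5, ((h2.mono (h6.trans inter_subset_left)).change
    (h.eventually_base_mem (chartAt (Coord n) c).open_source fun v hv => h4 v (h6 hv).2)).2⟩

theorem SmoothAt.comp {P' : Type} [NormedAddCommGroup P'] [NormedSpace ℝ P'] {f : P' → P} {w₁ : P'}
    (h : SmoothAt g (f w₁)) (hf : ContDiffAt ℝ ∞ f w₁) : SmoothAt (fun w => g (f w)) w₁ := by
  intro u
  obtain ⟨c, a, b, h1, h2, G, hG, h3⟩ := h u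
  exact ⟨c, a, b, h1, hf.continuousAt.eventually h2, fun w => G (f w), hG.comp w₁ hf,
    hf.continuousAt.eventually h3⟩

/-- Replaces the definition by a pointwise condition, which makes sense over every normed parameter
space and so applies also to curves of solutions. -/
theorem isSmoothFamily_iff {W : Set (GaussModel n)} (hW : IsOpen W)
    {g : GaussModel n → GaussSolution α} : IsSmoothFamily α W g ↔ ∀ w ∈ W, SmoothAt g w := by
  constructor
  · rintro ⟨hc, h⟩ w hw u
    obtain ⟨a, b, hab, hs⟩ := exists_Icc_base_mem (g w) (chartAt (Coord n) ((g w).base u)).open_source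
      (mem_chart_source _ _)
    obtain ⟨G, hG, hG'⟩ := h ((g w).base u) a b
    have hopen : ∀ᶠ w' in 𝓝 w, w' ∈ {w' ∈ W | ∀ u' ∈ Icc a b,
        (g w').base u' ∈ (chartAt (Coord n) ((g w).base u)).source} :=
      Filter.inter_mem (hW.mem_nhds hw) ((hc.continuousAt (hW.mem_nhds hw)).preimage_mem_nhds
        ((isOpen_forall_base_mem (chartAt (Coord n) _).open_source isCompact_Icc).mem_nhds hs))
    refine ⟨_, a, b, hab, hopen.mono fun w' hw' => hw'.2, G, hG.contDiffAt hopen, ?_⟩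
    filter_upwards [hopen] with w' hw' v
    rw [hG' w' hw', cotChart_apply]
    rfl
  · intro h
    refine ⟨fun w hw => (h w hw).continuousAt.continuousWithinAt, fun c a b => ?_⟩
    classical
    let G : GaussModel n → C(Icc a b, Coord n × CoCoord n) := fun w =>
      if hw : ∀ u ∈ Icc a b, (g w).base u ∈ (chartAt (Coord n) c).source then
        ⟨fun u => cotChart n c ((g w).path u), (cotChart n c).continuousOn.comp_continuous
          ((g w).path.continuous.comp continuous_subtype_val)
          fun u => mem_cotChart_source.2 (hw u u.2)⟩
      else 0
    refine ⟨G, fun w hw => ?_, fun w hw u => ?_⟩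
    · obtain ⟨h1, G', hG', h2⟩ := (h w hw.1).smoothInChart hw.2
      refine (hG'.congr_of_eventuallyEq ?_).contDiffWithinAt
      filter_upwards [h1, h2] with w' hw' h3
      ext1 u
      simp only [G, dif_pos hw', h3 u]
      rfl
    · simp only [G, dif_pos hw.2]
      exact cotChart_apply c _

theorem SmoothAt.contDiffAt_cotChart (h : SmoothAt g w₀) {c : M} {u : I}
    (hu : (g w₀).base u ∈ (chartAt (Coord n) c).source) :
    ContDiffAt ℝ ∞ (fun w => cotChart n c ((g w).path u)) w₀ := by
  obtain ⟨a, b, h1, h2⟩ := exists_Icc_base_mem (g w₀) (chartAt (Coord n) c).open_source hu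
  exact (h.smoothInChart h2).2.contDiffAt_apply (mem_of_mem_nhds h1)

/-- Over the support this is superposition with the smooth map `lift`, the values and rates of the
time function being continuous linear in it; near other times the family does not change. -/
theorem SmoothAt.act [T2Space M] (hg : SmoothAt g w₀) (h : Ham α) {S : P → TimeFun}
    (hS : ContDiffAt ℝ ∞ S w₀) : SmoothAt (fun w => h.act (S w) (g w)) w₀ := by
  intro u
  by_cases hu : (g w₀).base u ∈ h.supp
  · obtain ⟨a, b, h1, h2⟩ := exists_Icc_base_mem (g w₀) (chartAt (Coord n) h.center).open_source
      (h.supp_subset hu)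
    obtain ⟨h3, h4⟩ := hg.smoothInChart h2
    refine ⟨h.center, a, b, h1, ?_, ?_⟩
    · filter_upwards [h3] with w hw v hv
      exact Ham.hat_proj_mem (hw v hv) _ _
    · have h5 : SmoothOnIcc (fun w u => (TimeFun.jetCLM (S w) u, cotChart n h.center ((g w).path u)))
          w₀ a b :=
        (SmoothOnIcc.of_contDiffAt ((ContinuousLinearMap.contDiff _).contDiffAt.comp w₀ hS)).prodMk h4
      refine (h5.superpose isOpen_univ h.isLocalHam.contDiff_lift.contDiffOn
        fun _ _ => mem_univ _).congr ?_
      filter_upwards [h3] with w hw v hv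
      exact (Ham.cotChart_hat (hw v hv) _ _).symm
  · obtain ⟨a, b, h1, h2⟩ := exists_Icc_base_mem (g w₀)
      ((chartAt (Coord n) ((g w₀).base u)).open_source.inter h.isClosed_supp.isOpen_compl)
      ⟨mem_chart_source _ _, hu⟩
    obtain ⟨h3, h4⟩ := hg.smoothInChart fun v hv => (h2 v hv).1
    have h5 : ∀ᶠ w in 𝓝 w₀, ∀ v ∈ Icc a b, (h.act (S w) (g w)).path v = (g w).path v := by
      filter_upwards [hg.eventually_base_mem h.isClosed_supp.isOpen_compl fun v hv => (h2 v hv).2]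
        with w hw v hv
      exact Ham.hat_of_notMem (hw v hv) _ _
    refine ⟨(g w₀).base u, a, b, h1, ?_, h4.congr ?_⟩
    · filter_upwards [h3, h5] with w hw hw' v hv
      have h6 : (h.act (S w) (g w)).base v = (g w).base v := congrArg TotalSpace.proj (hw' v hv)
      rw [h6]
      exact hw v hv
    · filter_upwards [h5] with w hw v hv
      rw [hw v hv]

end SmoothFamilies

/-! ### Infinitesimal gauge transformations of families of solutions -/

section GaugeDerivatives

universe u

variable {n : ℕ} {M : Type u} [TopologicalSpace M] [ChartedSpace (Coord n) M]
  [IsManifold (𝓡 n) ∞ M] {α : PoissonStructure n M}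
  {P : Type} [NormedAddCommGroup P] [NormedSpace ℝ P]

/-- The derivative of the family `g` at `w` in the direction `v` is, at time `u` and in the chart
around `c`, the infinitesimal gauge transformation with parameter `ρ`. -/
def GaugeAt (g : P → GaussSolution α) (w v : P) (ρ : I → CotangentBundle n M) (c : M) (u : I) :
    Prop :=
  GaugeRel (α.coordCLM c) (cotChart n c ((g w).path u)) (secCoord ρ c u)
    (timeDeriv (secCoord ρ c) u) (fderiv ℝ (fun w => cotChart n c ((g w).path u)) w v)

/-- The derivative of the family `g` at `w` in the direction `v` is the infinitesimal gauge
transformation with parameter `ρ`. -/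
def IsGaugeDeriv (g : P → GaussSolution α) (w v : P) (ρ : I → CotangentBundle n M) : Prop :=
  ∀ (c : M) (u : I), (g w).base u ∈ (chartAt (Coord n) c).source → GaugeAt g w v ρ c u

variable {g : P → GaussSolution α} {w v : P} {ρ : I → CotangentBundle n M}

theorem cotChart_fst_mem {c : M} {z : CotangentBundle n M}
    (hz : z.proj ∈ (chartAt (Coord n) c).source) :
    (cotChart n c z).1 ∈ (chartAt (Coord n) c).target := by
  rw [cotChart_apply]
  exact (chartAt (Coord n) c).map_source hz

theorem GaussSolution.hasDerivWithinAt_coord (Z : GaussSolution α) {c : M} {u : I}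
    (hu : Z.base u ∈ (chartAt (Coord n) c).source) :
    HasDerivWithinAt (extend fun u => (cotChart n c (Z.path u)).1)
      (-α.coordCLM c (extend (fun u => (cotChart n c (Z.path u)).1) (u : ℝ))
        (cotChart n c (Z.path u)).2) (Icc 0 1) u := by
  rw [extend_coe]
  exact Z.gaussAt hu

/-- The transport lemma for the zero Hamiltonian, with the coordinate change as a map independent of
time. -/
theorem GaugeAt.change [T2Space M] {c c' : M} {u : I} (h : GaugeAt g w v ρ c u) (hg : SmoothAt g w)
    (hρ : IsSection (g w) ρ) (hc : (g w).base u ∈ (chartAt (Coord n) c).source)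
    (hc' : (g w).base u ∈ (chartAt (Coord n) c').source) : GaugeAt g w v ρ c' u := by
  have ha := α.isLocalPoisson c
  have hy := cotChart_fst_mem hc
  set y₀ := (cotChart n c ((g w).path u)).1 with hy₀
  have hyx : y₀ = chartAt (Coord n) c ((g w).base u) := by rw [hy₀, cotChart_apply]; rfl
  have hsy : (chartAt (Coord n) c).symm y₀ = (g w).base u := by
    rw [hyx, (chartAt (Coord n) c).left_inv hc]
  have hch : ContDiffAt ℝ ∞ (chartChange c c') y₀ := by
    rw [hyx]; exact contDiffAt_chartChange hc hc'
  have hch' : ContDiffAt ℝ ∞ (fderiv ℝ (chartChange c c')) y₀ := hch.fderiv_right (m := ∞) (by simp)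
  have hopen : ∀ᶠ z in 𝓝 y₀, z ∈ (chartAt (Coord n) c).target ∩
      (chartAt (Coord n) c).symm ⁻¹' (chartAt (Coord n) c').source :=
    ((chartAt (Coord n) c).isOpen_inter_preimage_symm (chartAt (Coord n) c').open_source).mem_nhds
      ⟨hy, by rw [mem_preimage, hsy]; exact hc'⟩
  have hjac : fderiv ℝ (chartChange c c') y₀ = jac c c' ((g w).base u) := by rw [jac, ← hyx]
  have hbase : ∀ᶠ w' in 𝓝 w, (g w').base u ∈ (chartAt (Coord n) c).source ∩
      (chartAt (Coord n) c').source := by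
    have := hg.eventually_base_mem (a := u) (b := u)
      ((chartAt (Coord n) c).open_source.inter (chartAt (Coord n) c').open_source)
      (fun v hv => by obtain rfl : v = u := le_antisymm hv.2 hv.1; exact ⟨hc, hc'⟩)
    filter_upwards [this] with w' hw' using hw' u ⟨le_rfl, le_rfl⟩
  have key := gaugeRel_transport (P := P) (E := Coord n) (Ω := (chartAt (Coord n) c).target)
    (a := α.coordCLM c) (a' := α.coordCLM c') (k := fun _ => 0)
    (Φ := fun z => chartChange c c' z.2) (J := fun z => fderiv ℝ (chartChange c c') z.2) (τ := 0)
    (s := fun _ => 0) (y := extend fun u => (cotChart n c ((g w).path u)).1)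
    (β := extend (secCoord ρ c')) (b := extend (secCoord ρ c)) (S := Icc 0 1) (u := u)
    (b' := timeDeriv (secCoord ρ c) u) (β' := timeDeriv (secCoord ρ c') u)
    (F := fun w => cotChart n c ((g w).path u)) (F' := fun w => cotChart n c' ((g w).path u))
    (w := w) (ν := v) ha (by rw [extend_coe]; exact hy) ?_ contDiff_const ?_ (fun _ => rfl) ?_ ?_ ?_
    ?_ (uniqueDiffOn_Icc_zero_one u u.2) u.2 (hasDerivWithinAt_const _ _ _)
    ((g w).hasDerivWithinAt_coord hc) (hρ.hasDerivWithinAt hc) (hρ.hasDerivWithinAt hc') ?_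
    (by rw [extend_coe]) ((hg.contDiffAt_cotChart hc).differentiableAt (by simp))
    ((hg.contDiffAt_cotChart hc').differentiableAt (by simp)) ?_ ?_ ?_
  · unfold GaugeAt
    simpa only [extend_coe] using key
  · rw [extend_coe, ← hy₀, hyx, chartChange_apply hc]
    exact ((α.contDiffOn_coordCLM c').contDiffAt ((chartAt (Coord n) c').open_target.mem_nhds
      ((chartAt (Coord n) c').map_source hc'))).differentiableAt (by simp)
  · rw [extend_coe]
    exact ContDiffAt.comp (g := chartChange c c') (f := Prod.snd) (0, y₀) hch contDiffAt_snd
  · rw [extend_coe]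
    exact ContDiffAt.comp (g := fderiv ℝ (chartChange c c')) (f := Prod.snd) (0, y₀) hch'
      contDiffAt_snd
  · rw [extend_coe, ← hy₀, hjac]
    exact fun x => ⟨jac c' c ((g w).base u) x, jac_comp_jac hc' hc x⟩
  · rw [extend_coe, ← hy₀]
    filter_upwards [hopen] with z hz q
    have h1 := α.coordCLM_change ((chartAt (Coord n) c).map_target hz.1) hz.2 q
    rw [jac, (chartAt (Coord n) c).right_inv hz.1] at h1
    exact h1.symm
  · rw [extend_coe, ← hy₀]
    refine .of_forall fun z => ?_
    have h1 : hamField (α.coordCLM c) (fun _ => 0) z = 0 := by simp [hamField]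
    rw [h1, map_zero]
    exact hasDerivAt_const (0 : ℝ) (chartChange c c' z)
  · filter_upwards [eventually_extend_mem (g w).continuous_base
      ((chartAt (Coord n) c).open_source.inter (chartAt (Coord n) c').open_source) ⟨hc, hc'⟩]
      with r hr
    simp only [extend, secCoord, cotChart_apply] at hr ⊢
    have h1 := hρ.proj_eq (projIcc 0 1 zero_le_one r)
    rw [← h1] at hr
    rw [covectorCoord_eq_comp_jac hr.1 hr.2, jac]
    rw [h1]
    rfl
  · filter_upwards [hbase] with w' hw'
    simp only [cotChart_apply]
    exact (chartChange_apply hw'.1).symm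
  · filter_upwards [hbase] with w' hw'
    rw [zero_smul, add_zero]
    simp only [cotChart_apply]
    rw [covectorCoord_eq_comp_jac (c := c) (c' := c') (x := ((g w').path u).proj) hw'.1 hw'.2]
    rfl
  · simpa only [extend_coe] using! h

/-- By covariance of the formulas, one convenient chart per time suffices: the chart of the
Hamiltonian over its support, any chart elsewhere. -/
theorem isGaugeDeriv_of_exists [T2Space M] (hg : SmoothAt g w) (hρ : IsSection (g w) ρ)
    (h : ∀ u, ∃ c : M, (g w).base u ∈ (chartAt (Coord n) c).source ∧ GaugeAt g w v ρ c u) :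
    IsGaugeDeriv g w v ρ := by
  intro c' u hu
  obtain ⟨c, hc, h'⟩ := h u
  exact h'.change hg hρ hc hu

namespace Ham

variable (h : Ham α)

/-- The covector and the translation do not influence the motion of the base point. Hence a gauge
parameter, pushed with a translation different from that of the solution, still lies over the
transformed solution. -/
theorem hat_proj_eq {z z' : CotangentBundle n M} (hz : z.proj = z'.proj) (ρ τ τ' : ℝ) :
    (h.hat ρ τ z).proj = (h.hat ρ τ' z').proj := by
  by_cases hzc : z.proj ∈ (chartAt (Coord n) h.center).source
  · have hzc' := hzc
    rw [hz] at hzc'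
    rw [hat_eq hzc, hat_eq hzc', cotChart_symm_proj (mem_cotChart_target.1 (lift_mem_target hzc _ _)),
      cotChart_symm_proj (mem_cotChart_target.1 (lift_mem_target hzc' _ _))]
    simp only [lift, cotChart_apply, hz]
  · have h1 : z.proj ∉ h.supp := fun h' => hzc (h.supp_subset h')
    rw [hat_of_notMem h1, hat_of_notMem (by rwa [← hz]), hz]

theorem hat_snd_eq_zero {z : CotangentBundle n M} (hz : z.snd = 0) (ρ : ℝ) :
    (h.hat ρ 0 z).snd = 0 := by
  by_cases hzc : z.proj ∈ (chartAt (Coord n) h.center).source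
  · have h1 := cotChart_hat hzc ρ 0
    have h2 : (cotChart n h.center z).2 = 0 := by
      rw [cotChart_apply, hz, covectorCoord_def, ContinuousLinearMap.zero_comp]
    rw [cotChart_apply] at h1
    have h3 := congrArg Prod.snd h1
    rw [lift, h2] at h3
    simp only [zero_smul, add_zero, ContinuousLinearMap.zero_comp] at h3
    rw [← covectorCoord_comp (hat_proj_mem hzc ρ 0) (h.hat ρ 0 z).snd, h3,
      ContinuousLinearMap.zero_comp]
  · rw [show h.hat ρ 0 z = z from if_neg hzc, hz]

/-- The action on gauge parameters, followed by a translation. -/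
def push (s t : TimeFun) (ρ : I → CotangentBundle n M) (u : I) : CotangentBundle n M :=
  h.hat (s.val u) (t.val u) (ρ u)

variable [T2Space M] {Z : GaussSolution α}

theorem secCoord_push (hρ : ∀ u, (ρ u).proj = Z.base u) {u : I}
    (hu : Z.base u ∈ (chartAt (Coord n) h.center).source) (s t : TimeFun) :
    secCoord (h.push s t ρ) h.center u = (lift (α.coordCLM h.center) h.fn (s.val u) (t.val u)
      ((cotChart n h.center (Z.path u)).1, secCoord ρ h.center u)).2 := by
  rw [secCoord, push, cotChart_hat (by rw [hρ]; exact hu)]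
  simp only [lift, secCoord, cotChart_apply, hρ u]
  rfl

theorem isSection_push (hρ : IsSection Z ρ) (s t : TimeFun) :
    IsSection (h.act s Z) (h.push s t ρ) := by
  refine IsSection.of_contDiffWithinAt (fun u => h.hat_proj_eq (hρ.proj_eq u) _ _ _) fun u => ?_
  by_cases hu : Z.base u ∈ h.supp
  · have hc := h.supp_subset hu
    refine ⟨h.center, hat_proj_mem hc _ _, ?_⟩
    have h0 : ContDiffWithinAt ℝ 1 (extend fun u => (cotChart n h.center (Z.path u)).1)
        (Icc 0 1) u := by
      have h1 : ContMDiffAt (𝓡∂ 1) 𝓘(ℝ, Coord n) 1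
          (fun u => chartAt (Coord n) h.center (Z.path u).proj) u := by
        have h2 : ContMDiffAt (𝓡 n) (𝓡 n) 1 (chartAt (Coord n) h.center) (Z.path u).proj :=
          contMDiffOn_chart.contMDiffAt ((chartAt (Coord n) h.center).open_source.mem_nhds hc)
        exact h2.comp u (Z.contMDiff_base u)
      simp only [cotChart_apply]
      exact contMDiffAt_iff_extend.1 h1
    have h1 : ContDiffWithinAt ℝ 1 (fun r : ℝ => lift (α.coordCLM h.center) h.fn (s.val r) (t.val r)
        (extend (fun u => (cotChart n h.center (Z.path u)).1) r, extend (secCoord ρ h.center) r))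
        (Icc 0 1) u :=
      ContDiffAt.comp_contDiffWithinAt (g := fun z : (ℝ × ℝ) × (Coord n × CoCoord n) =>
        lift (α.coordCLM h.center) h.fn z.1.1 z.1.2 z.2)
        (f := fun r : ℝ => ((s.val r, t.val r), (extend (fun u => (cotChart n h.center (Z.path u)).1) r,
          extend (secCoord ρ h.center) r))) (u : ℝ)
        ((h.isLocalHam.contDiff_lift.of_le (by simp)).contDiffAt)
        ((s.contDiff_val.contDiffWithinAt.prodMk t.contDiff_val.contDiffWithinAt).prodMk
          (h0.prodMk (hρ.contDiffWithinAt hc)))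
    have h3 : (extend (secCoord (h.push s t ρ) h.center)) =ᶠ[𝓝[Icc 0 1] (u : ℝ)] fun r =>
        (lift (α.coordCLM h.center) h.fn (s.val r) (t.val r)
        (extend (fun u => (cotChart n h.center (Z.path u)).1) r, extend (secCoord ρ h.center) r)).2 := by
      filter_upwards [eventually_extend_mem Z.continuous_base
        (chartAt (Coord n) h.center).open_source hc, self_mem_nhdsWithin] with r hr hr'
      rw [extend, h.secCoord_push hρ.proj_eq hr, projIcc_of_mem zero_le_one hr']
      simp only [extend, projIcc_of_mem zero_le_one hr']
    exact (contDiff_snd.contDiffAt.comp_contDiffWithinAt (u : ℝ) h1).congr_of_eventuallyEq h3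
      (h3.self_of_nhdsWithin u.2)
  · have hu' : (h.act s Z).base u = Z.base u := congrArg TotalSpace.proj (hat_of_notMem hu _ _)
    have hc := mem_chart_source (Coord n) (Z.base u)
    refine ⟨Z.base u, by rw [hu']; exact hc, ?_⟩
    have h3 : (extend (secCoord (h.push s t ρ) (Z.base u))) =ᶠ[𝓝[Icc 0 1] (u : ℝ)]
        extend (secCoord ρ (Z.base u)) := by
      filter_upwards [eventually_extend_mem Z.continuous_base h.isClosed_supp.isOpen_compl hu]
        with r hr
      simp only [extend, secCoord, push]
      rw [hat_of_notMem (by rw [hρ.proj_eq]; exact hr)]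
    exact (hρ.contDiffWithinAt hc).congr_of_eventuallyEq h3 (h3.self_of_nhdsWithin u.2)

theorem push_snd_eq_zero {u : I} {s t : TimeFun} (ht : t.val u = 0) (hu : (ρ u).snd = 0) :
    (h.push s t ρ u).snd = 0 := by
  rw [push, ht]
  exact h.hat_snd_eq_zero hu _

end Ham

/-- Near times at which the base point lies outside the support of the Hamiltonian, a symmetry
does not affect infinitesimal gauge transformations. -/
theorem GaugeAt.act_of_notMem [T2Space M] {h : Ham α} {S : P → TimeFun} {s t : TimeFun} {c : M}
    {u : I} (hg : SmoothAt g w) (hρ : IsSection (g w) ρ) (hu : (g w).base u ∉ h.supp)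
    (hrel : GaugeAt g w v ρ c u) :
    GaugeAt (fun w => h.act (S w) (g w)) w v (h.push s t ρ) c u := by
  have h1 : ∀ᶠ w' in 𝓝 w, (h.act (S w') (g w')).path u = (g w').path u := by
    have := hg.eventually_base_mem (a := u) (b := u) h.isClosed_supp.isOpen_compl
      (fun v hv => by obtain rfl : v = u := le_antisymm hv.2 hv.1; exact hu)
    filter_upwards [this] with w' hw'
    exact Ham.hat_of_notMem (hw' u ⟨le_rfl, le_rfl⟩) _ _
  have h3 : (secCoord (h.push s t ρ) c) =ᶠ[𝓝 u] secCoord ρ c := by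
    filter_upwards [(g w).continuous_base.continuousAt.preimage_mem_nhds
      (h.isClosed_supp.isOpen_compl.mem_nhds hu)] with r hr
    rw [secCoord, Ham.push, Ham.hat_of_notMem (by rw [hρ.proj_eq]; exact hr)]
    rfl
  have h4 : (fun w => cotChart n c ((h.act (S w) (g w)).path u)) =ᶠ[𝓝 w]
      fun w => cotChart n c ((g w).path u) := h1.mono fun w' hw' => by simp only [hw']
  have h5 : timeDeriv (secCoord (h.push s t ρ) c) u = timeDeriv (secCoord ρ c) u := by
    unfold timeDeriv
    rw [h3.mfderiv_eq]
    rfl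
  unfold GaugeAt
  rw [h1.self_of_nhds, h3.self_of_nhds, h4.fderiv_eq, h5]
  exact hrel

/-- The transport lemma for the Hamiltonian flow itself, with a time function that does not depend
on the parameter of the family. -/
theorem GaugeAt.act_const [T2Space M] {h : Ham α} {s : TimeFun} {u : I} (hg : SmoothAt g w)
    (hρ : IsSection (g w) ρ) (hu : (g w).base u ∈ (chartAt (Coord n) h.center).source)
    (hrel : GaugeAt g w v ρ h.center u) :
    GaugeAt (fun w => h.act s (g w)) w v (h.push s 0 ρ) h.center u := by
  have hH := h.isLocalHam
  have hy := cotChart_fst_mem hu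
  have hbase : ∀ᶠ w' in 𝓝 w, (g w').base u ∈ (chartAt (Coord n) h.center).source := by
    have := hg.eventually_base_mem (a := u) (b := u) (chartAt (Coord n) h.center).open_source
      (fun v hv => by obtain rfl : v = u := le_antisymm hv.2 hv.1; exact hu)
    filter_upwards [this] with w' hw' using hw' u ⟨le_rfl, le_rfl⟩
  have key := gaugeRel_transport (P := P) (E := Coord n)
    (Ω := (chartAt (Coord n) h.center).target)
    (a := α.coordCLM h.center) (a' := α.coordCLM h.center) (k := h.fn)
    (Φ := fun z => flow (hamField (α.coordCLM h.center) h.fn) z.1 z.2)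
    (J := fun z => flowDeriv (α.coordCLM h.center) h.fn z.1 z.2) (τ := s.2 u)
    (s := s.val) (y := extend fun u => (cotChart n h.center ((g w).path u)).1)
    (β := extend (secCoord (h.push s 0 ρ) h.center)) (b := extend (secCoord ρ h.center))
    (S := Icc 0 1) (u := u)
    (b' := timeDeriv (secCoord ρ h.center) u)
    (β' := timeDeriv (secCoord (h.push s 0 ρ) h.center) u)
    (F := fun w => cotChart n h.center ((g w).path u))
    (F' := fun w => cotChart n h.center ((h.act s (g w)).path u))
    (w := w) (ν := v) hH.poisson (by rw [extend_coe]; exact hy) ?_ hH.smooth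
    hH.contDiff_hamFlow.contDiffAt (fun _ => rfl) hH.contDiff_flowDeriv.contDiffAt ?_ ?_
    ?_ (uniqueDiffOn_Icc_zero_one u u.2) u.2 (s.hasDerivAt_val u).hasDerivWithinAt
    ((g w).hasDerivWithinAt_coord hu) (hρ.hasDerivWithinAt hu)
    ((h.isSection_push hρ s 0).hasDerivWithinAt (Ham.hat_proj_mem hu _ _)) ?_
    (by rw [extend_coe]) ((hg.contDiffAt_cotChart hu).differentiableAt (by simp))
    (((hg.act h contDiffAt_const).contDiffAt_cotChart
      (Ham.hat_proj_mem hu _ _)).differentiableAt (by simp)) ?_ ?_ ?_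
  · unfold GaugeAt
    simpa only [extend_coe] using key
  · rw [extend_coe]
    exact (hH.poisson.contDiffAt (hH.hamFlow_mem hy _)).differentiableAt (by simp)
  · exact fun x => ⟨_, congrArg (fun T => T x) (hH.flowDeriv_comp_neg _ _)⟩
  · rw [extend_coe]
    filter_upwards [(chartAt (Coord n) h.center).open_target.mem_nhds hy] with z hz q
    exact hH.flow_isPoisson hz _ q
  · refine .of_forall fun z => ?_
    rw [hH.flowDeriv_hamField]
    exact hH.hasDerivAt_hamFlow _ _
  · filter_upwards [eventually_extend_mem (g w).continuous_base
      (chartAt (Coord n) h.center).open_source hu, self_mem_nhdsWithin] with r hr hr'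
    rw [extend, extend, h.secCoord_push hρ.proj_eq hr, extend, projIcc_of_mem zero_le_one hr',
      hH.lift_snd_comp, TimeFun.val_zero, zero_smul, add_zero]
  · filter_upwards [hbase] with w' hw'
    rw [Ham.act_path, Ham.cotChart_hat hw']
    rfl
  · filter_upwards [hbase] with w' hw'
    rw [Ham.act_path, Ham.cotChart_hat hw', hH.lift_snd_comp]
  · simpa only [extend_coe] using! hrel

/-- The first-order action of a symmetry near the identity, needed when the time function varies
with the parameter. The three partial derivatives, in ρ, τ and the point, are computed separately.
-/
theorem hasFDerivAt_lift_zero {E : Type} [NormedAddCommGroup E] [NormedSpace ℝ E] [CompleteSpace E]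
    {Ω : Set E} {a : E → (E →L[ℝ] ℝ) →L[ℝ] E} {k : E → ℝ} (hH : IsLocalHam Ω a k)
    (y : E) (q : E →L[ℝ] ℝ) :
    ∃ D : (ℝ × ℝ) × (E × (E →L[ℝ] ℝ)) →L[ℝ] E × (E →L[ℝ] ℝ),
      HasFDerivAt (fun z : (ℝ × ℝ) × (E × (E →L[ℝ] ℝ)) => lift a k z.1.1 z.1.2 z.2) D ((0, 0), (y, q)) ∧
      ∀ ρ τ v, D ((ρ, τ), v) = v + (ρ • hamField a k y,
        τ • fderiv ℝ k y - ρ • (q ∘L fderiv ℝ (hamField a k) y)) := by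
  have hd := (hH.contDiff_lift.differentiable (by simp) ((0, 0), (y, q))).hasFDerivAt
  refine ⟨_, hd, fun ρ τ v => ?_⟩
  set D := fderiv ℝ (fun z : (ℝ × ℝ) × (E × (E →L[ℝ] ℝ)) => lift a k z.1.1 z.1.2 z.2)
    ((0, 0), (y, q))
  have h1 : D ((1, 0), 0) = (hamField a k y, -(q ∘L fderiv ℝ (hamField a k) y)) := by
    have e1 : HasDerivAt (fun r : ℝ => lift a k r 0 (y, q)) (D ((1, 0), 0)) 0 :=
      HasFDerivAt.comp_hasDerivAt (f := fun r : ℝ => ((r, (0 : ℝ)), (y, q))) 0 hd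
        (((hasDerivAt_id 0).prodMk (hasDerivAt_const 0 (0 : ℝ))).prodMk (hasDerivAt_const 0 (y, q)))
    have e2 := hH.hasDerivAt_hamFlow 0 y
    have e3 := hH.hasDerivAt_flowDeriv_sub 0 0 y
    simp only [hH.hamFlow_zero, zero_sub, neg_zero, hH.flowDeriv_zero] at e2 e3
    have e4 := (hasDerivAt_const (0 : ℝ) q).clm_comp e3
    have e5 := e2.prodMk e4
    have e6 : (fun r : ℝ => lift a k r 0 (y, q)) = fun r => (flow (hamField a k) r y,
        q ∘L flowDeriv a k (-r) (flow (hamField a k) r y)) := by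
      funext r
      simp [lift]
    rw [e6] at e1
    rw [e1.unique e5]
    refine Prod.ext rfl ?_
    ext x
    simp [hH.flowDeriv_zero, hH.hamFlow_zero]
  have h2 : D ((0, 1), 0) = (0, fderiv ℝ k y) := by
    have e1 : HasDerivAt (fun r : ℝ => lift a k 0 r (y, q)) (D ((0, 1), 0)) 0 :=
      HasFDerivAt.comp_hasDerivAt (f := fun r : ℝ => (((0 : ℝ), r), (y, q))) 0 hd
        (((hasDerivAt_const 0 (0 : ℝ)).prodMk (hasDerivAt_id 0)).prodMk (hasDerivAt_const 0 (y, q)))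
    have e6 : (fun r : ℝ => lift a k 0 r (y, q)) = fun r => (y, q + r • fderiv ℝ k y) := by
      funext r
      refine Prod.ext (hH.hamFlow_zero y) ?_
      simp only [lift, neg_zero, hH.flowDeriv_zero]
      ext x
      simp
    rw [e6] at e1
    have e2 := (hasDerivAt_const (0 : ℝ) y).prodMk
      (((hasDerivAt_id (0 : ℝ)).smul_const (fderiv ℝ k y)).const_add q)
    simpa using e1.unique e2
  have h3 : D (0, v) = v := by
    have e1 : HasFDerivAt (fun z : E × (E →L[ℝ] ℝ) => lift a k 0 0 z)
        (D ∘L ContinuousLinearMap.inr ℝ (ℝ × ℝ) _) (y, q) :=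
      HasFDerivAt.comp (g := fun z : (ℝ × ℝ) × (E × (E →L[ℝ] ℝ)) => lift a k z.1.1 z.1.2 z.2)
        (f := fun z => ((0, 0), z)) (y, q) hd (hasFDerivAt_prodMk_right _ _)
    simp only [hH.lift_zero] at e1
    exact congrArg (fun T => T v) (e1.unique (hasFDerivAt_id (y, q)))
  have h4 : (((ρ, τ), v) : (ℝ × ℝ) × (E × (E →L[ℝ] ℝ))) =
      ρ • ((1, 0), 0) + τ • ((0, 1), 0) + (0, v) := by
    simp
  rw [h4, map_add, map_add, map_smul, map_smul, h1, h2, h3]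
  refine Prod.ext ?_ ?_
  · simp [add_comm]
  · ext x
    simp
    ring

/-- A Hamiltonian with parameter-dependent time function acts at first order by the differential
of the Hamiltonian. -/
theorem GaugeAt.act_shift [T2Space M] {h : Ham α} {S : P → TimeFun} {u : I} (hg : SmoothAt g w)
    (hS : ContDiffAt ℝ ∞ S w) (hS0 : S w = 0)
    (hρ : IsSection (g w) ρ) (hu : (g w).base u ∈ (chartAt (Coord n) h.center).source)
    (hrel : GaugeAt g w v ρ h.center u) :
    GaugeAt (fun w => h.act (S w) (g w)) w v (h.push 0 (fderiv ℝ S w v) ρ) h.center u := by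
  have hH := h.isLocalHam
  have hy := cotChart_fst_mem hu
  have hbase : ∀ᶠ w' in 𝓝 w, (g w').base u ∈ (chartAt (Coord n) h.center).source := by
    have := hg.eventually_base_mem (a := u) (b := u) (chartAt (Coord n) h.center).open_source
      (fun v hv => by obtain rfl : v = u := le_antisymm hv.2 hv.1; exact hu)
    filter_upwards [this] with w' hw' using hw' u ⟨le_rfl, le_rfl⟩
  set t := fderiv ℝ S w v with ht
  set z := cotChart n h.center ((g w).path u) with hz
  have hact : h.act (S w) (g w) = g w := by rw [hS0, h.act_zero]
  have hFd := ((hg.contDiffAt_cotChart hu).differentiableAt (by simp)).hasFDerivAt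
  obtain ⟨D, hD, hD'⟩ := hasFDerivAt_lift_zero hH z.1 z.2
  have hSd : HasFDerivAt (fun w => ContinuousMap.evalCLM ℝ u (TimeFun.jetCLM (S w)))
      (ContinuousMap.evalCLM ℝ u ∘L TimeFun.jetCLM ∘L fderiv ℝ S w) w :=
    (ContinuousLinearMap.hasFDerivAt _).comp w ((ContinuousLinearMap.hasFDerivAt _).comp w
      (hS.differentiableAt (by simp)).hasFDerivAt)
  have hF' : fderiv ℝ (fun w => cotChart n h.center ((h.act (S w) (g w)).path u)) w v =
      D ((t.val u, t.2 u), fderiv ℝ (fun w => cotChart n h.center ((g w).path u)) w v) := by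
    have e1 : HasFDerivAt (fun w' => lift (α.coordCLM h.center) h.fn ((S w').val u) ((S w').2 u)
        (cotChart n h.center ((g w').path u))) _ w :=
      HasFDerivAt.comp (g := fun z : (ℝ × ℝ) × (Coord n × CoCoord n) =>
        lift (α.coordCLM h.center) h.fn z.1.1 z.1.2 z.2)
        (f := fun w' => (ContinuousMap.evalCLM ℝ u (TimeFun.jetCLM (S w')),
          cotChart n h.center ((g w').path u))) w
        (by
          have e0 : ContinuousMap.evalCLM ℝ u (TimeFun.jetCLM (S w)) = (0, 0) := by
            rw [hS0, map_zero, map_zero]; rfl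
          rw [e0]; exact hD)
        (hSd.prodMk hFd)
    have e2 : (fun w => cotChart n h.center ((h.act (S w) (g w)).path u)) =ᶠ[𝓝 w]
        fun w' => lift (α.coordCLM h.center) h.fn ((S w').val u) ((S w').2 u)
        (cotChart n h.center ((g w').path u)) := by
      filter_upwards [hbase] with w' hw'
      rw [Ham.act_path, Ham.cotChart_hat hw']
    rw [e2.fderiv_eq, e1.fderiv]
    rfl
  have hda : HasFDerivAt (α.coordCLM h.center) (fderiv ℝ (α.coordCLM h.center) z.1) z.1 :=
    hH.poisson.hasFDerivAt hy
  have hκd : HasFDerivAt (fderiv ℝ h.fn) (fderiv ℝ (fderiv ℝ h.fn) z.1) z.1 :=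
    hH.hasFDerivAt_fderiv z.1
  have hwd : HasFDerivAt (hamField (α.coordCLM h.center) h.fn)
      (-(α.coordCLM h.center z.1 ∘L fderiv ℝ (fderiv ℝ h.fn) z.1 +
      (fderiv ℝ (α.coordCLM h.center) z.1).flip (fderiv ℝ h.fn z.1))) z.1 :=
    (hda.clm_apply hκd).neg
  have hsec : ∀ r : I, (g w).base r ∈ (chartAt (Coord n) h.center).source →
      secCoord (h.push 0 t ρ) h.center r = secCoord ρ h.center r +
        t.val r • fderiv ℝ h.fn (cotChart n h.center ((g w).path r)).1 := by
    intro r hr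
    rw [h.secCoord_push hρ.proj_eq hr, TimeFun.val_zero, lift, neg_zero]
    simp only [hH.flowDeriv_zero]
    ext x
    simp
  -- The added parameter is t dk along X. Its time derivative is t' dk plus t times the Hessian
  -- applied to X' = -α η.
  have hsec' : timeDeriv (secCoord (h.push 0 t ρ) h.center) u = timeDeriv (secCoord ρ h.center) u +
      (t.2 u • fderiv ℝ h.fn z.1 -
        t.val u • fderiv ℝ (fderiv ℝ h.fn) z.1 (α.coordCLM h.center z.1 z.2)) := by
    have e1 := (g w).hasDerivWithinAt_coord hu
    have e2 : HasDerivWithinAt (fun r => fderiv ℝ h.fn (extend (fun u =>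
        (cotChart n h.center ((g w).path u)).1) r)) _ (Icc 0 1) u :=
      HasFDerivAt.comp_hasDerivWithinAt (l := fderiv ℝ h.fn) (u : ℝ)
        (by rw [extend_coe]; exact hκd) e1
    have e3 := (hρ.hasDerivWithinAt hu).add
      ((TimeFun.hasDerivAt_val t u).hasDerivWithinAt.smul e2)
    have e4 : extend (secCoord (h.push 0 t ρ) h.center) =ᶠ[𝓝[Icc 0 1] (u : ℝ)]
        (extend (secCoord ρ h.center) + t.val • fun r => fderiv ℝ h.fn (extend (fun u =>
        (cotChart n h.center ((g w).path u)).1) r)) := by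
      filter_upwards [eventually_extend_mem (g w).continuous_base
        (chartAt (Coord n) h.center).open_source hu, self_mem_nhdsWithin] with r hr hr'
      rw [extend, hsec _ hr, projIcc_of_mem zero_le_one hr']
      simp [extend, projIcc_of_mem zero_le_one hr']
    rw [timeDeriv_eq (e3.congr_of_eventuallyEq e4 (e4.self_of_nhdsWithin u.2))]
    simp only [extend_coe, map_neg, ← hz]
    rw [smul_neg]
    abel
  obtain ⟨hr1, hr2⟩ := hrel
  have hfl : ∀ (q : CoCoord n), fderiv ℝ (fun y => α.coordCLM h.center y q) z.1 =
      (fderiv ℝ (α.coordCLM h.center) z.1).flip q := fun q => by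
    rw [(hda.clm_apply (hasFDerivAt_const q z.1)).fderiv]
    simp
  unfold GaugeAt
  beta_reduce
  rw [hact, hF', hD', hsec u hu, hsec']
  refine ⟨?_, ?_⟩
  · rw [Prod.fst_add, hr1]
    simp [hamField, ← hz]
    abel
  -- The Hessian terms on both sides agree by skewness of α and symmetry of the second derivative.
  · rw [Prod.snd_add, hr2, hfl, hfl, hwd.fderiv]
    ext x
    have e1 := hH.poisson.skew z.1 hy z.2 (fderiv ℝ (fderiv ℝ h.fn) z.1 x)
    have e2 := hH.fderiv_symm z.1 x (α.coordCLM h.center z.1 z.2)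
    simp [← hz]
    simp only [e1, ← e2]
    ring

/-- The effect of a Hamiltonian with parameter-dependent time function on infinitesimal gauge
transformations of families of solutions. -/
theorem IsGaugeDeriv.act [T2Space M] {h : Ham α} {S : P → TimeFun} (hg : SmoothAt g w)
    (hS : ContDiffAt ℝ ∞ S w) (hρ : IsSection (g w) ρ) (hrel : IsGaugeDeriv g w v ρ) :
    IsGaugeDeriv (fun w => h.act (S w) (g w)) w v (h.push (S w) (fderiv ℝ S w v) ρ) := by
  have hS' : ContDiffAt ℝ ∞ (fun w' => S w' - S w) w := hS.sub contDiffAt_const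
  -- The time function is split into its value at `w` and a remainder that vanishes at `w`. The
  -- remainder is treated to first order by `GaugeAt.act_shift`, the fixed part by transport in
  -- `GaugeAt.act_const`.
  have h1 : (fun w' => h.act (S w') (g w')) = fun w' => h.act (S w) (h.act (S w' - S w) (g w')) := by
    funext w'
    rw [← h.act_add, add_sub_cancel]
  have h2 : h.push (S w) (fderiv ℝ S w v) ρ = h.push (S w) 0 (h.push 0 (fderiv ℝ S w v) ρ) := by
    funext u
    simp only [Ham.push, h.hat_add, TimeFun.val_zero, add_zero, zero_add]
  have h3 : h.act (S w - S w) (g w) = g w := by rw [sub_self, h.act_zero]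
  have h4 : fderiv ℝ (fun w' => S w' - S w) w = fderiv ℝ S w := fderiv_sub_const _
  have hg' := hg.act h hS'
  have hρ' : IsSection (h.act (S w - S w) (g w)) (h.push 0 (fderiv ℝ S w v) ρ) := by
    have := h.isSection_push hρ 0 (fderiv ℝ S w v)
    rwa [h.act_zero, ← h3] at this
  rw [h1, h2]
  refine isGaugeDeriv_of_exists (hg'.act h contDiffAt_const) (h.isSection_push hρ' _ _) fun u => ?_
  by_cases hu : (g w).base u ∈ h.supp
  · have hc := h.supp_subset hu
    have e1 := GaugeAt.act_shift hg hS' (sub_self _) hρ hc (hrel _ _ hc)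
    rw [h4] at e1
    have hc' : (h.act (S w - S w) (g w)).base u ∈ (chartAt (Coord n) h.center).source := by
      rw [h3]; exact hc
    exact ⟨h.center, Ham.hat_proj_mem hc' _ _, GaugeAt.act_const hg' hρ' hc' e1⟩
  · have hc := mem_chart_source (Coord n) ((g w).base u)
    have e1 := GaugeAt.act_of_notMem (S := fun w' => S w' - S w) (s := 0) (t := fderiv ℝ S w v)
      hg hρ hu (hrel _ _ hc)
    have hu' : (h.act (S w - S w) (g w)).base u ∉ h.supp := by rw [h3]; exact hu
    refine ⟨(g w).base u, ?_, GaugeAt.act_of_notMem (S := fun _ => S w) hg' hρ' hu' e1⟩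
    have h5 : (h.act (S w) (h.act (S w - S w) (g w))).base u = (g w).base u := by
      rw [h3]; exact congrArg TotalSpace.proj (Ham.hat_of_notMem hu _ _)
    rw [h5]
    exact hc

end GaugeDerivatives

/-! ### Compositions of Hamiltonian symmetries in a chart -/

section WordFlow

variable {n : ℕ} (a : Coord n → CoCoord n →L[ℝ] Coord n) (k : Fin n → Coord n → ℝ)

/-- The composition of the flows of the Hamiltonians `k i`, for the times `ρ i`. -/
def wordFlow : List (Fin n) → Coord n → Coord n → Coord n
  | [], _, y => y
  | i :: l, ρ, y => flow (hamField a (k i)) (ρ i) (wordFlow l ρ y)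

/-- The covector produced from zero by a composition of Hamiltonian symmetries, as a linear function
of the rates of the time functions. -/
def wordForm : List (Fin n) → Coord n → Coord n → Coord n →L[ℝ] CoCoord n
  | [], _, _ => 0
  | i :: l, ρ, y =>
    (ContinuousLinearMap.compL ℝ (Coord n) (Coord n) ℝ).flip
      (flowDeriv a (k i) (-ρ i) (flow (hamField a (k i)) (ρ i) (wordFlow a k l ρ y))) ∘L
      (wordForm l ρ y + (EuclideanSpace.proj i : Coord n →L[ℝ] ℝ).smulRight
        (fderiv ℝ (k i) (wordFlow a k l ρ y)))

variable {a k}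

theorem lift_wordFlow (i : Fin n) (l : List (Fin n)) (ρ τ y : Coord n) :
    lift a (k i) (ρ i) (τ i) (wordFlow a k l ρ y, wordForm a k l ρ y τ) =
      (wordFlow a k (i :: l) ρ y, wordForm a k (i :: l) ρ y τ) := rfl

variable {Ω : Set (Coord n)} (hk : ∀ i, IsLocalHam Ω a (k i))
include hk

theorem contDiff_wordFlow (l : List (Fin n)) :
    ContDiff ℝ ∞ (fun z : Coord n × Coord n => wordFlow a k l z.1 z.2) := by
  induction l with
  | nil => exact contDiff_snd
  | cons i l ih =>
    exact (hk i).contDiff_hamFlow.comp (g := fun z : ℝ × Coord n => flow (hamField a (k i)) z.1 z.2)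
      (f := fun z : Coord n × Coord n => (z.1 i, wordFlow a k l z.1 z.2))
      (((EuclideanSpace.proj i : Coord n →L[ℝ] ℝ).contDiff.comp contDiff_fst).prodMk ih)

theorem contDiff_wordForm (l : List (Fin n)) :
    ContDiff ℝ ∞ (fun z : Coord n × Coord n => wordForm a k l z.1 z.2) := by
  induction l with
  | nil => exact contDiff_const
  | cons i l ih =>
    have h0 : ContDiff ℝ ∞ (fun z : Coord n × Coord n => z.1 i) :=
      (EuclideanSpace.proj i : Coord n →L[ℝ] ℝ).contDiff.comp contDiff_fst
    have h1 := contDiff_wordFlow hk (i :: l)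
    have h2 : ContDiff ℝ ∞ (fun z : Coord n × Coord n => flowDeriv a (k i) (-z.1 i)
        (wordFlow a k (i :: l) z.1 z.2)) :=
      (hk i).contDiff_flowDeriv.comp (g := fun z : ℝ × Coord n => flowDeriv a (k i) z.1 z.2)
        (f := fun z : Coord n × Coord n => (-z.1 i, wordFlow a k (i :: l) z.1 z.2))
        (h0.neg.prodMk h1)
    have h3 : ContDiff ℝ ∞ (fun z : Coord n × Coord n => fderiv ℝ (k i) (wordFlow a k l z.1 z.2)) :=
      ((hk i).smooth.fderiv_right (m := ∞) (by simp)).comp (contDiff_wordFlow hk l)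
    have h4 : ContDiff ℝ ∞ (fun z : Coord n × Coord n =>
        (EuclideanSpace.proj i : Coord n →L[ℝ] ℝ).smulRight
          (fderiv ℝ (k i) (wordFlow a k l z.1 z.2))) :=
      contDiff_const.smulRight h3
    exact ((ContinuousLinearMap.compL ℝ (Coord n) (Coord n) ℝ).flip.contDiff.comp h2).clm_comp
      (ih.add h4)

theorem wordFlow_zero (l : List (Fin n)) (y : Coord n) : wordFlow a k l 0 y = y := by
  induction l with
  | nil => rfl
  | cons i l ih => 
    rw [wordFlow, ih]
    exact (hk i).hamFlow_zero y

theorem wordForm_zero (l : List (Fin n)) (y τ : Coord n) :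
    wordForm a k l 0 y τ = (l.map fun i => τ i • fderiv ℝ (k i) y).sum := by
  induction l with
  | nil => simp [wordForm]
  | cons i l ih =>
    rw [wordForm, List.map_cons, List.sum_cons, ← ih]
    have h : ((0 : Coord n) i) = 0 := rfl
    rw [h, neg_zero, (hk i).flowDeriv_zero, wordFlow_zero hk]
    ext x
    simp
    ring

end WordFlow

/-! ### Frames of Hamiltonians at a point, and their action on constant solutions -/

section HamFrames

universe u

variable {n : ℕ} {M : Type u} [TopologicalSpace M] [ChartedSpace (Coord n) M]
  [IsManifold (𝓡 n) ∞ M] 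

/-- Hamiltonians supported in the domain of the chart around `center` whose differentials at
`center` are the differentials of the coordinate functions. -/
structure HamFrame (α : PoissonStructure n M) where
  center : M
  fn : Fin n → Coord n → ℝ
  isLocalHam : ∀ i, IsLocalHam (chartAt (Coord n) center).target (α.coordCLM center) (fn i)
  fderiv_fn : ∀ i, fderiv ℝ (fn i) (chartAt (Coord n) center center) = EuclideanSpace.proj i

variable {α : PoissonStructure n M}

theorem exists_hamFrame [T2Space M] (x : M) : ∃ F : HamFrame α, F.center = x := by
  obtain ⟨χ, hχ, hχc, hχs, hχ1⟩ := exists_bump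
    ((chartAt (Coord n) x).open_target.mem_nhds
      ((chartAt (Coord n) x).map_source (mem_chart_source (Coord n) x)))
  refine ⟨⟨x, fun i y => χ y * (EuclideanSpace.proj i : Coord n →L[ℝ] ℝ) y, fun i =>
    ⟨α.isLocalPoisson x, hχ.mul (ContinuousLinearMap.contDiff _), hχc.mul_right,
      (closure_mono (Function.support_mul_subset_left _ _)).trans hχs⟩, fun i => ?_⟩, rfl⟩
  have : (fun y => χ y * (EuclideanSpace.proj i : Coord n →L[ℝ] ℝ) y) =ᶠ[
      𝓝 (chartAt (Coord n) x x)] (EuclideanSpace.proj i : Coord n →L[ℝ] ℝ) := by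
    filter_upwards [hχ1] with y hy
    rw [hy, one_mul]
  rw [this.fderiv_eq, ContinuousLinearMap.fderiv]

/-- The components of a vector valued function of time, given by its initial value and its
derivative. -/
def timeComp (i : Fin n) : GaussModel n →L[ℝ] TimeFun :=
  (EuclideanSpace.proj i : Coord n →L[ℝ] ℝ).prodMap
    (ContinuousLinearMap.compLeftContinuous ℝ I (EuclideanSpace.proj i : Coord n →L[ℝ] ℝ))

/-- The value at time `r` of the vector valued function of time with given initial value and
derivative. -/
def timeVal (S : GaussModel n) (r : ℝ) : Coord n := S.1 + prim S.2 r

theorem timeComp_val (i : Fin n) (S : GaussModel n) (r : ℝ) :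
    (timeComp i S).val r = timeVal S r i := by
  have := (EuclideanSpace.proj i : Coord n →L[ℝ] ℝ).intervalIntegral_comp_comm
    ((continuous_extend S.2).intervalIntegrable (μ := MeasureTheory.volume) 0 r)
  simp only [TimeFun.val, timeVal, PiLp.add_apply]
  exact congrArg (S.1 i + ·) this

theorem timeComp_snd (i : Fin n) (S : GaussModel n) (u : I) : (timeComp i S).2 u = S.2 u i := rfl

namespace HamFrame

variable (F : HamFrame α)

/-- The Hamiltonians of a frame. -/
def ham (i : Fin n) : Ham α := ⟨F.center, F.fn i, F.isLocalHam i⟩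

/-- The word of Hamiltonians with given vector of time functions. -/
def word (l : List (Fin n)) (S : GaussModel n) : List (Ham α × TimeFun) :=
  l.map fun i => (F.ham i, timeComp i S)

/-- The map `wordFlow` of a frame. -/
abbrev toFlow (l : List (Fin n)) : Coord n → Coord n → Coord n :=
  wordFlow (α.coordCLM F.center) F.fn l

/-- The map `wordForm` of a frame. -/
abbrev toForm (l : List (Fin n)) : Coord n → Coord n → Coord n →L[ℝ] CoCoord n :=
  wordForm (α.coordCLM F.center) F.fn l

variable [T2Space M] 

theorem base_mem (l : List (Fin n)) (S : GaussModel n) {Z : GaussSolution α} {u : I}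
    (hu : Z.base u ∈ (chartAt (Coord n) F.center).source) :
    (wordAct (F.word l S) Z).base u ∈ (chartAt (Coord n) F.center).source := by
  induction l with
  | nil => exact hu
  | cons i l ih => exact Ham.hat_proj_mem (h := F.ham i) ih _ _

theorem cotChart_wordAct (l : List (Fin n)) (S : GaussModel n) {x : M}
    (hx : x ∈ (chartAt (Coord n) F.center).source) (u : I) :
    cotChart n F.center ((wordAct (F.word l S) (GaussSolution.const α x)).path u) =
      (F.toFlow l (timeVal S u) (chartAt (Coord n) F.center x),
        F.toForm l (timeVal S u) (chartAt (Coord n) F.center x) (S.2 u)) := by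
  induction l with
  | nil =>
    show cotChart n F.center (⟨x, 0⟩ : CotangentBundle n M) = _
    rw [cotChart_apply, covectorCoord_def, ContinuousLinearMap.zero_comp]
    rfl
  | cons i l ih =>
    rw [← lift_wordFlow, ← ih, ← timeComp_val, ← timeComp_snd]
    exact Ham.cotChart_hat (h := F.ham i) (F.base_mem l S (Z := GaussSolution.const α x) hx) _ _

variable {P : Type} [NormedAddCommGroup P] [NormedSpace ℝ P] {y : P → Coord n} {S : P → GaussModel n}
  {w v : P}

theorem smoothAt_const {c : M} (hy : ContDiffAt ℝ ∞ y w) (hw : y w ∈ (chartAt (Coord n) c).target) :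
    SmoothAt (fun w => GaussSolution.const α ((chartAt (Coord n) c).symm (y w))) w := by
  have h1 : ∀ᶠ w' in 𝓝 w, y w' ∈ (chartAt (Coord n) c).target :=
    hy.continuousAt.preimage_mem_nhds ((chartAt (Coord n) c).open_target.mem_nhds hw)
  refine fun u => ⟨c, 0, 1, ?_, ?_, ?_⟩
  · have : Icc (0 : I) 1 = univ := by
      ext u; simp [unitInterval.le_one']
    rw [this]; exact Filter.univ_mem
  · exact h1.mono fun w' hw' u _ => (chartAt (Coord n) c).map_target hw'
  · refine ⟨fun w' => constCLM _ _ (y w', (0 : CoCoord n)),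
      (ContinuousLinearMap.contDiff _).contDiffAt.comp w (hy.prodMk contDiffAt_const), ?_⟩
    filter_upwards [h1] with w' hw' u
    show _ = cotChart n c (⟨(chartAt (Coord n) c).symm (y w'), 0⟩ : CotangentBundle n M)
    rw [cotChart_apply, covectorCoord_def, ContinuousLinearMap.zero_comp]
    simp [(chartAt (Coord n) c).right_inv hw']

theorem smoothAt_wordAct (l : List (Fin n)) (hy : ContDiffAt ℝ ∞ y w) (hS : ContDiffAt ℝ ∞ S w)
    (hw : y w ∈ (chartAt (Coord n) F.center).target) :
    SmoothAt (fun w => wordAct (F.word l (S w))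
      (GaussSolution.const α ((chartAt (Coord n) F.center).symm (y w)))) w := by
  induction l with
  | nil => exact smoothAt_const hy hw
  | cons i l ih =>
    exact ih.act (F.ham i) ((timeComp i).contDiff.contDiffAt.comp w hS)

/-- The derivatives of the words applied to constant solutions, along directions in which the
constant solution is stationary, are infinitesimal gauge transformations. -/
theorem exists_isGaugeDeriv (l : List (Fin n)) (hy : ContDiffAt ℝ ∞ y w) (hS : ContDiffAt ℝ ∞ S w)
    (hw : y w ∈ (chartAt (Coord n) F.center).target) (hv : fderiv ℝ y w v = 0) :
    ∃ ρ, IsSection (wordAct (F.word l (S w))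
        (GaussSolution.const α ((chartAt (Coord n) F.center).symm (y w)))) ρ ∧
      IsGaugeDeriv (fun w => wordAct (F.word l (S w))
        (GaussSolution.const α ((chartAt (Coord n) F.center).symm (y w)))) w v ρ ∧
      ∀ u, secCoord ρ F.center u = 
        F.toForm l (timeVal (S w) u) (y w) (timeVal (fderiv ℝ S w v) u) := by
  induction l with
  | nil =>
    have hsec : ∀ u, secCoord (fun u => (⟨(chartAt (Coord n) F.center).symm (y w), 0⟩ :
        CotangentBundle n M)) F.center u = 0 := fun u => by
      rw [secCoord, cotChart_apply, covectorCoord_def, ContinuousLinearMap.zero_comp]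
    have hsec' : extend (secCoord (fun u => (⟨(chartAt (Coord n) F.center).symm (y w), 0⟩ :
        CotangentBundle n M)) F.center) = fun _ => 0 := funext fun r => hsec _
    have hx := (chartAt (Coord n) F.center).map_target hw
    have hρ : IsSection (GaussSolution.const α ((chartAt (Coord n) F.center).symm (y w)))
        (fun u => (⟨(chartAt (Coord n) F.center).symm (y w), 0⟩ : CotangentBundle n M)) :=
      IsSection.of_contDiffWithinAt (fun u => rfl) fun u =>
        ⟨F.center, hx, by rw [hsec']; exact contDiffWithinAt_const⟩
    -- By `hv` the constant solution does not move to first order, so its gauge parameter is the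
    -- zero section.
    refine ⟨_, hρ, ?_, hsec⟩
    refine isGaugeDeriv_of_exists (smoothAt_const hy hw) hρ fun u => ⟨F.center, hx, ?_⟩
    have h1 : timeDeriv (secCoord (fun u => (⟨(chartAt (Coord n) F.center).symm (y w), 0⟩ :
        CotangentBundle n M)) F.center) u = 0 :=
      timeDeriv_eq (by rw [hsec']; exact hasDerivWithinAt_const _ _ _)
    have h2 : (fun w => cotChart n F.center ((GaussSolution.const α
        ((chartAt (Coord n) F.center).symm (y w))).path u)) =ᶠ[𝓝 w] fun w => (y w, (0 : CoCoord n)) := by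
      filter_upwards [hy.continuousAt.preimage_mem_nhds
        ((chartAt (Coord n) F.center).open_target.mem_nhds hw)] with w' hw'
      show cotChart n F.center (⟨(chartAt (Coord n) F.center).symm (y w'), 0⟩ : CotangentBundle n M) = _
      rw [cotChart_apply, covectorCoord_def, ContinuousLinearMap.zero_comp]
      simp [(chartAt (Coord n) F.center).right_inv hw']
    show GaugeRel _ _ _ _ (fderiv ℝ (fun w => cotChart n F.center ((GaussSolution.const α
      ((chartAt (Coord n) F.center).symm (y w))).path u)) w v)
    rw [h1, hsec, h2.fderiv_eq, ((hy.differentiableAt (by simp)).hasFDerivAt.prodMk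
      (hasFDerivAt_const (0 : CoCoord n) w)).fderiv]
    refine ⟨?_, ?_⟩
    · simp [hv]
    · simp
  | cons i l ih =>
    obtain ⟨ρ, h1, h2, h3⟩ := ih
    have hS' : ContDiffAt ℝ ∞ (fun w => timeComp i (S w)) w :=
      (timeComp i).contDiff.contDiffAt.comp w hS
    have hSd : fderiv ℝ (fun w => timeComp i (S w)) w v = timeComp i (fderiv ℝ S w v) := by
      rw [HasFDerivAt.fderiv (f := fun w => timeComp i (S w))
        ((timeComp i).hasFDerivAt.comp w (hS.differentiableAt (by simp)).hasFDerivAt)]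
      rfl
    refine ⟨_, (F.ham i).isSection_push h1 _ (timeComp i (fderiv ℝ S w v)), ?_, fun u => ?_⟩
    · rw [← hSd]
      exact IsGaugeDeriv.act (F.smoothAt_wordAct l hy hS hw) hS' h1 h2
    · have hx := (chartAt (Coord n) F.center).map_target hw
      have h4 := (F.ham i).secCoord_push h1.proj_eq (u := u) (F.base_mem l (S w)
        (Z := GaussSolution.const α ((chartAt (Coord n) F.center).symm (y w))) hx)
        (timeComp i (S w)) (timeComp i (fderiv ℝ S w v))
      refine h4.trans ?_
      rw [timeComp_val, timeComp_val]
      have h5 := F.cotChart_wordAct l (S w) hx u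
      rw [(chartAt (Coord n) F.center).right_inv hw] at h5
      have h6 : secCoord ρ (F.ham i).center u = _ := h3 u
      have h7 : cotChart n (F.ham i).center ((wordAct (F.word l (S w)) (GaussSolution.const α 
        ((chartAt (Coord n) F.center).symm (y w)))).path u) = _ := h5
      rw [h6, h7]
      rfl

end HamFrame

end HamFrames

/-! ### Solutions are determined by their covectors -/

theorem prim_eq {E : Type} [NormedAddCommGroup E] [NormedSpace ℝ E] [CompleteSpace E]
    {f : ℝ → E} {g : C(I, E)} (h : ∀ u : I, HasDerivWithinAt f (g u) (Icc 0 1) u) (u : I) :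
    prim g u = f u - f 0 := by
  have hsub : Icc (0 : ℝ) u ⊆ Icc 0 1 := Icc_subset_Icc_right u.2.2
  refine intervalIntegral.integral_eq_sub_of_hasDeriv_right ?_ (fun r hr => ?_)
    ((continuous_extend g).intervalIntegrable _ _)
  · rw [uIcc_of_le u.2.1]
    exact fun r hr => ((h ⟨r, hsub hr⟩).continuousWithinAt).mono hsub
  · rw [min_eq_left u.2.1, max_eq_right u.2.1] at hr
    have hr' : r ∈ Icc (0 : ℝ) 1 := hsub (Ioo_subset_Icc_self hr)
    rw [projIcc_of_mem zero_le_one hr']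
    exact ((h ⟨r, hr'⟩).hasDerivAt (Icc_mem_nhds hr.1 (hr.2.trans_le u.2.2))).hasDerivWithinAt

/-- Both curves run in a compact subset of `Ω`, on which the C¹ map `A` is Lipschitz, and `q` is
bounded; so uniqueness for Lipschitz equations applies. -/
theorem eqOn_of_hasDerivWithinAt {E F : Type} [NormedAddCommGroup E] [NormedSpace ℝ E]
    [NormedAddCommGroup F] [NormedSpace ℝ F] {Ω : Set E} {A : E → F →L[ℝ] E} (hΩ : IsOpen Ω)
    (hA : ContDiffOn ℝ 1 A Ω) {a b : ℝ} {q : ℝ → F} (hq : ContinuousOn q (Icc a b)) {x y : ℝ → E}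
    (hx : ∀ r ∈ Icc a b, HasDerivWithinAt x (A (x r) (q r)) (Icc a b) r)
    (hy : ∀ r ∈ Icc a b, HasDerivWithinAt y (A (y r) (q r)) (Icc a b) r)
    (hxΩ : ∀ r ∈ Icc a b, x r ∈ Ω) (hyΩ : ∀ r ∈ Icc a b, y r ∈ Ω) (h0 : x a = y a) :
    EqOn x y (Icc a b) := by
  have hxc : ContinuousOn x (Icc a b) := fun r hr => (hx r hr).continuousWithinAt
  have hyc : ContinuousOn y (Icc a b) := fun r hr => (hy r hr).continuousWithinAt
  set s := x '' Icc a b ∪ y '' Icc a b with hs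
  have hsc : IsCompact s := (isCompact_Icc.image_of_continuousOn hxc).union
    (isCompact_Icc.image_of_continuousOn hyc)
  have hsΩ : s ⊆ Ω := by
    rintro _ (⟨r, hr, rfl⟩ | ⟨r, hr, rfl⟩)
    exacts [hxΩ r hr, hyΩ r hr]
  obtain ⟨K, hK⟩ := LocallyLipschitzOn.exists_lipschitzOnWith_of_compact (f := A) hsc (by
    intro z hz
    obtain ⟨K, t, ht, hKt⟩ :=
      (hA.contDiffAt (hΩ.mem_nhds (hsΩ hz))).exists_lipschitzOnWith
    exact ⟨K, t, mem_nhdsWithin_of_mem_nhds ht, hKt⟩)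
  obtain ⟨C, hC⟩ := isCompact_Icc.exists_bound_of_continuousOn hq
  have hC' : ∀ r ∈ Icc a b, ‖q r‖ ≤ C.toNNReal := fun r hr =>
    (hC r hr).trans (Real.le_coe_toNNReal C)
  have hder : ∀ {f : ℝ → E}, (∀ r ∈ Icc a b, HasDerivWithinAt f (A (f r) (q r)) (Icc a b) r) →
      ∀ r ∈ Ico a b, HasDerivWithinAt f (A (f r) (q r)) (Ici r) r := fun hf r hr =>
    (hf r (Ico_subset_Icc_self hr)).mono_of_mem_nhdsWithin (Icc_mem_nhdsGE_of_mem hr)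
  refine ODE_solution_unique_of_mem_Icc_right (v := fun r z => A z (q r)) (s := fun _ => s)
    (K := K * C.toNNReal) (fun r hr => ?_) hxc (hder hx)
    (fun r hr => Or.inl ⟨r, Ico_subset_Icc_self hr, rfl⟩) hyc (hder hy)
    (fun r hr => Or.inr ⟨r, Ico_subset_Icc_self hr, rfl⟩) h0
  refine LipschitzOnWith.of_dist_le_mul fun z hz z' hz' => ?_
  rw [dist_eq_norm, ← sub_apply]
  refine ((A z - A z').le_opNorm _).trans ?_
  have h1 := hK.dist_le_mul z hz z' hz'
  rw [dist_eq_norm] at h1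
  calc ‖A z - A z'‖ * ‖q r‖ ≤ (K * dist z z') * C.toNNReal :=
        mul_le_mul h1 (hC' r (Ico_subset_Icc_self hr)) (norm_nonneg _) (by positivity)
    _ = _ := by push_cast; ring

section Uniqueness

universe u

variable {n : ℕ} {M : Type u} [TopologicalSpace M] [ChartedSpace (Coord n) M]
  [IsManifold (𝓡 n) ∞ M] {α : PoissonStructure n M}

theorem continuousAt_cotChart {c : M} {z : CotangentBundle n M}
    (hz : z.proj ∈ (chartAt (Coord n) c).source) : ContinuousAt (cotChart n c) z :=
  (cotChart n c).continuousAt (mem_cotChart_source.2 hz)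

/-- Once the covectors are known, the Gauss law is an ordinary differential equation for the base
path. This makes the starting point together with the covectors a complete set of coordinates. -/
theorem GaussSolution.path_eq_of_coord {Z Z' : GaussSolution α} {c : M} {a b : I}
    (hZ : ∀ u ∈ Icc a b, Z.base u ∈ (chartAt (Coord n) c).source)
    (hZ' : ∀ u ∈ Icc a b, Z'.base u ∈ (chartAt (Coord n) c).source)
    (hq : ∀ u ∈ Icc a b, (cotChart n c (Z.path u)).2 = (cotChart n c (Z'.path u)).2)
    (h0 : (cotChart n c (Z.path a)).1 = (cotChart n c (Z'.path a)).1) :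
    ∀ u ∈ Icc a b, Z.path u = Z'.path u := by
  have hmem : ∀ r ∈ Icc (a : ℝ) b, r ∈ Icc (0 : ℝ) 1 := fun r hr =>
    ⟨a.2.1.trans hr.1, hr.2.trans b.2.2⟩
  have hd : ∀ {Y : GaussSolution α},
      (∀ u ∈ Icc a b, Y.base u ∈ (chartAt (Coord n) c).source) →
      (∀ u ∈ Icc a b, (cotChart n c (Y.path u)).2 = (cotChart n c (Z.path u)).2) →
      ∀ r ∈ Icc (a : ℝ) b, HasDerivWithinAt (extend fun u => (cotChart n c (Y.path u)).1)
        ((-α.coordCLM c (extend (fun u => (cotChart n c (Y.path u)).1) r))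
          (extend (fun u => (cotChart n c (Z.path u)).2) r)) (Icc (a : ℝ) b) r := by
    intro Y hY hYq r hr
    have h1 := Y.hasDerivWithinAt_coord (c := c) (u := ⟨r, hmem r hr⟩) (hY _ hr)
    rw [hYq _ hr] at h1
    have h2 : extend (fun u => (cotChart n c (Z.path u)).2) r =
        (cotChart n c (Z.path ⟨r, hmem r hr⟩)).2 := by
      rw [extend, projIcc_of_mem zero_le_one (hmem r hr)]
    rw [h2]
    exact h1.mono hmem
  have hΩ : ∀ {Y : GaussSolution α},
      (∀ u ∈ Icc a b, Y.base u ∈ (chartAt (Coord n) c).source) → ∀ r ∈ Icc (a : ℝ) b,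
      extend (fun u => (cotChart n c (Y.path u)).1) r ∈ (chartAt (Coord n) c).target := by
    intro Y hY r hr
    rw [extend, projIcc_of_mem zero_le_one (hmem r hr)]
    exact cotChart_fst_mem (hY ⟨r, hmem r hr⟩ hr)
  have key := eqOn_of_hasDerivWithinAt (A := fun z => -α.coordCLM c z)
    (q := extend fun u => (cotChart n c (Z.path u)).2)
    (chartAt (Coord n) c).open_target ((α.contDiffOn_coordCLM c).neg.of_le (by simp)) ?_
    (hd hZ fun _ _ => rfl) (hd hZ' fun u hu => (hq u hu).symm) (hΩ hZ) (hΩ hZ')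
    (by simpa only [extend_coe] using h0)
  · intro u hu
    have h1 := key (show (u : ℝ) ∈ Icc (a : ℝ) b from hu)
    simp only [extend_coe] at h1
    exact (cotChart n c).injOn (mem_cotChart_source.2 (hZ u hu)) (mem_cotChart_source.2 (hZ' u hu))
      (Prod.ext h1 (hq u hu))
  · intro r hr
    have h1 : ContinuousAt (fun r => cotChart n c (extend Z.path r)) r :=
      ContinuousAt.comp (g := cotChart n c) (f := extend Z.path)
        (continuousAt_cotChart (by
          rw [extend, projIcc_of_mem zero_le_one (hmem r hr)]
          exact hZ ⟨r, hmem r hr⟩ hr))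
        (Z.path.continuous.comp continuous_projIcc).continuousAt
    exact h1.snd.continuousWithinAt

end Uniqueness

/-! ### Charts near constant solutions -/

/-- Identification of vectors with covectors. -/
def dualEquiv (n : ℕ) : Coord n ≃L[ℝ] CoCoord n :=
  LinearEquiv.toContinuousLinearEquiv
    { toFun := fun τ => ((List.finRange n).map fun i => τ i • EuclideanSpace.proj i).sum
      map_add' := fun τ τ' => by
        rw [← List.sum_map_add]; simp only [PiLp.add_apply, add_smul]
      map_smul' := fun a τ => by
        rw [RingHom.id_apply, List.smul_sum, List.map_map]
        congr 1
        refine List.map_congr_left fun i _ => ?_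
        simp [mul_smul]
      invFun := fun p => WithLp.toLp 2 fun i => p (EuclideanSpace.single i 1)
      left_inv := fun τ => by
        ext j
        simp [← List.ofFn_eq_map, List.sum_ofFn]
      right_inv := fun p => by
        show ((List.finRange n).map fun i => (WithLp.toLp 2 fun i => p (EuclideanSpace.single i 1) :
          Coord n) i • (EuclideanSpace.proj i : Coord n →L[ℝ] ℝ)).sum = p
        rw [← List.ofFn_eq_map, List.sum_ofFn]
        ext x
        conv_rhs => rw [← (EuclideanSpace.basisFun (Fin n) ℝ).sum_repr x, map_sum]
        simp [mul_comm] }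

/-- Post-composition of continuous functions with a linear equivalence. -/
def compEquiv {K E F : Type} [TopologicalSpace K] [CompactSpace K] [NormedAddCommGroup E]
    [NormedSpace ℝ E] [NormedAddCommGroup F] [NormedSpace ℝ F] (e : E ≃L[ℝ] F) :
    C(K, E) ≃L[ℝ] C(K, F) :=
  ContinuousLinearEquiv.equivOfInverse
    (ContinuousLinearMap.compLeftContinuous ℝ K (e : E →L[ℝ] F))
    (ContinuousLinearMap.compLeftContinuous ℝ K (e.symm : F →L[ℝ] E))
    (fun g => by ext u; exact e.symm_apply_apply _) (fun g => by ext u; exact e.apply_symm_apply _)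

section Charts

universe u

variable {n : ℕ} {M : Type u} [TopologicalSpace M] [ChartedSpace (Coord n) M]
  [IsManifold (𝓡 n) ∞ M] {α : PoissonStructure n M}

namespace HamFrame

variable (F : HamFrame α)

/-- The linear map `wordForm` of the full frame. -/
abbrev form (ρ y : Coord n) : Coord n →L[ℝ] CoCoord n := F.toForm (List.finRange n) ρ y

/-- The arguments of `form`, as functions of time. -/
def argCLM : GaussModel n →L[ℝ] C(I, (Coord n × Coord n) × Coord n) :=
  pairCLM ∘L ((pairCLM ∘L
    ((primCLM (Coord n) ∘L ContinuousLinearMap.snd ℝ _ _).prod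
      (constCLM I (Coord n) ∘L ContinuousLinearMap.fst ℝ _ _))).prod
    (ContinuousLinearMap.snd ℝ _ _))

theorem argCLM_apply (w : GaussModel n) (u : I) : argCLM w u = ((prim w.2 u, w.1), w.2 u) := rfl

/-- The starting point and the covectors of the solution obtained from the constant solution `w.1`
by the symmetries with rates `w.2`. -/
def coordMap (w : GaussModel n) : Coord n × C(I, CoCoord n) :=
  (w.1, superpose (fun z => F.form z.1.1 z.1.2 z.2) (argCLM w))

theorem contDiff_formApply :
    ContDiff ℝ ∞ (fun z : (Coord n × Coord n) × Coord n => F.form z.1.1 z.1.2 z.2) :=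
  ((contDiff_wordForm F.isLocalHam (List.finRange n)).comp contDiff_fst).clm_apply contDiff_snd

theorem coordMap_snd_apply (w : GaussModel n) (u : I) :
    (F.coordMap w).2 u = F.form (prim w.2 u) w.1 (w.2 u) :=
  superpose_apply (Ω := univ) F.contDiff_formApply.continuous.continuousOn (fun _ => mem_univ _) u

theorem contDiff_coordMap : ContDiff ℝ ∞ F.coordMap := by
  have h1 : ContDiff ℝ ∞ (superpose (fun z : (Coord n × Coord n) × Coord n =>
      F.form z.1.1 z.1.2 z.2) : C(I, _) → C(I, _)) := by
    have := contDiffOn_superpose (K := I) isOpen_univ F.contDiff_formApply.contDiffOn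
    simpa only [mem_univ, implies_true, ofPred_true, contDiffOn_univ] using this
  exact contDiff_fst.prodMk (h1.comp argCLM.contDiff)

/-- The coordinates of the centre of the frame. -/
abbrev origin : Coord n := chartAt (Coord n) F.center F.center

theorem form_origin : F.form 0 F.origin = dualEquiv n := by
  ext1 τ
  refine (wordForm_zero F.isLocalHam (List.finRange n) F.origin τ).trans ?_
  simp only [F.fderiv_fn]
  rfl

/-- The covector is `form` applied to the rate, and the rate is zero at the centre. Variations of
the coefficient `form` therefore do not contribute, and what remains is `form 0 F.origin`, which is
`dualEquiv`. -/
theorem hasFDerivAt_coordMap : HasFDerivAt F.coordMap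
    ((ContinuousLinearEquiv.refl ℝ (Coord n)).prodCongr (compEquiv (K := I) (dualEquiv n)) :
      GaussModel n →L[ℝ] Coord n × C(I, CoCoord n)) (F.origin, 0) := by
  have h1 := hasFDerivAt_superpose (K := I) isOpen_univ
    (F.contDiff_formApply.of_le (m := 1) (by simp)).contDiffOn
    (g := argCLM (F.origin, (0 : C(I, Coord n)))) (fun _ => mem_univ _)
  have h2 : HasFDerivAt F.coordMap _ (F.origin, (0 : C(I, Coord n))) :=
    hasFDerivAt_fst.prodMk (h1.comp _ argCLM.hasFDerivAt)
  convert! h2 using 1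
  refine ContinuousLinearMap.ext fun w => Prod.ext rfl (ContinuousMap.ext fun u => ?_)
  have hB := ((contDiff_wordForm F.isLocalHam (List.finRange n)).differentiable (by simp)
    ((0 : Coord n), F.origin)).hasFDerivAt
  have h3 : argCLM (F.origin, (0 : C(I, Coord n))) u = ((0, F.origin), 0) := by
    rw [argCLM_apply]
    simp [prim]
  have h4 : HasFDerivAt (fun z : (Coord n × Coord n) × Coord n => F.form z.1.1 z.1.2 z.2) _
      (((0 : Coord n), F.origin), (0 : Coord n)) :=
    HasFDerivAt.clm_apply (HasFDerivAt.comp (g := fun z : Coord n × Coord n => F.form z.1 z.2)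
      (f := Prod.fst) (((0 : Coord n), F.origin), (0 : Coord n)) hB hasFDerivAt_fst) hasFDerivAt_snd
  show dualEquiv n (w.2 u) = superpose (fderiv ℝ _) (argCLM (F.origin, 0)) u (argCLM w u)
  rw [superpose_apply (Ω := univ) ((F.contDiff_formApply.continuous_fderiv (by simp)).continuousOn)
    (fun _ => mem_univ _), h3, h4.fderiv, argCLM_apply]
  simp [F.form_origin]

/-- The parameters with values in the chart at which `coordMap` and the linear maps `form` are
invertible. -/
def regularSet : Set (GaussModel n) :=
  {w | w.1 ∈ (chartAt (Coord n) F.center).target ∧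
    fderiv ℝ F.coordMap w ∈ range
      (ContinuousLinearEquiv.toContinuousLinearMap (σ₁₂ := RingHom.id ℝ) (M₁ := GaussModel n)
        (M₂ := Coord n × C(I, CoCoord n))) ∧
    ∀ u : I, F.form (prim w.2 u) w.1 ∈ range
      (ContinuousLinearEquiv.toContinuousLinearMap (σ₁₂ := RingHom.id ℝ) (M₁ := Coord n)
        (M₂ := CoCoord n))}

theorem isOpen_regularSet : IsOpen F.regularSet := by
  refine ((chartAt (Coord n) F.center).open_target.preimage continuous_fst).inter
    ((ContinuousLinearEquiv.isOpen.preimage (F.contDiff_coordMap.continuous_fderiv (by simp))).inter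
      ?_)
  have h1 : IsOpen {z : (Coord n × Coord n) × Coord n | F.form z.1.1 z.1.2 ∈ range
      (ContinuousLinearEquiv.toContinuousLinearMap (σ₁₂ := RingHom.id ℝ) (M₁ := Coord n)
        (M₂ := CoCoord n))} :=
    ContinuousLinearEquiv.isOpen.preimage
      ((contDiff_wordForm F.isLocalHam (List.finRange n)).continuous.comp continuous_fst)
  exact (isOpen_setOf_forall_mem (K := I) h1).preimage argCLM.continuous

theorem origin_mem_regularSet : (F.origin, (0 : C(I, Coord n))) ∈ F.regularSet := by
  refine ⟨(chartAt (Coord n) F.center).map_source (mem_chart_source _ _),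
    ⟨_, F.hasFDerivAt_coordMap.fderiv.symm⟩, fun u => ⟨dualEquiv n, ?_⟩⟩
  have : prim (0 : C(I, Coord n)) u = 0 := by simp [prim]
  rw [this, F.form_origin]

/-- The local diffeomorphism defined by `coordMap`. -/
def coordHomeo : OpenPartialHomeomorph (GaussModel n) (Coord n × C(I, CoCoord n)) :=
  (ContDiffAt.toOpenPartialHomeomorph F.coordMap F.contDiff_coordMap.contDiffAt
    F.hasFDerivAt_coordMap (by simp : (∞ : WithTop ℕ∞) ≠ 0)).restrOpen F.regularSet
    F.isOpen_regularSet

theorem coordHomeo_apply (w : GaussModel n) : F.coordHomeo w = F.coordMap w := rfl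

theorem origin_mem : (F.origin, (0 : C(I, Coord n))) ∈ F.coordHomeo.source :=
  ⟨ContDiffAt.mem_toOpenPartialHomeomorph_source _ _ _, F.origin_mem_regularSet⟩

theorem mem_regularSet {w : GaussModel n} (hw : w ∈ F.coordHomeo.source) : w ∈ F.regularSet := hw.2

/-- The inverse function theorem controls the derivative at the centre only; the restriction to
`regularSet` makes it invertible at every point of the source. -/
theorem contDiffAt_coordHomeo_symm {z : Coord n × C(I, CoCoord n)} (hz : z ∈ F.coordHomeo.target) :
    ContDiffAt ℝ ∞ F.coordHomeo.symm z := by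
  obtain ⟨L, hL⟩ := (F.mem_regularSet (F.coordHomeo.map_target hz)).2.1
  refine F.coordHomeo.contDiffAt_symm (f₀' := L) hz ?_ F.contDiff_coordMap.contDiffAt
  rw [hL]
  exact (F.contDiff_coordMap.differentiable (by simp) _).hasFDerivAt

end HamFrame

end Charts

theorem fderiv_of_eval {P E F : Type} [NormedAddCommGroup P] [NormedSpace ℝ P]
    [NormedAddCommGroup E] [NormedSpace ℝ E] [NormedAddCommGroup F] [NormedSpace ℝ F]
    {f : P → E × C(I, F)} {w : P} {u : I} {g : P → F} (hf : DifferentiableAt ℝ f w)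
    (hg : (fun w => (f w).2 u) =ᶠ[𝓝 w] g) (v : P) : fderiv ℝ g w v = (fderiv ℝ f w v).2 u := by
  have h := (ContinuousMap.evalCLM ℝ u).hasFDerivAt.comp w hf.hasFDerivAt.snd
  rw [← hg.fderiv_eq, HasFDerivAt.fderiv (f := fun w => (f w).2 u) h]
  rfl

/-! ### The constant model of the gauge distribution -/

section LeafDirections

variable {n : ℕ}

/-- The starting point and the total displacement. -/
def endMap (n : ℕ) : GaussModel n →L[ℝ] Coord n × Coord n :=
  (ContinuousLinearMap.fst ℝ _ _).prod
    (ContinuousMap.evalCLM ℝ (1 : I) ∘L primCLM (Coord n) ∘L ContinuousLinearMap.snd ℝ _ _)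

theorem endMap_apply (w : GaussModel n) : endMap n w = (w.1, prim w.2 1) := rfl

/-- The model of the gauge distribution. -/
def leafDir (n : ℕ) : Submodule ℝ (GaussModel n) := (endMap n).ker

theorem mem_leafDir {w : GaussModel n} : w ∈ leafDir n ↔ w.1 = 0 ∧ prim w.2 1 = 0 := by
  rw [leafDir, LinearMap.mem_ker]
  exact Prod.ext_iff

theorem isClosed_leafDir : IsClosed (leafDir n : Set (GaussModel n)) :=
  (endMap n).isClosed_ker

theorem finrank_quotient_leafDir : Module.finrank ℝ (GaussModel n ⧸ leafDir n) = 2 * n := by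
  have hs : Function.Surjective (endMap n) := fun z =>
    ⟨(z.1, constCLM I (Coord n) z.2), by
      rw [endMap_apply]
      refine Prod.ext rfl ?_
      simp [prim]⟩
  have := LinearEquiv.finrank_eq ((endMap n).toLinearMap.quotKerEquivOfSurjective hs)
  rw [leafDir]
  refine this.trans ?_
  simp
  ring

end LeafDirections

/-! ### Charts adapted to the symmetries -/

section AdaptedCharts

universe u

variable {n : ℕ} {M : Type u} [TopologicalSpace M] [ChartedSpace (Coord n) M]
  [IsManifold (𝓡 n) ∞ M] {α : PoissonStructure n M}

theorem cotChart_snd_eq_zero {c : M} {z : CotangentBundle n M}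
    (hz : z.proj ∈ (chartAt (Coord n) c).source) : (cotChart n c z).2 = 0 ↔ z.snd = 0 := by
  rw [cotChart_apply]
  refine ⟨fun h => ?_, fun h => ?_⟩
  · rw [← covectorCoord_comp hz z.snd]
    have h' : covectorCoord n c z.proj z.snd = 0 := h
    rw [h', ContinuousLinearMap.zero_comp]
  · show covectorCoord n c z.proj z.snd = 0
    rw [h, covectorCoord_def, ContinuousLinearMap.zero_comp]

/-- Gauge parameters: sections vanishing at both ends. -/
structure IsEndSection (Z : GaussSolution α) (ρ : I → CotangentBundle n M) : Prop
    extends IsSection Z ρ where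
  zero_left : (ρ 0).snd = 0
  zero_right : (ρ 1).snd = 0

/-- The charts of `𝒞` built from Hamiltonian symmetries. -/
structure IsAdapted [T2Space M] (e : OpenPartialHomeomorph (GaussSolution α) (GaussModel n)) :
    Prop where
  smoothAt_symm : ∀ w ∈ e.target, SmoothAt e.symm w
  contDiffAt_comp : ∀ {P : Type} [NormedAddCommGroup P] [NormedSpace ℝ P]
    {g : P → GaussSolution α} {w : P}, SmoothAt g w → g w ∈ e.source →
    ContDiffAt ℝ ∞ (fun w => e (g w)) w
  unique : ∀ w ∈ e.target, ∀ (v v' : GaussModel n) (ρ : I → CotangentBundle n M),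
    IsSection (e.symm w) ρ → IsGaugeDeriv e.symm w v ρ → IsGaugeDeriv e.symm w v' ρ → v = v'
  exists_dir : ∀ w ∈ e.target, ∀ ρ : I → CotangentBundle n M, IsEndSection (e.symm w) ρ →
    ∃ v ∈ leafDir n, IsGaugeDeriv e.symm w v ρ
  exists_section : ∀ w ∈ e.target, ∀ v ∈ leafDir n,
    ∃ ρ, IsEndSection (e.symm w) ρ ∧ IsGaugeDeriv e.symm w v ρ
  symm_eq : ∃ (F : HamFrame α) (l : List (Ham α × TimeFun)), ∀ w ∈ e.target,
    w.1 ∈ (chartAt (Coord n) F.center).target ∧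
    e.symm w = wordAct l (wordAct (F.word (List.finRange n) (0, w.2))
      (GaussSolution.const α ((chartAt (Coord n) F.center).symm w.1)))

variable [T2Space M]

open Classical in
/-- The coordinates of the starting point and of the covectors of a solution in the domain of a
chart. -/
def coordRead (c : M) (Z : GaussSolution α) : Coord n × C(I, CoCoord n) :=
  if h : ∀ u, Z.base u ∈ (chartAt (Coord n) c).source then
    ((cotChart n c (Z.path 0)).1, ⟨fun u => (cotChart n c (Z.path u)).2,
      continuous_iff_continuousAt.2 fun u => (ContinuousAt.comp (g := cotChart n c) (f := Z.path)
        (continuousAt_cotChart (h u)) Z.path.continuous.continuousAt).snd⟩)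
  else 0

theorem coordRead_fst {c : M} {Z : GaussSolution α}
    (h : ∀ u, Z.base u ∈ (chartAt (Coord n) c).source) :
    (coordRead c Z).1 = (cotChart n c (Z.path 0)).1 := by
  rw [coordRead, dif_pos h]

theorem coordRead_snd {c : M} {Z : GaussSolution α}
    (h : ∀ u, Z.base u ∈ (chartAt (Coord n) c).source) (u : I) :
    (coordRead c Z).2 u = (cotChart n c (Z.path u)).2 := by
  rw [coordRead, dif_pos h]
  rfl

theorem isOpen_forall_base_mem_univ {U : Set M} (hU : IsOpen U) :
    IsOpen {Z : GaussSolution α | ∀ u, Z.base u ∈ U} := by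
  simpa using isOpen_forall_base_mem (α := α) hU isCompact_univ

theorem continuousOn_coordRead (c : M) : ContinuousOn (coordRead (α := α) c)
    {Z | ∀ u, Z.base u ∈ (chartAt (Coord n) c).source} := by
  rw [continuousOn_iff_continuous_domRestrict]
  have h1 : Continuous fun q : {Z : GaussSolution α // ∀ u, Z.base u ∈
      (chartAt (Coord n) c).source} × I => cotChart n c (q.1.1.path q.2) :=
    continuous_iff_continuousAt.2 fun q => ContinuousAt.comp (g := cotChart n c)
      (f := fun q : {Z : GaussSolution α // ∀ u, Z.base u ∈
        (chartAt (Coord n) c).source} × I => q.1.1.path q.2)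
      (continuousAt_cotChart (q.1.2 q.2)) (GaussSolution.continuous_eval.comp
        ((continuous_subtype_val.comp continuous_fst).prodMk continuous_snd)).continuousAt
  refine continuous_prodMk.2 ⟨?_, ContinuousMap.continuous_of_continuous_uncurry _ ?_⟩
  · have h2 : Continuous fun Z : {Z : GaussSolution α // ∀ u, Z.base u ∈
        (chartAt (Coord n) c).source} => (cotChart n c (Z.1.path 0)).1 :=
      (h1.comp (continuous_id.prodMk continuous_const)).fst
    exact h2.congr fun Z => (coordRead_fst Z.2).symm
  · exact h1.snd.congr fun q => (coordRead_snd q.1.2 q.2).symm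

theorem SmoothAt.contDiffAt_coordRead {P : Type} [NormedAddCommGroup P] [NormedSpace ℝ P]
    {g : P → GaussSolution α} {w : P} (hg : SmoothAt g w) {c : M}
    (h : ∀ u, (g w).base u ∈ (chartAt (Coord n) c).source) :
    ContDiffAt ℝ ∞ (fun w => coordRead c (g w)) w := by
  obtain ⟨h1, h2⟩ := hg.smoothInChart (a := 0) (b := 1) fun u _ => h u
  obtain ⟨G, hG, hG'⟩ := h2.exists_contDiffAt
  have h3 : ContDiffAt ℝ ∞ (fun w => ((ContinuousLinearMap.fst ℝ _ _ ∘L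
      ContinuousMap.evalCLM ℝ (0 : I)) (G w), (ContinuousLinearMap.compLeftContinuous ℝ I
        (ContinuousLinearMap.snd ℝ (Coord n) (CoCoord n))) (G w))) w :=
    ((ContinuousLinearMap.contDiff _).contDiffAt.comp w hG).prodMk
      ((ContinuousLinearMap.contDiff _).contDiffAt.comp w hG)
  refine h3.congr_of_eventuallyEq ?_
  filter_upwards [h1, hG'] with w' hw hw'
  have hw1 : ∀ u, (g w').base u ∈ (chartAt (Coord n) c).source := fun u =>
    hw u ⟨unitInterval.nonneg', unitInterval.le_one'⟩
  refine Prod.ext ?_ (ContinuousMap.ext fun u => ?_)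
  · rw [coordRead_fst hw1, ← hw']
    rfl
  · rw [coordRead_snd hw1, ← hw']
    rfl

namespace HamFrame

variable (F : HamFrame α)

/-- The solution obtained from the constant solution `w.1` by the symmetries with rates `w.2`. -/
def sol (w : GaussModel n) : GaussSolution α :=
  wordAct (F.word (List.finRange n) (0, w.2))
    (GaussSolution.const α ((chartAt (Coord n) F.center).symm w.1))

variable {F} {w : GaussModel n}

theorem sol_base_mem (hw : w.1 ∈ (chartAt (Coord n) F.center).target) (u : I) :
    (F.sol w).base u ∈ (chartAt (Coord n) F.center).source :=
  F.base_mem _ _ (Z := GaussSolution.const α _) ((chartAt (Coord n) F.center).map_target hw)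

theorem timeVal_zero_fst (p : C(I, Coord n)) (r : ℝ) : timeVal ((0 : Coord n), p) r = prim p r :=
  zero_add _

theorem cotChart_sol (hw : w.1 ∈ (chartAt (Coord n) F.center).target) (u : I) :
    cotChart n F.center ((F.sol w).path u) = (F.toFlow (List.finRange n) (prim w.2 u) w.1,
      F.form (prim w.2 u) w.1 (w.2 u)) := by
  have h := F.cotChart_wordAct (List.finRange n) (0, w.2)
    ((chartAt (Coord n) F.center).map_target hw) u
  rwa [(chartAt (Coord n) F.center).right_inv hw, timeVal_zero_fst] at h

theorem coordRead_sol (hw : w.1 ∈ (chartAt (Coord n) F.center).target) :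
    coordRead F.center (F.sol w) = F.coordMap w := by
  refine Prod.ext ?_ (ContinuousMap.ext fun u => ?_)
  · rw [coordRead_fst (sol_base_mem hw), cotChart_sol hw]
    have : prim w.2 ((0 : I) : ℝ) = 0 := prim_zero_right _
    rw [this]
    exact wordFlow_zero F.isLocalHam _ _
  · rw [coordRead_snd (sol_base_mem hw), cotChart_sol hw, F.coordMap_snd_apply]

theorem smoothAt_sol (hw : w.1 ∈ (chartAt (Coord n) F.center).target) : SmoothAt F.sol w :=
  F.smoothAt_wordAct (S := fun w : GaussModel n => (0, w.2)) (List.finRange n)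
    contDiffAt_fst (contDiffAt_const.prodMk contDiffAt_snd) hw

variable (F) in
/-- The chart of `𝒞` near a constant solution. -/
def chart : OpenPartialHomeomorph (GaussSolution α) (GaussModel n) where
  toFun Z := F.coordHomeo.symm (coordRead F.center Z)
  invFun := F.sol
  source := {Z | ∀ u, Z.base u ∈ (chartAt (Coord n) F.center).source} ∩
    coordRead F.center ⁻¹' F.coordHomeo.target
  target := F.coordHomeo.source
  map_source' Z hZ := F.coordHomeo.map_target hZ.2
  map_target' w hw := by
    have h1 := (F.mem_regularSet hw).1
    refine ⟨sol_base_mem h1, ?_⟩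
    rw [mem_preimage, coordRead_sol h1]
    exact F.coordHomeo.map_source hw
  -- The solution built from the chart value has the starting point and the covectors of `Z`, and
  -- these determine it.
  left_inv' Z hZ := by
    set w := F.coordHomeo.symm (coordRead F.center Z) with hw
    have h1 : F.coordMap w = coordRead F.center Z := F.coordHomeo.right_inv hZ.2
    have h2 := (F.mem_regularSet (F.coordHomeo.map_target hZ.2)).1
    rw [← coordRead_sol h2] at h1
    refine GaussSolution.ext fun u => GaussSolution.path_eq_of_coord (c := F.center) (a := 0)
      (b := 1) (fun u _ => sol_base_mem h2 u) (fun u _ => hZ.1 u) (fun u _ => ?_) ?_ u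
      ⟨unitInterval.nonneg', unitInterval.le_one'⟩
    · rw [← coordRead_snd (sol_base_mem h2), ← coordRead_snd hZ.1, h1]
    · rw [← coordRead_fst (sol_base_mem h2), ← coordRead_fst hZ.1, h1]
  right_inv' w hw := by
    rw [coordRead_sol (F.mem_regularSet hw).1]
    exact F.coordHomeo.left_inv hw
  open_source := (continuousOn_coordRead F.center).isOpen_inter_preimage
    (isOpen_forall_base_mem_univ (chartAt (Coord n) F.center).open_source) F.coordHomeo.open_target
  open_target := F.coordHomeo.open_source
  continuousOn_toFun := F.coordHomeo.continuousOn_symm.comp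
    ((continuousOn_coordRead F.center).mono inter_subset_left) fun Z hZ => hZ.2
  continuousOn_invFun w hw :=
    (smoothAt_sol (F.mem_regularSet hw).1).continuousAt.continuousWithinAt

variable (F) in
theorem const_mem_chart_source : GaussSolution.const α F.center ∈ F.chart.source := by
  have h := F.chart.map_target (x := (F.origin, (0 : C(I, Coord n)))) F.origin_mem
  have h1 : F.chart.symm (F.origin, (0 : C(I, Coord n))) = GaussSolution.const α F.center := by
    have h0 : F.origin ∈ (chartAt (Coord n) F.center).target :=
      (chartAt (Coord n) F.center).map_source (mem_chart_source _ _)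
    have hc : F.center ∈ (chartAt (Coord n) F.center).source := mem_chart_source _ _
    refine GaussSolution.ext fun u => (cotChart n F.center).injOn
      (mem_cotChart_source.2 (sol_base_mem h0 u))
      ((mem_cotChart_source (z := (GaussSolution.const α F.center).path u)).2 hc) ?_
    refine (cotChart_sol h0 u).trans ?_
    have h2 : prim (0 : C(I, Coord n)) u = 0 := by simp [prim]
    show _ = cotChart n F.center (⟨F.center, 0⟩ : CotangentBundle n M)
    rw [cotChart_apply, h2, covectorCoord_def, ContinuousLinearMap.zero_comp]
    exact Prod.ext (wordFlow_zero F.isLocalHam _ _) (map_zero _)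
  rwa [h1] at h

/-- Varying the rates by `v.2` varies the time functions by `prim v.2`, so the gauge parameter is a
linear image of `prim v.2 u`. It is zero at `u = 0`, and the condition defining `leafDir` makes it
zero at `u = 1`. -/
theorem exists_section (hw : w.1 ∈ (chartAt (Coord n) F.center).target) {v : GaussModel n}
    (hv : v ∈ leafDir n) : ∃ ρ, IsEndSection (F.sol w) ρ ∧ IsGaugeDeriv F.sol w v ρ ∧
      ∀ u, secCoord ρ F.center u = F.form (prim w.2 u) w.1 (prim v.2 u) := by
  obtain ⟨hv1, hv2⟩ := mem_leafDir.1 hv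
  obtain ⟨ρ, h1, h2, h3⟩ := F.exists_isGaugeDeriv (S := fun w : GaussModel n => (0, w.2)) (w := w)
    (v := v) (List.finRange n) contDiffAt_fst (contDiffAt_const.prodMk contDiffAt_snd) hw
    (by rw [fderiv_fst]; exact hv1)
  have hd : fderiv ℝ (fun w : GaussModel n => ((0 : Coord n), w.2)) w v = (0, v.2) := by
    rw [((hasFDerivAt_const (0 : Coord n) w).prodMk hasFDerivAt_snd).fderiv]
    rfl
  simp only [hd, timeVal_zero_fst] at h3
  have hz : ∀ u : I, prim v.2 u = 0 → (ρ u).snd = 0 := fun u hu => by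
    have h4 : (ρ u).proj ∈ (chartAt (Coord n) F.center).source := by
      rw [h1.proj_eq]; exact sol_base_mem hw u
    refine (cotChart_snd_eq_zero h4).1 ((h3 u).trans ?_)
    rw [hu, map_zero]
  exact ⟨ρ, ⟨h1, hz 0 (prim_zero_right _), hz 1 hv2⟩, h2, h3⟩

/-- On the regular set the linear maps `form` can be inverted along the whole path. The preimage `f`
of the gauge parameter is C¹ and vanishes at both ends, so its derivative has integral zero and is
the required direction. -/
theorem exists_dir (hw : w ∈ F.regularSet) {ρ : I → CotangentBundle n M}
    (hρ : IsEndSection (F.sol w) ρ) : ∃ v ∈ leafDir n, IsGaugeDeriv F.sol w v ρ := by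
  set B : ℝ → Coord n →L[ℝ] CoCoord n := fun r => F.form (prim w.2 r) w.1 with hB
  have hBc : ContDiff ℝ 1 B := ((contDiff_wordForm F.isLocalHam (List.finRange n)).of_le
    (m := 1) (by simp)).comp ((contDiff_prim w.2).prodMk contDiff_const)
  set f : ℝ → Coord n := fun r => (B r).inverse (extend (secCoord ρ F.center) r) with hf
  have hfc : ContDiffOn ℝ 1 f (Icc 0 1) := by
    intro r hr
    obtain ⟨L, hL⟩ := hw.2.2 ⟨r, hr⟩
    have h1 : ContDiffAt ℝ 1 (fun r => (B r).inverse) r := by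
      refine ContDiffAt.comp (g := ContinuousLinearMap.inverse) (f := B) r ?_ hBc.contDiffAt
      have hL' : B r = L := hL.symm
      rw [hL']
      exact contDiffAt_map_inverse L
    exact h1.contDiffWithinAt.clm_apply (hρ.contDiffWithinAt (u := ⟨r, hr⟩) (sol_base_mem hw.1 _))
  have hBf : ∀ u : I, B u (f u) = secCoord ρ F.center u := fun u => by
    obtain ⟨L, hL⟩ := hw.2.2 u
    have hL' : B u = L := hL.symm
    simp only [hf, hL', ContinuousLinearMap.inverse_equiv, extend_coe]
    exact L.apply_symm_apply _
  have hf0 : ∀ u : I, (ρ u).snd = 0 → f u = 0 := fun u hu => by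
    have h1 : secCoord ρ F.center u = 0 := (cotChart_snd_eq_zero (c := F.center) (by
      rw [hρ.proj_eq]; exact sol_base_mem hw.1 u)).2 hu
    simp only [hf, extend_coe, h1, map_zero]
  let p : C(I, Coord n) := ⟨fun u => derivWithin f (Icc 0 1) u,
    (hfc.continuousOn_derivWithin uniqueDiffOn_Icc_zero_one (by simp)).comp_continuous
      continuous_subtype_val fun u => u.2⟩
  have hp : ∀ u : I, prim p u = f u := fun u => by
    rw [prim_eq (f := f) (fun u => ((hfc u u.2).differentiableWithinAt (by simp)).hasDerivWithinAt)]
    have h1 : f ((0 : I) : ℝ) = 0 := hf0 0 hρ.zero_left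
    have h2 : f 0 = 0 := h1
    rw [h2, sub_zero]
  have hv : ((0 : Coord n), p) ∈ leafDir n :=
    mem_leafDir.2 ⟨rfl, (hp 1).trans (hf0 1 hρ.zero_right)⟩
  obtain ⟨ρ', h1, h2, h3⟩ := exists_section hw.1 hv
  refine ⟨_, hv, ?_⟩
  have : ρ' = ρ := by
    funext u
    have hm := sol_base_mem hw.1 u
    refine (cotChart n F.center).injOn (mem_cotChart_source.2 (by rw [h1.proj_eq]; exact hm))
      (mem_cotChart_source.2 (by rw [hρ.proj_eq]; exact hm)) (Prod.ext ?_ ?_)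
    · rw [cotChart_apply, cotChart_apply]
      show chartAt (Coord n) F.center _ = chartAt (Coord n) F.center _
      rw [h1.proj_eq, hρ.proj_eq]
    · refine (h3 u).trans (Eq.trans ?_ (hBf u))
      rw [hp]
  rwa [← this]

/-- The gauge formulas prescribe the derivatives of all coordinates of the solution, hence the
derivative of `coordMap` in the given direction, and this derivative is injective on the regular
set. -/
theorem isGaugeDeriv_unique (hw : w ∈ F.regularSet) {v v' : GaussModel n}
    {ρ : I → CotangentBundle n M} (h : IsGaugeDeriv F.sol w v ρ) (h' : IsGaugeDeriv F.sol w v' ρ) :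
    v = v' := by
  obtain ⟨L, hL⟩ := hw.2.1
  have hev : ∀ᶠ w' in 𝓝 w, w'.1 ∈ (chartAt (Coord n) F.center).target :=
    ((chartAt (Coord n) F.center).open_target.preimage continuous_fst).mem_nhds hw.1
  have hR : HasFDerivAt F.coordMap (fderiv ℝ F.coordMap w) w :=
    (F.contDiff_coordMap.differentiable (by simp) w).hasFDerivAt
  have key : ∀ u, fderiv ℝ (fun w => cotChart n F.center ((F.sol w).path u)) w v =
      fderiv ℝ (fun w => cotChart n F.center ((F.sol w).path u)) w v' := fun u => by
    have h1 := h F.center u (sol_base_mem hw.1 u)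
    have h2 := h' F.center u (sol_base_mem hw.1 u)
    exact Prod.ext (h1.1.trans h2.1.symm) (h1.2.trans h2.2.symm)
  have hd : ∀ u, HasFDerivAt (fun w => cotChart n F.center ((F.sol w).path u)) _ w := fun u =>
    (((smoothAt_sol hw.1).contDiffAt_cotChart (sol_base_mem hw.1 u)).differentiableAt
      (by simp)).hasFDerivAt
  have h1 : (fderiv ℝ F.coordMap w v).1 = (fderiv ℝ F.coordMap w v').1 := by
    have e1 := ((hd 0).fst.congr_of_eventuallyEq (f₁ := fun w => (F.coordMap w).1) (by
      filter_upwards [hev] with w' hw'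
      rw [← coordRead_sol hw', coordRead_fst (sol_base_mem hw')])).unique hR.fst
    have e2 := DFunLike.congr_fun e1 v
    have e3 := DFunLike.congr_fun e1 v'
    refine e2.symm.trans (Eq.trans ?_ e3)
    exact congrArg Prod.fst (key 0)
  have h2 : (fderiv ℝ F.coordMap w v).2 = (fderiv ℝ F.coordMap w v').2 := by
    refine ContinuousMap.ext fun u => ?_
    have e0 : (fun w => (F.coordMap w).2 u) =ᶠ[𝓝 w]
        fun w => (cotChart n F.center ((F.sol w).path u)).2 := by
      filter_upwards [hev] with w' hw'
      rw [← coordRead_sol hw', coordRead_snd (sol_base_mem hw')]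
    have e1 : ∀ x, _ = (fderiv ℝ F.coordMap w x).2 u := fderiv_of_eval hR.differentiableAt e0
    rw [← e1, ← e1, (hd u).snd.fderiv]
    exact congrArg Prod.snd (key u)
  have h3 := Prod.ext h1 h2
  rw [← hL] at h3
  exact L.injective h3

theorem isAdapted_chart : IsAdapted F.chart where
  smoothAt_symm w hw := smoothAt_sol (F.mem_regularSet hw).1
  contDiffAt_comp {_ _ _ g w} hg hs := ContDiffAt.comp (g := F.coordHomeo.symm)
    (f := fun w => coordRead F.center (g w)) w (F.contDiffAt_coordHomeo_symm hs.2)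
    (hg.contDiffAt_coordRead hs.1)
  unique w hw _ _ _ _ h h' := isGaugeDeriv_unique (F.mem_regularSet hw) h h'
  exists_dir w hw _ hρ := exists_dir (F.mem_regularSet hw) hρ
  exists_section w hw v hv := by
    obtain ⟨ρ, h1, h2, -⟩ := HamFrame.exists_section (F.mem_regularSet hw).1 hv
    exact ⟨ρ, h1, h2⟩
  symm_eq := ⟨F, [], fun w hw => ⟨(F.mem_regularSet hw).1, rfl⟩⟩

end HamFrame

namespace Ham

variable {h : Ham α}

theorem push_push (s t s' t' : TimeFun) (ρ : I → CotangentBundle n M) :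
    h.push s t (h.push s' t' ρ) = h.push (s + s') (t + t') ρ := by
  funext u
  simp only [push, hat_add, TimeFun.val_add]

theorem push_zero (ρ : I → CotangentBundle n M) : h.push 0 0 ρ = ρ := by
  funext u
  simp only [push, TimeFun.val_zero]
  exact h.hat_zero _

theorem isEndSection_push {Z : GaussSolution α} {ρ : I → CotangentBundle n M}
    (hρ : IsEndSection Z ρ) (s : TimeFun) : IsEndSection (h.act s Z) (h.push s 0 ρ) :=
  ⟨h.isSection_push hρ.toIsSection s 0, h.push_snd_eq_zero (TimeFun.val_zero _) hρ.zero_left,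
    h.push_snd_eq_zero (TimeFun.val_zero _) hρ.zero_right⟩

end Ham

theorem IsGaugeDeriv.act_const {P : Type} [NormedAddCommGroup P] [NormedSpace ℝ P]
    {g : P → GaussSolution α} {w v : P} {ρ : I → CotangentBundle n M} {h : Ham α} (s : TimeFun)
    (hg : SmoothAt g w) (hρ : IsSection (g w) ρ) (hrel : IsGaugeDeriv g w v ρ) :
    IsGaugeDeriv (fun w => h.act s (g w)) w v (h.push s 0 ρ) := by
  have := hrel.act (h := h) (S := fun _ => s) hg contDiffAt_const hρ
  rwa [fderiv_fun_const] at this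

/-- Translating a chart by a symmetry leaves directions in the model space unchanged, while gauge
parameters are carried along by `push`. This is invertible and preserves vanishing at the ends, so
every property is reduced to the old chart. -/
theorem IsAdapted.act {e : OpenPartialHomeomorph (GaussSolution α) (GaussModel n)}
    (he : IsAdapted e) (h : Ham α) (s : TimeFun) :
    IsAdapted ((h.actHomeo s).symm.transOpenPartialHomeomorph e) where
  smoothAt_symm w hw := (he.smoothAt_symm w hw).act h contDiffAt_const
  contDiffAt_comp hg hs := he.contDiffAt_comp (hg.act h contDiffAt_const) hs
  unique w hw v v' ρ hρ hv hv' := by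
    have hsm : SmoothAt (fun w => h.act s (e.symm w)) w :=
      (he.smoothAt_symm w hw).act h contDiffAt_const
    have e1 : (fun w => h.act (-s) (h.act s (e.symm w))) = e.symm := by
      funext w
      rw [← h.act_add, neg_add_cancel, h.act_zero]
    have h1 := IsGaugeDeriv.act_const (h := h) (-s) hsm hρ hv
    have h2 := IsGaugeDeriv.act_const (h := h) (-s) hsm hρ hv'
    have h3 := h.isSection_push hρ (-s) 0
    rw [e1] at h1 h2
    have e2 : h.act (-s) (((h.actHomeo s).symm.transOpenPartialHomeomorph e).symm w) = e.symm w :=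
      congrFun e1 w
    rw [e2] at h3
    exact he.unique w hw _ _ _ h3 h1 h2
  exists_dir w hw ρ hρ := by
    have e1 : h.act (-s) (((h.actHomeo s).symm.transOpenPartialHomeomorph e).symm w) = e.symm w := by
      show h.act (-s) (h.act s (e.symm w)) = _
      rw [← h.act_add, neg_add_cancel, h.act_zero]
    have h1 := h.isEndSection_push hρ (-s)
    rw [e1] at h1
    obtain ⟨v, hv, hv'⟩ := he.exists_dir w hw _ h1
    have h2 := IsGaugeDeriv.act_const (h := h) s (he.smoothAt_symm w hw) h1.toIsSection hv'
    rw [h.push_push, add_neg_cancel, add_zero, h.push_zero] at h2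
    exact ⟨v, hv, h2⟩
  exists_section w hw v hv := by
    obtain ⟨ρ, h1, h2⟩ := he.exists_section w hw v hv
    exact ⟨_, h.isEndSection_push h1 s,
      IsGaugeDeriv.act_const s (he.smoothAt_symm w hw) h1.toIsSection h2⟩
  symm_eq := by
    obtain ⟨F, l, hl⟩ := he.symm_eq
    refine ⟨F, (h, s) :: l, fun w hw => ⟨(hl w hw).1, ?_⟩⟩
    exact congrArg (h.act s) (hl w hw).2

theorem IsAdapted.wordAct {e : OpenPartialHomeomorph (GaussSolution α) (GaussModel n)}
    (he : IsAdapted e) (l : List (Ham α × TimeFun)) :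
    ∃ e' : OpenPartialHomeomorph (GaussSolution α) (GaussModel n), IsAdapted e' ∧
      ∀ Z ∈ e.source, wordAct l Z ∈ e'.source := by
  induction l with
  | nil => exact ⟨e, he, fun Z hZ => hZ⟩
  | cons a l ih =>
    obtain ⟨e', h1, h2⟩ := ih
    refine ⟨_, h1.act a.1 a.2, fun Z hZ => ?_⟩
    show a.1.act (-a.2) (a.1.act a.2 _) ∈ e'.source
    rw [← a.1.act_add, neg_add_cancel, a.1.act_zero]
    exact h2 Z hZ

end AdaptedCharts

/-! ### Every solution is obtained from a constant solution by Hamiltonian symmetries -/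

/-- A change of time which is the identity before `a` and stays in `[a, b]` afterwards. -/
theorem exists_timeChange {a b : ℝ} (hab : a < b) : ∃ k k' : ℝ → ℝ, Continuous k' ∧
    (∀ r, HasDerivAt k (k' r) r) ∧ (∀ r ≤ a, k r = r ∧ k' r = 1) ∧ ∀ r, a ≤ r → k r ∈ Icc a b := by
  set δ := b - a with hδ
  have hδ0 : 0 < δ := sub_pos.2 hab
  have hpos : ∀ r, 0 < δ + max (r - a) 0 := fun r => by positivity
  -- The speed is 1 up to `a` and then decays so that its integral from `a` to `r` is
  -- δ(r-a)/(δ+r-a), which stays below δ = b - a.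
  set g : ℝ → ℝ := fun r => δ ^ 2 / (δ + max (r - a) 0) ^ 2 with hg
  have hgc : Continuous g := continuous_const.div (by fun_prop) fun r => (pow_pos (hpos r) 2).ne'
  refine ⟨fun r => a + ∫ t in a..r, g t, g, hgc, fun r =>
    (hgc.integral_hasStrictDerivAt a r).hasDerivAt.const_add a, fun r hr => ⟨?_, ?_⟩, fun r hr => ?_⟩
  · have h1 : ∫ t in a..r, g t = ∫ t in a..r, (1 : ℝ) := by
      refine intervalIntegral.integral_congr fun t ht => ?_
      rw [uIcc_of_ge hr] at ht
      simp only [hg, max_eq_right (sub_nonpos.2 ht.2), add_zero]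
      exact div_self (by positivity)
    simp [h1]
  · simp only [hg, max_eq_right (sub_nonpos.2 hr), add_zero]
    exact div_self (by positivity)
  · have h1 : ∫ t in a..r, g t = -(δ ^ 2 / (δ + (r - a))) - -(δ ^ 2 / (δ + (a - a))) := by
      refine intervalIntegral.integral_eq_sub_of_hasDerivAt (f := fun t => -(δ ^ 2 / (δ + (t - a))))
        (fun t ht => ?_) (hgc.intervalIntegrable _ _)
      rw [uIcc_of_le hr] at ht
      have h2 : 0 < δ + (t - a) := by linarith [ht.1]
      have h3 := ((((hasDerivAt_id t).sub_const a).const_add δ).inv h2.ne').const_mul (δ ^ 2)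
      convert! h3.neg using 1
      simp only [hg, max_eq_left (sub_nonneg.2 ht.1), id]
      field_simp
    have h2 : 0 < δ + (r - a) := by linarith
    have h3 : ∫ t in a..r, g t = δ * (r - a) / (δ + (r - a)) := by
      rw [h1, sub_self, add_zero]
      field_simp
      ring
    have h4 : 0 ≤ δ * (r - a) / (δ + (r - a)) :=
      div_nonneg (mul_nonneg hδ0.le (by linarith)) h2.le
    have h5 : δ * (r - a) / (δ + (r - a)) ≤ δ := by
      rw [div_le_iff₀ h2]
      nlinarith
    simp only [h3]
    exact ⟨by linarith, by linarith⟩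

theorem TimeFun.exists_comp (s : TimeFun) {k k' : ℝ → ℝ} (hk' : Continuous k')
    (hk : ∀ r, HasDerivAt k (k' r) r) (hkI : ∀ u : I, k u ∈ I) :
    ∃ s' : TimeFun, ∀ u : I, s'.val u = s.val (k u) ∧ s'.2 u = k' u * s.2 ⟨k u, hkI u⟩ := by
  have hkc : Continuous k := continuous_iff_continuousAt.2 fun r => (hk r).continuousAt
  let p : C(I, ℝ) := ⟨fun u => k' u * s.2 ⟨k u, hkI u⟩,
    (hk'.comp continuous_subtype_val).mul
      (s.2.continuous.comp ((hkc.comp continuous_subtype_val).subtype_mk _))⟩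
  refine ⟨(s.val (k 0), p), fun u => ⟨?_, rfl⟩⟩
  have h := prim_eq (f := fun r => s.val (k r)) (g := p) (fun u => by
    have h1 := (s.hasDerivAt_val ⟨k u, hkI u⟩).comp (u : ℝ) (hk u)
    rw [mul_comm] at h1
    exact h1.hasDerivWithinAt) u
  simp only [TimeFun.val] at h ⊢
  rw [h]
  ring

section Words

universe u

variable {n : ℕ} {M : Type u} [TopologicalSpace M] [ChartedSpace (Coord n) M]
  [IsManifold (𝓡 n) ∞ M] {α : PoissonStructure n M}

/-- Multiplication of covectors by a number. -/
def scaleCov (a : ℝ) (z : CotangentBundle n M) : CotangentBundle n M := ⟨z.proj, a • z.snd⟩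

theorem cotChart_scaleCov (c : M) (a : ℝ) (z : CotangentBundle n M) :
    cotChart n c (scaleCov a z) = ((cotChart n c z).1, a • (cotChart n c z).2) := by
  simp only [cotChart_apply, scaleCov, covectorCoord_def, ContinuousLinearMap.smul_comp]

theorem Ham.hat_scaleCov (h : Ham α) (ρ τ a : ℝ) (z : CotangentBundle n M) :
    h.hat ρ (a * τ) (scaleCov a z) = scaleCov a (h.hat ρ τ z) := by
  by_cases hz : z.proj ∈ (chartAt (Coord n) h.center).source
  · have hz' : (scaleCov a z).proj ∈ (chartAt (Coord n) h.center).source := hz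
    refine (cotChart n h.center).injOn (mem_cotChart_source.2 (hat_proj_mem hz' _ _))
      (mem_cotChart_source.2 (show (scaleCov a (h.hat ρ τ z)).proj ∈ _ from hat_proj_mem hz _ _)) ?_
    rw [cotChart_hat hz', cotChart_scaleCov, cotChart_scaleCov, cotChart_hat hz]
    exact Prod.ext rfl (h.isLocalHam.lift_smul ρ τ a _ _)
  · have h1 : z.proj ∉ h.supp := fun h' => hz (h.supp_subset h')
    rw [hat_of_notMem h1, hat_of_notMem (z := scaleCov a z) h1]

variable [T2Space M]

theorem wordAct_append (l l' : List (Ham α × TimeFun)) (Z : GaussSolution α) :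
    wordAct (l ++ l') Z = wordAct l (wordAct l' Z) := by
  induction l with
  | nil => rfl
  | cons a l ih => exact congrArg (a.1.act a.2) ih

theorem wordAct_path_congr (l : List (Ham α × TimeFun)) {Z Z' : GaussSolution α} {u : I}
    (h : Z.path u = Z'.path u) : (wordAct l Z).path u = (wordAct l Z').path u := by
  induction l with
  | nil => exact h
  | cons a l ih => exact congrArg (a.1.hat (a.2.val u) (a.2.2 u)) ih

theorem exists_inverse_word (l : List (Ham α × TimeFun)) :
    ∃ l', ∀ Z, wordAct l' (wordAct l Z) = Z ∧ wordAct l (wordAct l' Z) = Z := by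
  induction l with
  | nil => exact ⟨[], fun Z => ⟨rfl, rfl⟩⟩
  | cons a l ih =>
    obtain ⟨l', hl'⟩ := ih
    refine ⟨l' ++ [(a.1, -a.2)], fun Z => ?_⟩
    rw [wordAct_append, wordAct_append]
    refine ⟨?_, ?_⟩
    · show wordAct l' (a.1.act (-a.2) (a.1.act a.2 (wordAct l Z))) = Z
      rw [← a.1.act_add, neg_add_cancel, a.1.act_zero, (hl' Z).1]
    · show a.1.act a.2 (wordAct l (wordAct l' (a.1.act (-a.2) Z))) = Z
      rw [(hl' _).2, ← a.1.act_add, add_neg_cancel, a.1.act_zero]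

/-- Each time function s is replaced by s ∘ k, whose rate acquires the factor k'. Fibrewise scaling
commutes with the symmetries in this sense (`Ham.hat_scaleCov`), and the zero covectors of the
constant solution are insensitive to scaling. -/
theorem exists_reparametrized_word (l : List (Ham α × TimeFun)) {k k' : ℝ → ℝ}
    (hk' : Continuous k') (hk : ∀ r, HasDerivAt k (k' r) r) (hkI : ∀ u : I, k u ∈ I) :
    ∃ l', ∀ (x : M) (u : I), (wordAct l' (GaussSolution.const α x)).path u =
      scaleCov (k' u) ((wordAct l (GaussSolution.const α x)).path ⟨k u, hkI u⟩) := by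
  induction l with
  | nil =>
    refine ⟨[], fun x u => ?_⟩
    show (⟨x, 0⟩ : CotangentBundle n M) = ⟨x, k' u • 0⟩
    rw [smul_zero]
  | cons a l ih =>
    obtain ⟨l', hl'⟩ := ih
    obtain ⟨s', hs'⟩ := a.2.exists_comp hk' hk hkI
    refine ⟨(a.1, s') :: l', fun x u => ?_⟩
    show a.1.hat (s'.val u) (s'.2 u) ((wordAct l' (GaussSolution.const α x)).path u) =
      scaleCov (k' u) (a.1.hat (a.2.val (k u)) (a.2.2 ⟨k u, hkI u⟩) _)
    rw [(hs' u).1, (hs' u).2, hl', Ham.hat_scaleCov]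
    rfl

/-- The solution `Z` is obtained from a constant solution by symmetries, at times in `s`. -/
def IsWordOn (Z : GaussSolution α) (s : Set I) : Prop :=
  ∃ (l : List (Ham α × TimeFun)) (x : M), ∀ u ∈ s,
    Z.path u = (wordAct l (GaussSolution.const α x)).path u

theorem IsWordOn.mono {Z : GaussSolution α} {s t : Set I} (h : IsWordOn Z s) (hts : t ⊆ s) :
    IsWordOn Z t := by
  obtain ⟨l, x, h⟩ := h
  exact ⟨l, x, fun u hu => h u (hts hu)⟩

/-- Let A and B realize `Z` on the two intervals, from the constants x and y. On the overlap, B⁻¹A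
takes the constant solution x to the constant solution y. Reparametrize B⁻¹A by a time that is true
time up to some b' in (a, b) and afterwards remains in [b', b]: the result agrees with B⁻¹A before
b' and is constantly y after. Applying B to it yields `Z` on the union. -/
theorem IsWordOn.glue {Z : GaussSolution α} {a b c : I} (hA : IsWordOn Z (Iic b))
    (hB : IsWordOn Z (Icc a c)) (hab : a < b) : IsWordOn Z (Iic c) := by
  rcases le_total c b with hcb | hbc
  · exact hA.mono (Iic_subset_Iic.2 hcb)
  obtain ⟨A, x, hA⟩ := hA
  obtain ⟨B, y, hB⟩ := hB
  have hab' : (a : ℝ) < b := hab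
  obtain ⟨b', hab₁, hb₁b⟩ := exists_between hab'
  obtain ⟨k, k', hk', hk, hk1, hk2⟩ := exists_timeChange hb₁b
  have hb'0 : 0 ≤ b' := a.2.1.trans hab₁.le
  have hkI : ∀ u : I, k u ∈ I := fun u => by
    rcases le_total (u : ℝ) b' with hu | hu
    · rw [(hk1 u hu).1]; exact u.2
    · exact ⟨hb'0.trans (hk2 u hu).1, (hk2 u hu).2.trans b.2.2⟩
  obtain ⟨B', hB'⟩ := exists_inverse_word B
  obtain ⟨D, hD⟩ := exists_reparametrized_word (B' ++ A) hk' hk hkI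
  refine ⟨B ++ D, x, fun u hu => ?_⟩
  rw [wordAct_append]
  rcases le_total (u : ℝ) b' with hub | hub
  · have h1 : (wordAct D (GaussSolution.const α x)).path u =
        (wordAct (B' ++ A) (GaussSolution.const α x)).path u := by
      rw [hD]
      have h2 : (⟨k u, hkI u⟩ : I) = u := Subtype.ext (hk1 u hub).1
      rw [h2, (hk1 u hub).2, scaleCov, one_smul]
    rw [wordAct_path_congr B h1, wordAct_append, (hB' _).2]
    exact hA u (show (u : ℝ) ≤ b from hub.trans hb₁b.le)
  · set v : I := ⟨k u, hkI u⟩ with hv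
    have hkv := hk2 u hub
    have hvb : v ≤ b := hkv.2
    have hav : a ≤ v := show (a : ℝ) ≤ k u from hab₁.le.trans hkv.1
    -- The changed time lies in the overlap, where both words describe `Z`.
    have h1 : (wordAct (B' ++ A) (GaussSolution.const α x)).path v =
        (GaussSolution.const α y).path v := by
      rw [wordAct_append, wordAct_path_congr B' ((hA v hvb).symm.trans (hB v ⟨hav, hvb.trans hbc⟩)),
        (hB' _).1]
    have h2 : (wordAct D (GaussSolution.const α x)).path u = (GaussSolution.const α y).path u := by
      rw [hD, h1]
      show (⟨y, k' u • 0⟩ : CotangentBundle n M) = ⟨y, 0⟩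
      rw [smul_zero]
    rw [wordAct_path_congr B h2]
    exact hB u ⟨show (a : ℝ) ≤ u from hab₁.le.trans hub, hu⟩

/-- Realization of small covectors on a short interval of time. -/
theorem HamFrame.exists_local_word (F : HamFrame α) {y : Coord n} {q : ℝ → CoCoord n} {a ε : ℝ}
    (hε : 0 < ε) {q' : C(I, CoCoord n)} (hq' : ∀ t, q' t = ε • q (a + ε * t))
    (hmem : (y, q') ∈ F.coordHomeo.target) :
    ∃ (l : List (Ham α × TimeFun)) (x : M), ∀ u : I, a ≤ u → u ≤ a + ε →
      (wordAct l (GaussSolution.const α x)).base u ∈ (chartAt (Coord n) F.center).source ∧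
      (cotChart n F.center ((wordAct l (GaussSolution.const α x)).path u)).2 = q u ∧
      (u = a → (cotChart n F.center ((wordAct l (GaussSolution.const α x)).path u)).1 = y) := by
  set w := F.coordHomeo.symm (y, q') with hw
  have hws := F.mem_regularSet (F.coordHomeo.map_target hmem)
  have hR : F.coordMap w = (y, q') := F.coordHomeo.right_inv hmem
  have hw1 : w.1 = y := congrArg Prod.fst hR
  have hw2 : ∀ t : I, F.form (prim w.2 t) y (w.2 t) = ε • q (a + ε * t) := fun t => by
    rw [← hq', ← hw1, ← F.coordMap_snd_apply, hR]
  -- Undoes the rescaling of [a, a+ε] to the unit interval: the time functions are composed with (r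
  -- - a)/ε, and their rates get the factor ε⁻¹, which cancels the ε in `hq'`.
  set f : ℝ → Coord n := fun r => prim w.2 ((r - a) / ε) with hf
  let p : C(I, Coord n) := ⟨fun u => ε⁻¹ • w.2 (projIcc 0 1 zero_le_one (((u : ℝ) - a) / ε)),
    Continuous.const_smul (Continuous.comp (g := fun r : ℝ => w.2 (projIcc 0 1 zero_le_one r))
      (f := fun u : I => ((u : ℝ) - a) / ε) (continuous_extend w.2) (by fun_prop)) ε⁻¹⟩
  have hfd : ∀ u : I, HasDerivAt f (p u) u := fun u => by
    have h1 : HasDerivAt (fun r : ℝ => (r - a) / ε) ε⁻¹ (u : ℝ) := by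
      simpa using! ((hasDerivAt_id (u : ℝ)).sub_const a).div_const ε
    exact (hasDerivAt_prim w.2 (((u : ℝ) - a) / ε)).scomp (u : ℝ) h1
  have hp : ∀ u : I, prim p u = f u - f 0 := fun u =>
    prim_eq (f := f) (fun u => (hfd u).hasDerivWithinAt) u
  have hfa : f a = 0 := by simp [hf]
  set S : GaussModel n := (f 0, p) with hS
  have hSv : ∀ u : I, timeVal S u = f u := fun u => by
    rw [timeVal, hp]
    exact add_sub_cancel _ _
  have hy : y ∈ (chartAt (Coord n) F.center).target := hw1 ▸ hws.1
  have hx := (chartAt (Coord n) F.center).map_target hy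
  refine ⟨F.word (List.finRange n) S, (chartAt (Coord n) F.center).symm y, fun u h1 h2 =>
    ⟨F.base_mem _ S (Z := GaussSolution.const α _) hx, ?_, fun hua => ?_⟩⟩
  · have ht : ((u : ℝ) - a) / ε ∈ Icc (0 : ℝ) 1 :=
      ⟨div_nonneg (by linarith) hε.le, (div_le_one hε).2 (by linarith)⟩
    have h3 := hw2 ⟨_, ht⟩
    rw [F.cotChart_wordAct _ _ hx, (chartAt (Coord n) F.center).right_inv hy, hSv]
    have h4 : S.2 u = ε⁻¹ • w.2 ⟨_, ht⟩ := by
      show ε⁻¹ • w.2 (projIcc 0 1 zero_le_one (((u : ℝ) - a) / ε)) = _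
      rw [projIcc_of_mem zero_le_one ht]
    show F.form (f u) y (S.2 u) = q u
    rw [h4, map_smul]
    have h5 : a + ε * (((u : ℝ) - a) / ε) = u := by field_simp; ring
    simp only [h5] at h3
    rw [h3, smul_smul, inv_mul_cancel₀ hε.ne', one_smul]
  · rw [F.cotChart_wordAct _ _ hx, (chartAt (Coord n) F.center).right_inv hy, hSv, hua, hfa]
    exact wordFlow_zero F.isLocalHam _ _

/-- Rescaling an interval of length ε to unit length multiplies the covectors by ε. For small ε the
starting point and the rescaled covectors are close to those of a constant solution, hence realized
by the frame; uniqueness for the Gauss law identifies the result with `Z`. -/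
theorem exists_isWordOn (Z : GaussSolution α) (u₀ : I) :
    ∃ δ > 0, IsWordOn Z {u | |(u : ℝ) - u₀| < δ} := by
  obtain ⟨F, hF⟩ := exists_hamFrame (α := α) (Z.base u₀)
  obtain ⟨a₁, b₁, hab, hsrc⟩ := exists_Icc_base_mem Z (chartAt (Coord n) F.center).open_source
    (u := u₀) (by rw [hF]; exact mem_chart_source _ _)
  have hu₀ := mem_of_mem_nhds hab
  have hab' : a₁ ≤ b₁ := hu₀.1.trans hu₀.2
  -- Clamping to [a₁, b₁], where `Z` stays in the chart domain, gives coordinate functions that are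
  -- defined and continuous on the whole line.
  set cl : ℝ → I := fun r => max a₁ (min b₁ (projIcc 0 1 zero_le_one r)) with hcl
  have hclc : Continuous cl := by
    have := continuous_projIcc (h := zero_le_one (α := ℝ))
    fun_prop
  have hclm : ∀ r, cl r ∈ Icc a₁ b₁ := fun r => ⟨le_max_left _ _, max_le hab' (min_le_left _ _)⟩
  have hclu : ∀ u ∈ Icc a₁ b₁, cl u = u := fun u hu => by
    simp only [hcl, projIcc_val]
    rw [min_eq_right hu.2, max_eq_right hu.1]
  set z : ℝ → Coord n × CoCoord n := fun r => cotChart n F.center (Z.path (cl r)) with hz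
  have hzc : Continuous z := continuous_iff_continuousAt.2 fun r =>
    ContinuousAt.comp (g := cotChart n F.center) (f := fun r => Z.path (cl r))
      (continuousAt_cotChart (hsrc _ (hclm r))) (Z.path.continuous.comp hclc).continuousAt
  obtain ⟨C, hC⟩ : ∃ C, ∀ r, ‖(z r).2‖ ≤ C := by
    obtain ⟨C, hC⟩ := (isCompact_Icc (a := a₁) (b := b₁)).exists_bound_of_continuousOn
      (f := fun u : I => (z u).2) (hzc.snd.comp continuous_subtype_val).continuousOn
    refine ⟨C, fun r => ?_⟩
    have h1 := hC (cl r) (hclm r)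
    simp only [hz] at h1 ⊢
    rwa [hclu _ (hclm r)] at h1
  have horig : (z u₀).1 = F.origin := by
    simp only [hz, hclu u₀ hu₀, cotChart_apply]
    have : (Z.path u₀).proj = F.center := hF.symm
    rw [this]
  have hR0 : F.coordMap (F.origin, (0 : C(I, Coord n))) = (F.origin, 0) := by
    refine Prod.ext rfl (ContinuousMap.ext fun u => ?_)
    rw [F.coordMap_snd_apply]
    exact map_zero _
  have htar : F.coordHomeo.target ∈ 𝓝 (F.origin, (0 : C(I, CoCoord n))) := by
    refine F.coordHomeo.open_target.mem_nhds ?_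
    have := F.coordHomeo.map_source F.origin_mem
    rwa [F.coordHomeo_apply, hR0] at this
  obtain ⟨r, hr, hball⟩ := Metric.mem_nhds_iff.1 htar
  have hl1 : Filter.Tendsto (fun ε : ℝ => ε * (|C| + 1)) (𝓝[>] 0) (𝓝 0) := by
    have : Continuous fun ε : ℝ => ε * (|C| + 1) := by fun_prop
    have h := this.tendsto 0
    rw [zero_mul] at h
    exact h.mono_left nhdsWithin_le_nhds
  have hl2 : Filter.Tendsto (fun ε : ℝ => (z (cl (u₀ - ε / 2))).1) (𝓝[>] 0) (𝓝 F.origin) := by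
    have : Continuous fun ε : ℝ => (z (cl (u₀ - ε / 2))).1 :=
      hzc.fst.comp (continuous_subtype_val.comp (hclc.comp (by fun_prop)))
    have h := this.tendsto 0
    rw [zero_div, sub_zero, hclu u₀ hu₀, horig] at h
    exact h.mono_left nhdsWithin_le_nhds
  obtain ⟨ε, ⟨hε1, hε2⟩, hε⟩ := ((hl1.eventually (gt_mem_nhds hr)).and
    (hl2.eventually (Metric.ball_mem_nhds _ hr))).and self_mem_nhdsWithin |>.exists
  have hε0 : 0 < ε := hε
  -- The initial time lies slightly before `u₀` where there is room, and is the left end of the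
  -- interval otherwise; in either case [a, a+ε] contains all nearby later times.
  set a := cl (u₀ - ε / 2) with ha
  let q' : C(I, CoCoord n) := ⟨fun t => ε • (z (a + ε * t)).2,
    Continuous.const_smul (Continuous.comp (g := fun r : ℝ => (z r).2)
      (f := fun t : I => (a : ℝ) + ε * t) hzc.snd (by fun_prop)) ε⟩
  have hmem : ((z a).1, q') ∈ F.coordHomeo.target := by
    refine hball ?_
    rw [Metric.mem_ball, Prod.dist_eq, max_lt_iff]
    refine ⟨hε2, ?_⟩
    rw [dist_zero_right, ContinuousMap.norm_lt_iff _ hr]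
    intro t
    show ‖ε • (z (a + ε * t)).2‖ < r
    rw [norm_smul, Real.norm_of_nonneg hε0.le]
    refine (mul_le_mul_of_nonneg_left ((hC _).trans ?_) hε0.le).trans_lt hε1
    exact (le_abs_self C).trans (by linarith)
  obtain ⟨l, x, hlx⟩ := F.exists_local_word (q := fun r => (z r).2) hε0 (q' := q')
    (fun t => rfl) hmem
  obtain ⟨δ, hδ, hδb⟩ := Metric.mem_nhds_iff.1 hab
  refine ⟨min δ (ε / 2), by positivity, l, x, fun u hu => ?_⟩
  obtain ⟨hu1, hu2⟩ := lt_min_iff.1 (show |(u : ℝ) - u₀| < min δ (ε / 2) from hu)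
  have huab : u ∈ Icc a₁ b₁ := hδb (by rw [Metric.mem_ball, Subtype.dist_eq, Real.dist_eq]; exact hu1)
  rw [abs_lt] at hu2
  have hau : a ≤ u := by
    refine max_le huab.1 ((min_le_right _ _).trans ?_)
    show max 0 (min 1 ((u₀ : ℝ) - ε / 2)) ≤ u
    exact max_le u.2.1 ((min_le_right _ _).trans (by linarith))
  have haε : (u₀ : ℝ) - ε / 2 ≤ a := by
    have h1 : min b₁ (projIcc 0 1 zero_le_one ((u₀ : ℝ) - ε / 2)) ≤ a := le_max_right _ _
    rcases min_le_iff.1 h1 with h | h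
    · have : (u₀ : ℝ) ≤ b₁ := hu₀.2
      have h' : (b₁ : ℝ) ≤ a := h
      linarith
    · have h' : max 0 (min 1 ((u₀ : ℝ) - ε / 2)) ≤ a := h
      have h2 : min 1 ((u₀ : ℝ) - ε / 2) = (u₀ : ℝ) - ε / 2 :=
        min_eq_right (by linarith [u₀.2.2])
      rw [h2] at h'
      exact (le_max_right _ _).trans h'
  have hle : ∀ v ∈ Icc a u, (a : ℝ) ≤ v ∧ (v : ℝ) ≤ a + ε ∧ v ∈ Icc a₁ b₁ := fun v hv =>
    ⟨hv.1, (show (v : ℝ) ≤ u from hv.2).trans (by linarith), (hclm _).1.trans hv.1,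
      hv.2.trans huab.2⟩
  refine GaussSolution.path_eq_of_coord (c := F.center) (a := a) (b := u)
    (fun v hv => hsrc v (hle v hv).2.2) (fun v hv => (hlx v (hle v hv).1 (hle v hv).2.1).1)
    (fun v hv => ?_) ?_ u ⟨hau, le_rfl⟩
  · rw [(hlx v (hle v hv).1 (hle v hv).2.1).2.1]
    simp only [hz, hclu v (hle v hv).2.2]
  · rw [(hlx a le_rfl (by linarith)).2.2 rfl]
    simp only [hz, hclu a (hclm _)]

/-- The set of times up to which `Z` is obtained from a constant solution is nonempty, open and
closed in `I`: the local words have a uniform range around each point and can be glued to what is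
already there. -/
theorem exists_eq_wordAct (Z : GaussSolution α) :
    ∃ (l : List (Ham α × TimeFun)) (x : M), Z = wordAct l (GaussSolution.const α x) := by
  set T : Set I := {b | IsWordOn Z (Iic b)} with hT
  have key : ∀ u₀ : I, ∃ δ > 0, ∀ b ∈ T, |(b : ℝ) - u₀| < δ → ∀ c : I, |(c : ℝ) - u₀| < δ →
      c ∈ T := by
    intro u₀
    obtain ⟨δ, hδ, hw⟩ := exists_isWordOn Z u₀
    refine ⟨δ, hδ, fun b hb hbδ c hcδ => ?_⟩
    rw [abs_lt] at hbδ hcδ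
    -- Near the left end the local word alone covers the initial segment. Otherwise it is glued
    -- along an overlap [a, b], with `a` midway between u₀ - δ and `b`.
    by_cases h0 : (u₀ : ℝ) - δ < 0
    · refine hw.mono fun u hu => ?_
      have hu' : (u : ℝ) ≤ c := hu
      show |(u : ℝ) - u₀| < δ
      rw [abs_lt]
      exact ⟨by linarith [u.2.1], by linarith⟩
    · let a : I := ⟨((u₀ : ℝ) - δ + b) / 2, by linarith, by linarith [b.2.2]⟩
      have hab : (a : ℝ) < b := show ((u₀ : ℝ) - δ + b) / 2 < b by linarith
      refine hb.glue (a := a) (hw.mono fun u hu => ?_) hab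
      have h1 : ((u₀ : ℝ) - δ + b) / 2 ≤ u := hu.1
      have h2 : (u : ℝ) ≤ c := hu.2
      show |(u : ℝ) - u₀| < δ
      rw [abs_lt]
      exact ⟨by linarith, by linarith⟩
  have hopen : IsOpen T := Metric.isOpen_iff.2 fun u hu => by
    obtain ⟨δ, hδ, h⟩ := key u
    refine ⟨δ, hδ, fun c hc => h u hu (by simpa using hδ) c ?_⟩
    rwa [Metric.mem_ball, Subtype.dist_eq, Real.dist_eq] at hc
  have hclosed : IsClosed T := isClosed_of_closure_subset fun u hu => by
    obtain ⟨δ, hδ, h⟩ := key u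
    obtain ⟨b, hb, hbu⟩ := Metric.mem_closure_iff.1 hu δ hδ
    rw [dist_comm, Subtype.dist_eq, Real.dist_eq] at hbu
    exact h b hb hbu u (by simpa using hδ)
  have h0 : (0 : I) ∈ T := by
    obtain ⟨δ, hδ, hw⟩ := exists_isWordOn Z 0
    refine hw.mono fun u hu => ?_
    have : u = 0 := le_antisymm hu unitInterval.nonneg'
    rw [this]
    simpa using hδ
  have hT1 : T = univ := IsClopen.eq_univ ⟨hclosed, hopen⟩ ⟨0, h0⟩
  obtain ⟨l, x, h⟩ : (1 : I) ∈ T := hT1 ▸ mem_univ _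
  exact ⟨l, x, GaussSolution.ext fun u => h u unitInterval.le_one'⟩

theorem exists_isAdapted (Z : GaussSolution α) :
    ∃ e : OpenPartialHomeomorph (GaussSolution α) (GaussModel n), IsAdapted e ∧ Z ∈ e.source := by
  obtain ⟨l, x, rfl⟩ := exists_eq_wordAct Z
  obtain ⟨F, rfl⟩ := exists_hamFrame (α := α) x
  obtain ⟨e, he, hs⟩ := F.isAdapted_chart.wordAct l
  exact ⟨e, he, hs _ F.const_mem_chart_source⟩

end Words

/-! ### The manifold of solutions -/

section ManifoldStructure

universe u

variable {n : ℕ} {M : Type u} [TopologicalSpace M] [ChartedSpace (Coord n) M]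
  [IsManifold (𝓡 n) ∞ M] {α : PoissonStructure n M} [T2Space M]

theorem IsAdapted.mem_gaussAtlas {e : OpenPartialHomeomorph (GaussSolution α) (GaussModel n)}
    (he : IsAdapted e) : e ∈ gaussAtlas α :=
  ⟨(isSmoothFamily_iff e.open_target).2 he.smoothAt_symm, fun _ _ hW hg w hw =>
    (he.contDiffAt_comp ((isSmoothFamily_iff hW).1 hg w hw.1) hw.2).contDiffWithinAt⟩

variable (α) in
instance gaussChartedSpace : ChartedSpace (GaussModel n) (GaussSolution α) where
  atlas := gaussAtlas α
  chartAt Z := (exists_isAdapted Z).choose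
  mem_chart_source Z := (exists_isAdapted Z).choose_spec.2
  chart_mem_atlas Z := (exists_isAdapted Z).choose_spec.1.mem_gaussAtlas

/-- A coordinate change is the smooth family `e.symm` read through the other chart, so it is smooth
by the second condition on the atlas. -/
instance : IsManifold 𝓘(ℝ, GaussModel n) ∞ (GaussSolution α) :=
  isManifold_of_contDiffOn _ _ _ fun e e' he he' => by
    have h := he'.2 e.target e.symm e.open_target he.1
    simpa using! h

variable {e : OpenPartialHomeomorph (GaussSolution α) (GaussModel n)} {Z : GaussSolution α}

theorem smoothAt_of_mem_gaussAtlas (he : e ∈ gaussAtlas α) {w : GaussModel n} (hw : w ∈ e.target) :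
    SmoothAt e.symm w :=
  (isSmoothFamily_iff e.open_target).1 he.1 w hw

theorem mdifferentiable_of_mem_gaussAtlas (he : e ∈ gaussAtlas α) :
    e.MDifferentiable 𝓘(ℝ, GaussModel n) 𝓘(ℝ, GaussModel n) :=
  mdifferentiable_of_mem_atlas he

theorem hasMFDerivAt_of_mem_gaussAtlas (he : e ∈ gaussAtlas α) (hZ : Z ∈ e.source) :
    HasMFDerivAt 𝓘(ℝ, GaussModel n) 𝓘(ℝ, GaussModel n) e Z
      (mfderiv 𝓘(ℝ, GaussModel n) 𝓘(ℝ, GaussModel n) e Z) :=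
  ((mdifferentiable_of_mem_gaussAtlas he).mdifferentiableAt hZ).hasMFDerivAt

theorem hasMFDerivAt_of_comp_symm {F : Type} [NormedAddCommGroup F] [NormedSpace ℝ F]
    {f : GaussSolution α → F} {f' : GaussModel n →L[ℝ] F} (he : e ∈ gaussAtlas α)
    (hZ : Z ∈ e.source) (hf : HasFDerivAt (fun w => f (e.symm w)) f' (e Z)) :
    HasMFDerivAt 𝓘(ℝ, GaussModel n) 𝓘(ℝ, F) f Z
      (f' ∘L (mfderiv 𝓘(ℝ, GaussModel n) 𝓘(ℝ, GaussModel n) e Z)) := by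
  refine (HasMFDerivAt.comp (g := fun w => f (e.symm w)) Z hf.hasMFDerivAt
    (hasMFDerivAt_of_mem_gaussAtlas he hZ)).congr_of_eventuallyEq ?_
  filter_upwards [e.open_source.mem_nhds hZ] with Y hY
  rw [Function.comp_apply, e.left_inv hY]

theorem GaussSolution.xCoord_eq (c : M) (u : I) (Z : GaussSolution α) :
    Z.xCoord c u = (cotChart n c (Z.path u)).1 := by
  rw [cotChart_apply]
  rfl

theorem GaussSolution.etaCoord_eq (c : M) (u : I) (Z : GaussSolution α) :
    Z.etaCoord c u = (cotChart n c (Z.path u)).2 := by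
  rw [cotChart_apply]
  rfl

/-- Translates tangent vectors of 𝒞 into directions in a chart, so that everything proved about
families of solutions applies to the distribution. -/
theorem isGaugeVector_iff (he : e ∈ gaussAtlas α) (hZ : Z ∈ e.source)
    {β : ∀ u : I, Cotangent n (Z.base u)} {v : TangentSpace 𝓘(ℝ, GaussModel n) Z} :
    IsGaugeVector Z β v ↔ IsGaugeDeriv e.symm (e Z)
      (mfderiv 𝓘(ℝ, GaussModel n) 𝓘(ℝ, GaussModel n) e Z v : GaussModel n)
      (fun u => ⟨Z.base u, β u⟩) := by
  have hleft := e.left_inv hZ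
  refine forall_congr' fun c => forall_congr' fun u => ?_
  have hb : (e.symm (e Z)).base u = Z.base u := by rw [hleft]
  rw [hb]
  refine imp_congr_right fun hu => ?_
  have hd : DifferentiableAt ℝ (fun w => cotChart n c ((e.symm w).path u)) (e Z) :=
    ((smoothAt_of_mem_gaussAtlas he (e.map_source hZ)).contDiffAt_cotChart
      (by rw [hleft]; exact hu)).differentiableAt (by simp)
  have h1 := hasMFDerivAt_of_comp_symm (f := GaussSolution.xCoord c u) he hZ
    (by simpa only [GaussSolution.xCoord_eq] using hd.hasFDerivAt.fst)
  have h2 := hasMFDerivAt_of_comp_symm (f := GaussSolution.etaCoord c u) he hZ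
    (by simpa only [GaussSolution.etaCoord_eq] using hd.hasFDerivAt.snd)
  unfold GaugeAt
  have hsec : secCoord (fun u => (⟨Z.base u, β u⟩ : CotangentBundle n M)) c =
      fun u => covectorCoord n c (Z.base u) (β u) := by
    funext u
    rw [secCoord, cotChart_apply]
  rw [hleft, h1.mfderiv, h2.mfderiv, GaussSolution.xCoord_eq, GaussSolution.etaCoord_eq, hsec]
  rfl

theorem bijective_mfderiv_of_mem_gaussAtlas (he : e ∈ gaussAtlas α) (hZ : Z ∈ e.source) :
    Function.Bijective (mfderiv 𝓘(ℝ, GaussModel n) 𝓘(ℝ, GaussModel n) e Z) :=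
  (mdifferentiable_of_mem_gaussAtlas he).mfderiv_bijective hZ

theorem isEndSection_iff {β : ∀ u : I, Cotangent n (Z.base u)} :
    IsGaugeSection Z β ↔ IsEndSection Z (fun u => ⟨Z.base u, β u⟩) := by
  rw [isGaugeSection_iff]
  exact ⟨fun h => ⟨h.1, h.2.1, h.2.2⟩, fun h => ⟨h.toIsSection, h.zero_left, h.zero_right⟩⟩

theorem IsEndSection.exists_covectors {ρ : I → CotangentBundle n M} (hρ : IsEndSection Z ρ) :
    ∃ β : ∀ u : I, Cotangent n (Z.base u), IsGaugeSection Z β ∧ (fun u => ⟨Z.base u, β u⟩) = ρ := by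
  obtain ⟨β, rfl, -⟩ := PoissonSigma.exists_covectors hρ.proj_eq
  exact ⟨β, isEndSection_iff.2 hρ, rfl⟩

theorem IsAdapted.existsUnique_gaugeVector (he : IsAdapted e) (hZ : Z ∈ e.source)
    {β : ∀ u : I, Cotangent n (Z.base u)} (hβ : IsGaugeSection Z β) :
    ∃ v : TangentSpace 𝓘(ℝ, GaussModel n) Z, IsGaugeVector Z β v ∧
      (mfderiv 𝓘(ℝ, GaussModel n) 𝓘(ℝ, GaussModel n) e Z v : GaussModel n) ∈ leafDir n ∧
      ∀ v', IsGaugeVector Z β v' → v' = v := by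
  have hbij := bijective_mfderiv_of_mem_gaussAtlas he.mem_gaussAtlas hZ
  have hρ := isEndSection_iff.1 hβ
  have hρ' : IsEndSection (e.symm (e Z)) (fun u => (⟨Z.base u, β u⟩ : CotangentBundle n M)) := by
    rwa [e.left_inv hZ]
  obtain ⟨w, hw, hw'⟩ := he.exists_dir _ (e.map_source hZ) _ hρ'
  obtain ⟨v, hv⟩ := hbij.2 w
  refine ⟨v, (isGaugeVector_iff he.mem_gaussAtlas hZ).2 (by rw [hv]; exact hw'),
    by rw [hv]; exact hw, fun v' hv' => hbij.1 ?_⟩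
  rw [hv]
  exact he.unique _ (e.map_source hZ) _ _ _ hρ'.toIsSection
    ((isGaugeVector_iff he.mem_gaussAtlas hZ).1 hv') hw'

theorem IsAdapted.exists_gaugeSection (he : IsAdapted e) (hZ : Z ∈ e.source)
    {v : TangentSpace 𝓘(ℝ, GaussModel n) Z}
    (hv : (mfderiv 𝓘(ℝ, GaussModel n) 𝓘(ℝ, GaussModel n) e Z v : GaussModel n) ∈ leafDir n) :
    ∃ β, IsGaugeSection Z β ∧ IsGaugeVector Z β v := by
  obtain ⟨ρ, h1, h2⟩ := he.exists_section _ (e.map_source hZ) _ hv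
  rw [e.left_inv hZ] at h1
  obtain ⟨β, hβ, rfl⟩ := h1.exists_covectors
  exact ⟨β, hβ, (isGaugeVector_iff he.mem_gaussAtlas hZ).2 h2⟩

/-- In an adapted chart the gauge vectors already form the subspace `leafDir`, so taking the span
adds nothing. -/
theorem IsAdapted.gaugeDistribution_eq (he : IsAdapted e) (hZ : Z ∈ e.source) :
    gaugeDistribution Z = (leafDir n).comap
      (mfderiv 𝓘(ℝ, GaussModel n) 𝓘(ℝ, GaussModel n) e Z).toLinearMap := by
  have : {v | ∃ β, IsGaugeSection Z β ∧ IsGaugeVector Z β v} =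
      ((leafDir n).comap
        (mfderiv 𝓘(ℝ, GaussModel n) 𝓘(ℝ, GaussModel n) e Z).toLinearMap : Set _) := by
    ext v
    constructor
    · rintro ⟨β, hβ, hv⟩
      obtain ⟨v', -, h2, h3⟩ := he.existsUnique_gaugeVector hZ hβ
      rw [h3 v hv]
      exact h2
    · exact fun hv => he.exists_gaugeSection hZ hv
  rw [gaugeDistribution, this, Submodule.span_eq]

theorem IsAdapted.mem_gaugeDistribution (he : IsAdapted e) (hZ : Z ∈ e.source)
    {v : TangentSpace 𝓘(ℝ, GaussModel n) Z} : v ∈ gaugeDistribution Z ↔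
      (mfderiv 𝓘(ℝ, GaussModel n) 𝓘(ℝ, GaussModel n) e Z v : GaussModel n) ∈ leafDir n := by
  rw [he.gaugeDistribution_eq hZ]
  rfl

theorem isClosed_gaugeDistribution (Z : GaussSolution α) :
    IsClosed (gaugeDistribution Z : Set (TangentSpace 𝓘(ℝ, GaussModel n) Z)) := by
  obtain ⟨e, he, hZ⟩ := exists_isAdapted Z
  rw [he.gaugeDistribution_eq hZ]
  exact isClosed_leafDir.preimage
    (mfderiv 𝓘(ℝ, GaussModel n) 𝓘(ℝ, GaussModel n) e Z).continuous

theorem finrank_quotient_gaugeDistribution (Z : GaussSolution α) :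
    Module.finrank ℝ (TangentSpace 𝓘(ℝ, GaussModel n) Z ⧸ gaugeDistribution Z) = 2 * n := by
  obtain ⟨e, he, hZ⟩ := exists_isAdapted Z
  have hbij := bijective_mfderiv_of_mem_gaussAtlas he.mem_gaussAtlas hZ
  let L : TangentSpace 𝓘(ℝ, GaussModel n) Z ≃ₗ[ℝ] GaussModel n := LinearEquiv.ofBijective
    (mfderiv 𝓘(ℝ, GaussModel n) 𝓘(ℝ, GaussModel n) e Z).toLinearMap hbij
  have h : (gaugeDistribution Z).map L.toLinearMap = leafDir n := by
    rw [he.gaugeDistribution_eq hZ]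
    exact Submodule.map_comap_eq_of_surjective hbij.2 _
  exact (Submodule.Quotient.equiv _ _ L h).finrank_eq.trans finrank_quotient_leafDir

theorem isGaugeDistributionIntegrable : IsGaugeDistributionIntegrable α (2 * n) := by
  intro Z
  obtain ⟨e, he, hZ⟩ := exists_isAdapted Z
  exact ⟨e, IsManifold.subset_maximalAtlas he.mem_gaussAtlas, hZ, leafDir n, isClosed_leafDir,
    finrank_quotient_leafDir, fun Y hY v => he.mem_gaugeDistribution hY⟩

end ManifoldStructure

/-! ### Families of one-forms -/

section PartialDerivatives

variable {T E F : Type} [NormedAddCommGroup T] [NormedSpace ℝ T] [NormedAddCommGroup E]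
  [NormedSpace ℝ E] [NormedAddCommGroup F] [NormedSpace ℝ F]

/-- Needed for the topology of Ω¹(M), which involves all space derivatives. A partial derivative is
the total one restricted to the second factor, so smoothness propagates by induction. -/
theorem contDiffOn_iteratedFDeriv_partial {B : T × E → F} {Ω : Set E} (hΩ : IsOpen Ω)
    (hB : ContDiffOn ℝ ∞ B (univ ×ˢ Ω)) (k : ℕ) :
    ContDiffOn ℝ ∞ (fun q : T × E => iteratedFDeriv ℝ k (fun y => B (q.1, y)) q.2)
      (univ ×ˢ Ω) := by
  have hU : IsOpen ((univ : Set T) ×ˢ Ω) := isOpen_univ.prod hΩ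
  induction k with
  | zero =>
    simp only [iteratedFDeriv_zero_eq_comp, Function.comp_apply]
    exact (continuousMultilinearCurryFin0 ℝ E F).symm.contDiff.comp_contDiffOn hB
  | succ k ih =>
    simp only [iteratedFDeriv_succ_eq_comp_left, Function.comp_apply]
    have h0 : ContDiff ℝ ∞ (continuousMultilinearCurryLeftEquiv ℝ (fun _ : Fin (k + 1) => E) F).symm :=
      LinearIsometryEquiv.contDiff _
    refine h0.comp_contDiffOn ?_
    have h1 : ContDiffOn ℝ ∞ (fun q : T × E => fderiv ℝ (fun q : T × E =>
        iteratedFDeriv ℝ k (fun y => B (q.1, y)) q.2) q ∘L ContinuousLinearMap.inr ℝ T E)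
        (univ ×ˢ Ω) :=
      ((contDiffOn_infty_iff_fderiv_of_isOpen hU).1 ih).2.clm_comp contDiffOn_const
    refine h1.congr fun q hq => ?_
    exact HasFDerivAt.fderiv (HasFDerivAt.comp (g := fun q : T × E =>
      iteratedFDeriv ℝ k (fun y => B (q.1, y)) q.2) (f := fun y => (q.1, y)) q.2
      (((ih.contDiffAt (hU.mem_nhds hq)).differentiableAt (by simp)).hasFDerivAt)
      (hasFDerivAt_prodMk_right q.1 q.2))

end PartialDerivatives

section FormFamilies

universe u

variable {n : ℕ} {M : Type u} [TopologicalSpace M] [ChartedSpace (Coord n) M]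
  [IsManifold (𝓡 n) ∞ M] {α : PoissonStructure n M}
  {T : Type} [NormedAddCommGroup T] [NormedSpace ℝ T]

/-- A family of one-forms on `M` depending smoothly on a parameter. -/
structure SmoothForms (b : T → M → CotangentBundle n M) : Prop where
  proj_eq : ∀ θ x, (b θ x).proj = x
  smooth : ∀ (c : M) (θ : T), ∀ x ∈ (chartAt (Coord n) c).source,
    ContDiffAt ℝ ∞ (fun q : T × Coord n => (cotChart n c (b q.1 ((chartAt (Coord n) c).symm q.2))).2)
      (θ, chartAt (Coord n) c x)

theorem cotChart_snd_eq_comp_jac {c c' x : M} (hx : x ∈ (chartAt (Coord n) c).source)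
    (hx' : x ∈ (chartAt (Coord n) c').source) {z : CotangentBundle n M} (hz : z.proj = x) :
    (cotChart n c z).2 = (cotChart n c' z).2 ∘L jac c c' x := by
  subst hz
  rw [cotChart_apply, cotChart_apply]
  exact covectorCoord_eq_comp_jac hx hx' z.snd

theorem SmoothForms.of_exists {b : T → M → CotangentBundle n M} (hb : ∀ θ x, (b θ x).proj = x)
    (h : ∀ (θ : T) (x : M), ∃ c : M, x ∈ (chartAt (Coord n) c).source ∧
      ContDiffAt ℝ ∞ (fun q : T × Coord n =>
        (cotChart n c (b q.1 ((chartAt (Coord n) c).symm q.2))).2) (θ, chartAt (Coord n) c x)) :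
    SmoothForms b := by
  refine ⟨hb, fun c' θ x hx' => ?_⟩
  obtain ⟨c, hx, h⟩ := h θ x
  have h0 := contDiffAt_chartChange hx' hx
  have h1 : ContDiffAt ℝ ∞ (fun q : T × Coord n => (q.1, chartChange c' c q.2))
      (θ, chartAt (Coord n) c' x) :=
    contDiffAt_fst.prodMk (ContDiffAt.comp (g := chartChange c' c) (f := Prod.snd)
      (θ, chartAt (Coord n) c' x) h0 contDiffAt_snd)
  have h2 : ContDiffAt ℝ ∞ (fun q : T × Coord n => fderiv ℝ (chartChange c' c) q.2)
      (θ, chartAt (Coord n) c' x) :=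
    ContDiffAt.comp (g := fderiv ℝ (chartChange c' c)) (f := Prod.snd)
      (θ, chartAt (Coord n) c' x) (h0.fderiv_right (m := ∞) (by simp)) contDiffAt_snd
  rw [← chartChange_apply (c := c') hx'] at h
  have h3 := (ContDiffAt.comp (g := fun q : T × Coord n =>
        (cotChart n c (b q.1 ((chartAt (Coord n) c).symm q.2))).2)
        (f := fun q : T × Coord n => (q.1, chartChange c' c q.2)) (θ, chartAt (Coord n) c' x)
        h h1).clm_comp h2
  refine h3.congr_of_eventuallyEq ?_
  have hopen := ((chartAt (Coord n) c').isOpen_inter_preimage_symm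
    (chartAt (Coord n) c).open_source).preimage (continuous_snd (X := T))
  filter_upwards [hopen.mem_nhds (x := (θ, chartAt (Coord n) c' x))
    ⟨(chartAt (Coord n) c').map_source hx', by
      rw [mem_preimage, (chartAt (Coord n) c').left_inv hx']; exact hx⟩] with q hq
  have hq1 := (chartAt (Coord n) c').map_target hq.1
  have hq2 : (chartAt (Coord n) c').symm q.2 ∈ (chartAt (Coord n) c).source := hq.2
  rw [cotChart_snd_eq_comp_jac hq1 hq2 (hb _ _), jac, (chartAt (Coord n) c').right_inv hq.1]
  simp only [Function.comp_apply, chartChange, (chartAt (Coord n) c).left_inv hq2]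

theorem SmoothForms.contDiffOn {b : T → M → CotangentBundle n M} (hb : SmoothForms b) (c : M) :
    ContDiffOn ℝ ∞ (fun q : T × Coord n => (cotChart n c (b q.1 ((chartAt (Coord n) c).symm q.2))).2)
      (univ ×ˢ (chartAt (Coord n) c).target) := fun q hq => by
  have h := hb.smooth c q.1 _ ((chartAt (Coord n) c).map_target hq.2)
  rw [(chartAt (Coord n) c).right_inv hq.2] at h
  exact h.contDiffWithinAt

theorem smoothForms_zero : SmoothForms (fun (_ : T) (x : M) => (⟨x, 0⟩ : CotangentBundle n M)) := by
  refine ⟨fun _ _ => rfl, fun c θ x hx => ?_⟩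
  refine (contDiffAt_const (c := (0 : CoCoord n))).congr_of_eventuallyEq (.of_forall fun q => ?_)
  show (cotChart n c (⟨(chartAt (Coord n) c).symm q.2, 0⟩ : CotangentBundle n M)).2 = 0
  rw [cotChart_apply, covectorCoord_def, ContinuousLinearMap.zero_comp]

/-- This is the push-forward of one-forms by the time ρ flow, combined with the translation: the
value at `x` comes from the point reached from `x` in time -ρ, which is the base point of `h.hat
(-ρ) 0 ⟨x, 0⟩`. -/
theorem SmoothForms.hat [T2Space M] {b : T → M → CotangentBundle n M} (hb : SmoothForms b)
    (h : Ham α) : SmoothForms (fun (q : (ℝ × ℝ) × T) x =>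
      h.hat q.1.1 q.1.2 (b q.2 (h.hat (-q.1.1) 0 ⟨x, 0⟩).proj)) := by
  have hproj : ∀ (ρ τ : ℝ) (θ : T) (x : M), (h.hat ρ τ (b θ (h.hat (-ρ) 0 ⟨x, 0⟩).proj)).proj = x := by
    intro ρ τ θ x
    rw [h.hat_proj_eq (z' := h.hat (-ρ) 0 ⟨x, 0⟩) (hb.proj_eq _ _) ρ τ 0, h.hat_add, add_neg_cancel,
      add_zero, h.hat_zero]
  refine SmoothForms.of_exists (fun q x => hproj _ _ _ _) ?_
  rintro ⟨⟨ρ, τ⟩, θ⟩ x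
  by_cases hx : x ∈ h.supp
  · have hc := h.supp_subset hx
    have hy := (chartAt (Coord n) h.center).map_source hc
    refine ⟨h.center, hc, ?_⟩
    have hflow : ContDiff ℝ ∞ (fun q : ((ℝ × ℝ) × T) × Coord n =>
        flow (hamField (α.coordCLM h.center) h.fn) (-q.1.1.1) q.2) :=
      h.isLocalHam.contDiff_hamFlow.comp (g := fun z : ℝ × Coord n =>
        flow (hamField (α.coordCLM h.center) h.fn) z.1 z.2)
        (f := fun q : ((ℝ × ℝ) × T) × Coord n => (-q.1.1.1, q.2)) (by fun_prop)
    have hmem : ∀ (ρ : ℝ) {y : Coord n}, y ∈ (chartAt (Coord n) h.center).target →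
        flow (hamField (α.coordCLM h.center) h.fn) ρ y ∈ (chartAt (Coord n) h.center).target :=
      fun ρ y hy => h.isLocalHam.hamFlow_mem hy ρ
    have h1 : ContDiffAt ℝ ∞ (fun q : ((ℝ × ℝ) × T) × Coord n => (cotChart n h.center (b q.1.2
        ((chartAt (Coord n) h.center).symm
          (flow (hamField (α.coordCLM h.center) h.fn) (-q.1.1.1) q.2)))).2)
        (((ρ, τ), θ), chartAt (Coord n) h.center x) :=
      ContDiffAt.comp (g := fun q : T × Coord n =>
        (cotChart n h.center (b q.1 ((chartAt (Coord n) h.center).symm q.2))).2)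
        (f := fun q : ((ℝ × ℝ) × T) × Coord n =>
          (q.1.2, flow (hamField (α.coordCLM h.center) h.fn) (-q.1.1.1) q.2))
        (((ρ, τ), θ), chartAt (Coord n) h.center x)
        ((hb.contDiffOn h.center).contDiffAt ((isOpen_univ.prod
          (chartAt (Coord n) h.center).open_target).mem_nhds ⟨mem_univ _, hmem _ hy⟩))
        (contDiffAt_fst.snd.prodMk hflow.contDiffAt)
    have h2 : ContDiffAt ℝ ∞ (fun q : ((ℝ × ℝ) × T) × Coord n =>
        (lift (α.coordCLM h.center) h.fn q.1.1.1 q.1.1.2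
          (flow (hamField (α.coordCLM h.center) h.fn) (-q.1.1.1) q.2, (cotChart n h.center (b q.1.2
          ((chartAt (Coord n) h.center).symm
            (flow (hamField (α.coordCLM h.center) h.fn) (-q.1.1.1) q.2)))).2)).2)
        (((ρ, τ), θ), chartAt (Coord n) h.center x) :=
      (ContDiffAt.comp (g := fun z : (ℝ × ℝ) × (Coord n × CoCoord n) =>
        lift (α.coordCLM h.center) h.fn z.1.1 z.1.2 z.2)
        (f := fun q : ((ℝ × ℝ) × T) × Coord n => (q.1.1,
          (flow (hamField (α.coordCLM h.center) h.fn) (-q.1.1.1) q.2, (cotChart n h.center (b q.1.2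
          ((chartAt (Coord n) h.center).symm
            (flow (hamField (α.coordCLM h.center) h.fn) (-q.1.1.1) q.2)))).2)))
        (((ρ, τ), θ), chartAt (Coord n) h.center x)
        h.isLocalHam.contDiff_lift.contDiffAt
        (contDiffAt_fst.fst.prodMk (hflow.contDiffAt.prodMk h1))).snd
    refine h2.congr_of_eventuallyEq ?_
    filter_upwards [((chartAt (Coord n) h.center).open_target.preimage
      (continuous_snd (X := (ℝ × ℝ) × T))).mem_nhds hy] with q hq
    have hq' : q.2 ∈ (chartAt (Coord n) h.center).target := hq
    have hsy := (chartAt (Coord n) h.center).map_target hq'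
    have e1 : (h.hat (-q.1.1.1) 0 ⟨(chartAt (Coord n) h.center).symm q.2, 0⟩).proj =
        (chartAt (Coord n) h.center).symm
          (flow (hamField (α.coordCLM h.center) h.fn) (-q.1.1.1) q.2) := by
      rw [Ham.hat_eq (z := ⟨(chartAt (Coord n) h.center).symm q.2, 0⟩) hsy, cotChart_symm_proj
        (mem_cotChart_target.1 (Ham.lift_mem_target
          (z := ⟨(chartAt (Coord n) h.center).symm q.2, 0⟩) hsy _ _))]
      simp only [lift, cotChart_apply, (chartAt (Coord n) h.center).right_inv hq']
    have e2 := (chartAt (Coord n) h.center).map_target (hmem (-q.1.1.1) hq')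
    rw [e1, Ham.cotChart_hat (by rw [hb.proj_eq]; exact e2)]
    congr 2
    refine Prod.ext ?_ rfl
    rw [cotChart_apply]
    show chartAt (Coord n) h.center (b _ _).proj = _
    rw [hb.proj_eq, (chartAt (Coord n) h.center).right_inv (hmem _ hq')]
  · have hc := mem_chart_source (Coord n) x
    refine ⟨x, hc, ?_⟩
    have h1 : ContDiffAt ℝ ∞ (fun q : ((ℝ × ℝ) × T) × Coord n =>
        (cotChart n x (b q.1.2 ((chartAt (Coord n) x).symm q.2))).2)
        (((ρ, τ), θ), chartAt (Coord n) x x) :=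
      ContDiffAt.comp (g := fun q : T × Coord n =>
        (cotChart n x (b q.1 ((chartAt (Coord n) x).symm q.2))).2)
        (f := fun q : ((ℝ × ℝ) × T) × Coord n => (q.1.2, q.2))
        (((ρ, τ), θ), chartAt (Coord n) x x) (hb.smooth x θ x hc)
        (contDiffAt_fst.snd.prodMk contDiffAt_snd)
    refine h1.congr_of_eventuallyEq ?_
    have h2 : ContinuousAt (fun q : ((ℝ × ℝ) × T) × Coord n => (chartAt (Coord n) x).symm q.2)
        (((ρ, τ), θ), chartAt (Coord n) x x) :=
      ContinuousAt.comp (g := (chartAt (Coord n) x).symm)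
        ((chartAt (Coord n) x).continuousAt_symm ((chartAt (Coord n) x).map_source hc))
        continuousAt_snd
    filter_upwards [h2.preimage_mem_nhds (h.isClosed_supp.isOpen_compl.mem_nhds (by
      rw [(chartAt (Coord n) x).left_inv hc]; exact hx))] with q hq
    have hq' : (chartAt (Coord n) x).symm q.2 ∉ h.supp := hq
    have e1 := h.hat_of_notMem (z := ⟨(chartAt (Coord n) x).symm q.2, 0⟩) hq' (-q.1.1.1) 0
    rw [e1, Ham.hat_of_notMem (by rw [hb.proj_eq]; exact hq')]

/-- The covector of a section of the cotangent bundle. -/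
def toCovector (x : M) (z : CotangentBundle n M) : Cotangent n x :=
  (cotChart n x z).2 ∘L frame n x x

theorem toCovector_eq {x : M} {z : CotangentBundle n M} (hz : z.proj = x) :
    (⟨x, toCovector x z⟩ : CotangentBundle n M) = z := by
  subst hz
  rw [toCovector, cotChart_apply, covectorCoord_comp (mem_chart_source _ _)]

theorem covectorCoord_toCovector {c x : M}
    {z : CotangentBundle n M} (hz : z.proj = x) :
    covectorCoord n c x (toCovector x z) = (cotChart n c z).2 := by
  have h := toCovector_eq hz
  conv_rhs => rw [← h, cotChart_apply]

theorem SmoothForms.isContinuousFormFamily {b : T → M → CotangentBundle n M} (hb : SmoothForms b)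
    {θ : I → T} (hθ : Continuous θ) :
    IsContinuousFormFamily (fun u x => toCovector x (b (θ u) x)) := by
  intro c
  have hB := hb.contDiffOn c
  have heq : ∀ u : I, ∀ y ∈ (chartAt (Coord n) c).target,
      covectorCoord n c ((chartAt (Coord n) c).symm y) (toCovector ((chartAt (Coord n) c).symm y)
        (b (θ u) ((chartAt (Coord n) c).symm y))) =
      (cotChart n c (b (θ u) ((chartAt (Coord n) c).symm y))).2 := fun u y hy =>
    covectorCoord_toCovector (hb.proj_eq _ _)
  refine ⟨fun u => ?_, fun k => ?_⟩
  · have h1 : ContDiffOn ℝ ∞ (fun y => (cotChart n c (b (θ u) ((chartAt (Coord n) c).symm y))).2)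
        (chartAt (Coord n) c).target :=
      hB.comp (t := univ ×ˢ (chartAt (Coord n) c).target) (f := fun y => (θ u, y))
        (contDiff_const.prodMk contDiff_id).contDiffOn fun y hy => ⟨mem_univ _, hy⟩
    exact h1.congr (heq u)
  · have h1 := (contDiffOn_iteratedFDeriv_partial (chartAt (Coord n) c).open_target hB k).continuousOn
    have h2 : ContinuousOn (fun q : I × Coord n => iteratedFDeriv ℝ k (fun y =>
        (cotChart n c (b (θ q.1) ((chartAt (Coord n) c).symm y))).2) q.2)
        (univ ×ˢ (chartAt (Coord n) c).target) :=
      h1.comp (f := fun q : I × Coord n => (θ q.1, q.2))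
        ((hθ.comp continuous_fst).prodMk continuous_snd).continuousOn fun q hq => ⟨mem_univ _, hq.2⟩
    refine h2.congr fun q hq => ?_
    have h3 : (fun y => covectorCoord n c ((chartAt (Coord n) c).symm y)
        (toCovector ((chartAt (Coord n) c).symm y) (b (θ q.1) ((chartAt (Coord n) c).symm y))))
        =ᶠ[𝓝 q.2] fun y => (cotChart n c (b (θ q.1) ((chartAt (Coord n) c).symm y))).2 := by
      filter_upwards [(chartAt (Coord n) c).open_target.mem_nhds hq.2] with y hy using heq q.1 y hy
    exact (h3.iteratedFDeriv ℝ k).self_of_nhds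

/-- The derivative of a family of one-forms with respect to the parameter. -/
def formDeriv (b : T → M → CotangentBundle n M) (q : T × T) (x : M) : CotangentBundle n M :=
  ⟨x, fderiv ℝ (fun θ => (cotChart n x (b θ x)).2) q.1 q.2 ∘L frame n x x⟩

theorem SmoothForms.contDiff_apply {b : T → M → CotangentBundle n M} (hb : SmoothForms b) {c x : M}
    (hx : x ∈ (chartAt (Coord n) c).source) : ContDiff ℝ ∞ fun θ => (cotChart n c (b θ x)).2 := by
  rw [← contDiffOn_univ]
  have h := (hb.contDiffOn c).comp (t := univ ×ˢ (chartAt (Coord n) c).target) (s := univ)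
    (f := fun θ : T => (θ, chartAt (Coord n) c x)) (contDiff_id.prodMk contDiff_const).contDiffOn
    fun θ _ => ⟨mem_univ _, (chartAt (Coord n) c).map_source hx⟩
  refine h.congr fun θ _ => ?_
  simp only [Function.comp_apply, (chartAt (Coord n) c).left_inv hx]

theorem SmoothForms.cotChart_formDeriv {b : T → M → CotangentBundle n M} (hb : SmoothForms b)
    {c x : M} (hx : x ∈ (chartAt (Coord n) c).source) (q : T × T) :
    (cotChart n c (formDeriv b q x)).2 = fderiv ℝ (fun θ => (cotChart n c (b θ x)).2) q.1 q.2 := by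
  have hxx := mem_chart_source (Coord n) x
  have h1 : (fun θ => (cotChart n c (b θ x)).2) =
      fun θ => (cotChart n x (b θ x)).2 ∘L jac c x x :=
    funext fun θ => cotChart_snd_eq_comp_jac hx hxx (hb.proj_eq θ x)
  have h2 := (((hb.contDiff_apply hxx).differentiable (by simp) q.1).hasFDerivAt).clm_comp
    (hasFDerivAt_const (jac c x x) q.1)
  rw [h1, h2.fderiv, cotChart_snd_eq_comp_jac (z := formDeriv b q x) hx hxx rfl, cotChart_apply,
    formDeriv, covectorCoord_comp_frame hxx]
  ext v
  simp

theorem SmoothForms.formDeriv {b : T → M → CotangentBundle n M} (hb : SmoothForms b) :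
    SmoothForms (PoissonSigma.formDeriv b) := by
  refine ⟨fun _ _ => rfl, fun c q x hx => ?_⟩
  have hy := (chartAt (Coord n) c).map_source hx
  have hU := isOpen_univ (X := T) |>.prod (chartAt (Coord n) c).open_target
  have h0 := ((contDiffOn_infty_iff_fderiv_of_isOpen hU).1 (hb.contDiffOn c)).2.contDiffAt
    (hU.mem_nhds (x := (q.1, chartAt (Coord n) c x)) ⟨mem_univ _, hy⟩)
  have h1 := (ContDiffAt.comp (f := fun r : (T × T) × Coord n => (r.1.1, r.2))
    (q, chartAt (Coord n) c x) h0 (contDiffAt_fst.fst.prodMk contDiffAt_snd)).clm_apply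
    (g := fun r : (T × T) × Coord n => (r.1.2, (0 : Coord n)))
    (contDiffAt_fst.snd.prodMk contDiffAt_const)
  refine h1.congr_of_eventuallyEq ?_
  filter_upwards [((chartAt (Coord n) c).open_target.preimage
    (continuous_snd (X := T × T))).mem_nhds hy] with r hr
  have hr' : r.2 ∈ (chartAt (Coord n) c).target := hr
  have h2 := ((hb.contDiffOn c).contDiffAt (hU.mem_nhds (x := (r.1.1, r.2)) ⟨mem_univ _, hr'⟩)
    ).differentiableAt (by simp)
  have h3 := HasFDerivAt.comp (f := fun θ : T => (θ, r.2)) r.1.1 h2.hasFDerivAt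
    (hasFDerivAt_prodMk_left r.1.1 r.2)
  rw [hb.cotChart_formDeriv ((chartAt (Coord n) c).map_target hr')]
  exact DFunLike.congr_fun h3.fderiv r.1.2

/-- A family of one-forms depending continuously differentiably on time, through a parameter. -/
def IsFormCurve (ζ : I → M → CotangentBundle n M) : Prop :=
  ∃ (T : Type) (_ : NormedAddCommGroup T) (_ : NormedSpace ℝ T) (θ : ℝ → T) (θ' : C(I, T))
    (b : T → M → CotangentBundle n M), (∀ u : I, HasDerivAt θ (θ' u) u) ∧ SmoothForms b ∧
    ∀ u x, ζ u x = b (θ u) x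

theorem isFormCurve_zero : IsFormCurve (fun _ x => (⟨x, 0⟩ : CotangentBundle n M)) :=
  ⟨ℝ, inferInstance, inferInstance, fun _ => 0, 0, fun _ x => ⟨x, 0⟩,
    fun _ => hasDerivAt_const _ _, smoothForms_zero, fun _ _ => rfl⟩

/-- The times ρ and τ join the parameter space. In this way the dependence on the parameter stays
smooth through any number of letters, although the functions of time themselves are only C¹. -/
theorem IsFormCurve.hat [T2Space M] {ζ : I → M → CotangentBundle n M} (hζ : IsFormCurve ζ)
    (h : Ham α) (s t : TimeFun) : IsFormCurve (fun u x =>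
      h.hat (s.val u) (t.val u) (ζ u (h.hat (-s.val u) 0 ⟨x, 0⟩).proj)) := by
  obtain ⟨T, _, _, θ, θ', b, h1, h2, h3⟩ := hζ
  refine ⟨(ℝ × ℝ) × T, inferInstance, inferInstance, fun r => ((s.val r, t.val r), θ r),
    (s.2.prodMk t.2).prodMk θ', _,
    fun u => ((s.hasDerivAt_val u).prodMk (t.hasDerivAt_val u)).prodMk (h1 u), h2.hat h,
    fun u x => ?_⟩
  simp only [h3]

/-- By the chain rule the time derivative is `formDeriv` evaluated at (θ, θ'), which is again a
smooth family at a continuous parameter. Hence it is continuous together with all its space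
derivatives. -/
theorem IsFormCurve.exists_gaugeForm {ζ : I → M → CotangentBundle n M} (hζ : IsFormCurve ζ)
    (h0 : ∀ x, (ζ 0 x).snd = 0) (h1 : ∀ x, (ζ 1 x).snd = 0) :
    ∃ β : GaugeForm n M, ∀ u x, (⟨x, β.form u x⟩ : CotangentBundle n M) = ζ u x := by
  obtain ⟨T, _, _, θ, θ', b, hθ, hb, hbζ⟩ := hζ
  have hproj : ∀ u x, (ζ u x).proj = x := fun u x => by rw [hbζ, hb.proj_eq]
  have hθc : Continuous fun u : I => θ u :=
    continuous_iff_continuousAt.2 fun u =>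
      ContinuousAt.comp (g := θ) (hθ u).continuousAt continuous_subtype_val.continuousAt
  have hz : ∀ {u : I}, (∀ x, (ζ u x).snd = 0) → (fun x => toCovector x (b (θ u) x)) = 0 := by
    intro u hu
    funext x
    have h2 : (cotChart n x (ζ u x)).2 = 0 :=
      (cotChart_snd_eq_zero (by rw [hproj]; exact mem_chart_source _ _)).2 (hu x)
    rw [toCovector, ← hbζ, h2]
    exact ContinuousLinearMap.zero_comp _
  refine ⟨⟨fun u x => toCovector x (b (θ u) x), hb.isContinuousFormFamily hθc,
    ⟨fun u x => toCovector x (formDeriv b (θ u, θ' u) x),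
      hb.formDeriv.isContinuousFormFamily (hθc.prodMk θ'.continuous), fun u x v => ?_⟩,
      hz h0, hz h1⟩, fun u x => ?_⟩
  · have hxx := mem_chart_source (Coord n) x
    have h2 := (((hb.contDiff_apply hxx).differentiable (by simp) (θ u)).hasFDerivAt).comp_hasDerivAt
      (u : ℝ) (hθ u)
    change HasDerivWithinAt _ ((cotChart n x (formDeriv b (θ u, θ' u) x)).2 (frame n x x v)) _ _
    rw [hb.cotChart_formDeriv hxx]
    have h3 : HasDerivAt (fun r => (cotChart n x (b (θ r) x)).2 (frame n x x v)) _ (u : ℝ) :=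
      h2.clm_apply (hasDerivAt_const (u : ℝ) (frame n x x v))
    rw [map_zero, add_zero] at h3
    refine h3.hasDerivWithinAt.congr (fun r hr => ?_) ?_
    · rw [projIcc_of_mem zero_le_one hr]
      rfl
    · rw [projIcc_val]
      rfl
  · rw [hbζ]
    exact toCovector_eq (hb.proj_eq _ _)

end FormFamilies

/-! ### Elements of the gauge group -/

section GaugeGroupElements

universe u

variable {n : ℕ} {M : Type u} [TopologicalSpace M] [ChartedSpace (Coord n) M]
  [IsManifold (𝓡 n) ∞ M] {α : PoissonStructure n M} [T2Space M]

theorem mk_proj_zero {z : CotangentBundle n M} (hz : z.snd = 0) :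
    (⟨z.proj, 0⟩ : CotangentBundle n M) = z := by
  rw [← hz]

theorem smoothAt_of_const {P : Type} [NormedAddCommGroup P] [NormedSpace ℝ P]
    (Y : GaussSolution α) (w : P) : SmoothAt (fun _ => Y) w := by
  obtain ⟨e, he, hY⟩ := exists_isAdapted Y
  have h := (he.smoothAt_symm (e Y) (e.map_source hY)).comp (f := fun _ : P => e Y)
    (w₁ := w) contDiffAt_const
  simpa only [e.left_inv hY] using h

theorem isSection_zero (Y : GaussSolution α) :
    IsSection Y (fun u => (⟨Y.base u, 0⟩ : CotangentBundle n M)) := by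
  refine IsSection.of_contDiffWithinAt (fun u => rfl) fun u =>
    ⟨Y.base u, mem_chart_source _ _, ?_⟩
  refine (contDiffWithinAt_const (c := (0 : CoCoord n))).congr_of_eventuallyEq
    (.of_forall fun r => ?_) ?_
  all_goals
    simp only [extend, secCoord]
    rw [cotChart_apply, covectorCoord_def, ContinuousLinearMap.zero_comp]

theorem isGaugeDeriv_const {P : Type} [NormedAddCommGroup P] [NormedSpace ℝ P]
    (Y : GaussSolution α) (w v : P) :
    IsGaugeDeriv (fun _ => Y) w v (fun u => (⟨Y.base u, 0⟩ : CotangentBundle n M)) := by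
  intro c u hu
  have h0 : secCoord (fun u => (⟨Y.base u, 0⟩ : CotangentBundle n M)) c = fun _ => 0 := by
    funext u
    rw [secCoord, cotChart_apply, covectorCoord_def, ContinuousLinearMap.zero_comp]
  have h1 : timeDeriv (secCoord (fun u => (⟨Y.base u, 0⟩ : CotangentBundle n M)) c) u = 0 := by
    refine timeDeriv_eq ?_
    rw [h0]
    exact hasDerivWithinAt_const _ _ _
  unfold GaugeAt
  rw [h1, h0, fderiv_fun_const]
  refine ⟨?_, ?_⟩
  · simp
  · simp

/-- A curve in `𝒞` with infinitesimal gauge transformations as derivatives is a gauge curve. -/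
theorem IsGaugeDeriv.isGaugeCurveAt {γ : ℝ → GaussSolution α} {t : ℝ} {β : GaugeForm n M}
    (hγ : SmoothAt γ t) (h : IsGaugeDeriv γ t 1
      (fun u => (⟨(γ t).base u, β.form u ((γ t).base u)⟩ : CotangentBundle n M))) :
    IsGaugeCurveAt β γ t := by
  obtain ⟨e, he, hZ⟩ := exists_isAdapted (γ t)
  have hat := he.mem_gaussAtlas
  set f : ℝ → GaussModel n := fun r => e (γ r) with hf
  have hfd : HasDerivAt f (deriv f t) t :=
    ((he.contDiffAt_comp hγ hZ).differentiableAt (by simp)).hasDerivAt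
  have hev : ∀ᶠ r in 𝓝 t, γ r = e.symm (f r) := by
    filter_upwards [hγ.continuousAt.preimage_mem_nhds (e.open_source.mem_nhds hZ)] with r hr
    exact (e.left_inv hr).symm
  have hes := (mdifferentiable_of_mem_gaussAtlas hat).mdifferentiableAt_symm (e.map_source hZ)
  have hcomp := (HasMFDerivAt.comp (g := e.symm) (f := f) t hes.hasMFDerivAt
    hfd.hasFDerivAt.hasMFDerivAt).congr_of_eventuallyEq hev
  have hid : mfderiv 𝓘(ℝ, GaussModel n) 𝓘(ℝ, GaussModel n) e (γ t)
      ((mfderiv 𝓘(ℝ, GaussModel n) 𝓘(ℝ, GaussModel n) e.symm (e (γ t)) (deriv f t) :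
        TangentSpace 𝓘(ℝ, GaussModel n) (e.symm (e (γ t)))) : GaussModel n) = deriv f t := by
    have h2 := (mdifferentiable_of_mem_gaussAtlas hat).comp_symm_deriv (e.map_source hZ)
    rw [e.left_inv hZ] at h2
    exact DFunLike.congr_fun h2 (deriv f t)
  refine ⟨(mfderiv 𝓘(ℝ, GaussModel n) 𝓘(ℝ, GaussModel n) e.symm (e (γ t)) (deriv f t) :
    GaussModel n), (isGaugeVector_iff hat hZ).2 ?_, ?_⟩
  · rw [hid]
    intro c u hu
    rw [e.left_inv hZ] at hu
    have h1 := h c u hu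
    unfold GaugeAt at h1 ⊢
    rw [e.left_inv hZ]
    have h2 : DifferentiableAt ℝ (fun w => cotChart n c ((e.symm w).path u)) (f t) :=
      ((he.smoothAt_symm _ (e.map_source hZ)).contDiffAt_cotChart
        (by rw [e.left_inv hZ]; exact hu)).differentiableAt (by simp)
    have h3 : (fun r => cotChart n c ((γ r).path u)) =ᶠ[𝓝 t]
        fun r => cotChart n c ((e.symm (f r)).path u) := hev.mono fun r hr => by simp only [hr]
    have h4 : HasDerivAt (fun r => cotChart n c ((e.symm (f r)).path u)) _ t :=
      h2.hasFDerivAt.comp_hasDerivAt t hfd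
    rw [h3.fderiv_eq, h4.hasFDerivAt.fderiv] at h1
    simpa using! h1
  · refine HasMFDerivAt.congr_mfderiv hcomp ?_
    refine ContinuousLinearMap.ext fun r => ?_
    let L : GaussModel n →L[ℝ] GaussModel n :=
      mfderiv 𝓘(ℝ, GaussModel n) 𝓘(ℝ, GaussModel n) e.symm (e (γ t))
    exact map_smul L (show ℝ from r) (deriv f t)

/-- The velocity at time `t` is the gauge transformation by one family of forms that depends neither
on `t` nor on the solution: it is s dk for the empty word, and each further letter pushes it
forward. This independence makes the curves flow lines of a single field ξ_β. -/
theorem IsFormCurve.exists_gaugeDeriv (l : List (Ham α × TimeFun)) (h : Ham α) (s : TimeFun)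
    (h0 : s.val 0 = 0) (h1 : s.val 1 = 0) :
    ∃ ζ : I → M → CotangentBundle n M, IsFormCurve ζ ∧ (∀ x, (ζ 0 x).snd = 0) ∧
      (∀ x, (ζ 1 x).snd = 0) ∧ ∀ (Y : GaussSolution α) (t : ℝ),
        SmoothAt (fun r : ℝ => wordAct l (h.act (r • s) Y)) t ∧
        IsSection (wordAct l (h.act (t • s) Y))
          (fun u => ζ u ((wordAct l (h.act (t • s) Y)).base u)) ∧
        IsGaugeDeriv (fun r : ℝ => wordAct l (h.act (r • s) Y)) t 1
          (fun u => ζ u ((wordAct l (h.act (t • s) Y)).base u)) := by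
  induction l with
  | nil =>
    refine ⟨_, isFormCurve_zero.hat h 0 s, fun x => ?_, fun x => ?_, fun Y t => ?_⟩
    · have e : s.val ((0 : I) : ℝ) = 0 := h0
      rw [e]
      exact h.hat_snd_eq_zero rfl _
    · have e : s.val ((1 : I) : ℝ) = 0 := h1
      rw [e]
      exact h.hat_snd_eq_zero rfl _
    · have hS : ContDiffAt ℝ ∞ (fun r : ℝ => r • s) t := (contDiff_id.smul contDiff_const).contDiffAt
      have hg := smoothAt_of_const Y t
      have hd : fderiv ℝ (fun r : ℝ => r • s) t 1 = s := by
        have hd' : HasDerivAt (fun r : ℝ => r • s) ((1 : ℝ) • s) t := (hasDerivAt_id t).smul_const s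
        rw [hd'.hasFDerivAt.fderiv]
        simp
      -- Invariance of dk under its own flow, contained in the group law `hat_add`: translating
      -- first and flowing afterwards gives s dk at the new base point.
      have hρ : h.push (t • s) s (fun u => (⟨Y.base u, 0⟩ : CotangentBundle n M)) = fun u : I =>
          h.hat ((0 : TimeFun).val u) (s.val u) (⟨(h.hat (-(0 : TimeFun).val u) 0
            (⟨(h.act (t • s) Y).base u, 0⟩ : CotangentBundle n M)).proj, 0⟩) := by
        funext u
        have e1 : (⟨(h.hat ((t • s).val u) ((t • s).2 u) (Y.path u)).proj, 0⟩ :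
            CotangentBundle n M) = h.hat ((t • s).val u) 0 ⟨Y.base u, 0⟩ := by
          rw [h.hat_proj_eq (z := Y.path u) (z' := (⟨Y.base u, 0⟩ : CotangentBundle n M)) rfl _ _ 0]
          exact mk_proj_zero (h.hat_snd_eq_zero rfl _)
        rw [TimeFun.val_zero, neg_zero, h.hat_zero]
        show _ = h.hat 0 (s.val u) ⟨(h.hat ((t • s).val u) ((t • s).2 u) (Y.path u)).proj, 0⟩
        rw [e1, h.hat_add, zero_add, add_zero]
        rfl
      refine ⟨hg.act h hS, ?_, ?_⟩
      · have := h.isSection_push (isSection_zero Y) (t • s) s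
        rwa [hρ] at this
      · have := (isGaugeDeriv_const Y t (1 : ℝ)).act (h := h) hg hS (isSection_zero Y)
        rwa [hd, hρ] at this
  | cons a l ih =>
    obtain ⟨ζ, hζ, hz0, hz1, hY⟩ := ih
    refine ⟨_, hζ.hat a.1 a.2 0, fun x => ?_, fun x => ?_, fun Y t => ?_⟩
    · rw [TimeFun.val_zero]
      exact a.1.hat_snd_eq_zero (hz0 _) _
    · rw [TimeFun.val_zero]
      exact a.1.hat_snd_eq_zero (hz1 _) _
    · obtain ⟨hg, hs, hd⟩ := hY Y t
      have hρ : a.1.push a.2 0 (fun u => ζ u ((wordAct l (h.act (t • s) Y)).base u)) = fun u : I =>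
          a.1.hat (a.2.val u) ((0 : TimeFun).val u) (ζ u (a.1.hat (-a.2.val u) 0
            ⟨(wordAct (a :: l) (h.act (t • s) Y)).base u, 0⟩).proj) := by
        funext u
        have e1 : (a.1.hat (-a.2.val u) 0
            (⟨(a.1.hat (a.2.val u) (a.2.2 u) ((wordAct l (h.act (t • s) Y)).path u)).proj, 0⟩ :
              CotangentBundle n M)).proj = (wordAct l (h.act (t • s) Y)).base u := by
          rw [a.1.hat_proj_eq (z := ⟨_, 0⟩) (z' := a.1.hat (a.2.val u) (a.2.2 u)
            ((wordAct l (h.act (t • s) Y)).path u)) rfl _ 0 (-a.2.2 u), a.1.hat_add,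
            neg_add_cancel, neg_add_cancel, a.1.hat_zero]
          rfl
        show _ = a.1.hat _ _ (ζ u (a.1.hat (-a.2.val u) 0 (⟨(a.1.hat (a.2.val u) (a.2.2 u)
          ((wordAct l (h.act (t • s) Y)).path u)).proj, 0⟩ : CotangentBundle n M)).proj)
        rw [e1]
        rfl
      refine ⟨hg.act a.1 contDiffAt_const, ?_, ?_⟩
      · have := a.1.isSection_push hs a.2 0
        rwa [hρ] at this
      · have := IsGaugeDeriv.act_const (h := a.1) a.2 hg hs hd
        rwa [hρ] at this

/-- The conjugates of the symmetries whose time function vanishes at both ends belong to the gauge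
group. -/
theorem exists_mem_gaugeGroup (l : List (Ham α × TimeFun)) (h : Ham α) (s : TimeFun)
    (h0 : s.val 0 = 0) (h1 : s.val 1 = 0) :
    ∃ f ∈ gaugeGroup α, ∀ Y, f (wordAct l Y) = wordAct l (h.act s Y) := by
  obtain ⟨ζ, hζ, hz0, hz1, hY⟩ := IsFormCurve.exists_gaugeDeriv l h s h0 h1
  obtain ⟨β, hβ⟩ := hζ.exists_gaugeForm hz0 hz1
  -- The one-parameter group t ↦ action of t s, conjugated by the word, is defined for all times;
  -- hence the field is complete and its flow belongs to the generators.
  let Φ : Flow ℝ (GaussSolution α) :=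
    { toFun := fun t Z => wordAct l (h.act (t • s) ((wordAct l).symm Z))
      cont' := (wordAct l).continuous.comp (h.continuous_act.comp
        ((continuous_fst.smul continuous_const).prodMk
          ((wordAct l).symm.continuous.comp continuous_snd)))
      map_add' := fun t t' Z => by
        rw [Homeomorph.symm_apply_apply, add_smul, h.act_add]
      map_zero' := fun Z => by
        rw [zero_smul, h.act_zero, Homeomorph.apply_symm_apply] }
  let f : Equiv.Perm (GaussSolution α) :=
    ((wordAct l).symm.trans ((h.actHomeo s).trans (wordAct l))).toEquiv
  refine ⟨f, Subgroup.subset_closure ⟨β, Φ, fun Z t => ?_, 1, fun Z => ?_⟩, fun Y => ?_⟩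
  · obtain ⟨hg, -, hd⟩ := hY ((wordAct l).symm Z) t
    refine IsGaugeDeriv.isGaugeCurveAt hg ?_
    simp only [hβ]
    exact hd
  · show wordAct l (h.act s ((wordAct l).symm Z)) =
      wordAct l (h.act ((1 : ℝ) • s) ((wordAct l).symm Z))
    rw [one_smul]
  · show wordAct l (h.act s ((wordAct l).symm (wordAct l Y))) = _
    rw [Homeomorph.symm_apply_apply]

theorem act_mem_orbit (l : List (Ham α × TimeFun)) (h : Ham α) (s : TimeFun)
    (h0 : s.val 0 = 0) (h1 : s.val 1 = 0) (Y : GaussSolution α) :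
    wordAct l (h.act s Y) ∈ MulAction.orbit (gaugeGroup α) (wordAct l Y) := by
  obtain ⟨f, hf, hf'⟩ := exists_mem_gaugeGroup l h s h0 h1
  exact ⟨⟨f, hf⟩, hf' Y⟩

/-- The time functions are exchanged one letter at a time. Exchanging a letter amounts to inserting
the action of the difference of the two time functions, which vanishes at both ends, conjugated by
the preceding letters. -/
theorem HamFrame.word_mem_orbit (F : HamFrame α) (l : List (Ham α × TimeFun)) (k : List (Fin n))
    {S S' : GaussModel n} (hS : S - S' ∈ leafDir n) (Y : GaussSolution α) :
    wordAct l (wordAct (F.word k S) Y) ∈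
      MulAction.orbit (gaugeGroup α) (wordAct l (wordAct (F.word k S') Y)) := by
  induction k generalizing l with
  | nil => exact MulAction.mem_orbit_self _
  | cons i k ih =>
    have e1 : ∀ T : GaussModel n, wordAct l (wordAct (F.word (i :: k) T) Y) =
        wordAct (l ++ [(F.ham i, timeComp i T)]) (wordAct (F.word k T) Y) := fun T => by
      rw [wordAct_append]
      rfl
    have h1 := ih (l ++ [(F.ham i, timeComp i S)])
    rw [← e1 S] at h1
    obtain ⟨hS1, hS2⟩ := mem_leafDir.1 hS
    have h2 : ∀ r, timeVal (S - S') r = 0 → (timeComp i (S - S')).val r = 0 := fun r hr => by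
      rw [timeComp_val, hr]
      rfl
    have h3 := act_mem_orbit (l ++ [(F.ham i, timeComp i S')]) (F.ham i) (timeComp i (S - S'))
      (h2 0 (by rw [timeVal, hS1, prim_zero_right, add_zero]))
      (h2 1 (by rw [timeVal, hS1, hS2, add_zero])) (wordAct (F.word k S') Y)
    rw [← e1] at h3
    rw [← MulAction.orbit_eq_iff.2 h3]
    convert h1 using 2
    rw [wordAct_append, wordAct_append]
    show wordAct l ((F.ham i).act _ ((F.ham i).act _ _)) = wordAct l ((F.ham i).act _ _)
    rw [← (F.ham i).act_add, ← map_add, add_sub_cancel]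
    rfl

/-- Points of an adapted chart which differ by a vector along the leaves lie in the same orbit. -/
theorem IsAdapted.mem_orbit {e : OpenPartialHomeomorph (GaussSolution α) (GaussModel n)}
    (he : IsAdapted e) {w w' : GaussModel n} (hw : w ∈ e.target) (hw' : w' ∈ e.target)
    (h : w - w' ∈ leafDir n) :
    e.symm w ∈ MulAction.orbit (gaugeGroup α) (e.symm w') := by
  obtain ⟨F, l, hF⟩ := he.symm_eq
  rw [(hF w hw).2, (hF w' hw').2]
  have h1 : w.1 = w'.1 := sub_eq_zero.1 (mem_leafDir.1 h).1
  rw [h1]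
  exact F.word_mem_orbit l _ (by
    rw [mem_leafDir]
    exact ⟨sub_self _, (mem_leafDir.1 h).2⟩) _

end GaugeGroupElements

/-! ### Gauge forms along solutions -/

section PartialDerivativesWithin

variable {E F : Type} [NormedAddCommGroup E] [NormedSpace ℝ E] [NormedAddCommGroup F]
  [NormedSpace ℝ F] {S : Set ℝ} {Ω : Set E} {b b' : ℝ → E → F} {X X' : ℝ → E}

/-- Only the two partial derivatives are available. The increment splits into b(t, X t) - b(r, X t),
which the mean value inequality in time estimates uniformly in the space variable by continuity of
b', and the derivative of b(r, X t) along the path. -/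
theorem hasDerivWithinAt_of_partial (hS : Convex ℝ S) (hΩ : IsOpen Ω)
    (ht : ∀ r ∈ S, ∀ y ∈ Ω, HasDerivWithinAt (fun r => b r y) (b' r y) S r)
    (hb' : ContinuousOn (fun q : ℝ × E => b' q.1 q.2) (S ×ˢ Ω)) {r : ℝ} {x' : E} (hr : r ∈ S)
    (hy : X r ∈ Ω) (hX : HasDerivWithinAt X x' S r) (hd : DifferentiableAt ℝ (b r) (X r)) :
    HasDerivWithinAt (fun r => b r (X r)) (b' r (X r) + fderiv ℝ (b r) (X r) x') S r := by
  have h1 : HasDerivWithinAt (fun t => b r (X t)) (fderiv ℝ (b r) (X r) x') S r :=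
    HasFDerivAt.comp_hasDerivWithinAt r hd.hasFDerivAt hX
  have h2 : HasDerivWithinAt (fun t => b t (X t) - b r (X t)) (b' r (X r)) S r := by
    rw [hasDerivWithinAt_iff_isLittleO, Asymptotics.isLittleO_iff]
    intro ε hε
    have h3 := Metric.continuousWithinAt_iff.1 (hb' (r, X r) ⟨hr, hy⟩) ε hε
    obtain ⟨δ, hδ, h3⟩ := h3
    filter_upwards [hX.continuousWithinAt.preimage_mem_nhdsWithin (Metric.ball_mem_nhds _ hδ),
      hX.continuousWithinAt.preimage_mem_nhdsWithin (hΩ.mem_nhds hy), self_mem_nhdsWithin,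
      mem_nhdsWithin_of_mem_nhds (Metric.ball_mem_nhds r hδ)] with t ht1 ht2 ht3 ht4
    have h4 := (hS.inter (convex_ball r δ)).norm_image_sub_le_of_norm_hasDerivWithin_le
      (f := fun t' => b t' (X t) - t' • b' r (X r)) (f' := fun t' => b' t' (X t) - b' r (X r))
      (C := ε) (fun t' ht' => ?_) (fun t' ht' => ?_) ⟨hr, Metric.mem_ball_self hδ⟩ ⟨ht3, ht4⟩
    · convert! h4 using 2
      rw [sub_smul]
      abel
    · have h5 := ((ht t' ht'.1 (X t) ht2).mono inter_subset_left).sub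
        (((hasDerivAt_id t').smul_const (b' r (X r))).hasDerivWithinAt (s := S ∩ Metric.ball r δ))
      rw [one_smul] at h5
      exact h5
    · rw [← dist_eq_norm]
      refine (h3 (x := (t', X t)) ⟨ht'.1, ht2⟩ ?_).le
      exact max_lt ht'.2 ht1
  refine (h2.add h1).congr_of_mem (fun t _ => ?_) hr
  simp

theorem contDiffWithinAt_of_partial (hS : Convex ℝ S) (hΩ : IsOpen Ω)
    (ht : ∀ r ∈ S, ∀ y ∈ Ω, HasDerivWithinAt (fun r => b r y) (b' r y) S r)
    (hb' : ContinuousOn (fun q : ℝ × E => b' q.1 q.2) (S ×ˢ Ω))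
    (hd : ∀ r ∈ S, ∀ y ∈ Ω, DifferentiableAt ℝ (b r) y)
    (hfd : ContinuousOn (fun q : ℝ × E => fderiv ℝ (b q.1) q.2) (S ×ˢ Ω)) {r : ℝ} {U : Set ℝ}
    (hr : r ∈ S) (hU : U ∈ 𝓝[S] r) (hUS : U ⊆ S) (hXU : MapsTo X U Ω)
    (hX : ∀ t ∈ U, HasDerivWithinAt X (X' t) S t) (hX' : ContinuousOn X' U) :
    ContDiffWithinAt ℝ 1 (fun r => b r (X r)) S r := by
  rw [← zero_add (1 : WithTop ℕ∞), contDiffWithinAt_succ_iff_hasFDerivWithinAt' (by simp),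
    insert_eq_of_mem hr]
  refine ⟨U, hU, hUS, by simp, fun r => ContinuousLinearMap.toSpanSingleton ℝ
    (b' r (X r) + fderiv ℝ (b r) (X r) (X' r)), fun t h => (hasDerivWithinAt_of_partial hS hΩ ht hb'
      (hUS h) (hXU h) (hX t h) (hd t (hUS h) _ (hXU h))).hasFDerivWithinAt, ?_⟩
  rw [contDiffWithinAt_zero hr]
  refine ⟨U, hU, ContinuousOn.mono (s := U) ?_ inter_subset_right⟩
  have h1 : ContinuousOn (fun t => (t, X t)) U :=
    continuousOn_id.prodMk fun t h => ((hX t h).continuousWithinAt.mono hUS)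
  have h2 : MapsTo (fun t => (t, X t)) U (S ×ˢ Ω) := fun t h => ⟨hUS h, hXU h⟩
  have h3 : ContinuousOn (fun t => b' t (X t) + fderiv ℝ (b t) (X t) (X' t)) U :=
    (hb'.comp (g := fun q : ℝ × E => b' q.1 q.2) h1 h2).add
      ((hfd.comp (g := fun q : ℝ × E => fderiv ℝ (b q.1) q.2) h1 h2).clm_apply hX')
  exact (ContinuousLinearMap.toSpanSingletonCLE (𝕜 := ℝ) (E := F)).continuous.comp_continuousOn h3

end PartialDerivativesWithin

section GaugeForms

universe u

variable {n : ℕ} {M : Type u} [TopologicalSpace M] [ChartedSpace (Coord n) M]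
  [IsManifold (𝓡 n) ∞ M] {α : PoissonStructure n M}

theorem hasDerivWithinAt_of_apply {L : ℝ → CoCoord n} {L' : CoCoord n} {S : Set ℝ} {r : ℝ}
    (h : ∀ v, HasDerivWithinAt (fun r => L r v) (L' v) S r) : HasDerivWithinAt L L' S r := by
  have h0 : ∀ T : CoCoord n, T = ∑ i, T (EuclideanSpace.single i 1) •
      (EuclideanSpace.proj i : CoCoord n) := fun T => by
    ext v
    conv_lhs => rw [← (EuclideanSpace.basisFun (Fin n) ℝ).sum_repr v]
    simp [mul_comm]
  rw [h0 L', show L = fun r => ∑ i, L r (EuclideanSpace.single i 1) •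
    (EuclideanSpace.proj i : CoCoord n) from funext fun r => h0 (L r)]
  exact HasDerivWithinAt.fun_sum fun i _ => HasDerivWithinAt.smul_const (F := CoCoord n) (h _) _

/-- Elements of P₀Ω¹(M) restrict to C¹ sections along solutions: continuity of the time derivative
(order 0) and of the first space derivative (order 1) suffices, the path being C¹ by the Gauss law.
-/
theorem GaugeForm.isSection (β : GaugeForm n M) (Z : GaussSolution α) :
    IsSection Z (fun u => (⟨Z.base u, β.form u (Z.base u)⟩ : CotangentBundle n M)) := by
  obtain ⟨form', hc', hd'⟩ := β.hasDeriv
  refine IsSection.of_contDiffWithinAt (fun u => rfl) fun u =>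
    ⟨Z.base u, mem_chart_source _ _, ?_⟩
  set c := Z.base u with hc
  have hΩ := (chartAt (Coord n) c).open_target
  set p : ℝ → I := projIcc 0 1 zero_le_one with hp
  have hpc : Continuous p := continuous_projIcc
  set b : (I → ∀ x : M, Cotangent n x) → ℝ → Coord n → CoCoord n := fun f r y =>
    covectorCoord n c ((chartAt (Coord n) c).symm y) (f (p r) ((chartAt (Coord n) c).symm y)) with hb
  have hm : MapsTo (fun q : ℝ × Coord n => (p q.1, q.2)) (Icc 0 1 ×ˢ (chartAt (Coord n) c).target)
      (univ ×ˢ (chartAt (Coord n) c).target) := fun q hq => ⟨mem_univ _, hq.2⟩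
  have hpc' : ContinuousOn (fun q : ℝ × Coord n => (p q.1, q.2))
      (Icc 0 1 ×ˢ (chartAt (Coord n) c).target) :=
    ((hpc.comp continuous_fst).prodMk continuous_snd).continuousOn
  set U : Set ℝ := Icc 0 1 ∩ {r | Z.base (p r) ∈ (chartAt (Coord n) c).source} with hU
  have key := contDiffWithinAt_of_partial (S := Icc (0 : ℝ) 1) (Ω := (chartAt (Coord n) c).target)
    (b := b β.form) (b' := b form') (X := extend fun u => (cotChart n c (Z.path u)).1)
    (X' := fun r => -α.coordCLM c (cotChart n c (Z.path (p r))).1 (cotChart n c (Z.path (p r))).2)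
    (r := u) (U := U) (convex_Icc 0 1) hΩ ?_ ?_ ?_ ?_ u.2 ?_ inter_subset_left ?_ ?_ ?_
  · have he : ∀ r, Z.base (p r) ∈ (chartAt (Coord n) c).source →
        extend (secCoord (fun u => (⟨Z.base u, β.form u (Z.base u)⟩ : CotangentBundle n M)) c) r =
          b β.form r (extend (fun u => (cotChart n c (Z.path u)).1) r) := fun r hr => by
      show (cotChart n c (⟨Z.base (p r), β.form (p r) (Z.base (p r))⟩ : CotangentBundle n M)).2 =
        b β.form r (cotChart n c (Z.path (p r))).1
      rw [cotChart_apply, cotChart_apply]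
      have h1 : (chartAt (Coord n) c).symm (chartAt (Coord n) c (Z.base (p r))) = Z.base (p r) :=
        (chartAt (Coord n) c).left_inv hr
      show _ = covectorCoord n c ((chartAt (Coord n) c).symm (chartAt (Coord n) c (Z.base (p r))))
        (β.form (p r) ((chartAt (Coord n) c).symm (chartAt (Coord n) c (Z.base (p r)))))
      rw [h1]
    have hev : ∀ᶠ r in 𝓝[Icc 0 1] (u : ℝ), Z.base (p r) ∈ (chartAt (Coord n) c).source :=
      eventually_extend_mem Z.continuous_base (chartAt (Coord n) c).open_source
        (mem_chart_source _ _)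
    exact key.congr_of_eventuallyEq (hev.mono he) (he _ (hev.self_of_nhdsWithin u.2))
  · intro r hr y hy
    refine hasDerivWithinAt_of_apply fun v => ?_
    have := hd' ⟨r, hr⟩ ((chartAt (Coord n) c).symm y) (coframe n c ((chartAt (Coord n) c).symm y) v)
    have e1 : p r = ⟨r, hr⟩ := projIcc_of_mem _ hr
    have e2 : ∀ (f : I → ∀ x : M, Cotangent n x) (t : ℝ), b f t y v =
        f (p t) ((chartAt (Coord n) c).symm y) (coframe n c ((chartAt (Coord n) c).symm y) v) :=
      fun f t => by
        simp only [hb]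
        rw [covectorCoord_def]
        rfl
    simp only [e2]
    rw [e1]
    exact this
  · have h1 := ((continuousMultilinearCurryFin0 ℝ (Coord n) (CoCoord n)).continuous.comp_continuousOn
      ((hc' c).2 0)).comp hpc' hm
    exact h1
  · intro r hr y hy
    exact (((β.continuous c).1 (p r)).contDiffAt (hΩ.mem_nhds hy)).differentiableAt (by simp)
  · have h1 := ((continuousMultilinearCurryFin1 ℝ (Coord n) (CoCoord n)).continuous.comp_continuousOn
      ((β.continuous c).2 1)).comp hpc' hm
    refine h1.congr fun q hq => ?_
    ext v
    simp [iteratedFDeriv_one_apply]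
    rfl
  · exact Filter.inter_mem self_mem_nhdsWithin (eventually_extend_mem Z.continuous_base
      (chartAt (Coord n) c).open_source (mem_chart_source _ _))
  · intro r hr
    exact cotChart_fst_mem hr.2
  · intro r hr
    have h1 := Z.hasDerivWithinAt_coord hr.2
    have e1 : p r = ⟨r, hr.1⟩ := projIcc_of_mem _ hr.1
    rw [extend_coe, e1] at h1
    rw [e1]
    exact h1
  · have h1 : ContinuousOn (fun r => cotChart n c (Z.path (p r))) U := fun r hr =>
      (ContinuousAt.comp (g := cotChart n c) (f := fun r => Z.path (p r))
        (continuousAt_cotChart hr.2) (Z.path.continuous.comp hpc).continuousAt).continuousWithinAt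
    exact ((((α.contDiffOn_coordCLM c).continuousOn).comp h1.fst fun r hr =>
      cotChart_fst_mem hr.2).clm_apply h1.snd).neg

theorem GaugeForm.isGaugeSection (β : GaugeForm n M) (Z : GaussSolution α) :
    IsGaugeSection Z (fun u => β.form u (Z.base u)) := by
  rw [isGaugeSection_iff]
  refine ⟨β.isSection Z, ?_, ?_⟩
  · rw [β.zero_left]
    rfl
  · rw [β.zero_right]
    rfl

end GaugeForms

/-! ### Maps tangent to the gauge distribution -/

section Tangency

universe u

variable {n : ℕ} {M : Type u} [TopologicalSpace M] [ChartedSpace (Coord n) M]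
  [IsManifold (𝓡 n) ∞ M] {α : PoissonStructure n M} [T2Space M]
  {P : Type} [NormedAddCommGroup P] [NormedSpace ℝ P]

/-- The composition with `endMap`, whose kernel is `leafDir`, has zero derivative on a ball and so
is constant there. -/
theorem eventually_sub_mem_leafDir {f : P → GaussModel n} {x : P}
    (hf : ∀ᶠ y in 𝓝 x, ∃ f' : P →L[ℝ] GaussModel n, HasFDerivAt f f' y ∧
      ∀ v, f' v ∈ leafDir n) : ∀ᶠ y in 𝓝 x, f y - f x ∈ leafDir n := by
  obtain ⟨ε, hε, h⟩ := Metric.eventually_nhds_iff_ball.1 hf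
  have h1 : ∀ y ∈ Metric.ball x ε, HasFDerivAt (fun y => endMap n (f y)) (0 : P →L[ℝ] _) y := by
    intro y hy
    obtain ⟨f', hf', hl⟩ := h y hy
    convert! (endMap n).hasFDerivAt.comp y hf' using 1
    ext1 v
    exact (LinearMap.mem_ker.1 (hl v)).symm
  filter_upwards [Metric.ball_mem_nhds x hε] with y hy
  have h2 := Metric.isOpen_ball.is_const_of_fderiv_eq_zero (convex_ball x ε).isPreconnected
    (fun y hy => (h1 y hy).differentiableAt.differentiableWithinAt)
    (fun y hy => (h1 y hy).fderiv) hy (Metric.mem_ball_self hε)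
  refine LinearMap.mem_ker.2 ?_
  show endMap n _ = 0
  rw [map_sub, sub_eq_zero]
  exact h2

/-- The map `g` has a derivative at `x` with values in the gauge distribution. -/
def IsTangentAt (g : P → GaussSolution α) (x : P) : Prop :=
  ∃ g' : P →L[ℝ] GaussModel n, HasMFDerivAt 𝓘(ℝ, P) 𝓘(ℝ, GaussModel n) g x g' ∧
    ∀ v, (show TangentSpace 𝓘(ℝ, GaussModel n) (g x) from g' v) ∈ gaugeDistribution (g x)

variable {g : P → GaussSolution α} {x : P}
  {e : OpenPartialHomeomorph (GaussSolution α) (GaussModel n)}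

theorem IsTangentAt.continuousAt (h : IsTangentAt g x) : ContinuousAt g x := by
  obtain ⟨g', h1, -⟩ := h
  exact h1.continuousAt

theorem IsAdapted.hasFDerivAt_comp (he : IsAdapted e) (hx : g x ∈ e.source) (h : IsTangentAt g x) :
    ∃ f' : P →L[ℝ] GaussModel n, HasFDerivAt (fun y => e (g y)) f' x ∧ ∀ v, f' v ∈ leafDir n := by
  obtain ⟨g', h1, h2⟩ := h
  have h3 := HasMFDerivAt.comp (g := e) x (hasMFDerivAt_of_mem_gaussAtlas he.mem_gaussAtlas hx) h1
  exact ⟨_, h3.hasFDerivAt, fun v => (he.mem_gaugeDistribution hx).1 (h2 v)⟩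

theorem IsAdapted.eventually_sub_mem (he : IsAdapted e) (hx : g x ∈ e.source)
    (h : ∀ᶠ y in 𝓝 x, IsTangentAt g y) :
    ∀ᶠ y in 𝓝 x, g y ∈ e.source ∧ e (g y) - e (g x) ∈ leafDir n := by
  have h1 : ∀ᶠ y in 𝓝 x, g y ∈ e.source :=
    h.self_of_nhds.continuousAt.preimage_mem_nhds (e.open_source.mem_nhds hx)
  refine h1.and (eventually_sub_mem_leafDir (f := fun y => e (g y)) ?_)
  filter_upwards [h, h1] with y hy hy'
  exact he.hasFDerivAt_comp hy' hy

/-- A map tangent to the gauge distribution stays locally in an orbit of the gauge group. -/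
theorem eventually_mem_orbit (h : ∀ᶠ y in 𝓝 x, IsTangentAt g y) :
    ∀ᶠ y in 𝓝 x, g y ∈ MulAction.orbit (gaugeGroup α) (g x) := by
  obtain ⟨e, he, hx⟩ := exists_isAdapted (g x)
  filter_upwards [he.eventually_sub_mem hx h] with y hy
  have := he.mem_orbit (e.map_source hy.1) (e.map_source hx) hy.2
  rwa [e.left_inv hy.1, e.left_inv hx] at this

/-- Lying in the same orbit is an equivalence relation; if it holds locally, it holds on a
preconnected space. -/
theorem mem_orbit_of_eventually {X : Type*} [TopologicalSpace X] [PreconnectedSpace X]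
    {g : X → GaussSolution α}
    (h : ∀ x, ∀ᶠ y in 𝓝 x, g y ∈ MulAction.orbit (gaugeGroup α) (g x)) (x y : X) :
    g y ∈ MulAction.orbit (gaugeGroup α) (g x) := by
  have : Std.Symm (fun x y => g y ∈ MulAction.orbit (gaugeGroup α) (g x)) :=
    ⟨fun a b hab => MulAction.mem_orbit_symm.1 hab⟩
  refine PreconnectedSpace.induction₂ (fun x y => g y ∈ MulAction.orbit (gaugeGroup α) (g x)) h
    ⟨fun a b c hab hbc => ?_⟩ x y
  rwa [← MulAction.orbit_eq_iff.2 hab]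

theorem IsGaugeCurveAt.isTangentAt {β : GaugeForm n M} {γ : ℝ → GaussSolution α} {t : ℝ}
    (h : IsGaugeCurveAt β γ t) : IsTangentAt γ t := by
  obtain ⟨v, h1, h2⟩ := h
  refine ⟨_, h2, fun r => ?_⟩
  exact (gaugeDistribution (γ t)).smul_mem (show ℝ from r)
    (Submodule.subset_span ⟨_, β.isGaugeSection (γ t), h1⟩)

theorem mem_orbit_of_isGaugeCurveAt {β : GaugeForm n M} {γ : ℝ → GaussSolution α} {a b : ℝ}
    (h : ∀ t ∈ Ioo a b, IsGaugeCurveAt β γ t) {s t : ℝ} (hs : s ∈ Ioo a b) (ht : t ∈ Ioo a b) :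
    γ t ∈ MulAction.orbit (gaugeGroup α) (γ s) := by
  have : PreconnectedSpace (Ioo a b) := Subtype.preconnectedSpace isPreconnected_Ioo
  refine mem_orbit_of_eventually (g := fun t : Ioo a b => γ t) (fun t => ?_) ⟨s, hs⟩ ⟨t, ht⟩
  refine continuous_subtype_val.continuousAt.eventually (eventually_mem_orbit (x := (t : ℝ)) ?_)
  filter_upwards [isOpen_Ioo.mem_nhds t.2] with r hr
  exact (h r hr).isTangentAt

end Tangency

/-! ### Connected integral manifolds lie in orbits -/

section MaximalLeaves

universe u

variable {n : ℕ} {M : Type u} [TopologicalSpace M] [ChartedSpace (Coord n) M]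
  [IsManifold (𝓡 n) ∞ M] {α : PoissonStructure n M} [T2Space M]

/-- Read in a chart of its parameter manifold, the immersion is a map tangent to the distribution.
It therefore stays locally in one orbit, and globally by connectedness. -/
theorem IsConnectedIntegralManifold.subset_orbit {S : Set (GaussSolution α)}
    (hS : IsConnectedIntegralManifold S) {Z : GaussSolution α} (hZ : Z ∈ S) :
    S ⊆ MulAction.orbit (gaugeGroup α) Z := by
  obtain ⟨F, _, _, _, L, _, _, _, _, j, -, rfl, hj, hd⟩ := hS
  obtain ⟨p, rfl⟩ := hZ
  rintro _ ⟨q, rfl⟩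
  refine mem_orbit_of_eventually (g := j) (fun p => ?_) p q
  set φ := chartAt F p with hφ
  have hp : p ∈ φ.source := mem_chart_source F p
  have hφm : φ.MDifferentiable 𝓘(ℝ, F) 𝓘(ℝ, F) := mdifferentiable_of_mem_atlas (chart_mem_atlas F p)
  have h1 : ∀ᶠ y in 𝓝 (φ p), j (φ.symm y) ∈ MulAction.orbit (gaugeGroup α) (j (φ.symm (φ p))) := by
    refine eventually_mem_orbit (g := fun y => j (φ.symm y)) ?_
    filter_upwards [φ.open_target.mem_nhds (φ.map_source hp)] with y hy
    have h2 := HasMFDerivAt.comp (g := j) (f := φ.symm) y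
      ((hj.mdifferentiable (by simp) (φ.symm y)).hasMFDerivAt)
      (hφm.mdifferentiableAt_symm hy).hasMFDerivAt
    refine ⟨_, h2, fun v => ?_⟩
    have h3 := (hd (φ.symm y)).2
    have h4 : ∀ w, mfderiv 𝓘(ℝ, F) 𝓘(ℝ, GaussModel n) j (φ.symm y) w ∈
        (gaugeDistribution (j (φ.symm y)) : Set _) := fun w => h3 ▸ mem_range_self w
    exact h4 _
  filter_upwards [(φ.continuousAt hp).eventually h1, φ.open_source.mem_nhds hp] with q hq hq'
  rwa [φ.left_inv hq', φ.left_inv hp] at hq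

end MaximalLeaves

/-! ### The orbits of the gauge group as manifolds -/

theorem exists_leafProj (n : ℕ) : ∃ p : GaussModel n →L[ℝ] leafDir n, ∀ v : leafDir n, p v = v := by
  have : FiniteDimensional ℝ (GaussModel n ⧸ leafDir n) :=
    ((endMap n).toLinearMap.quotKerEquivRange).symm.finiteDimensional
  exact Submodule.ClosedComplemented.of_finiteDimensional_quotient isClosed_leafDir

/-- A continuous linear projection onto the directions along the leaves. -/
def leafProj (n : ℕ) : GaussModel n →L[ℝ] leafDir n := (exists_leafProj n).choose

theorem leafProj_apply {n : ℕ} (v : leafDir n) : leafProj n v = v := (exists_leafProj n).choose_spec v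

theorem coe_leafProj {n : ℕ} {v : GaussModel n} (hv : v ∈ leafDir n) : (leafProj n v : GaussModel n) = v :=
  congrArg Subtype.val (leafProj_apply ⟨v, hv⟩)

theorem contDiff_leafProj {n : ℕ} : ContDiff ℝ ∞ (leafProj n) :=
  ContinuousLinearMap.contDiff (𝕜 := ℝ) (E := GaussModel n) (F := leafDir n) (leafProj n)

theorem hasFDerivAt_add_coe {E : Type} [NormedAddCommGroup E] [NormedSpace ℝ E] {p : Submodule ℝ E}
    (w : E) (v : p) : HasFDerivAt (fun v : p => w + (v : E)) p.subtypeL v :=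
  p.subtypeL.hasFDerivAt.const_add w

theorem contDiff_add_coe {E : Type} [NormedAddCommGroup E] [NormedSpace ℝ E] {p : Submodule ℝ E}
    (w : E) : ContDiff ℝ ∞ (fun v : p => w + (v : E)) :=
  contDiff_const.add p.subtypeL.contDiff

section Leaves

universe u

variable {n : ℕ} {M : Type u} [TopologicalSpace M] [ChartedSpace (Coord n) M]
  [IsManifold (𝓡 n) ∞ M] {α : PoissonStructure n M} [T2Space M]

/-- The orbit of `Z` under the gauge group, to be equipped with the leaf topology. -/
structure Leaf (Z : GaussSolution α) where
  /-- The inclusion of the orbit into `𝒞`. -/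
  incl : GaussSolution α
  mem_orbit : incl ∈ MulAction.orbit (gaugeGroup α) Z

namespace Leaf

variable {Z : GaussSolution α}

theorem incl_injective : Function.Injective (incl : Leaf Z → GaussSolution α) := by
  rintro ⟨Y, hY⟩ ⟨Y', hY'⟩ rfl
  rfl

theorem range_incl : range (incl : Leaf Z → GaussSolution α) = MulAction.orbit (gaugeGroup α) Z :=
  Set.ext fun Y => ⟨by rintro ⟨Y, rfl⟩; exact Y.mem_orbit, fun h => ⟨⟨Y, h⟩, rfl⟩⟩

open Classical in
/-- The point of the orbit given by a solution (the base point if the solution is not in the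
orbit). -/
def ofSolution (Z Y : GaussSolution α) : Leaf Z :=
  if h : Y ∈ MulAction.orbit (gaugeGroup α) Z then ⟨Y, h⟩ else ⟨Z, MulAction.mem_orbit_self Z⟩

theorem incl_ofSolution {Y : GaussSolution α} (h : Y ∈ MulAction.orbit (gaugeGroup α) Z) :
    (ofSolution Z Y).incl = Y := by
  rw [ofSolution, dif_pos h]

theorem ofSolution_incl (Y : Leaf Z) : ofSolution Z Y.incl = Y :=
  incl_injective (incl_ofSolution Y.mem_orbit)

/-- The plaque of an adapted chart through a point of the orbit, as a chart of the orbit. -/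
def plaque (Z : GaussSolution α) (e : OpenPartialHomeomorph (GaussSolution α) (GaussModel n))
    (he : IsAdapted e) (Y : Leaf Z) (hY : Y.incl ∈ e.source) : PartialEquiv (Leaf Z) (leafDir n) where
  toFun X := leafProj n (e X.incl - e Y.incl)
  invFun v := ofSolution Z (e.symm (e Y.incl + v))
  source := {X | X.incl ∈ e.source ∧ e X.incl - e Y.incl ∈ leafDir n}
  target := {v | e Y.incl + v ∈ e.target}
  map_source' X hX := by
    show _ + _ ∈ e.target
    rw [coe_leafProj hX.2, add_sub_cancel]
    exact e.map_source hX.1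
  map_target' v hv := by
    -- Points of the slice through `Y` belong to the orbit, so the default value of `ofSolution`
    -- does not occur.
    have h1 : e.symm (e Y.incl + v) ∈ MulAction.orbit (gaugeGroup α) Z := by
      have := he.mem_orbit hv (e.map_source hY) (by rw [add_sub_cancel_left]; exact v.2)
      rw [e.left_inv hY] at this
      rwa [← MulAction.orbit_eq_iff.2 Y.mem_orbit]
    show _ ∧ _
    rw [incl_ofSolution h1, e.right_inv hv, add_sub_cancel_left]
    exact ⟨e.map_target hv, v.2⟩
  left_inv' X hX := by
    rw [coe_leafProj hX.2, add_sub_cancel, e.left_inv hX.1, ofSolution_incl]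
  right_inv' v hv := by
    have h1 : e.symm (e Y.incl + v) ∈ MulAction.orbit (gaugeGroup α) Z := by
      have := he.mem_orbit hv (e.map_source hY) (by rw [add_sub_cancel_left]; exact v.2)
      rw [e.left_inv hY] at this
      rwa [← MulAction.orbit_eq_iff.2 Y.mem_orbit]
    rw [incl_ofSolution h1, e.right_inv hv, add_sub_cancel_left, leafProj_apply]

variable {e e' : OpenPartialHomeomorph (GaussSolution α) (GaussModel n)} {he : IsAdapted e}
  {he' : IsAdapted e'} {Y Y' : Leaf Z} {hY : Y.incl ∈ e.source} {hY' : Y'.incl ∈ e'.source}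

theorem incl_plaque_symm {v : leafDir n} (hv : v ∈ (plaque Z e he Y hY).target) :
    ((plaque Z e he Y hY).symm v).incl = e.symm (e Y.incl + v) := by
  have h := (plaque Z e he Y hY).right_inv hv
  have h1 := (plaque Z e he Y hY).map_target hv
  have h2 : leafProj n (e ((plaque Z e he Y hY).symm v).incl - e Y.incl) = v := h
  have h3 := coe_leafProj h1.2
  rw [h2] at h3
  rw [h3, add_sub_cancel, e.left_inv h1.1]

/-- The parametrization of a plaque is tangent to the gauge distribution. -/
theorem _root_.PoissonSigma.IsAdapted.isTangentAt (he : IsAdapted e) {w₀ : GaussModel n} {v : leafDir n}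
    (hv : w₀ + v ∈ e.target) : IsTangentAt (fun v : leafDir n => e.symm (w₀ + v)) v := by
  have hat := mdifferentiable_of_mem_gaussAtlas he.mem_gaussAtlas
  have h2 := HasMFDerivAt.comp (g := e.symm) (f := fun v : leafDir n => w₀ + (v : GaussModel n)) v
    (hat.mdifferentiableAt_symm hv).hasMFDerivAt (hasFDerivAt_add_coe w₀ v).hasMFDerivAt
  refine ⟨_, h2, fun u => (he.mem_gaugeDistribution (e.map_target hv)).2 ?_⟩
  have h3 := hat.symm.symm_comp_deriv (x := w₀ + v) hv
  have h4 := DFunLike.congr_fun h3 (u : GaussModel n)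
  have h5 : (mfderiv 𝓘(ℝ, GaussModel n) 𝓘(ℝ, GaussModel n) e (e.symm (w₀ + v))
    (mfderiv 𝓘(ℝ, GaussModel n) 𝓘(ℝ, GaussModel n) e.symm (w₀ + v) (u : GaussModel n)) :
      GaussModel n) = (u : GaussModel n) := h4
  show (mfderiv 𝓘(ℝ, GaussModel n) 𝓘(ℝ, GaussModel n) e (e.symm (w₀ + v))
    (mfderiv 𝓘(ℝ, GaussModel n) 𝓘(ℝ, GaussModel n) e.symm (w₀ + v) (u : GaussModel n)) :
      GaussModel n) ∈ leafDir n
  rw [h5]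
  exact u.2

/-- A plaque is parametrized tangentially to the distribution. Seen in a second adapted chart it
thus moves, near each of its points, only along `leafDir`, which keeps it in one plaque of that
chart. This makes the leaf topology well defined. -/
theorem isOpen_plaque_trans_source :
    IsOpen ((plaque Z e he Y hY).symm.trans (plaque Z e' he' Y' hY')).source := by
  rw [isOpen_iff_mem_nhds]
  rintro v ⟨hv, hv'⟩
  have hv1 : e Y.incl + v ∈ e.target := hv
  have hv2 : ((plaque Z e he Y hY).symm v).incl ∈ e'.source ∧
    e' ((plaque Z e he Y hY).symm v).incl - e' Y'.incl ∈ leafDir n := hv'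
  rw [incl_plaque_symm hv] at hv2
  have hev : ∀ᶠ v : leafDir n in 𝓝 v, e Y.incl + v ∈ e.target :=
    (continuous_const.add continuous_subtype_val).continuousAt.preimage_mem_nhds
      (e.open_target.mem_nhds hv1)
  filter_upwards [hev, he'.eventually_sub_mem (g := fun v : leafDir n => e.symm (e Y.incl + v)) hv2.1
    (hev.mono fun v hv => he.isTangentAt hv)] with x hx hx'
  refine ⟨hx, ?_⟩
  show ((plaque Z e he Y hY).symm x).incl ∈ e'.source ∧
    e' ((plaque Z e he Y hY).symm x).incl - e' Y'.incl ∈ leafDir n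
  rw [incl_plaque_symm hx]
  refine ⟨hx'.1, ?_⟩
  have := (leafDir n).add_mem hx'.2 hv2.2
  rwa [sub_add_sub_cancel] at this

theorem contDiffOn_plaque_trans :
    ContDiffOn ℝ ∞ ((plaque Z e he Y hY).symm.trans (plaque Z e' he' Y' hY'))
      ((plaque Z e he Y hY).symm.trans (plaque Z e' he' Y' hY')).source := by
  rintro v ⟨hv, hv'⟩
  have hv1 : e Y.incl + v ∈ e.target := hv
  have hv2 : ((plaque Z e he Y hY).symm v).incl ∈ e'.source := hv'.1
  rw [incl_plaque_symm hv] at hv2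
  have h1 := (contDiff_add_coe (e Y.incl)).contDiffAt (x := v)
  have h2 := he'.contDiffAt_comp (g := e.symm) (he.smoothAt_symm _ hv1) hv2
  have h3 := contDiff_leafProj.contDiffAt.comp v ((h2.comp v h1).sub
    (contDiffAt_const (c := e' Y'.incl)))
  refine h3.contDiffWithinAt.congr_of_mem (fun x hx => ?_) ⟨hv, hv'⟩
  show leafProj n (e' ((plaque Z e he Y hY).symm x).incl - e' Y'.incl) = _
  rw [incl_plaque_symm hx.1]
  rfl

/-- The plaques of the adapted charts form an atlas of the orbit. -/
def core (Z : GaussSolution α) : ChartedSpaceCore (leafDir n) (Leaf Z) where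
  atlas := {p | ∃ e he Y hY, p = plaque Z e he Y hY}
  chartAt Y := plaque Z _ (exists_isAdapted Y.incl).choose_spec.1 Y
    (exists_isAdapted Y.incl).choose_spec.2
  mem_chart_source Y := ⟨(exists_isAdapted Y.incl).choose_spec.2, by
    rw [sub_self]; exact zero_mem _⟩
  chart_mem_atlas Y := ⟨_, _, _, _, rfl⟩
  open_source := by
    rintro _ _ ⟨e, he, Y, hY, rfl⟩ ⟨e', he', Y', hY', rfl⟩
    exact isOpen_plaque_trans_source
  continuousOn_toFun := by
    rintro _ _ ⟨e, he, Y, hY, rfl⟩ ⟨e', he', Y', hY', rfl⟩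
    exact contDiffOn_plaque_trans.continuousOn

instance : TopologicalSpace (Leaf Z) := (core Z).toTopologicalSpace

instance : ChartedSpace (leafDir n) (Leaf Z) := (core Z).toChartedSpace

theorem exists_eq_plaque {φ : OpenPartialHomeomorph (Leaf Z) (leafDir n)}
    (h : φ ∈ atlas (leafDir n) (Leaf Z)) : ∃ e he Y hY, φ.toPartialEquiv = plaque Z e he Y hY := by
  obtain ⟨_, ⟨p, rfl⟩, h1⟩ := h
  obtain ⟨_, ⟨⟨e, he, Y, hY, rfl⟩, rfl⟩, h2⟩ := h1
  rw [mem_singleton_iff] at h2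
  exact ⟨e, he, Y, hY, by rw [h2]; rfl⟩

theorem exists_chartAt_eq (Y : Leaf Z) : ∃ e he hY,
    (chartAt (leafDir n) Y).toPartialEquiv = plaque Z e he Y hY :=
  ⟨_, (exists_isAdapted Y.incl).choose_spec.1, (exists_isAdapted Y.incl).choose_spec.2, rfl⟩

instance : IsManifold 𝓘(ℝ, leafDir n) ∞ (Leaf Z) :=
  isManifold_of_contDiffOn _ _ _ fun φ φ' h h' => by
    obtain ⟨e, he, Y, hY, h1⟩ := exists_eq_plaque h
    obtain ⟨e', he', Y', hY', h2⟩ := exists_eq_plaque h'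
    have h3 := contDiffOn_plaque_trans (he := he) (hY := hY) (he' := he') (hY' := hY')
    rw [← h1, ← h2] at h3
    simpa using! h3

/-- In the chart of the orbit around `Y`, the inclusion is affine in an adapted chart of `𝒞`. -/
theorem exists_incl_eq (Y : Leaf Z) : ∃ e, IsAdapted e ∧ Y.incl ∈ e.source ∧
    ∀ X ∈ (chartAt (leafDir n) Y).source, e Y.incl + (chartAt (leafDir n) Y X : GaussModel n) ∈ e.target ∧
      X.incl = e.symm (e Y.incl + (chartAt (leafDir n) Y X : GaussModel n)) := by
  obtain ⟨e, he, hY, h⟩ := exists_chartAt_eq Y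
  refine ⟨e, he, hY, fun X hX => ?_⟩
  have h1 : X ∈ (plaque Z e he Y hY).source := by rw [← h]; exact hX
  have h2 : chartAt (leafDir n) Y X = plaque Z e he Y hY X := by rw [← h]; rfl
  have h3 : (chartAt (leafDir n) Y X : GaussModel n) = e X.incl - e Y.incl := by
    rw [h2]
    exact coe_leafProj h1.2
  rw [h3, add_sub_cancel]
  exact ⟨e.map_source h1.1, (e.left_inv h1.1).symm⟩

theorem contMDiff_incl : ContMDiff 𝓘(ℝ, leafDir n) 𝓘(ℝ, GaussModel n) ∞
    (incl : Leaf Z → GaussSolution α) := by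
  intro Y
  obtain ⟨e, he, hY, h⟩ := exists_incl_eq Y
  set φ := chartAt (leafDir n) Y
  have hm : Y ∈ φ.source := mem_chart_source _ Y
  have h1 : ContMDiffAt 𝓘(ℝ, leafDir n) 𝓘(ℝ, leafDir n) ∞ φ Y :=
    contMDiffOn_chart.contMDiffAt (φ.open_source.mem_nhds hm)
  have h2 := (contDiff_add_coe (p := leafDir n) (e Y.incl)).contMDiff
  have h3 : ContMDiffAt 𝓘(ℝ, GaussModel n) 𝓘(ℝ, GaussModel n) ∞ e.symm
      (e Y.incl + (φ Y : GaussModel n)) :=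
    (contMDiffOn_symm_of_mem_maximalAtlas (IsManifold.subset_maximalAtlas
      he.mem_gaussAtlas)).contMDiffAt (e.open_target.mem_nhds (h Y hm).1)
  have h4 := ContMDiffAt.comp (g := e.symm) Y h3 ((h2.contMDiffAt (x := φ Y)).comp Y h1)
  refine h4.congr_of_eventuallyEq ?_
  filter_upwards [φ.open_source.mem_nhds hm] with X hX
  exact (h X hX).2

/-- In the plaque chart and the adapted chart the inclusion is the affine map v ↦ e(Y) + v, whose
derivative is the inclusion of `leafDir`; the derivatives of both charts are bijective. -/
theorem mfderiv_incl (Y : Leaf Z) :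
    Function.Injective (mfderiv 𝓘(ℝ, leafDir n) 𝓘(ℝ, GaussModel n) incl Y) ∧
      range (mfderiv 𝓘(ℝ, leafDir n) 𝓘(ℝ, GaussModel n) incl Y) =
        (gaugeDistribution Y.incl : Set _) := by
  obtain ⟨e, he, hY, h⟩ := exists_incl_eq Y
  set φ := chartAt (leafDir n) Y
  have hm : Y ∈ φ.source := mem_chart_source _ Y
  have hφ : φ.MDifferentiable 𝓘(ℝ, leafDir n) 𝓘(ℝ, leafDir n) :=
    mdifferentiable_of_mem_atlas (chart_mem_atlas _ Y)
  have hat := mdifferentiable_of_mem_gaussAtlas he.mem_gaussAtlas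
  have hbij := hφ.mfderiv_bijective hm
  have hbij' := bijective_mfderiv_of_mem_gaussAtlas he.mem_gaussAtlas hY
  have h1 := (contMDiff_incl.mdifferentiable (by simp) Y).hasMFDerivAt
  have h2 := HasMFDerivAt.comp (g := e) (f := incl) Y
    (hasMFDerivAt_of_mem_gaussAtlas he.mem_gaussAtlas hY) h1
  have h4 := HasMFDerivAt.comp (g := fun v : leafDir n => e Y.incl + (v : GaussModel n)) (f := φ) Y
    (hasFDerivAt_add_coe (e Y.incl) (φ Y)).hasMFDerivAt (hφ.mdifferentiableAt hm).hasMFDerivAt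
  have h5 := h4.congr_of_eventuallyEq (f₁ := e ∘ incl) (by
    filter_upwards [φ.open_source.mem_nhds hm] with X hX
    rw [Function.comp_apply, (h X hX).2, e.right_inv (h X hX).1]
    rfl)
  have key : ∀ u, (mfderiv 𝓘(ℝ, GaussModel n) 𝓘(ℝ, GaussModel n) e Y.incl
      (mfderiv 𝓘(ℝ, leafDir n) 𝓘(ℝ, GaussModel n) incl Y u) : GaussModel n) =
      ((show leafDir n from mfderiv 𝓘(ℝ, leafDir n) 𝓘(ℝ, leafDir n) φ Y u) : GaussModel n) := fun u =>
    DFunLike.congr_fun (hasMFDerivAt_unique h2 h5) u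
  refine ⟨fun u u' hu => hbij.1 (Subtype.ext ?_), Set.ext fun v => ⟨?_, fun hv => ?_⟩⟩
  · refine (key u).symm.trans (Eq.trans ?_ (key u'))
    rw [hu]
  · rintro ⟨u, rfl⟩
    refine (he.mem_gaugeDistribution hY).2 ?_
    rw [key]
    exact Subtype.property _
  · obtain ⟨u, hu⟩ := hbij.2 (⟨_, (he.mem_gaugeDistribution hY).1 hv⟩ : leafDir n)
    refine ⟨u, hbij'.1 ((key u).trans ?_)⟩
    rw [hu]

/-- Curves in the orbit which are tangent to the gauge distribution are continuous in the leaf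
topology. -/
theorem continuous_of_isTangentAt {γ : ℝ → Leaf Z} (h : ∀ t, IsTangentAt (fun t => (γ t).incl) t) :
    Continuous γ := by
  refine continuous_iff_continuousAt.2 fun t => ?_
  obtain ⟨e, he, hY, h1⟩ := exists_chartAt_eq (γ t)
  set φ := chartAt (leafDir n) (γ t)
  have hm : γ t ∈ φ.source := mem_chart_source _ _
  have hs : φ.source = (plaque Z e he (γ t) hY).source := congrArg PartialEquiv.source h1
  have hf : ∀ X, φ X = plaque Z e he (γ t) hY X := fun X => by rw [← h1]; rfl
  -- Tangency keeps the curve in the plaque through γ(t) for nearby times; there the leaf chart is a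
  -- linear image of the ambient chart, so ambient continuity suffices.
  have h2 : ∀ᶠ r in 𝓝 t, γ r ∈ φ.source := by
    filter_upwards [he.eventually_sub_mem (g := fun t => (γ t).incl) hY (.of_forall h)] with r hr
    rw [hs]
    exact hr
  have h3 : ContinuousAt (fun r => φ (γ r)) t := by
    simp only [hf]
    exact ((leafProj n).continuous.continuousAt).comp
      (((e.continuousAt hY).comp (f := fun t => (γ t).incl) (h t).continuousAt).sub continuousAt_const)
  have h4 : ContinuousAt (fun r => φ.symm (φ (γ r))) t :=
    ContinuousAt.comp (g := φ.symm) (φ.continuousAt_symm (φ.map_source hm)) h3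
  refine h4.congr ?_
  filter_upwards [h2] with r hr using φ.left_inv hr

theorem apply_mem {f : Equiv.Perm (GaussSolution α)} (hf : f ∈ gaugeGroup α) (Y : Leaf Z) :
    f Y.incl ∈ MulAction.orbit (gaugeGroup α) Z :=
  MulAction.mem_orbit_of_mem_orbit (⟨f, hf⟩ : gaugeGroup α) Y.mem_orbit

/-- A flow line of a generator is tangent to the distribution, hence a continuous curve in the leaf
topology, and cannot leave its component. Products and inverses follow by induction over the group.
-/
theorem ofSolution_mem_connectedComponent {f : Equiv.Perm (GaussSolution α)} (hf : f ∈ gaugeGroup α)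
    (Y : Leaf Z) : ofSolution Z (f Y.incl) ∈ connectedComponent Y := by
  induction hf using Subgroup.closure_induction generalizing Y with
  | mem f h =>
    obtain ⟨β, Φ, hΦ, t, ht⟩ := h
    have h1 : ∀ s, IsTangentAt (fun s => Φ s Y.incl) s := fun s => (hΦ Y.incl s).isTangentAt
    have h2 : ∀ s, Φ s Y.incl ∈ MulAction.orbit (gaugeGroup α) Z := fun s => by
      have := mem_orbit_of_eventually (g := fun s => Φ s Y.incl)
        (fun s => eventually_mem_orbit (.of_forall h1)) 0 s
      simp only [Flow.map_zero_apply] at this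
      rwa [MulAction.orbit_eq_iff.2 Y.mem_orbit] at this
    have h3 : Continuous fun s => ofSolution Z (Φ s Y.incl) :=
      continuous_of_isTangentAt fun s => by
        simp only [incl_ofSolution (h2 _)]
        exact h1 s
    have h4 := (isPreconnected_univ.image _ h3.continuousOn).subset_connectedComponent
      (mem_image_of_mem (fun s => ofSolution Z (Φ s Y.incl)) (mem_univ (0 : ℝ)))
    rw [Flow.map_zero_apply, ofSolution_incl] at h4
    rw [ht]
    exact h4 (mem_image_of_mem _ (mem_univ t))
  | one =>
    show ofSolution Z Y.incl ∈ _
    rw [ofSolution_incl]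
    exact mem_connectedComponent
  | mul f g hf hg ihf ihg =>
    have h1 := ihf (ofSolution Z (g Y.incl))
    rw [incl_ofSolution (apply_mem hg Y), ← connectedComponent_eq (ihg Y)] at h1
    exact h1
  | inv f hf ih =>
    have h1 := ih (ofSolution Z (f⁻¹ Y.incl))
    rw [incl_ofSolution (apply_mem (inv_mem hf) Y), show f (f⁻¹ Y.incl) = Y.incl from
      f.apply_symm_apply _, ofSolution_incl] at h1
    rw [← connectedComponent_eq h1]
    exact mem_connectedComponent

instance : ConnectedSpace (Leaf Z) := by
  have : Nonempty (Leaf Z) := ⟨ofSolution Z Z⟩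
  refine connectedSpace_iff_connectedComponent.2 ⟨ofSolution Z Z, eq_univ_of_forall fun Y => ?_⟩
  obtain ⟨⟨f, hf⟩, h⟩ := Y.mem_orbit
  have h1 := ofSolution_mem_connectedComponent hf (ofSolution Z Z)
  rw [incl_ofSolution (MulAction.mem_orbit_self Z)] at h1
  have h2 : f Z = Y.incl := h
  rwa [h2, ofSolution_incl] at h1

end Leaf

theorem isConnectedIntegralManifold_orbit (Z : GaussSolution α) :
    IsConnectedIntegralManifold (MulAction.orbit (gaugeGroup α) Z) :=
  ⟨leafDir n, inferInstance, inferInstance, isClosed_leafDir.completeSpace_coe, Leaf Z, inferInstance,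
    inferInstance, inferInstance, inferInstance, Leaf.incl, Leaf.incl_injective, Leaf.range_incl,
    Leaf.contMDiff_incl, Leaf.mfderiv_incl⟩

end Leaves

end PoissonSigma

end

theorem mainTheorem2 {n : ℕ} {M : Type*} [TopologicalSpace M] [T2Space M] [ParacompactSpace M]
    [ChartedSpace (Coord n) M] [IsManifold (𝓡 n) ∞ M] (α : PoissonStructure n M) :
    -- the natural atlas makes `𝒞` a smooth Banach manifold
    ∃ cs : ChartedSpace (GaussModel n) (GaussSolution α),
      cs.atlas = gaussAtlas α ∧ IsManifold 𝓘(ℝ, GaussModel n) ∞ (GaussSolution α) ∧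
      -- each gauge parameter defines a tangent vector of `𝒞`
      (∀ (Z : GaussSolution α) (β : ∀ u, Cotangent n (Z.base u)), IsGaugeSection Z β →
        ∃! v : TangentSpace 𝓘(ℝ, GaussModel n) Z, IsGaugeVector Z β v) ∧
      -- these vectors span closed subspaces of codimension `2 dim M`
      (∀ Z : GaussSolution α,
        IsClosed (gaugeDistribution Z : Set (TangentSpace 𝓘(ℝ, GaussModel n) Z)) ∧
        Module.finrank ℝ (TangentSpace 𝓘(ℝ, GaussModel n) Z ⧸ gaugeDistribution Z) = 2 * n) ∧
      -- the distribution is integrable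
      IsGaugeDistributionIntegrable α (2 * n) ∧
      -- the orbits of `H` are the maximal connected integral manifolds
      (∀ Z : GaussSolution α,
        IsGreatest {S : Set (GaussSolution α) | IsConnectedIntegralManifold S ∧ Z ∈ S}
          (MulAction.orbit (gaugeGroup α) Z)) ∧
      -- the flow lines of gauge fields with incomplete flow also stay in orbits of `H`
      (∀ (β : GaugeForm n M) (γ : ℝ → GaussSolution α) (a b : ℝ),
        (∀ t ∈ Set.Ioo a b, IsGaugeCurveAt β γ t) →
        ∀ s ∈ Set.Ioo a b, ∀ t ∈ Set.Ioo a b,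
          γ t ∈ MulAction.orbit (gaugeGroup α) (γ s)) := by
  refine ⟨gaussChartedSpace α, rfl, inferInstance, fun Z β hβ => ?_, fun Z =>
    ⟨isClosed_gaugeDistribution Z, finrank_quotient_gaugeDistribution Z⟩,
    isGaugeDistributionIntegrable, fun Z => ⟨⟨isConnectedIntegralManifold_orbit Z,
      MulAction.mem_orbit_self Z⟩, fun S hS => hS.1.subset_orbit hS.2⟩,
    fun β γ a b h s hs t ht => mem_orbit_of_isGaugeCurveAt h hs ht⟩
  obtain ⟨e, he, hZ⟩ := exists_isAdapted Z
  obtain ⟨v, h1, -, h2⟩ := he.existsUnique_gaugeVector hZ hβ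
  exact ⟨v, h1, h2⟩
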